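/- Let $G$ be a split connected reductive group over the finite field $\mathbb{F}_q$ and let $B\subset G$ be a Borel subgroup. For an $\mathbb{F}_q$-scheme $S$ put $K(S)=G(\Gamma(S,\mathcal{O}_S)[[z]])$ and $I(S)=\{g\in K(S): g \bmod z\in B(S)\}$, and let $K'$ be one of the group sheaves $K$, $I$. Let $G'$ be the smooth affine parahoric group scheme over $\mathbb{F}_q[[z]]$ with generic fibre $G\times_{\mathbb{F}_q}\mathbb{F}_q((z))$ and $K'(S)=G'(\Gamma(S,\mathcal{O}_S)[[z]])$; explicitly, $G'=G\times_{\mathbb{F}_q}\mathbb{F}_q[[z]]$ if $K'=K$, and $G'$ is the dilatation of $G\times_{\mathbb{F}_q}\mathbb{F}_q[[z]]$ in the subgroup $B$ of its special fibre if $K'=I$. Let $\widehat{G'}$ be its $z$-adic formal completion. For an $\mathbb{F}_q$-scheme $S$ let $S[[z]]$ be the formal scheme $(S,\mathcal{O}_S[[z]])=\varinjlim_n S\times_{\mathbb{F}_q}\operatorname{Spec}\mathbb{F}_q[z]/(z^{n})$. Let $*\in\{\text{ét},\text{fppf},\text{fpqc}\}$. A $K'$-torsor on $S$ for the $*$-topology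 is a sheaf on $S$ for the $*$-topology with a right action of $K'$ that is isomorphic to $K'$ (with right multiplication) on a $*$-covering of $S$. A formal $\widehat{G'}$-torsor over $S[[z]]$ is a $z$-adic formal scheme over $S[[z]]$ with a right action of $\widehat{G'}$ over $S[[z]]$ that becomes equivariantly isomorphic to $\widehat{G'}\,\widehat\times\, S'[[z]]$ (with right multiplication) over $S'[[z]]$ for a $*$-covering $S'\to S$. Let $\mathrm{PHS}_*(S[[z]],\widehat{G'})$ be the set of isomorphism classes of such formal torsors, pointed by the trivial one, and let $\check H^1(S_*,K')$ be the first Čech cohomology (the colimit over all $*$-coverings of $S$ of the cohomology classes of $1$-cocycles), pointed by the trivial class. (a) For every $*$ and every $\mathbb{F}_q$-scheme $S$ there is a bijection of pointed sets $\mathrm{PHS}_*(S[[z]],\widehat{G'})\cong\check H^1(S_*,K')$. It is natural: it sends the class of a formal torsor with trivializations $\alpha_i$ over $U_i[[z]]$, for any $*$-covering $(U_i\to S)_i$, to the class of the cocycle of elements of $K'$ given by the transition maps $\alpha_i\circ\alpha_j^{-1}$, it is compatible with base change along every morphism $S'\to S$ of $\mathbb{F}_q$-schemes, and it is compatible with the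 natural maps for the passage from the étale to the fppf and from the fppf to the fpqc topology. (b) For every $\mathbb{F}_q$-scheme $S$ the natural maps $\check H^1(S_{\text{ét}},K')\to\check H^1(S_{\text{fppf}},K')\to\check H^1(S_{\text{fpqc}},K')$ are bijective. (c) Let $S=\operatorname{Spec}R$ be an affine $\mathbb{F}_q$-scheme, let $\mathfrak{a}\subset R$ be a nilpotent ideal, and set $\overline S=\operatorname{Spec}R/\mathfrak{a}$. For every $K'$-torsor $\mathcal{G}$ on $S$ (for any of the three topologies) and every trivialization $\bar\alpha:\mathcal{G}_{\overline S}\to K'_{\overline S}$ of its pullback to $\overline S$ there is a trivialization $\alpha:\mathcal{G}\to K'_S$ that lifts $\bar\alpha$. Likewise, for every formal $\widehat{G'}$-torsor $\widehat{\mathcal{G}}$ over $S[[z]]$, every trivialization of its pullback to $\overline S[[z]]$ lifts to a trivialization of $\widehat{\mathcal{G}}$ over $S[[z]]$. -/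

import Mathlib

open CategoryTheory AlgebraicGeometry Opposite Limits
open scoped TensorProduct PowerSeries
open PowerSeries (X)
universe u
set_option linter.unusedSectionVars false
set_option linter.unusedVariables false

/- With this instance the type of morphisms `X ⟶ Y` in a category would be elaborated through the
class `ReflQuiver`. -/
attribute [-instance] CategoryTheory.catToReflQuiver

/-! ### Orders in Hopf algebras and groups of points -/

namespace LoopTorsor

section
variable {O F M N M' N' : Type u} [CommRing O] [Field F] [Algebra O F]
  [CommRing M] [CommRing N] [CommRing M'] [CommRing N']
  [Algebra O M] [Algebra O N] [Algebra O M'] [Algebra O N'] [Algebra F M'] [Algebra F N']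
  [IsScalarTower O F M'] [IsScalarTower O F N']

/-- The map `M ⊗[O] N → M' ⊗[F] N'` induced by `M → M'` and `N → N'`. -/
noncomputable def tensorBase (F : Type u) [Field F] [Algebra O F] [Algebra F M'] [Algebra F N']
    [IsScalarTower O F M'] [IsScalarTower O F N']
    (f : M →ₐ[O] M') (g : N →ₐ[O] N') : M ⊗[O] N →ₐ[O] M' ⊗[F] N' :=
  Algebra.TensorProduct.lift
    ((Algebra.TensorProduct.includeLeft : M' →ₐ[O] M' ⊗[F] N').comp f)
    (((Algebra.TensorProduct.includeRight : N' →ₐ[F] M' ⊗[F] N').restrictScalars O).comp g)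
    (fun _ _ ↦ Commute.all _ _)

@[simp] theorem tensorBase_tmul (f : M →ₐ[O] M') (g : N →ₐ[O] N') (m : M) (n : N) :
    tensorBase F f g (m ⊗ₜ n) = f m ⊗ₜ g n := by
  simp [tensorBase]

theorem tensorBase_injective [IsDomain O] [IsFractionRing O F] [Module.Flat O N]
    (f : M →ₐ[O] M') (g : N →ₐ[O] N')
    (hf : Function.Injective f) (hg : Function.Injective g) :
    Function.Injective (tensorBase F f g) := by
  have : Module.Flat O F := IsLocalization.flat F (nonZeroDivisors O)
  have : Module.Flat O M' := Module.Flat.trans O F M'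
  have := IsLocalization.tensorProduct_compatibleSMul (nonZeroDivisors O) F M' N'
  have key : (tensorBase F f g).toLinearMap =
      (TensorProduct.equivOfCompatibleSMul F O O M' N').toLinearMap ∘ₗ
        (g.toLinearMap.lTensor M') ∘ₗ (f.toLinearMap.rTensor N) := by
    ext; simp; rfl
  have h : ((tensorBase F f g).toLinearMap : M ⊗[O] N → M' ⊗[F] N') = tensorBase F f g := rfl
  rw [← h, key]
  exact (TensorProduct.equivOfCompatibleSMul F O O M' N').injective.comp
    ((Module.Flat.lTensor_preserves_injective_linearMap _ hg).comp
      (Module.Flat.rTensor_preserves_injective_linearMap _ hf))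
end

section
variable {O F H : Type u} [CommRing O] [IsDedekindDomain O] [Field F] [Algebra O F]
  [IsFractionRing O F] [CommRing H] [HopfAlgebra F H] [Algebra O H] [IsScalarTower O F H]

theorem flat_subalgebra (F : Type u) [Field F] [Algebra O F] [IsFractionRing O F] [Algebra F H]
    [IsScalarTower O F H] (D : Subalgebra O H) : Module.Flat O D := by
  have : Module.Flat O F := IsLocalization.flat F (nonZeroDivisors O)
  have : Module.Flat O H := Module.Flat.trans O F H
  have : Module.IsTorsionFree O D :=
    Function.Injective.moduleIsTorsionFree D.val Subtype.val_injective (fun _ _ ↦ rfl)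
  infer_instance

/-- An order in a Hopf algebra: a subalgebra over `O` that is stable under the structure maps. -/
structure IsHopfOrder (F : Type u) [Field F] [Algebra O F] [HopfAlgebra F H]
    [IsScalarTower O F H] (D : Subalgebra O H) : Prop where
  comul_mem : ∀ d ∈ D, Coalgebra.comul (R := F) d ∈ (tensorBase F D.val D.val).range
  counit_mem : ∀ d ∈ D, Coalgebra.counit (R := F) d ∈ (Algebra.ofId O F).range
  antipode_mem : ∀ d ∈ D, HopfAlgebra.antipode F d ∈ D


namespace IsHopfOrder

/-- The comultiplication of an order. -/
noncomputable def comul {D : Subalgebra O H} (hD : IsHopfOrder F D) : D →ₐ[O] D ⊗[O] D :=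
  have := flat_subalgebra F D
  ((AlgEquiv.ofInjective (tensorBase F D.val D.val)
    (tensorBase_injective _ _ Subtype.val_injective Subtype.val_injective)).symm : _ →ₐ[O] _).comp
    ((((Bialgebra.comulAlgHom F H).restrictScalars O).comp D.val).codRestrict _
      (fun d ↦ hD.comul_mem d d.2))

/-- The counit of an order. -/
noncomputable def counit {D : Subalgebra O H} (hD : IsHopfOrder F D) : D →ₐ[O] O :=
  ((AlgEquiv.ofInjective (Algebra.ofId O F) (IsFractionRing.injective O F)).symm :
    _ →ₐ[O] _).comp ((((Bialgebra.counitAlgHom F H).restrictScalars O).comp D.val).codRestrict _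
      (fun d ↦ hD.counit_mem d d.2))

/-- The antipode of an order. -/
noncomputable def antipode {D : Subalgebra O H} (hD : IsHopfOrder F D) : D →ₐ[O] D :=
  (((HopfAlgebra.antipodeAlgHom F H).restrictScalars O).comp D.val).codRestrict _
      (fun d ↦ hD.antipode_mem d d.2)

theorem tensorBase_comul {D : Subalgebra O H} (hD : IsHopfOrder F D) (d : D) :
    tensorBase F D.val D.val (hD.comul d) = Coalgebra.comul (R := F) (d : H) := by
  have := flat_subalgebra F D
  have h := AlgEquiv.ofInjective_apply (tensorBase F D.val D.val)
    (tensorBase_injective _ _ Subtype.val_injective Subtype.val_injective) (hD.comul d)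
  rw [← h]
  simp [IsHopfOrder.comul]
  rfl

theorem algebraMap_counit {D : Subalgebra O H} (hD : IsHopfOrder F D) (d : D) :
    algebraMap O F (hD.counit d) = Coalgebra.counit (R := F) (d : H) := by
  have h := AlgEquiv.ofInjective_apply (Algebra.ofId O F) (IsFractionRing.injective O F)
    (hD.counit d)
  rw [← Algebra.ofId_apply, ← h]
  simp [IsHopfOrder.counit]
  rfl

/-- An order is a bialgebra over `O`. -/
@[reducible]
noncomputable def bialgebra {D : Subalgebra O H} (hD : IsHopfOrder F D) : Bialgebra O D :=
  have := flat_subalgebra F D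
  have hj := tensorBase_injective (F := F) D.val D.val Subtype.val_injective Subtype.val_injective
  Bialgebra.ofAlgHom hD.comul hD.counit
    (by
      have h3 := tensorBase_injective (F := F) D.val (tensorBase F D.val D.val)
        Subtype.val_injective hj
      ext d
      apply h3
      have e1 : ∀ x : D ⊗[O] D, tensorBase F D.val (tensorBase F D.val D.val)
          (Algebra.TensorProduct.assoc O O O D D D (Algebra.TensorProduct.map hD.comul (.id O D) x))
          = Algebra.TensorProduct.assoc F F F H H H (Algebra.TensorProduct.map
            (Bialgebra.comulAlgHom F H) (.id F H) (tensorBase F D.val D.val x)) := by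
        intro x
        induction x with
        | zero => simp
        | add x y hx hy => simp only [map_add, hx, hy]
        | tmul a b =>
          simp only [Algebra.TensorProduct.map_tmul, AlgHom.id_apply, tensorBase_tmul,
            Bialgebra.comulAlgHom_apply, Subalgebra.coe_val, ← hD.tensorBase_comul a]
          induction hD.comul a with
          | zero => simp
          | add x y hx hy => simp only [map_add, TensorProduct.add_tmul, hx, hy]
          | tmul u v => simp
      have e2 : ∀ x : D ⊗[O] D, tensorBase F D.val (tensorBase F D.val D.val)
          (Algebra.TensorProduct.map (.id O D) hD.comul x)
          = Algebra.TensorProduct.map (.id F H)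
            (Bialgebra.comulAlgHom F H) (tensorBase F D.val D.val x) := by
        intro x
        induction x with
        | zero => simp
        | add x y hx hy => simp only [map_add, hx, hy]
        | tmul a b => simp [hD.tensorBase_comul]
      have := e1 (hD.comul d)
      rw [hD.tensorBase_comul] at this
      have h2 := e2 (hD.comul d)
      rw [hD.tensorBase_comul] at h2
      refine this.trans (.trans ?_ h2.symm)
      exact Coalgebra.coassoc_apply (R := F) (d : H))
    (by
      ext d
      apply (Algebra.TensorProduct.lid O D).injective
      apply Subtype.val_injective
      have e : ∀ x : D ⊗[O] D, ((Algebra.TensorProduct.lid O D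
          (Algebra.TensorProduct.map hD.counit (.id O D) x) : D) : H)
          = Algebra.TensorProduct.lid F H (Algebra.TensorProduct.map
            (Bialgebra.counitAlgHom F H) (.id F H) (tensorBase F D.val D.val x)) := by
        intro x
        induction x with
        | zero => simp
        | add x y hx hy => simp only [map_add, hx, hy, Subalgebra.coe_add]
        | tmul a b => simp [← hD.algebraMap_counit]
      refine (e (hD.comul d)).trans ?_
      rw [hD.tensorBase_comul]
      have := Coalgebra.rTensor_counit_comul (R := F) (d : H)
      change Algebra.TensorProduct.lid F H (LinearMap.rTensor H (Coalgebra.counit (R := F))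
        (Coalgebra.comul (R := F) (d : H))) = _
      rw [this]
      simp)
    (by
      ext d
      apply (Algebra.TensorProduct.rid O O D).injective
      apply Subtype.val_injective
      have e : ∀ x : D ⊗[O] D, ((Algebra.TensorProduct.rid O O D
          (Algebra.TensorProduct.map (.id O D) hD.counit x) : D) : H)
          = Algebra.TensorProduct.rid F F H (Algebra.TensorProduct.map
            (.id F H) (Bialgebra.counitAlgHom F H) (tensorBase F D.val D.val x)) := by
        intro x
        induction x with
        | zero => simp
        | add x y hx hy => simp only [map_add, hx, hy, Subalgebra.coe_add]
        | tmul a b => simp [← hD.algebraMap_counit]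
      refine (e (hD.comul d)).trans ?_
      rw [hD.tensorBase_comul]
      have := Coalgebra.lTensor_counit_comul (R := F) (d : H)
      change Algebra.TensorProduct.rid F F H (LinearMap.lTensor H (Coalgebra.counit (R := F))
        (Coalgebra.comul (R := F) (d : H))) = _
      rw [this]
      simp)

/-- An order is a Hopf algebra over `O`. -/
@[reducible]
noncomputable def hopfAlgebra {D : Subalgebra O H} (hD : IsHopfOrder F D) : HopfAlgebra O D :=
  letI := hD.bialgebra
  HopfAlgebra.ofAlgHom hD.antipode
    (by
      ext d
      have e : ∀ x : D ⊗[O] D, ((Algebra.TensorProduct.lift hD.antipode (.id O D)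
          (fun _ ↦ Commute.all _) x : D) : H)
          = LinearMap.mul' F H ((HopfAlgebra.antipode F).rTensor H
            (tensorBase F D.val D.val x)) := by
        intro x
        induction x with
        | zero => simp
        | add x y hx hy => simp only [map_add, hx, hy, Subalgebra.coe_add]
        | tmul a b => simp [IsHopfOrder.antipode]; rfl
      refine (e (hD.comul d)).trans ?_
      rw [hD.tensorBase_comul]
      have := HopfAlgebra.mul_antipode_rTensor_comul_apply (R := F) (d : H)
      rw [this, ← hD.algebraMap_counit, ← IsScalarTower.algebraMap_apply]
      rfl)
    (by
      ext d
      have e : ∀ x : D ⊗[O] D, ((Algebra.TensorProduct.lift (.id O D) hD.antipode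
          (fun _ _ ↦ Commute.all _ _) x : D) : H)
          = LinearMap.mul' F H ((HopfAlgebra.antipode F).lTensor H
            (tensorBase F D.val D.val x)) := by
        intro x
        induction x with
        | zero => simp
        | add x y hx hy => simp only [map_add, hx, hy, Subalgebra.coe_add]
        | tmul a b => simp [IsHopfOrder.antipode]; rfl
      refine (e (hD.comul d)).trans ?_
      rw [hD.tensorBase_comul]
      have := HopfAlgebra.mul_antipode_lTensor_comul_apply (R := F) (d : H)
      rw [this, ← hD.algebraMap_counit, ← IsScalarTower.algebraMap_apply]
      rfl)

end IsHopfOrder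

end

section
open Coalgebra
variable {k O F A P : Type u} [Field k] [CommRing O] [Field F] [Algebra k O] [Algebra O F]
  [Algebra k F] [IsScalarTower k O F] [CommRing A] [HopfAlgebra k A] [CommRing P] [HopfAlgebra k P]

/-- The group structure on the set of `B`-valued points of the affine group scheme `Spec H`. -/
noncomputable instance pointsGroup {R H B : Type u} [CommRing R] [CommRing H] [HopfAlgebra R H]
    [CommRing B] [Algebra R B] : Group (WithConv (H →ₐ[R] B)) where
  inv g := .toConv (g.ofConv.comp (HopfAlgebra.antipodeAlgHom R H))
  inv_mul_cancel g := by
    ext a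
    have h := congr(g.ofConv ($(HopfAlgebra.mul_antipode_rTensor_comul_apply (R := R) a)))
    rw [AlgHom.commutes] at h
    refine Eq.trans ?_ h
    change Algebra.TensorProduct.lmul' R (Algebra.TensorProduct.map
      (g.ofConv.comp (HopfAlgebra.antipodeAlgHom R H)) g.ofConv (comul (R := R) a)) = _
    induction comul (R := R) a with
    | zero => simp
    | add x y hx hy => simp only [map_add, hx, hy]
    | tmul u v => simp

/-- The homomorphism `P(B) → G(B)` of groups of points induced by a homomorphism of Hopf algebras
`O(G) → O(P)`. -/
def precompPoints {R H₁ H₂ : Type u} [CommRing R] [CommRing H₁] [HopfAlgebra R H₁] [CommRing H₂]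
    [HopfAlgebra R H₂] (p : H₁ →ₐc[R] H₂) (B : Type u) [CommRing B] [Algebra R B] :
    WithConv (H₂ →ₐ[R] B) →* WithConv (H₁ →ₐ[R] B) where
  toFun g := .toConv (g.ofConv.comp (p : H₁ →ₐ[R] H₂))
  map_one' := by
    ext a
    change algebraMap R B (counit (R := R) (p a)) = algebraMap R B (counit (R := R) a)
    rw [CoalgHomClass.counit_comp_apply]
  map_mul' f g := WithConv.ext (AlgHom.convMul_comp_bialgHom_distrib f g p)

theorem map_antipode_of_bialgHom {R H₁ H₂ : Type u} [CommRing R] [CommRing H₁] [HopfAlgebra R H₁]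
    [CommRing H₂] [HopfAlgebra R H₂] (p : H₁ →ₐc[R] H₂) (a : H₁) :
    p (HopfAlgebra.antipode R a) = HopfAlgebra.antipode R (p a) := by
  have h := map_inv (precompPoints p H₂) (.toConv (.id R H₂))
  exact (congr($h a)).symm

theorem comul_mem_of_ker (p : A →ₐc[k] P) (hp : Function.Surjective p) (b : A) (hb : p b = 0) :
    comul (R := k) b ∈
      Ideal.map (Algebra.TensorProduct.includeLeft : A →ₐ[k] A ⊗[k] A) (RingHom.ker p) ⊔
        Ideal.map (Algebra.TensorProduct.includeRight : A →ₐ[k] A ⊗[k] A) (RingHom.ker p) := by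
  have h := Algebra.TensorProduct.map_ker (p : A →ₐ[k] P) (p : A →ₐ[k] P) hp hp
  have h2 : Algebra.TensorProduct.map (p : A →ₐ[k] P) (p : A →ₐ[k] P) (comul (R := k) b) = 0 := by
    have := CoalgHomClass.map_comp_comul_apply p b
    refine Eq.trans ?_ (this.trans ?_)
    · rfl
    · simp [hb]
  exact h.le h2

theorem comul_base_tmul (c : F) (a : A) :
    comul (R := F) (c ⊗ₜ[k] a : F ⊗[k] A) =
      c • tensorBase (O := k) F (Algebra.TensorProduct.includeRight : A →ₐ[k] F ⊗[k] A)
        (Algebra.TensorProduct.includeRight : A →ₐ[k] F ⊗[k] A) (comul (R := k) a) := by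
  rw [TensorProduct.comul_tmul]
  induction comul (R := k) a with
  | zero => simp
  | add x y hx hy => simp only [map_add, TensorProduct.tmul_add, hx, hy, smul_add]
  | tmul u v =>
    have e : ∀ w : A, c ⊗ₜ[k] w = c • ((1 : F) ⊗ₜ[k] w) := fun w ↦ by
      simp [TensorProduct.smul_tmul']
    simp only [TensorProduct.AlgebraTensorModule.tensorTensorTensorComm_tmul, tensorBase_tmul,
      CommSemiring.comul_apply, Algebra.TensorProduct.includeRight_apply]
    rw [e v, TensorProduct.tmul_smul]

/-- The elements `1 ⊗ a` for `a ∈ A` and `c ⊗ b` for `b` in the kernel of `p`. -/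
def dilatationGens (p : A →ₐc[k] P) (c : F) : Set (F ⊗[k] A) :=
  {x | ∃ a : A, x = 1 ⊗ₜ[k] a} ∪ {x | ∃ b : A, p b = 0 ∧ x = c ⊗ₜ[k] b}

theorem isHopfOrder_adjoin (O : Type u) [CommRing O] [Algebra k O] [Algebra O F]
    [IsScalarTower k O F]
    (p : A →ₐc[k] P) (hp : Function.Surjective p) (c : F) :
    IsHopfOrder F (Algebra.adjoin O (dilatationGens p c)) := by
  set D := Algebra.adjoin O (dilatationGens p c) with hDdef
  have h1 : ∀ a : A, (1 : F) ⊗ₜ[k] a ∈ D := fun a ↦ Algebra.subset_adjoin (Or.inl ⟨a, rfl⟩)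
  have hc : ∀ b : A, p b = 0 → c ⊗ₜ[k] b ∈ D :=
    fun b hb ↦ Algebra.subset_adjoin (Or.inr ⟨b, hb, rfl⟩)
  have hr : ∀ x ∈ D, ∀ y ∈ D, x ⊗ₜ[F] y ∈ (tensorBase F D.val D.val).range :=
    fun x hx y hy ↦ ⟨(⟨x, hx⟩ : D) ⊗ₜ (⟨y, hy⟩ : D), by simp⟩
  have hL : ∀ t : A ⊗[k] A, tensorBase (O := k) F
      (Algebra.TensorProduct.includeRight : A →ₐ[k] F ⊗[k] A)
      (Algebra.TensorProduct.includeRight : A →ₐ[k] F ⊗[k] A) t ∈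
        (tensorBase F D.val D.val).range := by
    intro t
    induction t with
    | zero => simp [zero_mem]
    | add x y hx hy => rw [map_add]; exact add_mem hx hy
    | tmul u v => simpa using hr _ (h1 u) _ (h1 v)
  constructor
  · have : D ≤ (tensorBase F D.val D.val).range.comap
        ((Bialgebra.comulAlgHom F (F ⊗[k] A)).restrictScalars O) := by
      refine Algebra.adjoin_le ?_
      rintro x (⟨a, rfl⟩ | ⟨b, hb, rfl⟩)
      · change comul (R := F) (_ : F ⊗[k] A) ∈ (tensorBase F D.val D.val).range
        rw [comul_base_tmul, one_smul]
        exact hL _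
      · change comul (R := F) _ ∈ (tensorBase F D.val D.val).range
        rw [comul_base_tmul]
        have hI := comul_mem_of_ker p hp b hb
        obtain ⟨s, hs, t, ht, hst⟩ := Submodule.mem_sup.1 hI
        rw [← hst, map_add, smul_add]
        refine add_mem ?_ ?_
        · refine Submodule.span_induction (p := fun s _ ↦ c • tensorBase (O := k) F
            (Algebra.TensorProduct.includeRight : A →ₐ[k] F ⊗[k] A)
            (Algebra.TensorProduct.includeRight : A →ₐ[k] F ⊗[k] A) s ∈
              (tensorBase F D.val D.val).range) ?_ (by simp [zero_mem])
              (fun x y _ _ hx hy ↦ by rw [map_add, smul_add]; exact add_mem hx hy) ?_ hs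
          · rintro _ ⟨u, hu, rfl⟩
            simpa [TensorProduct.smul_tmul'] using hr _ (hc u hu) _ (h1 1)
          · intro x y _ hy
            rw [smul_eq_mul, map_mul, ← mul_smul_comm]
            exact mul_mem (hL x) hy
        · refine Submodule.span_induction (p := fun s _ ↦ c • tensorBase (O := k) F
            (Algebra.TensorProduct.includeRight : A →ₐ[k] F ⊗[k] A)
            (Algebra.TensorProduct.includeRight : A →ₐ[k] F ⊗[k] A) s ∈
              (tensorBase F D.val D.val).range) ?_ (by simp [zero_mem])
              (fun x y _ _ hx hy ↦ by rw [map_add, smul_add]; exact add_mem hx hy) ?_ ht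
          · rintro _ ⟨u, hu, rfl⟩
            have e : c ⊗ₜ[k] u = c • ((1 : F) ⊗ₜ[k] u) := by simp [TensorProduct.smul_tmul']
            have := hr _ (h1 1) _ (hc u hu)
            rw [e, TensorProduct.tmul_smul] at this
            simpa only [AlgHom.coe_toRingHom, Algebra.TensorProduct.includeRight_apply,
              tensorBase_tmul] using this
          · intro x y _ hy
            rw [smul_eq_mul, map_mul, ← mul_smul_comm]
            exact mul_mem (hL x) hy
    exact fun d hd ↦ this hd
  · have : D ≤ (Algebra.ofId O F).range.comap
        ((Bialgebra.counitAlgHom F (F ⊗[k] A)).restrictScalars O) := by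
      refine Algebra.adjoin_le ?_
      rintro x (⟨a, rfl⟩ | ⟨b, hb, rfl⟩)
      · refine ⟨algebraMap k O (counit (R := k) a), ?_⟩
        simp [← IsScalarTower.algebraMap_apply, Algebra.smul_def]
      · refine ⟨0, ?_⟩
        have : counit (R := k) b = 0 := by
          rw [← CoalgHomClass.counit_comp_apply p b, hb, map_zero]
        simp [this]
    exact fun d hd ↦ this hd
  · have : D ≤ D.comap ((HopfAlgebra.antipodeAlgHom F (F ⊗[k] A)).restrictScalars O) := by
      refine Algebra.adjoin_le ?_
      rintro x (⟨a, rfl⟩ | ⟨b, hb, rfl⟩)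
      · change HopfAlgebra.antipode F ((1 : F) ⊗ₜ[k] a) ∈ D
        simpa using h1 _
      · change HopfAlgebra.antipode F (c ⊗ₜ[k] b) ∈ D
        have : p (HopfAlgebra.antipode k b) = 0 := by
          rw [map_antipode_of_bialgHom, hb, map_zero]
        simpa using hc _ this
    exact fun d hd ↦ this hd
end

/-! ### Closed subgroups and their dilatations -/


/-- A closed subgroup scheme of the affine group scheme `G = Spec A` over `k`: a surjection of
Hopf algebras from `A` onto the coordinate ring of the subgroup. -/
structure ClosedSubgroupScheme (k A : Type u) [Field k] [CommRing A] [HopfAlgebra k A] where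
  coord : Type u
  [commRing : CommRing coord]
  [hopfAlgebra : HopfAlgebra k coord]
  res : A →ₐc[k] coord
  surjective : Function.Surjective res

attribute [instance] ClosedSubgroupScheme.commRing ClosedSubgroupScheme.hopfAlgebra

/-- The group `G`, as a closed subgroup of itself. -/
def ClosedSubgroupScheme.whole (k A : Type u) [Field k] [CommRing A] [HopfAlgebra k A] :
    ClosedSubgroupScheme k A where
  coord := A
  res := BialgHom.id k A
  surjective := Function.surjective_id

section Groups

variable {k A : Type u} [Field k] [CommRing A] [HopfAlgebra k A]

/-- The coordinate ring of the group scheme `G'` over `k⟦z⟧`: the dilatation of `G` over `k⟦z⟧` in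
the closed subgroup `Q` of its special fibre. It is the `k⟦z⟧`-subalgebra of the coordinate ring
`k((z)) ⊗ A` of the generic fibre that is generated by `A` and by `z⁻¹ f` for the functions `f` on
`G` that vanish on `Q`. For `Q = G` this is `k⟦z⟧ ⊗ A`, that is `G' = G ×_k k⟦z⟧`; for a Borel
subgroup `Q` it is the Iwahori group scheme. -/
noncomputable def dilatation (Q : ClosedSubgroupScheme k A) :
    Subalgebra k⟦X⟧ (FractionRing k⟦X⟧ ⊗[k] A) :=
  Algebra.adjoin k⟦X⟧ (dilatationGens Q.res (algebraMap k⟦X⟧ (FractionRing k⟦X⟧) X)⁻¹)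

noncomputable instance (Q : ClosedSubgroupScheme k A) : HopfAlgebra k⟦X⟧ (dilatation Q) :=
  (isHopfOrder_adjoin k⟦X⟧ Q.res Q.surjective
    (algebraMap k⟦X⟧ (FractionRing k⟦X⟧) X)⁻¹).hopfAlgebra

/-- The inclusion of `A` into the coordinate ring of `G'`. -/
noncomputable def dilatation.incl (Q : ClosedSubgroupScheme k A) (a : A) : dilatation Q :=
  ⟨1 ⊗ₜ[k] a, Algebra.subset_adjoin (Or.inl ⟨a, rfl⟩)⟩

/-! ### Split connected reductive groups and Borel subgroups -/

section Reductive

/-- The Zariski topology on the group of points of an affine group over `K` (used for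
algebraically closed `K`). -/
@[reducible]
def zariskiTopology (K H : Type u) [Field K] [CommRing H] [HopfAlgebra K H] :
    TopologicalSpace (WithConv (H →ₐ[K] K)) :=
  .generateFrom {V | ∃ f : H, V = {g | g f ≠ 0}}

/-- Closed and connected subgroups for the Zariski topology. -/
def IsClosedConnected {K H : Type u} [Field K] [CommRing H] [HopfAlgebra K H]
    (N : Subgroup (WithConv (H →ₐ[K] K))) : Prop :=
  @IsClosed _ (zariskiTopology K H) (N : Set (WithConv (H →ₐ[K] K))) ∧
    @IsConnected _ (zariskiTopology K H) (N : Set (WithConv (H →ₐ[K] K)))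

/-- The right translation of functions by a point `g`, that is `f ↦ (x ↦ f (x g))`. -/
noncomputable def rightTranslation {K H : Type u} [Field K] [CommRing H] [HopfAlgebra K H]
    (g : WithConv (H →ₐ[K] K)) : Module.End K H :=
  (TensorProduct.rid K H).toLinearMap ∘ₗ (g.ofConv.toLinearMap.lTensor H) ∘ₗ
    Coalgebra.comul (R := K) (A := H)

/-- A point is unipotent if its right translation is locally unipotent. -/
def IsUnipotentPoint {K H : Type u} [Field K] [CommRing H] [HopfAlgebra K H]
    (g : WithConv (H →ₐ[K] K)) : Prop :=
  ∀ f : H, ∃ n : ℕ, ((rightTranslation g - 1) ^ n) f = 0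

/-- The subgroup `Q(k̄)` of `G(k̄)`. -/
noncomputable def ClosedSubgroupScheme.geomPoints (Q : ClosedSubgroupScheme k A) :
    Subgroup (WithConv ((AlgebraicClosure k ⊗[k] A) →ₐ[AlgebraicClosure k] AlgebraicClosure k)) :=
  (precompPoints (Bialgebra.TensorProduct.map
    (BialgHom.id (AlgebraicClosure k) (AlgebraicClosure k)) Q.res) (AlgebraicClosure k)).range

variable (k A) in
/-- `G = Spec A` is a connected reductive group over `k`: it is smooth and connected, and `G(k̄)`
has no nontrivial closed connected normal subgroup consisting of unipotent elements. -/
structure IsConnectedReductive : Prop where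
  smooth : Algebra.Smooth k A
  connected : ConnectedSpace (PrimeSpectrum A)
  unipotentRadical_trivial :
    ∀ N : Subgroup (WithConv
        ((AlgebraicClosure k ⊗[k] A) →ₐ[AlgebraicClosure k] AlgebraicClosure k)),
      N.Normal → IsClosedConnected N → (∀ g ∈ N, IsUnipotentPoint g) → N = ⊥

/-- `T` is a split torus over `k`, and over `k̄` it is not contained in a larger torus of `G`. -/
structure ClosedSubgroupScheme.IsSplitMaximalTorus (T : ClosedSubgroupScheme k A) : Prop where
  split : ∃ r : ℕ, Nonempty (T.coord ≃ₐc[k] AddMonoidAlgebra k (Fin r → ℤ))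
  maximal : ∀ (r : ℕ) (ψ : (AlgebraicClosure k ⊗[k] A) →ₐc[AlgebraicClosure k]
      AddMonoidAlgebra (AlgebraicClosure k) (Fin r → ℤ)), Function.Surjective ψ →
    RingHom.ker ψ ≤ RingHom.ker (Bialgebra.TensorProduct.map
      (BialgHom.id (AlgebraicClosure k) (AlgebraicClosure k)) T.res) →
    RingHom.ker ψ = RingHom.ker (Bialgebra.TensorProduct.map
      (BialgHom.id (AlgebraicClosure k) (AlgebraicClosure k)) T.res)

variable (k A) in
/-- `G = Spec A` is a split connected reductive group over `k`. -/
def IsSplitConnectedReductive : Prop :=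
  IsConnectedReductive k A ∧ ∃ T : ClosedSubgroupScheme k A, T.IsSplitMaximalTorus

/-- `Q` is a Borel subgroup of `G`: it is smooth over `k`, and `Q(k̄)` is a maximal closed connected
solvable subgroup of `G(k̄)`. -/
structure ClosedSubgroupScheme.IsBorel (Q : ClosedSubgroupScheme k A) : Prop where
  smooth : Algebra.Smooth k Q.coord
  maximal : Maximal (fun N : Subgroup (WithConv
    ((AlgebraicClosure k ⊗[k] A) →ₐ[AlgebraicClosure k] AlgebraicClosure k)) ↦
      IsClosedConnected N ∧ Group.IsSolvable N) Q.geomPoints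

end Reductive

/-! ### The group sheaf `K'` -/

/-- The homomorphism `G(B) → G(B')` induced by an algebra homomorphism `B → B'`. -/
def postcompPoints {R : Type u} (H : Type u) {B B' : Type u} [CommRing R] [CommRing H]
    [HopfAlgebra R H] [CommRing B] [Algebra R B] [CommRing B'] [Algebra R B'] (f : B →ₐ[R] B') :
    WithConv (H →ₐ[R] B) →* WithConv (H →ₐ[R] B') where
  toFun g := .toConv (f.comp g.ofConv)
  map_one' := by
    ext a
    exact f.commutes _
  map_mul' g h := WithConv.ext (AlgHom.comp_convMul_distrib f g h)

/-- The functor of points of the affine group scheme `Spec H` over `R`, on `R`-algebras. -/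
noncomputable def hopfPoints (R H : Type u) [CommRing R] [CommRing H] [HopfAlgebra R H] :
    CommAlgCat.{u} R ⥤ GrpCat.{u} where
  obj B := GrpCat.of (WithConv (H →ₐ[R] B))
  map f := GrpCat.ofHom (postcompPoints H f.hom)

/-- The reduction `B⟦z⟧ → B` modulo `z`. -/
def constCoeffAlgHom (k B : Type u) [CommRing k] [CommRing B] [Algebra k B] : B⟦X⟧ →ₐ[k] B where
  toRingHom := PowerSeries.constantCoeff
  commutes' r := by
    change PowerSeries.constantCoeff (algebraMap k B⟦X⟧ r) = _
    rw [PowerSeries.algebraMap_apply, PowerSeries.constantCoeff_C]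

/-- `K'(B) = {g ∈ G(B⟦z⟧) : g mod z ∈ Q(B)}`. -/
noncomputable def loopSubgroup (Q : ClosedSubgroupScheme k A) (B : Type u) [CommRing B] [Algebra k B] :
    Subgroup (WithConv (A →ₐ[k] B⟦X⟧)) :=
  (precompPoints Q.res B).range.comap (postcompPoints A (constCoeffAlgHom k B))

theorem loopSubgroup_map (Q : ClosedSubgroupScheme k A) {B B' : Type u} [CommRing B] [Algebra k B]
    [CommRing B'] [Algebra k B'] (f : B →ₐ[k] B') (g : WithConv (A →ₐ[k] B⟦X⟧))
    (hg : g ∈ loopSubgroup Q B) :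
    postcompPoints A (PowerSeries.mapAlgHom f) g ∈ loopSubgroup Q B' := by
  obtain ⟨b, hb⟩ := hg
  refine ⟨postcompPoints Q.coord f b, ?_⟩
  ext a
  have := congr(f ($hb a))
  refine this.trans ?_
  change f (PowerSeries.constantCoeff (g a)) =
    PowerSeries.constantCoeff (PowerSeries.mapAlgHom f (g a))
  rw [PowerSeries.mapAlgHom_apply, ← PowerSeries.coeff_zero_eq_constantCoeff_apply,
    ← PowerSeries.coeff_zero_eq_constantCoeff_apply, PowerSeries.coeff_map]
  rfl

/-- The functor `B ↦ K'(B)` on `k`-algebras. -/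
noncomputable def loopFunctor (Q : ClosedSubgroupScheme k A) : CommAlgCat.{u} k ⥤ GrpCat.{u} where
  obj B := GrpCat.of (loopSubgroup Q B)
  map f := GrpCat.ofHom
    (((postcompPoints A (PowerSeries.mapAlgHom f.hom)).comp (loopSubgroup Q _).subtype).codRestrict
      (loopSubgroup Q _) (fun g ↦ loopSubgroup_map Q f.hom g.1 g.2))
  map_id B := by
    refine GrpCat.hom_ext (MonoidHom.ext fun g ↦ Subtype.ext (WithConv.ext (AlgHom.ext fun a ↦ ?_)))
    change PowerSeries.mapAlgHom (AlgHom.id k B) (g.1 a) = g.1 a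
    rw [PowerSeries.mapAlgHom_apply]
    refine PowerSeries.ext fun n ↦ ?_
    rw [PowerSeries.coeff_map]
    rfl
  map_comp f f' := by
    refine GrpCat.hom_ext (MonoidHom.ext fun g ↦ Subtype.ext (WithConv.ext (AlgHom.ext fun a ↦ ?_)))
    change PowerSeries.mapAlgHom (f'.hom.comp f.hom) (g.1 a) =
      PowerSeries.mapAlgHom f'.hom (PowerSeries.mapAlgHom f.hom (g.1 a))
    simp only [PowerSeries.mapAlgHom_apply]
    refine PowerSeries.ext fun n ↦ ?_
    rw [PowerSeries.coeff_map, PowerSeries.coeff_map, PowerSeries.coeff_map]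
    rfl

/-- The category of `R`-schemes. -/
abbrev SchOver (R : Type u) [CommRing R] := Over (Spec (CommRingCat.of R))

/-- The global sections of an `R`-scheme, as an `R`-algebra. -/
noncomputable abbrev globalSections {R : Type u} [CommRing R] (T : SchOver R) : CommAlgCat.{u} R :=
  ((algΓ (CommRingCat.of R)).obj T).unop

/-- The presheaf of groups `K'` on `k`-schemes,
`K'(T) = {g ∈ G(Γ(T, O_T)⟦z⟧) : g mod z ∈ Q(Γ(T, O_T))}`. -/
noncomputable def loopGroup (Q : ClosedSubgroupScheme k A) : (SchOver k)ᵒᵖ ⥤ GrpCat.{u} :=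
  (algΓ (CommRingCat.of k)).leftOp ⋙ loopFunctor Q

/-- The group functor `G'` on schemes over `k⟦z⟧`. -/
noncomputable def modelGroup (Q : ClosedSubgroupScheme k A) : (SchOver k⟦X⟧)ᵒᵖ ⥤ GrpCat.{u} :=
  (algΓ (CommRingCat.of k⟦X⟧)).leftOp ⋙ hopfPoints k⟦X⟧ (dilatation Q)

/-! ### The étale, fppf and fpqc topologies -/

/-- The three topologies. -/
inductive Top3
  | etale
  | fppf
  | fpqc

/-- The corresponding Grothendieck topology on the category of `k`-schemes. -/
noncomputable def Top3.topology (k : Type u) [Field k] (τ : Top3) :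
    GrothendieckTopology (SchOver k) :=
  GrothendieckTopology.over
    (match τ with
      | etale => Scheme.etaleTopology.{u}
      | fppf => Scheme.fppfTopology.{u}
      | fpqc => Scheme.fpqcTopology.{u})
    (Spec (CommRingCat.of k))

theorem over_mono {C : Type*} [Category C] {J J' : GrothendieckTopology C} (h : J ≤ J') (X : C) :
    J.over X ≤ J'.over X := fun Y _ hS ↦ h Y.left hS

theorem etale_le_fppf (k : Type u) [Field k] : Top3.etale.topology k ≤ Top3.fppf.topology k := by
  refine over_mono (Precoverage.toGrothendieck_mono ?_) _
  exact Scheme.precoverage_mono fun X Y f hf ↦ ⟨inferInstance, inferInstance⟩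

theorem fppf_le_fpqc (k : Type u) [Field k] : Top3.fppf.topology k ≤ Top3.fpqc.topology k :=
  over_mono Scheme.fppfTopology_le_fpqcTopology _

end Groups

/-! ### Čech cohomology in degree one -/

section Cech

variable {C : Type (u + 1)} [Category.{u} C]

/-- The restriction of a presheaf of groups to the category of objects over `S`. -/
abbrev restrictOver (H : Cᵒᵖ ⥤ GrpCat.{u}) (S : C) : (Over S)ᵒᵖ ⥤ GrpCat.{u} :=
  (Over.forget S).op ⋙ H

/-- The family `U` of objects over `S` is a covering of `S`. -/
def Covers (J : GrothendieckTopology C) {S : C} {I : Type u} (U : I → Over S) : Prop :=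
  Sieve.ofArrows (fun i ↦ (U i).left) (fun i ↦ (U i).hom) ∈ J S

/-- A Čech 1-cocycle on some covering of `S`. -/
structure CechCocycle (J : GrothendieckTopology C) (H : Cᵒᵖ ⥤ GrpCat.{u}) (S : C) where
  I : Type u
  U : I → Over S
  covers : Covers J U
  cocycle : PresheafOfGroups.OneCocycle (restrictOver H S) U

/-- The restriction of a cocycle to a refinement `V` of `U`. -/
def refineCocycle {H : Cᵒᵖ ⥤ GrpCat.{u}} {S : C} {I I' : Type u} {U : I → Over S}
    {V : I' → Over S} (r : I' → I) (ρ : ∀ j, V j ⟶ U (r j))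
    (γ : PresheafOfGroups.OneCocycle (restrictOver H S) U) :
    PresheafOfGroups.OneCocycle (restrictOver H S) V where
  ev i j _ a b := γ.ev (r i) (r j) (a ≫ ρ i) (b ≫ ρ j)
  ev_precomp i j T T' φ a b := by
    simpa only [Category.assoc] using γ.ev_precomp (r i) (r j) φ (a ≫ ρ i) (b ≫ ρ j)
  ev_trans i j l T a b c := γ.ev_trans _ _ _ _ _ _

/-- `d` lives on a refinement of the covering of `c`, and there it is cohomologous to the
restriction of `c`. -/
def CechCocycle.Rel {J : GrothendieckTopology C} {H : Cᵒᵖ ⥤ GrpCat.{u}} {S : C}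
    (c d : CechCocycle J H S) : Prop :=
  ∃ (r : d.I → c.I) (ρ : ∀ j, d.U j ⟶ c.U (r j)),
    (refineCocycle r ρ c.cocycle).IsCohomologous d.cocycle

/-- The Čech cohomology `Ȟ¹(S, H)` of a presheaf of groups: the colimit, over the coverings of `S`
and their refinements, of the sets of cohomology classes of 1-cocycles. -/
def CechH1 (J : GrothendieckTopology C) (H : Cᵒᵖ ⥤ GrpCat.{u}) (S : C) : Type (u + 1) :=
  Quot (CechCocycle.Rel (J := J) (H := H) (S := S))

theorem covers_self (J : GrothendieckTopology C) (S : C) :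
    Covers J (fun _ : PUnit.{u + 1} ↦ Over.mk (𝟙 S)) := by
  refine J.superset_covering ?_ (J.top_mem S)
  intro Y f _
  exact ⟨_, f, 𝟙 S, ⟨PUnit.unit⟩, by simp⟩

/-- The distinguished point of `Ȟ¹(S, H)`. -/
def CechH1.base (J : GrothendieckTopology C) (H : Cᵒᵖ ⥤ GrpCat.{u}) (S : C) : CechH1 J H S :=
  Quot.mk _ { I := PUnit, U := fun _ ↦ Over.mk (𝟙 S), covers := covers_self J S, cocycle := 1 }

/-- The natural map from the Čech cohomology of a topology to that of a finer topology. -/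
def CechH1.map {J J' : GrothendieckTopology C} (h : J ≤ J') (H : Cᵒᵖ ⥤ GrpCat.{u}) (S : C) :
    CechH1 J H S → CechH1 J' H S :=
  Quot.map (fun c ↦ { c with covers := h S c.covers }) (fun _ _ hcd ↦ hcd)

variable [HasPullbacks C]

/-- The morphism `T → U` over `f : S' → S` that belongs to a morphism `T → U ×_S S'` over `S'`. -/
noncomputable def toBase {S S' : C} (f : S' ⟶ S) {T : Over S'} {U : Over S}
    (a : T ⟶ (Over.pullback f).obj U) : (Over.map f).obj T ⟶ U :=
  ((Over.mapPullbackAdj f).homEquiv T U).symm a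

theorem toBase_precomp {S S' : C} (f : S' ⟶ S) {T T' : Over S'} {U : Over S} (φ : T ⟶ T')
    (a : T' ⟶ (Over.pullback f).obj U) :
    toBase f (φ ≫ a) = (Over.map f).map φ ≫ toBase f a :=
  Adjunction.homEquiv_naturality_left_symm _ _ _

theorem toBase_postcomp {S S' : C} (f : S' ⟶ S) {T : Over S'} {U V : Over S}
    (a : T ⟶ (Over.pullback f).obj U) (ρ : U ⟶ V) :
    toBase f (a ≫ (Over.pullback f).map ρ) = toBase f a ≫ ρ :=
  Adjunction.homEquiv_naturality_right_symm _ _ _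

/-- The pullback of a Čech cocycle along `f : S' → S`. -/
noncomputable def CechCocycle.pullback {J : GrothendieckTopology C} {H : Cᵒᵖ ⥤ GrpCat.{u}}
    {S S' : C} (f : S' ⟶ S) (c : CechCocycle J H S) : CechCocycle J H S' where
  I := c.I
  U i := (Over.pullback f).obj (c.U i)
  covers := by
    refine J.superset_covering ?_ (J.pullback_stable f c.covers)
    rintro Y g ⟨Z, a, _, ⟨i⟩, hab⟩
    refine ⟨_, Limits.pullback.lift a g hab, _, ⟨i⟩, ?_⟩
    exact Limits.pullback.lift_snd _ _ _
  cocycle :=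
    { ev := fun i j _ a b ↦ c.cocycle.ev i j (toBase f a) (toBase f b)
      ev_precomp := fun i j T T' φ a b ↦ by
        rw [toBase_precomp, toBase_precomp]
        exact c.cocycle.ev_precomp i j ((Over.map f).map φ) (toBase f a) (toBase f b)
      ev_trans := fun i j l T a b d ↦ c.cocycle.ev_trans i j l _ _ _ }

/-- The pullback map `Ȟ¹(S, H) → Ȟ¹(S', H)` along `f : S' → S`. -/
noncomputable def CechH1.pullback {J : GrothendieckTopology C} {H : Cᵒᵖ ⥤ GrpCat.{u}}
    {S S' : C} (f : S' ⟶ S) : CechH1 J H S → CechH1 J H S' :=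
  Quot.map (CechCocycle.pullback f) (by
    rintro c d ⟨r, ρ, β, hβ⟩
    refine ⟨r, fun j ↦ (Over.pullback f).map (ρ j),
      fun j ↦ H.map (toBase f (𝟙 ((Over.pullback f).obj (d.U j)))).left.op (β j), ?_⟩
    intro i j T a b
    have key : ∀ (i : d.I) (a : T ⟶ (Over.pullback f).obj (d.U i)),
        H.map a.left.op (H.map (toBase f (𝟙 ((Over.pullback f).obj (d.U i)))).left.op (β i)) =
          H.map (toBase f a).left.op (β i) := by
      intro i a
      have h := toBase_precomp f a (𝟙 ((Over.pullback f).obj (d.U i)))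
      rw [Category.comp_id] at h
      rw [h, Over.comp_left, op_comp, H.map_comp]
      rfl
    have h := hβ i j (toBase f a) (toBase f b)
    simp only [Functor.comp_map, Functor.op_map, Quiver.Hom.unop_op, Over.forget_map] at h ⊢
    erw [key, key]
    refine Eq.trans ?_ h
    refine congrArg (H.map (toBase f a).left.op (β i) * ·) ?_
    exact congrArg₂ (fun x y ↦ c.cocycle.ev (r i) (r j) x y) (toBase_postcomp f a (ρ i))
      (toBase_postcomp f b (ρ j)))

end Cech

/-! ### Torsors for a sheaf of groups -/

section Torsor

variable {C : Type (u + 1)} [Category.{u} C]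

/-- A presheaf of sets on `S` with a right action of the presheaf of groups `H`. -/
structure RightSpace (H : Cᵒᵖ ⥤ GrpCat.{u}) (S : C) where
  P : (Over S)ᵒᵖ ⥤ Type u
  act : ∀ {T : Over S}, P.obj (op T) → H.obj (op T.left) → P.obj (op T)
  act_one : ∀ {T : Over S} (x : P.obj (op T)), act x 1 = x
  act_mul : ∀ {T : Over S} (x : P.obj (op T)) (g h : H.obj (op T.left)),
    act x (g * h) = act (act x g) h
  map_act : ∀ {T T' : Over S} (φ : T ⟶ T') (x : P.obj (op T')) (g : H.obj (op T'.left)),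
    P.map φ.op (act x g) = act (P.map φ.op x) (H.map φ.left.op g)

/-- The pullback along `f : S' → S`. -/
def RightSpace.restrict {H : Cᵒᵖ ⥤ GrpCat.{u}} {S S' : C} (X : RightSpace H S) (f : S' ⟶ S) :
    RightSpace H S' where
  P := (Over.map f).op ⋙ X.P
  act {T} x g := X.act (T := (Over.map f).obj T) x g
  act_one x := X.act_one x
  act_mul x g h := X.act_mul x g h
  map_act φ x g := X.map_act ((Over.map f).map φ) x g

/-- An isomorphism of `X` with `H`, on which `H` acts by right multiplication. -/
structure RightSpace.Trivialization {H : Cᵒᵖ ⥤ GrpCat.{u}} {S : C} (X : RightSpace H S) where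
  equiv : ∀ T : Over S, X.P.obj (op T) ≃ H.obj (op T.left)
  natural : ∀ {T T' : Over S} (φ : T ⟶ T') (x : X.P.obj (op T')),
    equiv T (X.P.map φ.op x) = H.map φ.left.op (equiv T' x)
  equivariant : ∀ {T : Over S} (x : X.P.obj (op T)) (g : H.obj (op T.left)),
    equiv T (X.act x g) = equiv T x * g

/-- `X` is a torsor under `H` on `S` for the topology `J`: a sheaf that is isomorphic to `H` on a
covering of `S`. -/
def RightSpace.IsTorsor {H : Cᵒᵖ ⥤ GrpCat.{u}} {S : C} (X : RightSpace H S)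
    (J : GrothendieckTopology C) : Prop :=
  Presheaf.IsSheaf (J.over S) X.P ∧
    ∃ (I : Type u) (U : I → Over S), Covers J U ∧
      ∀ i, Nonempty (X.restrict (U i).hom).Trivialization

end Torsor

/-! ### Formal schemes as inductive systems

The definitions of this section are applied below with `C` the category of `k`-schemes, `D` the
category of `k⟦z⟧`-schemes, `Th n` the functor `S ↦ S ×_k Spec k⟦z⟧/(z^(n+1))`, `incl n` the closed
immersion of the `n`-th thickening in the next one, and `Γ` the group functor `G'`. Then the formal
scheme `S⟦z⟧` is the inductive limit of the `Th n S`. -/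

section Formal

variable {C : Type (u + 1)} [Category.{u} C] {D : Type (u + 1)} [Category.{u} D]

/-- A `z`-adic formal scheme over `S⟦z⟧`, given by the inductive system of its reductions modulo the
powers of `z`: schemes `X n` over `S ×_k Spec k⟦z⟧/(z^(n+1))` such that `X n` is the base change of
`X (n + 1)`. -/
structure AdicScheme (Th : ℕ → C ⥤ D) (incl : ∀ n, Th n ⟶ Th (n + 1))
    (S : C) where
  X : ℕ → D
  π : ∀ n, X n ⟶ (Th n).obj S
  ι : ∀ n, X n ⟶ X (n + 1)
  isPullback : ∀ n, IsPullback (ι n) (π n) (π (n + 1)) ((incl n).app S)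

/-- A `z`-adic formal scheme over `S⟦z⟧` with a right action of the formal completion of `G'` by
automorphisms over `S⟦z⟧`. The action is given on points: `G'(T)` acts on `X n (T)`, functorially
in the `k⟦z⟧`-scheme `T` and compatibly for varying `n`. -/
structure AdicSpace (Th : ℕ → C ⥤ D) (incl : ∀ n, Th n ⟶ Th (n + 1))
    (Γ : Dᵒᵖ ⥤ GrpCat.{u}) (S : C) extends AdicScheme Th incl S where
  act : ∀ (n : ℕ) {T : D}, (T ⟶ X n) → Γ.obj (op T) → (T ⟶ X n)
  act_π : ∀ (n : ℕ) {T : D} (x : T ⟶ X n) (g : Γ.obj (op T)),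
    act n x g ≫ π n = x ≫ π n
  act_one : ∀ (n : ℕ) {T : D} (x : T ⟶ X n), act n x 1 = x
  act_mul : ∀ (n : ℕ) {T : D} (x : T ⟶ X n) (g h : Γ.obj (op T)),
    act n x (g * h) = act n (act n x g) h
  comp_act : ∀ (n : ℕ) {T T' : D} (φ : T ⟶ T') (x : T' ⟶ X n)
    (g : Γ.obj (op T')), φ ≫ act n x g = act n (φ ≫ x) (Γ.map φ.op g)
  act_ι : ∀ (n : ℕ) {T : D} (x : T ⟶ X n) (g : Γ.obj (op T)),
    act n x g ≫ ι n = act (n + 1) (x ≫ ι n) g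

variable {Th : ℕ → C ⥤ D} {incl : ∀ n, Th n ⟶ Th (n + 1)} {Γ : Dᵒᵖ ⥤ GrpCat.{u}}

namespace AdicSpace

/-- An equivariant isomorphism over `U⟦z⟧` of the base change of `X` along `f : U → S` with the
formal completion of `G' × U⟦z⟧`, on which `G'` acts by right multiplication. The isomorphism is
given on points: a `T`-valued point of the base change of `X n` is a pair of a point `u` of the
`n`-th thickening of `U` and a point `x` of `X n` with the same image in the thickening of `S`. -/
structure Trivialization {S U : C} (X : AdicSpace Th incl Γ S) (f : U ⟶ S) where
  toFun : ∀ (n : ℕ) {T : D} (u : T ⟶ (Th n).obj U) (x : T ⟶ X.X n),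
    x ≫ X.π n = u ≫ (Th n).map f → Γ.obj (op T)
  bijective : ∀ (n : ℕ) {T : D} (u : T ⟶ (Th n).obj U)
    (g : Γ.obj (op T)),
    ∃! x : T ⟶ X.X n, ∃ hx : x ≫ X.π n = u ≫ (Th n).map f, toFun n u x hx = g
  natural : ∀ (n : ℕ) {T T' : D} (φ : T ⟶ T') (u : T' ⟶ (Th n).obj U)
    (x : T' ⟶ X.X n) (hx : x ≫ X.π n = u ≫ (Th n).map f)
    (hx' : (φ ≫ x) ≫ X.π n = (φ ≫ u) ≫ (Th n).map f),
    toFun n (φ ≫ u) (φ ≫ x) hx' = Γ.map φ.op (toFun n u x hx)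
  equivariant : ∀ (n : ℕ) {T : D} (u : T ⟶ (Th n).obj U) (x : T ⟶ X.X n)
    (g : Γ.obj (op T)) (hx : x ≫ X.π n = u ≫ (Th n).map f)
    (hx' : X.act n x g ≫ X.π n = u ≫ (Th n).map f),
    toFun n u (X.act n x g) hx' = toFun n u x hx * g
  compatible : ∀ (n : ℕ) {T : D} (u : T ⟶ (Th n).obj U) (x : T ⟶ X.X n)
    (hx : x ≫ X.π n = u ≫ (Th n).map f)
    (hx' : (x ≫ X.ι n) ≫ X.π (n + 1) = (u ≫ (incl n).app U) ≫ (Th (n + 1)).map f),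
    toFun (n + 1) (u ≫ (incl n).app U) (x ≫ X.ι n) hx' = toFun n u x hx

/-- An equivariant isomorphism over `S⟦z⟧`. -/
structure Iso {S : C} (X Y : AdicSpace Th incl Γ S) where
  iso : ∀ n, X.X n ≅ Y.X n
  hom_π : ∀ n, (iso n).hom ≫ Y.π n = X.π n
  hom_ι : ∀ n, (iso n).hom ≫ Y.ι n = X.ι n ≫ (iso (n + 1)).hom
  equivariant : ∀ (n : ℕ) {T : D} (x : T ⟶ X.X n) (g : Γ.obj (op T)),
    X.act n x g ≫ (iso n).hom = Y.act n (x ≫ (iso n).hom) g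

/-- `Y` is the base change of `X` along `f : S' → S`. -/
def IsBaseChange {S S' : C} (f : S' ⟶ S) (Y : AdicSpace Th incl Γ S') (X : AdicSpace Th incl Γ S) :
    Prop :=
  ∃ φ : ∀ n, Y.X n ⟶ X.X n,
    (∀ n, IsPullback (φ n) (Y.π n) (X.π n) ((Th n).map f)) ∧
    (∀ n, φ n ≫ X.ι n = Y.ι n ≫ φ (n + 1)) ∧
    ∀ (n : ℕ) {T : D} (y : T ⟶ Y.X n) (g : Γ.obj (op T)),
      Y.act n y g ≫ φ n = X.act n (y ≫ φ n) g

end AdicSpace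

variable (Th incl Γ) in
/-- A formal torsor over `S⟦z⟧` for the formal completion of `G'`: it is isomorphic to `G'` over
`U⟦z⟧` for a covering `U` of `S` in the topology `J`. -/
structure AdicTorsor (J : GrothendieckTopology C) (S : C) extends
    AdicSpace Th incl Γ S where
  locally_trivial : ∃ (I : Type u) (U : I → Over S), Covers J U ∧
    ∀ i, Nonempty (toAdicSpace.Trivialization (U i).hom)

variable (Th incl Γ) in
/-- The set of isomorphism classes of formal torsors over `S⟦z⟧`. -/
def AdicPHS (J : GrothendieckTopology C) (S : C) : Type (u + 1) :=
  Quot (fun X Y : AdicTorsor Th incl Γ J S ↦ Nonempty (X.toAdicSpace.Iso Y.toAdicSpace))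

/-- The natural map from the torsors for a topology to the torsors for a finer topology. -/
def AdicPHS.map {J J' : GrothendieckTopology C} (h : J ≤ J') (S : C) :
    AdicPHS Th incl Γ J S → AdicPHS Th incl Γ J' S :=
  Quot.map
    (fun Y ↦
      { toAdicSpace := Y.toAdicSpace
        locally_trivial := by
          obtain ⟨I, U, hU, hY⟩ := Y.locally_trivial
          exact ⟨I, U, h S hU, hY⟩ })
    (fun _ _ e ↦ e)

/-! The trivial torsor `M × Th n S`, where `M` represents the group functor. -/

section Trivial

variable [HasBinaryProducts D] (Γ) {M : D} (e : ∀ T : D, (T ⟶ M) ≃ Γ.obj (op T))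

theorem isPullback_prod {Z Z' : D} (M : D) (j : Z ⟶ Z') :
    IsPullback (prod.map (𝟙 M) j) prod.snd prod.snd j := by
  refine IsPullback.of_isLimit' ⟨prod.map_snd _ _⟩ (PullbackCone.IsLimit.mk _
    (fun s ↦ prod.lift (s.fst ≫ prod.fst) s.snd) ?_ ?_ ?_)
  · intro s
    apply Limits.prod.hom_ext
    · rw [Category.assoc, prod.map_fst, ← Category.assoc, prod.lift_fst, Category.comp_id]
    · rw [Category.assoc, prod.map_snd, ← Category.assoc, prod.lift_snd]
      exact s.condition.symm
  · intro s
    exact prod.lift_snd _ _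
  · intro s m h₁ h₂
    apply Limits.prod.hom_ext
    · rw [prod.lift_fst, ← h₁, Category.assoc, prod.map_fst, Category.comp_id]
    · rw [prod.lift_snd]
      exact h₂

/-- The first coordinate of a point of `M × Z`, where `M` represents the group functor `Γ`. -/
noncomputable def prodCoord {Z T : D} (x : T ⟶ M ⨯ Z) : Γ.obj (op T) := e T (x ≫ prod.fst)

/-- Right multiplication on the first factor of `M × Z`. -/
noncomputable def prodAct {Z T : D} (x : T ⟶ M ⨯ Z) (g : Γ.obj (op T)) : T ⟶ M ⨯ Z :=
  prod.lift ((e T).symm (prodCoord Γ e x * g)) (x ≫ prod.snd)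

theorem prodAct_snd {Z T : D} (x : T ⟶ M ⨯ Z) (g : Γ.obj (op T)) :
    prodAct Γ e x g ≫ prod.snd = x ≫ prod.snd :=
  prod.lift_snd _ _

theorem prodCoord_prodAct {Z T : D} (x : T ⟶ M ⨯ Z) (g : Γ.obj (op T)) :
    prodCoord Γ e (prodAct Γ e x g) = prodCoord Γ e x * g := by
  rw [prodCoord, prodAct, prod.lift_fst, Equiv.apply_symm_apply]

theorem prod_ext_coord {Z T : D} {x y : T ⟶ M ⨯ Z} (h₁ : prodCoord Γ e x = prodCoord Γ e y)
    (h₂ : x ≫ prod.snd = y ≫ prod.snd) : x = y :=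
  Limits.prod.hom_ext ((e T).injective h₁) h₂

theorem prodAct_one {Z T : D} (x : T ⟶ M ⨯ Z) : prodAct Γ e x 1 = x :=
  prod_ext_coord Γ e (by rw [prodCoord_prodAct, mul_one]) (prodAct_snd Γ e x 1)

theorem prodAct_mul {Z T : D} (x : T ⟶ M ⨯ Z) (g h : Γ.obj (op T)) :
    prodAct Γ e x (g * h) = prodAct Γ e (prodAct Γ e x g) h :=
  prod_ext_coord Γ e (by simp only [prodCoord_prodAct, mul_assoc]) (by simp only [prodAct_snd])

theorem prodCoord_comp (he : ∀ (T T' : D) (φ : T ⟶ T') (x : T' ⟶ M),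
    e T (φ ≫ x) = Γ.map φ.op (e T' x)) {Z T T' : D} (φ : T ⟶ T') (x : T' ⟶ M ⨯ Z) :
    prodCoord Γ e (φ ≫ x) = Γ.map φ.op (prodCoord Γ e x) := by
  rw [prodCoord, Category.assoc, he]
  rfl

theorem comp_prodAct (he : ∀ (T T' : D) (φ : T ⟶ T') (x : T' ⟶ M),
    e T (φ ≫ x) = Γ.map φ.op (e T' x)) {Z T T' : D} (φ : T ⟶ T') (x : T' ⟶ M ⨯ Z)
    (g : Γ.obj (op T')) :
    φ ≫ prodAct Γ e x g = prodAct Γ e (φ ≫ x) (Γ.map φ.op g) :=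
  prod_ext_coord Γ e
    (by rw [prodCoord_comp Γ e he, prodCoord_prodAct, prodCoord_prodAct,
      prodCoord_comp Γ e he, map_mul])
    (by rw [Category.assoc, prodAct_snd, prodAct_snd, Category.assoc])

theorem prodCoord_map {Z Z' T : D} (x : T ⟶ M ⨯ Z) (j : Z ⟶ Z') :
    prodCoord Γ e (x ≫ prod.map (𝟙 M) j) = prodCoord Γ e x := by
  rw [prodCoord, Category.assoc, prod.map_fst, Category.comp_id, prodCoord]

theorem prodAct_map {Z Z' T : D} (x : T ⟶ M ⨯ Z) (g : Γ.obj (op T)) (j : Z ⟶ Z') :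
    prodAct Γ e x g ≫ prod.map (𝟙 M) j = prodAct Γ e (x ≫ prod.map (𝟙 M) j) g :=
  prod_ext_coord Γ e
    (by rw [prodCoord_map, prodCoord_prodAct, prodCoord_prodAct, prodCoord_map])
    (by
      rw [prodAct_snd, Category.assoc, Category.assoc, prod.map_snd, ← Category.assoc,
        prodAct_snd, Category.assoc])

theorem existsUnique_prodCoord {Z T : D} (u : T ⟶ Z) (g : Γ.obj (op T)) :
    ∃! x : T ⟶ M ⨯ Z, x ≫ prod.snd = u ∧ prodCoord Γ e x = g :=
  ⟨prod.lift ((e T).symm g) u,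
    ⟨prod.lift_snd _ _, by rw [prodCoord, prod.lift_fst, Equiv.apply_symm_apply]⟩,
    fun y hy ↦ prod_ext_coord Γ e
      (by rw [hy.2, prodCoord, prod.lift_fst, Equiv.apply_symm_apply])
      (by rw [hy.1, prod.lift_snd])⟩

/-- The trivial torsor, with the group acting by right multiplication. -/
noncomputable def AdicSpace.trivial (he : ∀ (T T' : D) (φ : T ⟶ T') (x : T' ⟶ M),
    e T (φ ≫ x) = Γ.map φ.op (e T' x)) (S : C) : AdicSpace Th incl Γ S where
  X n := M ⨯ (Th n).obj S
  π n := prod.snd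
  ι n := prod.map (𝟙 _) ((incl n).app S)
  isPullback n := isPullback_prod _ _
  act n T x g := prodAct Γ e x g
  act_π n T x g := prodAct_snd Γ e x g
  act_one n T x := prodAct_one Γ e x
  act_mul n T x g h := prodAct_mul Γ e x g h
  comp_act n T T' φ x g := comp_prodAct Γ e he φ x g
  act_ι n T x g := prodAct_map Γ e x g _

/-- The trivialization of the trivial torsor. -/
noncomputable def AdicSpace.trivialTrivialization (he : ∀ (T T' : D) (φ : T ⟶ T') (x : T' ⟶ M),
    e T (φ ≫ x) = Γ.map φ.op (e T' x)) (S : C) :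
    (AdicSpace.trivial (Th := Th) (incl := incl) Γ e he S).Trivialization (𝟙 S) where
  toFun n T u x hx := prodCoord Γ e x
  bijective n T u g := by
    have hid : u ≫ (Th n).map (𝟙 S) = u := by
      rw [(Th n).map_id, Category.comp_id]
    obtain ⟨x, ⟨h₁, h₂⟩, h₃⟩ := existsUnique_prodCoord Γ e u g
    exact ⟨x, ⟨h₁.trans hid.symm, h₂⟩, fun y ⟨hy, hy'⟩ ↦ h₃ y ⟨hy.trans hid, hy'⟩⟩
  natural n T T' φ u x hx hx' := prodCoord_comp Γ e he φ x
  equivariant n T u x g hx hx' := prodCoord_prodAct Γ e x g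
  compatible n T u x hx hx' := prodCoord_map Γ e x _

/-- The class of the trivial torsor. -/
noncomputable def AdicPHS.base (he : ∀ (T T' : D) (φ : T ⟶ T') (x : T' ⟶ M),
    e T (φ ≫ x) = Γ.map φ.op (e T' x)) (J : GrothendieckTopology C) (S : C) :
    AdicPHS Th incl Γ J S :=
  Quot.mk _
    { AdicSpace.trivial Γ e he S with
      locally_trivial := ⟨PUnit, fun _ ↦ Over.mk (𝟙 S), covers_self J S,
        fun _ ↦ ⟨AdicSpace.trivialTrivialization Γ e he S⟩⟩ }

end Trivial

end Formal

section FormalTorsors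

variable {k A : Type u} [Field k] [CommRing A] [HopfAlgebra k A]

/-! ### The formal schemes `S⟦z⟧` and formal torsors -/

/-- The functor `S ↦ S ×_k Spec k⟦z⟧/(z^(n+1))` from `k`-schemes to `k⟦z⟧`-schemes. -/
noncomputable def thick (k : Type u) [Field k] (n : ℕ) : SchOver k ⥤ SchOver k⟦X⟧ :=
  Over.pullback (Spec.map (CommRingCat.ofHom
      (algebraMap k (k⟦X⟧ ⧸ Ideal.span {(X : k⟦X⟧) ^ (n + 1)})))) ⋙
    Over.map (Spec.map (CommRingCat.ofHom (Ideal.Quotient.mk (Ideal.span {(X : k⟦X⟧) ^ (n + 1)}))))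

/-- The projection `S ×_k Spec k⟦z⟧/(z^(n+1)) → S`. -/
noncomputable def thickProj (n : ℕ) (S : SchOver k) : ((thick k n).obj S).left ⟶ S.left :=
  Limits.pullback.fst S.hom _

theorem span_pow_le (k : Type u) [Field k] (n : ℕ) :
    Ideal.span {(X : k⟦X⟧) ^ (n + 1 + 1)} ≤ Ideal.span {(X : k⟦X⟧) ^ (n + 1)} :=
  Ideal.span_singleton_le_span_singleton.2 (pow_dvd_pow _ (Nat.le_succ _))

/-- The closed immersion `Spec k⟦z⟧/(z^(n+1)) → Spec k⟦z⟧/(z^(n+2))`. -/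
noncomputable def thickIncl₀ (k : Type u) [Field k] (n : ℕ) :
    Spec (CommRingCat.of (k⟦X⟧ ⧸ Ideal.span {(X : k⟦X⟧) ^ (n + 1)})) ⟶
      Spec (CommRingCat.of (k⟦X⟧ ⧸ Ideal.span {(X : k⟦X⟧) ^ (n + 1 + 1)})) :=
  Spec.map (CommRingCat.ofHom (Ideal.Quotient.factor (span_pow_le k n)))

theorem thickIncl₀_algebraMap (k : Type u) [Field k] (n : ℕ) :
    thickIncl₀ k n ≫ Spec.map (CommRingCat.ofHom
        (algebraMap k (k⟦X⟧ ⧸ Ideal.span {(X : k⟦X⟧) ^ (n + 1 + 1)}))) =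
      Spec.map (CommRingCat.ofHom
        (algebraMap k (k⟦X⟧ ⧸ Ideal.span {(X : k⟦X⟧) ^ (n + 1)}))) := by
  rw [thickIncl₀, ← Spec.map_comp, ← CommRingCat.ofHom_comp]
  rfl

theorem thickIncl₀_mk (k : Type u) [Field k] (n : ℕ) :
    thickIncl₀ k n ≫ Spec.map (CommRingCat.ofHom
        (Ideal.Quotient.mk (Ideal.span {(X : k⟦X⟧) ^ (n + 1 + 1)}))) =
      Spec.map (CommRingCat.ofHom (Ideal.Quotient.mk (Ideal.span {(X : k⟦X⟧) ^ (n + 1)}))) := by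
  rw [thickIncl₀, ← Spec.map_comp, ← CommRingCat.ofHom_comp]
  rfl

/-- For morphisms `p : Y → B`, `p' : Y' → B` and `q : Y → E`, `q' : Y' → E`, a morphism `i : Y → Y'`
over `B` and `E` induces morphisms `S ×_B Y → S ×_B Y'` over `E`. -/
noncomputable def pullbackMapHom {C : Type (u + 1)} [Category.{u} C] [HasPullbacks C]
    {B E Y Y' : C} {p : Y ⟶ B} {p' : Y' ⟶ B} {q : Y ⟶ E} {q' : Y' ⟶ E} (i : Y ⟶ Y')
    (hp : i ≫ p' = p) (hq : i ≫ q' = q) :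
    Over.pullback p ⋙ Over.map q ⟶ Over.pullback p' ⋙ Over.map q' where
  app S := Over.homMk
    (Limits.pullback.lift (Limits.pullback.fst S.hom p) (Limits.pullback.snd S.hom p ≫ i)
      (by rw [Category.assoc, hp, Limits.pullback.condition]))
    (by
      simp only [Functor.comp_obj, Over.map_obj_hom, Over.pullback_obj_hom]
      rw [Limits.pullback.lift_snd_assoc, Category.assoc, hq])
  naturality S S' f := by
    apply Over.OverMorphism.ext
    apply Limits.pullback.hom_ext
    · simp [Limits.pullback.lift_fst, Limits.pullback.lift_fst_assoc]
    · simp [Limits.pullback.lift_snd, Limits.pullback.lift_snd_assoc]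

/-- The closed immersions `S ×_k Spec k⟦z⟧/(z^(n+1)) → S ×_k Spec k⟦z⟧/(z^(n+2))`. -/
noncomputable def thickIncl (k : Type u) [Field k] (n : ℕ) : thick k n ⟶ thick k (n + 1) :=
  pullbackMapHom (thickIncl₀ k n) (thickIncl₀_algebraMap k n) (thickIncl₀_mk k n)

section Model

variable (Q : ClosedSubgroupScheme k A)

/-- The scheme `G'` over `k⟦z⟧`. -/
noncomputable def modelScheme : SchOver k⟦X⟧ :=
  (algSpec (CommRingCat.of k⟦X⟧)).obj (op (CommAlgCat.of k⟦X⟧ (dilatation Q)))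

/-- `G'` represents its functor of points. -/
noncomputable def modelPoint (T : SchOver k⟦X⟧) :
    (T ⟶ modelScheme Q) ≃ (modelGroup Q).obj (op T) where
  toFun x := WithConv.toConv
    (((algΓAlgSpecAdjunction (CommRingCat.of k⟦X⟧)).homEquiv T _).symm x).unop.hom
  invFun g := ((algΓAlgSpecAdjunction (CommRingCat.of k⟦X⟧)).homEquiv T
    (op (CommAlgCat.of k⟦X⟧ (dilatation Q)))) (CommAlgCat.ofHom (WithConv.ofConv g)).op
  left_inv x := ((algΓAlgSpecAdjunction (CommRingCat.of k⟦X⟧)).homEquiv T _).apply_symm_apply x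
  right_inv g := congrArg (fun m ↦ WithConv.toConv m.unop.hom)
    (((algΓAlgSpecAdjunction (CommRingCat.of k⟦X⟧)).homEquiv T
      (op (CommAlgCat.of k⟦X⟧ (dilatation Q)))).symm_apply_apply
        (CommAlgCat.ofHom (WithConv.ofConv g)).op)

theorem modelPoint_comp {T T' : SchOver k⟦X⟧} (φ : T ⟶ T') (x : T' ⟶ modelScheme Q) :
    modelPoint Q T (φ ≫ x) = (modelGroup Q).map φ.op (modelPoint Q T' x) := by
  have h := Adjunction.homEquiv_naturality_left_symm
    (algΓAlgSpecAdjunction (CommRingCat.of k⟦X⟧)) φ x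
  exact congrArg (fun m ↦ WithConv.toConv m.unop.hom) h

theorem comp_modelPoint_symm {T T' : SchOver k⟦X⟧} (φ : T ⟶ T')
    (g : (modelGroup Q).obj (op T')) :
    φ ≫ (modelPoint Q T').symm g = (modelPoint Q T).symm ((modelGroup Q).map φ.op g) := by
  rw [Equiv.eq_symm_apply, modelPoint_comp, Equiv.apply_symm_apply]

/-- A `z`-adic formal scheme over `S⟦z⟧` with a right action of the formal completion of `G'`. -/
abbrev FormalSpace (S : SchOver k) := AdicSpace (thick k) (thickIncl k) (modelGroup Q) S

/-- A formal torsor over `S⟦z⟧` under the formal completion of `G'`, for the topology `J`. -/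
abbrev FormalTorsor (J : GrothendieckTopology (SchOver k)) (S : SchOver k) :=
  AdicTorsor (thick k) (thickIncl k) (modelGroup Q) J S

/-- The set of isomorphism classes of formal torsors over `S⟦z⟧`. -/
abbrev PHS (J : GrothendieckTopology (SchOver k)) (S : SchOver k) : Type (u + 1) :=
  AdicPHS (thick k) (thickIncl k) (modelGroup Q) J S

/-- The class of the trivial formal torsor `G' × S⟦z⟧`. -/
noncomputable def PHS.base (J : GrothendieckTopology (SchOver k)) (S : SchOver k) : PHS Q J S :=
  AdicPHS.base (modelGroup Q) (modelPoint Q) (fun _ _ φ x ↦ modelPoint_comp Q φ x) J S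

end Model

/-! ### The cocycle of a formal torsor -/

/-- An element of `K'(S)`, as a homomorphism `O(G) → Γ(S, O_S)⟦z⟧`. -/
noncomputable def loopPoint {Q : ClosedSubgroupScheme k A} {S : SchOver k}
    (h : (loopGroup Q).obj (op S)) : A →ₐ[k] (globalSections S)⟦X⟧ :=
  WithConv.ofConv (Subtype.val (p := (· ∈ loopSubgroup Q (globalSections S))) h)

/-- An element of `G'(T)`, as a homomorphism `O(G') → Γ(T, O_T)`. -/
noncomputable def modelPointHom {Q : ClosedSubgroupScheme k A} {T : SchOver k⟦X⟧}
    (g : (modelGroup Q).obj (op T)) : dilatation Q →ₐ[k⟦X⟧] globalSections T :=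
  WithConv.ofConv (A := dilatation Q →ₐ[k⟦X⟧] globalSections T) g

/-- The point `g ∈ G'(T)` is the image of `h ∈ K'(S)` under the reduction
`K'(S) = G'(Γ(S, O_S)⟦z⟧) → G'(T)` that belongs to `t : T → S ×_k Spec k⟦z⟧/(z^(n+1))`. The
map `h' : O(G') → Γ(S, O_S)⟦z⟧` is the (unique) extension of `h`, and the ring homomorphism
`Γ(S, O_S)⟦z⟧ → Γ(T, O_T)` sends `∑ bᵢ zⁱ` to the finite sum of the `t^*(bᵢ) zⁱ` with `i ≤ n`. -/
def IsReduction {Q : ClosedSubgroupScheme k A} {S : SchOver k} (h : (loopGroup Q).obj (op S)) (n : ℕ)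
    {T : SchOver k⟦X⟧} (t : T ⟶ (thick k n).obj S) (g : (modelGroup Q).obj (op T)) : Prop :=
  ∃ h' : dilatation Q →ₐ[k⟦X⟧] (globalSections S)⟦X⟧,
    (∀ a : A, h' (dilatation.incl Q a) = loopPoint h a) ∧
    ∀ d : dilatation Q, modelPointHom g d =
      ∑ i ∈ Finset.range (n + 1),
        (show globalSections T from
          (t.left ≫ thickProj n S).appTop.hom (PowerSeries.coeff i (h' d))) *
        algebraMap k⟦X⟧ (globalSections T) X ^ i

/-- `γ` is the cocycle of the transition maps `α i ∘ (α j)⁻¹` of the trivializations `α i` of `X`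
over the `U i`: over a common `S`-scheme `V` of `U i` and `U j` the map `α i ∘ (α j)⁻¹` is the left
multiplication by the section of `γ` over `V`. -/
def IsTransitionCocycle {Q : ClosedSubgroupScheme k A} {S : SchOver k} (X : FormalSpace Q S) {I : Type u}
    (U : I → Over S) (α : ∀ i, X.Trivialization (U i).hom)
    (γ : PresheafOfGroups.OneCocycle (restrictOver (loopGroup Q) S) U) : Prop :=
  ∀ (i j : I) (V : Over S) (a : V ⟶ U i) (b : V ⟶ U j) (n : ℕ) (T : SchOver k⟦X⟧)
    (t : T ⟶ (thick k n).obj V.left) (x : T ⟶ X.X n)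
    (hi : x ≫ X.π n = (t ≫ (thick k n).map a.left) ≫ (thick k n).map (U i).hom)
    (hj : x ≫ X.π n = (t ≫ (thick k n).map b.left) ≫ (thick k n).map (U j).hom),
    ∃ g : (modelGroup Q).obj (op T), IsReduction (S := V.left) (γ.ev i j a b) n t g ∧
      (α i).toFun n (t ≫ (thick k n).map a.left) x hi =
        g * (α j).toFun n (t ≫ (thick k n).map b.left) x hj

/-! ### Thickenings of affine schemes -/

/-- `Spec R` as a `k`-scheme. -/
noncomputable abbrev affineSch (k R : Type u) [Field k] [CommRing R] [Algebra k R] : SchOver k :=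
  (algSpec (CommRingCat.of k)).obj (op (CommAlgCat.of k R))

/-- The closed immersion `Spec (R ⧸ 𝔞) → Spec R`. -/
noncomputable abbrev affineIncl (k : Type u) {R : Type u} [Field k] [CommRing R] [Algebra k R]
    (𝔞 : Ideal R) : affineSch k (R ⧸ 𝔞) ⟶ affineSch k R :=
  (algSpec (CommRingCat.of k)).map (CommAlgCat.ofHom (Ideal.Quotient.mkₐ k 𝔞)).op

end FormalTorsors

end LoopTorsor

open LoopTorsor

-- Write `Th n` for the functor S ↦ S ×_k Spec k⟦z⟧/(z^(n+1)). Everything rests on two facts about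
-- `G'`.
--
-- First, `K'(V)` is the group of compatible systems of points of `G'` over all the `Th n V`
-- (`IsDilatation.existsUnique_red`). Indeed, the condition g mod z ∈ Q is exactly what the
-- universal property of the dilatation needs in order to extend A → B⟦z⟧ to O(G'), so that K'(B) =
-- G'(B⟦z⟧). Moreover the functions on `Th n V` are uniquely of the form ∑ b_j z^j with j ≤ n, also
-- when V is not affine, so that compatible systems of functions are power series.
--
-- Second, `G'` is smooth over k⟦z⟧ (`smooth_dilatation`). It is flat and of finite type, and its
-- fibres are formally smooth: where z is invertible this is the smoothness of G, and where z = 0 a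
-- lift is the constant term of a suitable one-parameter deformation
-- (`IsDilatation.exists_lift_of_eq_zero`).
--
-- Part (a). Two trivializations over U⟦z⟧ differ by a unique element of `K'(U)`. So local
-- trivializations have a transition cocycle, and another choice of trivializations changes neither
-- its Čech class nor the torsor. Torsors with the same cocycle are isomorphic since both represent
-- the functor `Fam` of local coordinates related by that cocycle. Conversely, for each n and each
-- cocycle `Fam` is an fpqc sheaf over `Th n S` that is locally a product with the affine scheme
-- `G'`. Effective fpqc descent for affine morphisms (`exists_isUniversalOver`) represents it by a
-- scheme that is affine and smooth over `Th n S`, and the representing schemes form a formal torsor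
-- (`exists_isTransition_of_universal`).
--
-- Part (b). The reduction `X 0` of a formal torsor is smooth and surjective over S, hence has
-- sections locally for the étale topology (`exists_etale_section`). Over an affine étale U such a
-- section lifts to all `Th n U` by smoothness, and a compatible system of sections is a
-- trivialization. So every formal fpqc torsor is trivial étale locally, which gives surjectivity.
-- For injectivity, two cocycles that become equivalent in the finer topology belong to one formal
-- torsor, and its two families of trivializations are compared on the fibre products of the two
-- coverings, which form a covering already in the coarser topology.
--
-- Part (c). A section over `Th (n+1) S` is prescribed on the two closed subschemes `Th n S` and `Th
-- (n+1) S̄`, whose intersection is `Th n S̄`. Since one of them is defined by a nilpotent ideal,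
-- the infinitesimal lifting property extends the two pieces together
-- (`exists_section_of_isPullback`). A sheaf torsor is handled through the formal torsor with the
-- same cocycle: the given trivialization becomes a compatible system of sections over S̄, and the
-- coordinates of a lifted system define a global point of the sheaf torsor.

universe w v

namespace LoopTorsor

/-! ### Descent of algebras along flat homomorphisms. -/

section
variable {R R' M : Type u} [CommRing R] [CommRing R'] [Algebra R R'] [CommRing M] [Algebra R M]
  [Algebra R' M] [IsScalarTower R R' M]

open scoped TensorProduct

/-- Descent of algebras along a flat ring homomorphism: an algebra with a descent datum is the
base change of the algebra of its invariants. -/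
theorem bijective_lift_equalizer [Module.Flat R R'] (ρ : M →ₐ[R] R' ⊗[R] M)
    (smul : ∀ (r : R') (m : M), ρ (r • m) = (r ⊗ₜ 1) * ρ m)
    (counit : ∀ m : M, Algebra.TensorProduct.lift (Algebra.ofId R' M) (AlgHom.id R M)
      (fun _ _ ↦ Commute.all _ _) (ρ m) = m)
    (coassoc : ∀ m : M, Algebra.TensorProduct.map (AlgHom.id R R') ρ (ρ m) =
      Algebra.TensorProduct.map (AlgHom.id R R') Algebra.TensorProduct.includeRight (ρ m)) :
    Function.Bijective (Algebra.TensorProduct.lift (Algebra.ofId R' M)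
      (AlgHom.equalizer ρ Algebra.TensorProduct.includeRight).val (fun _ _ ↦ Commute.all _ _)) := by
  set E := AlgHom.equalizer ρ (Algebra.TensorProduct.includeRight : M →ₐ[R] R' ⊗[R] M) with hE
  -- Followed by `ρ`, the map in question is the base change of the inclusion of the invariants,
  -- which is injective because `R'` is flat. This gives injectivity.
  have hρ : ∀ x : R' ⊗[R] E, ρ (Algebra.TensorProduct.lift (Algebra.ofId R' M) E.val
      (fun _ _ ↦ Commute.all _ _) x) = Algebra.TensorProduct.map (AlgHom.id R R') E.val x := by
    intro x
    induction x with
    | zero => simp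
    | add x y hx hy => simp only [map_add, hx, hy]
    | tmul r e =>
      have he : ρ e = 1 ⊗ₜ (e : M) := e.2
      rw [Algebra.TensorProduct.lift_tmul, Algebra.ofId_apply, ← Algebra.smul_def, smul]
      simp [he]
  have hinj : Function.Injective (Algebra.TensorProduct.map (AlgHom.id R R') E.val) :=
    Module.Flat.lTensor_preserves_injective_linearMap (M := R') E.val.toLinearMap
      Subtype.val_injective
  constructor
  · rw [injective_iff_map_eq_zero]
    intro x hx
    apply hinj
    rw [← hρ, hx, map_zero, map_zero]
  · intro m
    -- Flat base change commutes with equalizers, and coassociativity says that `ρ m` lies in the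
    -- base-changed equalizer. The counit then turns a preimage of `ρ m` into a preimage of `m`.
    have h := Module.Flat.eqLocus_lTensor_eq R R' ρ.toLinearMap
      (Algebra.TensorProduct.includeRight : M →ₐ[R] R' ⊗[R] M).toLinearMap
    have hm : ρ m ∈ LinearMap.eqLocus (ρ.toLinearMap.lTensor R')
      ((Algebra.TensorProduct.includeRight : M →ₐ[R] R' ⊗[R] M).toLinearMap.lTensor R') :=
      coassoc m
    obtain ⟨x, hx⟩ : ∃ x : R' ⊗[R] E,
        Algebra.TensorProduct.map (AlgHom.id R R') E.val x = ρ m := h.le hm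
    refine ⟨x, ?_⟩
    rw [← counit m, ← hx]
    clear hx hm h
    induction x with
    | zero => simp
    | add x y hx hy => simp only [map_add, hx, hy]
    | tmul r e => simp
end

/-! ### Gluing sections of sheaves and descending universal sections. -/

section
variable {E : Type u} [Category.{v} E]

theorem map_op_comp (F : Eᵒᵖ ⥤ Type w) {T T' T'' : E} (a : T'' ⟶ T') (b : T' ⟶ T)
    (x : F.obj (op T)) : F.map (a ≫ b).op x = F.map a.op (F.map b.op x) := by
  rw [op_comp, F.map_comp]; rfl

/-- Gluing of the sections of a sheaf over a covering sieve. -/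
theorem existsUnique_glue {K : GrothendieckTopology E} {F : Eᵒᵖ ⥤ Type w}
    (hF : Presieve.IsSheaf K F) {T : E} {R : Sieve T} (hR : R ∈ K T)
    (s : ∀ {T' : E} (φ : T' ⟶ T), R φ → F.obj (op T'))
    (hs : ∀ {T' T'' : E} (ψ : T'' ⟶ T') (φ : T' ⟶ T) (h : R φ),
      s (ψ ≫ φ) (R.downward_closed h ψ) = F.map ψ.op (s φ h)) :
    ∃! x : F.obj (op T), ∀ {T' : E} (φ : T' ⟶ T) (h : R φ), F.map φ.op x = s φ h := by
  let σ : Presieve.FamilyOfElements F R.arrows := fun _ φ h ↦ s φ h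
  have hc : σ.Compatible := by
    rw [Presieve.compatible_iff_sieveCompatible]
    exact fun Y Z f g h ↦ hs g f h
  obtain ⟨x, hx, hu⟩ := hF R hR σ hc
  exact ⟨x, fun φ h ↦ hx φ h, fun y hy ↦ hu y fun _ φ h ↦ hy φ h⟩

theorem sheaf_ext {K : GrothendieckTopology E} {F : Eᵒᵖ ⥤ Type w}
    (hF : Presieve.IsSheaf K F) {T : E} {R : Sieve T} (hR : R ∈ K T) {x y : F.obj (op T)}
    (h : ∀ {T' : E} (φ : T' ⟶ T), R φ → F.map φ.op x = F.map φ.op y) : x = y :=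
  (hF.isSeparated R hR).ext fun _ φ hφ ↦ h φ hφ

theorem existsUnique_glue_of_cover {K : GrothendieckTopology E} {F : Eᵒᵖ ⥤ Type w}
    (hF : Presieve.IsSheaf K F) {T T₁ : E} (c : T₁ ⟶ T) (hc : Sieve.generate (.singleton c) ∈ K T)
    (y : F.obj (op T₁))
    (hy : ∀ {T₂ : E} (a b : T₂ ⟶ T₁), a ≫ c = b ≫ c → F.map a.op y = F.map b.op y) :
    ∃! x : F.obj (op T), F.map c.op x = y := by
  have key := (Presieve.isSheafFor_iff_generate _).2 (hF _ hc)
  have hcomp : Presieve.FamilyOfElements.Compatible (P := F)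
      -- The presieve has `c` as its only arrow; the `eqToHom` only identifies the domain of an
      -- arrow of the presieve with `T₁`.
      (R := Presieve.singleton c) (fun _ φ h ↦ F.map (eqToHom (by cases h; rfl)).op y) := by
    rintro _ _ _ a b _ _ ⟨⟩ ⟨⟩ hab
    simpa using hy a b hab
  obtain ⟨x, hx, hu⟩ := key _ hcomp
  refine ⟨x, by simpa using hx c ⟨⟩, fun x' hx' ↦ hu x' ?_⟩
  rintro _ _ ⟨⟩
  simpa using hx'

theorem sheaf_ext_of_cover {K : GrothendieckTopology E} {F : Eᵒᵖ ⥤ Type w}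
    (hF : Presieve.IsSheaf K F) {T T₁ : E} (c : T₁ ⟶ T) (hc : Sieve.generate (.singleton c) ∈ K T)
    {x y : F.obj (op T)} (h : F.map c.op x = F.map c.op y) : x = y := by
  refine sheaf_ext hF hc ?_
  rintro T' φ ⟨Z, a, b, ⟨⟩, rfl⟩
  simp only [op_comp, F.map_comp]
  exact congrArg (F.map a.op) h

/-- For a presheaf `F` over the object `Z` and `w : W ⟶ Z`, the object `Y` over `W` with the
section `y` of `F` represents the base change of `F` to `W`. -/
def IsUniversalOver (F : Eᵒᵖ ⥤ Type w) {Z : E} (τ : ∀ T : E, F.obj (op T) → (T ⟶ Z))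
    {W Y : E} (w : W ⟶ Z) (π : Y ⟶ W) (y : F.obj (op Y)) : Prop :=
  τ _ y = π ≫ w ∧ ∀ {T : E} (t : T ⟶ W) (f : F.obj (op T)), τ _ f = t ≫ w →
    ∃! x : T ⟶ Y, x ≫ π = t ∧ F.map x.op y = f

variable {F : Eᵒᵖ ⥤ Type w} {Z : E} {τ : ∀ T : E, F.obj (op T) → (T ⟶ Z)}

theorem IsUniversalOver.hom_ext
    (hτ : ∀ {T T' : E} (φ : T ⟶ T') (f : F.obj (op T')), τ _ (F.map φ.op f) = φ ≫ τ _ f)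
    {W Y : E} {w : W ⟶ Z} {π : Y ⟶ W} {y : F.obj (op Y)}
    (h : IsUniversalOver F τ w π y) {T : E} {x₁ x₂ : T ⟶ Y} (hπ : x₁ ≫ π = x₂ ≫ π)
    (hy : F.map x₁.op y = F.map x₂.op y) : x₁ = x₂ :=
  (h.2 (x₂ ≫ π) (F.map x₂.op y) (by rw [hτ, h.1, Category.assoc])).unique ⟨hπ, hy⟩ ⟨rfl, rfl⟩

/-- A universal section over `W` is the base change of a universal section over `W₁`. -/
theorem IsUniversalOver.isPullback
    (hτ : ∀ {T T' : E} (φ : T ⟶ T') (f : F.obj (op T')), τ _ (F.map φ.op f) = φ ≫ τ _ f)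
    {W W₁ Y Y₁ : E} {w : W ⟶ Z} {w₁ : W₁ ⟶ Z} {π : Y ⟶ W} {π₁ : Y₁ ⟶ W₁}
    {y : F.obj (op Y)} {y₁ : F.obj (op Y₁)}
    (h : IsUniversalOver F τ w π y) (h₁ : IsUniversalOver F τ w₁ π₁ y₁) {j : W ⟶ W₁}
    (hj : j ≫ w₁ = w) {r : Y ⟶ Y₁} (hr : r ≫ π₁ = π ≫ j) (hry : F.map r.op y₁ = y) :
    IsPullback r π π₁ j := by
  refine ⟨⟨hr⟩, ⟨PullbackCone.IsLimit.mk _ (fun s ↦ (h.2 s.snd (F.map s.fst.op y₁) ?_).choose)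
    ?_ ?_ ?_⟩⟩
  · rw [hτ, h₁.1, ← Category.assoc, s.condition, Category.assoc, hj]
  · intro s
    have hx := (h.2 s.snd (F.map s.fst.op y₁)
      (by rw [hτ, h₁.1, ← Category.assoc, s.condition, Category.assoc, hj])).choose_spec.1
    refine h₁.hom_ext hτ ?_ ?_
    · rw [Category.assoc, hr, ← Category.assoc, hx.1, s.condition]
    · rw [map_op_comp, hry, hx.2]
  · intro s
    exact (h.2 s.snd (F.map s.fst.op y₁)
      (by rw [hτ, h₁.1, ← Category.assoc, s.condition, Category.assoc, hj])).choose_spec.1.1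
  · intro s m hm hm'
    have hx := (h.2 s.snd (F.map s.fst.op y₁)
      (by rw [hτ, h₁.1, ← Category.assoc, s.condition, Category.assoc, hj])).choose_spec
    refine hx.2 m ⟨hm', ?_⟩
    rw [← hry, ← map_op_comp, hm]

/-- A universal section descends along a covering `p : W' ⟶ W` whose base changes are coverings. -/
theorem IsUniversalOver.descend [HasPullbacks E] {K : GrothendieckTopology E} [K.Subcanonical]
    (hF : Presieve.IsSheaf K F)
    (hτ : ∀ {T T' : E} (φ : T ⟶ T') (f : F.obj (op T')), τ _ (F.map φ.op f) = φ ≫ τ _ f)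
    {W W' Y Y' : E} {w : W ⟶ Z} {p : W' ⟶ W}
    (hp : ∀ {T T' : E} {c : T' ⟶ T} {t' : T' ⟶ W'} {t : T ⟶ W}, IsPullback c t' t p →
      Sieve.generate (.singleton c) ∈ K T)
    {π' : Y' ⟶ W'} {y' : F.obj (op Y')} (hy' : IsUniversalOver F τ (p ≫ w) π' y')
    {r : Y' ⟶ Y} {π : Y ⟶ W} (hr : IsPullback r π' π p)
    {Y₂ : E} {p₁ q : Y₂ ⟶ Y'} {p₂ : Y₂ ⟶ W'} (hY₂ : IsPullback p₁ p₂ (π' ≫ p) p)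
    (hq : q ≫ π' = p₂) (hqy : F.map q.op y' = F.map p₁.op y') (hqr : q ≫ r = p₁ ≫ r) :
    ∃ y : F.obj (op Y), F.map r.op y = y' ∧ IsUniversalOver F τ w π y := by
  -- Two points `a`, `b` of `Y'` with the same image in `Y` amount to a point of `Y₂ = Y' ×_W W'`
  -- that `p₁` sends to `a` and `q` to `b`; as `q` and `p₁` pull `y'` back to the same section, `y'`
  -- descends to `Y`.
  obtain ⟨y, hy, -⟩ := existsUnique_glue_of_cover hF r (hp hr) y' (fun {T} a b hab ↦ by
    have h1 : a ≫ π' ≫ p = (b ≫ π') ≫ p := by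
      rw [← hr.w, ← Category.assoc, hab, Category.assoc, Category.assoc, hr.w]
    have h2 : hY₂.lift a (b ≫ π') h1 ≫ q = b := by
      apply hr.hom_ext
      · rw [Category.assoc, hqr, ← Category.assoc, hY₂.lift_fst, hab]
      · rw [Category.assoc, hq, hY₂.lift_snd]
    have h3 := congrArg (F.map (hY₂.lift a (b ≫ π') h1).op) hqy
    rw [← map_op_comp, h2, ← map_op_comp, hY₂.lift_fst] at h3
    exact h3.symm)
  have hyon : ∀ Z : E, Presieve.IsSheaf K (yoneda.obj Z) := fun Z ↦
    GrothendieckTopology.Subcanonical.isSheaf_of_isRepresentable _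
  -- A point of `Y` is determined by its base point and its section: after base change along `p` it
  -- becomes a point of `Y'`, where this holds by universality.
  have hinj : ∀ {T : E} (x₁ x₂ : T ⟶ Y), x₁ ≫ π = x₂ ≫ π → F.map x₁.op y = F.map x₂.op y →
      x₁ = x₂ := by
    intro T x₁ x₂ h₁ h₂
    have hT := IsPullback.of_hasPullback (x₁ ≫ π) p
    have e₁ : (Limits.pullback.fst (x₁ ≫ π) p ≫ x₁) ≫ π =
        Limits.pullback.snd (x₁ ≫ π) p ≫ p := by
      rw [Category.assoc, hT.w]
    have e₂ : (Limits.pullback.fst (x₁ ≫ π) p ≫ x₂) ≫ π =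
        Limits.pullback.snd (x₁ ≫ π) p ≫ p := by
      rw [Category.assoc, ← h₁, hT.w]
    have e : hr.lift _ _ e₁ = hr.lift _ _ e₂ := by
      apply hy'.hom_ext hτ
      · rw [hr.lift_snd, hr.lift_snd]
      · rw [← hy, ← map_op_comp, hr.lift_fst, ← map_op_comp, hr.lift_fst, map_op_comp,
          map_op_comp, h₂]
    have e' := congrArg (· ≫ r) e
    simp only [hr.lift_fst] at e'
    exact sheaf_ext_of_cover (hyon Y) (Limits.pullback.fst (x₁ ≫ π) p) (hp hT) e'
  refine ⟨y, hy, ?_, fun {T} t f hf ↦ ?_⟩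
  · refine sheaf_ext_of_cover (hyon Z) r (hp hr) ?_
    change r ≫ τ _ y = r ≫ π ≫ w
    rw [← hτ, hy, hy'.1, ← Category.assoc, ← Category.assoc, hr.w]
  have hT := IsPullback.of_hasPullback t p
  set c := Limits.pullback.fst t p
  obtain ⟨x', ⟨hx'₁, hx'₂⟩, -⟩ := hy'.2 (Limits.pullback.snd t p) (F.map c.op f)
    (by rw [hτ, hf, ← Category.assoc, ← Category.assoc, hT.w])
  have hx'y : F.map (x' ≫ r).op y = F.map c.op f := by
    rw [map_op_comp, hy, hx'₂]
  -- The point of `Y'` found over the covering of `T` descends to a point of `Y`, since `hinj` makes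
  -- it compatible on overlaps.
  obtain ⟨x, hx, -⟩ := existsUnique_glue_of_cover (hyon Y) c (hp hT) (x' ≫ r) (fun {T₂} a b hab ↦ by
    change a ≫ x' ≫ r = b ≫ x' ≫ r
    have hab' : (a ≫ x' ≫ r) ≫ π = (b ≫ x' ≫ r) ≫ π := by
      simp only [Category.assoc, hr.w]
      rw [← Category.assoc x', hx'₁, ← hT.w, ← Category.assoc, hab, Category.assoc]
    refine hinj _ _ hab' ?_
    rw [map_op_comp, map_op_comp F b, hx'y, ← map_op_comp, ← map_op_comp, hab])
  change c ≫ x = x' ≫ r at hx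
  refine ⟨x, ⟨?_, ?_⟩, fun x₁ ⟨h₁, h₂⟩ ↦ ?_⟩
  · refine sheaf_ext_of_cover (hyon W) c (hp hT) ?_
    change c ≫ x ≫ π = c ≫ t
    rw [← Category.assoc, hx, Category.assoc, hr.w, ← Category.assoc, hx'₁, hT.w]
  · refine sheaf_ext_of_cover hF c (hp hT) ?_
    rw [← hx'y, ← hx, map_op_comp]
  · have hxπ : x ≫ π = t := by
      refine sheaf_ext_of_cover (hyon W) c (hp hT) ?_
      change c ≫ x ≫ π = c ≫ t
      rw [← Category.assoc, hx, Category.assoc, hr.w, ← Category.assoc, hx'₁, hT.w]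
    refine hinj _ _ (h₁.trans hxπ.symm) (h₂.trans ?_)
    refine sheaf_ext_of_cover hF c (hp hT) ?_
    rw [← hx'y, ← hx, map_op_comp]

end

/-! ### Effective fpqc descent for affine morphisms. -/

theorem generate_singleton_mem_fpqc {X Y : Scheme.{u}} (f : X ⟶ Y) [Flat f] [Surjective f]
    [QuasiCompact f] : Sieve.generate (.singleton f) ∈ Scheme.fpqcTopology Y :=
  Precoverage.generate_mem_toGrothendieck (Scheme.Hom.singleton_mem_fpqcPrecoverage f)

section
variable {F : Scheme.{u}ᵒᵖ ⥤ Type w} {Z : Scheme.{u}}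
  {τ : ∀ T : Scheme.{u}, F.obj (op T) → (T ⟶ Z)}

/-- Effective descent along a faithfully flat homomorphism of rings, for affine schemes. -/
theorem exists_isUniversalOver_of_faithfullyFlat (hF : Presieve.IsSheaf Scheme.fpqcTopology F)
    (hτ : ∀ {T T' : Scheme.{u}} (φ : T ⟶ T') (f : F.obj (op T')),
      τ _ (F.map φ.op f) = φ ≫ τ _ f)
    {R R' M : Type u} [CommRing R] [CommRing R'] [CommRing M] [Algebra R R'] [Algebra R' M]
    [Algebra R M] [IsScalarTower R R' M] 
    [Flat (Spec.map (CommRingCat.ofHom (algebraMap R R')))]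
    [Surjective (Spec.map (CommRingCat.ofHom (algebraMap R R')))]
    {w : Spec (.of R) ⟶ Z} {y' : F.obj (op (Spec (.of M)))}
    (hy' : IsUniversalOver F τ (Spec.map (CommRingCat.ofHom (algebraMap R R')) ≫ w)
      (Spec.map (CommRingCat.ofHom (algebraMap R' M))) y') :
    ∃ (Y : Scheme.{u}) (π : Y ⟶ Spec (.of R)) (y : F.obj (op Y)) (r : Spec (.of M) ⟶ Y),
      IsAffineHom π ∧ IsUniversalOver F τ w π y ∧
        IsPullback r (Spec.map (CommRingCat.ofHom (algebraMap R' M))) π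
          (Spec.map (CommRingCat.ofHom (algebraMap R R'))) := by
  let p : Spec (.of R') ⟶ Spec (.of R) := Spec.map (CommRingCat.ofHom (algebraMap R R'))
  let π' : Spec (.of M) ⟶ Spec (.of R') := Spec.map (CommRingCat.ofHom (algebraMap R' M))
  let p₁ : Spec (.of (R' ⊗[R] M)) ⟶ Spec (.of M) := Spec.map (CommRingCat.ofHom
    (Algebra.TensorProduct.includeRight : M →ₐ[R] R' ⊗[R] M).toRingHom)
  let p₂ : Spec (.of (R' ⊗[R] M)) ⟶ Spec (.of R') := Spec.map (CommRingCat.ofHom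
    (algebraMap R' (R' ⊗[R] M)))
  have hπp : π' ≫ p = Spec.map (CommRingCat.ofHom (algebraMap R M)) := by
    rw [← Spec.map_comp, ← CommRingCat.ofHom_comp, ← IsScalarTower.algebraMap_eq]
  have hY₂ : IsPullback p₁ p₂ (π' ≫ p) p := by
    rw [hπp]
    exact (isPullback_SpecMap_of_isPushout _ _ _ _
      (CommRingCat.isPushout_tensorProduct R R' M)).flip
  -- Universality of `y'` produces the descent datum: the section `p₁^* y'`, seen over the second
  -- copy of `W'`, is classified by `q`. On rings `q` is a coaction `ρ` of `R'` on `M`.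
  obtain ⟨q, ⟨hq, hqy⟩, -⟩ := hy'.2 p₂ (F.map p₁.op y')
    (by rw [hτ, hy'.1, ← Category.assoc p₂, ← hY₂.w]; rfl)
  obtain ⟨ρ', rfl⟩ := Spec.map_surjective q
  have hρ' : ∀ r : R', ρ'.hom (algebraMap R' M r) = r ⊗ₜ 1 := by
    intro r
    rw [← Spec.map_comp] at hq
    exact congr(($(Spec.map_injective hq)).hom r)
  let ρ : M →ₐ[R] R' ⊗[R] M :=
    { ρ'.hom with
      commutes' := fun r ↦ by
        change ρ'.hom (algebraMap R M r) = _
        rw [IsScalarTower.algebraMap_apply R R' M, hρ']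
        rfl }
  have hρ : CommRingCat.ofHom ρ.toRingHom = ρ' := rfl
  have hQ : Spec.map (CommRingCat.ofHom ρ.toRingHom) = Spec.map ρ' := rfl
  have smul : ∀ (r : R') (m : M), ρ (r • m) = (r ⊗ₜ 1) * ρ m := fun r m ↦ by
    rw [Algebra.smul_def, map_mul]
    exact congrArg (· * ρ m) (hρ' r)
  have counit : ∀ m : M, Algebra.TensorProduct.lift (Algebra.ofId R' M) (AlgHom.id R M)
      (fun _ _ ↦ Commute.all _ _) (ρ m) = m := by
    let c₀ := Algebra.TensorProduct.lift (Algebra.ofId R' M) (AlgHom.id R M)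
      (fun _ _ ↦ Commute.all _ _)
    let c : Spec (.of M) ⟶ Spec (.of (R' ⊗[R] M)) := Spec.map (CommRingCat.ofHom c₀.toRingHom)
    have h1 : c ≫ p₁ = 𝟙 _ := by
      rw [← Spec.map_comp, ← CommRingCat.ofHom_comp, ← Spec.map_id]
      congr 1
      ext m
      change c₀ (1 ⊗ₜ m) = m
      simp [c₀]
    have h2 : c ≫ p₂ = π' := by
      rw [← Spec.map_comp, ← CommRingCat.ofHom_comp]
      congr 2
      ext r
      change c₀ (r ⊗ₜ 1) = _
      simp [c₀]
    -- Restricted to the diagonal, `q` and the identity classify the same section over the same base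
    -- point.
    have h3 : c ≫ Spec.map ρ' = 𝟙 _ := by
      refine hy'.hom_ext hτ ?_ ?_
      · rw [Category.assoc, hq, Category.id_comp]; exact h2
      · rw [map_op_comp, hqy, ← map_op_comp, h1]
    intro m
    rw [← Spec.map_comp, ← Spec.map_id] at h3
    exact congr(($(Spec.map_injective h3)).hom m)
  have coassoc : ∀ m : M, Algebra.TensorProduct.map (AlgHom.id R R') ρ (ρ m) =
      Algebra.TensorProduct.map (AlgHom.id R R') Algebra.TensorProduct.includeRight (ρ m) := by
    let U : Spec (.of (R' ⊗[R] (R' ⊗[R] M))) ⟶ Spec (.of (R' ⊗[R] M)) := Spec.map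
      (CommRingCat.ofHom (Algebra.TensorProduct.map (AlgHom.id R R') ρ).toRingHom)
    let V : Spec (.of (R' ⊗[R] (R' ⊗[R] M))) ⟶ Spec (.of (R' ⊗[R] M)) := Spec.map
      (CommRingCat.ofHom (Algebra.TensorProduct.map (AlgHom.id R R')
        Algebra.TensorProduct.includeRight).toRingHom)
    let e : Spec (.of (R' ⊗[R] (R' ⊗[R] M))) ⟶ Spec (.of (R' ⊗[R] M)) := Spec.map
      (CommRingCat.ofHom (Algebra.TensorProduct.includeRight :
        R' ⊗[R] M →ₐ[R] R' ⊗[R] (R' ⊗[R] M)).toRingHom)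
    have h1 : U ≫ p₂ = V ≫ p₂ := by
      rw [← Spec.map_comp, ← Spec.map_comp, ← CommRingCat.ofHom_comp, ← CommRingCat.ofHom_comp]
      congr 2
      ext r
      change Algebra.TensorProduct.map (AlgHom.id R R') ρ (r ⊗ₜ 1) =
        Algebra.TensorProduct.map (AlgHom.id R R') Algebra.TensorProduct.includeRight (r ⊗ₜ 1)
      simp [Algebra.TensorProduct.one_def]
    have h2 : U ≫ p₁ = e ≫ Spec.map ρ' := by
      rw [← Spec.map_comp, ← Spec.map_comp, ← CommRingCat.ofHom_comp, ← hρ,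
        ← CommRingCat.ofHom_comp]
      congr 2
    have h3 : V ≫ p₁ = e ≫ p₁ := by
      rw [← Spec.map_comp, ← Spec.map_comp, ← CommRingCat.ofHom_comp, ← CommRingCat.ofHom_comp]
      congr 2
    -- The cocycle condition need not be imposed: both composites classify the same section of `F`,
    -- because `q` and `p₁` pull `y'` back to the same section.
    have h4 : U ≫ Spec.map ρ' = V ≫ Spec.map ρ' := by
      refine hy'.hom_ext hτ ?_ ?_
      · rw [Category.assoc, hq, Category.assoc, hq, h1]
      · rw [map_op_comp, hqy, ← map_op_comp, h2, map_op_comp, hqy, ← map_op_comp, ← h3,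
          map_op_comp, ← hqy, ← map_op_comp]
    intro m
    rw [← Spec.map_comp, ← Spec.map_comp] at h4
    exact congr(($(Spec.map_injective h4)).hom m)
  have : Module.Flat R R' := by
    rw [← RingHom.flat_algebraMap_iff]
    exact Flat.SpecMap_iff.1 ‹Flat (Spec.map (CommRingCat.ofHom (algebraMap R R')))›
  have key := bijective_lift_equalizer ρ smul counit coassoc
  set M₀ := AlgHom.equalizer ρ (Algebra.TensorProduct.includeRight : M →ₐ[R] R' ⊗[R] M) with hM₀
  let π : Spec (.of M₀) ⟶ Spec (.of R) := Spec.map (CommRingCat.ofHom (algebraMap R M₀))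
  let r : Spec (.of M) ⟶ Spec (.of M₀) := Spec.map (CommRingCat.ofHom (algebraMap M₀ M))
  have hr : IsPullback r π' π p := by
    refine (isPullback_SpecMap_of_isPushout _ _ _ _
      ((CommRingCat.isPushout_tensorProduct R R' M₀).of_iso (Iso.refl _) (Iso.refl _) (Iso.refl _)
        (AlgEquiv.ofBijective _ key).toRingEquiv.toCommRingCatIso ?_ ?_ ?_ ?_)).flip
    · simp
    · simp
    · ext a
      simp
    · ext a
      simp
  -- This is the equation defining the invariants.
  have hqr : Spec.map ρ' ≫ r = p₁ ≫ r := by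
    rw [← hρ, ← Spec.map_comp, ← Spec.map_comp, ← CommRingCat.ofHom_comp,
      ← CommRingCat.ofHom_comp]
    congr 2
    ext m
    exact m.2
  have : Flat p := ‹_›
  have : Surjective p := ‹_›
  obtain ⟨y, -, hy⟩ := hy'.descend hF hτ (fun {T T' c t' t} h ↦ by
    have : Flat c := MorphismProperty.of_isPullback h.flip ‹_›
    have : Surjective c := MorphismProperty.of_isPullback h.flip ‹_›
    have : QuasiCompact c := MorphismProperty.of_isPullback h.flip (inferInstanceAs (QuasiCompact p))
    exact generate_singleton_mem_fpqc c) hr hY₂ hq hqy hqr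
  exact ⟨_, π, y, r, inferInstance, hy, hr⟩

theorem IsUniversalOver.of_iso
    (hτ : ∀ {T T' : Scheme.{u}} (φ : T ⟶ T') (f : F.obj (op T')),
      τ _ (F.map φ.op f) = φ ≫ τ _ f)
    {W W₀ Y Y₀ : Scheme.{u}} {w : W ⟶ Z} {π : Y ⟶ W} {y : F.obj (op Y)}
    (h : IsUniversalOver F τ w π y) (eW : W₀ ≅ W) (eY : Y₀ ≅ Y) {π₀ : Y₀ ⟶ W₀}
    (hπ : π₀ ≫ eW.hom = eY.hom ≫ π) :
    IsUniversalOver F τ (eW.hom ≫ w) π₀ (F.map eY.hom.op y) := by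
  refine ⟨by rw [hτ, h.1, ← Category.assoc, ← hπ, Category.assoc], fun {T} t f hf ↦ ?_⟩
  obtain ⟨x, ⟨hx₁, hx₂⟩, hu⟩ := h.2 (t ≫ eW.hom) f (by rw [hf, Category.assoc])
  refine ⟨x ≫ eY.inv, ⟨?_, ?_⟩, fun x' ⟨h₁, h₂⟩ ↦ ?_⟩
  · rw [← cancel_mono eW.hom, Category.assoc, Category.assoc, hπ, eY.inv_hom_id_assoc, hx₁]
  · rw [← map_op_comp, Category.assoc, eY.inv_hom_id, Category.comp_id, hx₂]
  · rw [← cancel_mono eY.hom, Category.assoc, eY.inv_hom_id, Category.comp_id]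
    refine hu _ ⟨?_, ?_⟩
    · rw [Category.assoc, ← hπ, ← Category.assoc, h₁]
    · rw [map_op_comp, h₂]

/-- Effective descent along a faithfully flat morphism of affine schemes, for affine morphisms. -/
theorem IsUniversalOver.exists_of_isAffine (hF : Presieve.IsSheaf Scheme.fpqcTopology F)
    (hτ : ∀ {T T' : Scheme.{u}} (φ : T ⟶ T') (f : F.obj (op T')),
      τ _ (F.map φ.op f) = φ ≫ τ _ f)
    {W W' Y' : Scheme.{u}} [IsAffine W] [IsAffine W'] {w : W ⟶ Z} {p : W' ⟶ W} [Flat p]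
    [Surjective p] {π' : Y' ⟶ W'} [IsAffineHom π'] {y' : F.obj (op Y')}
    (hy' : IsUniversalOver F τ (p ≫ w) π' y') :
    ∃ (Y : Scheme.{u}) (π : Y ⟶ W) (y : F.obj (op Y)) (r : Y' ⟶ Y),
      IsAffineHom π ∧ IsUniversalOver F τ w π y ∧ IsPullback r π' π p := by
  have : IsAffine Y' := isAffine_of_isAffineHom π'
  let R := Γ(W, ⊤)
  let R' := Γ(W', ⊤)
  let M := Γ(Y', ⊤)
  let : Algebra R R' := p.appTop.hom.toAlgebra
  let : Algebra R' M := π'.appTop.hom.toAlgebra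
  let : Algebra R M := (π'.appTop.hom.comp p.appTop.hom).toAlgebra
  have : IsScalarTower R R' M := .of_algebraMap_eq' rfl
  have hp : Spec.map (CommRingCat.ofHom (algebraMap R R')) ≫ W.isoSpec.inv =
      W'.isoSpec.inv ≫ p := by
    exact (Scheme.isoSpec_inv_naturality p)
  have hπ : Spec.map (CommRingCat.ofHom (algebraMap R' M)) ≫ W'.isoSpec.inv =
      Y'.isoSpec.inv ≫ π' := by
    exact (Scheme.isoSpec_inv_naturality π')
  have hp' : Spec.map (CommRingCat.ofHom (algebraMap R R')) =
      W'.isoSpec.inv ≫ p ≫ W.isoSpec.hom := by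
    rw [← Category.assoc, ← hp, Category.assoc, Iso.inv_hom_id, Category.comp_id]
  have : Flat (Spec.map (CommRingCat.ofHom (algebraMap R R'))) := by
    rw [hp']
    infer_instance
  have : Surjective (Spec.map (CommRingCat.ofHom (algebraMap R R'))) := by
    rw [hp']
    infer_instance
  have h := hy'.of_iso hτ W'.isoSpec.symm Y'.isoSpec.symm hπ
  simp only [Iso.symm_hom, ← Category.assoc] at h
  rw [← hp, Category.assoc] at h
  obtain ⟨Y, π, y, r, ha, hy, hr⟩ := exists_isUniversalOver_of_faithfullyFlat hF hτ h
  have hy₂ := hy.of_iso hτ W.isoSpec (Iso.refl Y) (π₀ := π ≫ W.isoSpec.inv) (by simp)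
  simp only [Iso.hom_inv_id_assoc] at hy₂
  refine ⟨Y, π ≫ W.isoSpec.inv, _, Y'.isoSpec.hom ≫ r, inferInstance, hy₂, ?_⟩
  refine hr.of_iso Y'.isoSpec.symm (Iso.refl _) W'.isoSpec.symm W.isoSpec.symm ?_ ?_ ?_ ?_
  · simp
  · exact hπ
  · simp
  · exact hp

end

instance : IsZariskiLocalAtTarget (@IsAffineHom.{u}) :=
  @HasAffineProperty.instIsZariskiLocalAtTarget _ _
    instHasAffinePropertyIsAffineHomIsAffine

instance : IsZariskiLocalAtTarget (@Smooth.{u}) :=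
  HasRingHomProperty.instIsZariskiLocalAtTarget (Q := RingHom.Smooth) _

instance : IsZariskiLocalAtSource (@Flat.{u}) :=
  HasRingHomProperty.instIsZariskiLocalAtSource (Q := RingHom.Flat)

instance : MorphismProperty.RespectsLeft (@Flat.{u}) (@IsOpenImmersion.{u}) where
  precomp f hf g hg := by
    have : IsOpenImmersion f := hf
    have : Flat g := hg
    infer_instance

/-- Fpqc coverings compose, so a covering sieve contains a single quasi-compact flat family.
Quasi-compactness lets finitely many affine pieces of it cover the affine scheme `W`. -/
theorem exists_affineCover_mem {W : Scheme.{u}} [IsAffine W] {S : Sieve W}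
    (hS : S ∈ Scheme.fpqcTopology W) :
    ∃ 𝒱 : Scheme.AffineCover.{u + 1} @Flat W, Finite 𝒱.I₀ ∧ ∀ i, S (𝒱.f i) := by
  obtain ⟨R, hR, hRS⟩ := Precoverage.mem_toGrothendieck_iff_of_isStableUnderComposition.1 hS
  obtain ⟨𝒰, h𝒰, rfl⟩ := Scheme.mem_propQCPrecoverage_iff_exists_quasiCompactCover.1 hR
  obtain ⟨𝒱, f, hfin, -⟩ := QuasiCompactCover.exists_hom 𝒰
  refine ⟨𝒱, hfin, fun i ↦ ?_⟩
  have h := S.downward_closed (hRS _ _ (Presieve.ofArrows.mk (f.s₀ i))) (f.h₀ i)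
  exact (show f.h₀ i ≫ 𝒰.f (f.s₀ i) = 𝒱.f i from f.w₀ i) ▸ h

section
variable {F : Scheme.{u}ᵒᵖ ⥤ Type w} {Z : Scheme.{u}}
  {τ : ∀ T : Scheme.{u}, F.obj (op T) → (T ⟶ Z)}

/-- The summands of a coproduct form a Zariski covering with empty overlaps, over which a sheaf has
at most one section; so sections on the summands can be prescribed independently. -/
theorem exists_sigma_section (hF : Presieve.IsSheaf Scheme.fpqcTopology F) {I : Type v} [Small.{u} I]
    (g : I → Scheme.{u}) (s : ∀ i, F.obj (op (g i))) :
    ∃ f : F.obj (op (∐ g)), ∀ i, F.map (Sigma.ι g i).op f = s i := by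
  have h : Presieve.IsSheafFor F (Presieve.ofArrows g (Sigma.ι g)) := by
    rw [Presieve.isSheafFor_iff_generate]
    exact hF _ (Scheme.zariskiTopology_le_fpqcTopology _
      (sigmaOpenCover g).mem_grothendieckTopology)
  rw [Presieve.isSheafFor_arrows_iff] at h
  refine (h s fun i j T a b hab ↦ ?_).exists
  by_cases hij : i = j
  · subst hij
    rw [cancel_mono] at hab
    rw [hab]
  · have : IsEmpty T := isEmpty_of_commSq_sigmaι_of_ne ⟨hab⟩ hij
    exact sheaf_ext hF (Scheme.bot_mem_propQCTopology T) fun _ h ↦ h.elim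

/-- A finite affine flat covering may be replaced by its coproduct, which is a single affine scheme
faithfully flat over `W`. There `F` has a section, `hloc` gives a representing scheme, and descent
along one homomorphism of rings applies. Smoothness descends as well. -/
theorem exists_isUniversalOver_of_isAffine
    (hF : Presieve.IsSheaf Scheme.fpqcTopology F)
    (hτ : ∀ {T T' : Scheme.{u}} (φ : T ⟶ T') (f : F.obj (op T')), τ _ (F.map φ.op f) = φ ≫ τ _ f)
    (hloc : ∀ {W : Scheme.{u}} (w : W ⟶ Z) (f : F.obj (op W)), τ _ f = w →
      ∃ (Y : Scheme.{u}) (π : Y ⟶ W) (y : F.obj (op Y)), IsAffineHom π ∧ Smooth π ∧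
      IsUniversalOver F τ w π y)
    {S : Sieve Z} (hS : S ∈ Scheme.fpqcTopology Z)
    (hSF : ∀ {W : Scheme.{u}} (w : W ⟶ Z), S w → ∃ f : F.obj (op W), τ _ f = w)
    {W : Scheme.{u}} [IsAffine W] (w : W ⟶ Z) :
    ∃ (Y : Scheme.{u}) (π : Y ⟶ W) (y : F.obj (op Y)), IsAffineHom π ∧ Smooth π ∧
      IsUniversalOver F τ w π y := by
  obtain ⟨𝒱, hfin, h𝒱⟩ := exists_affineCover_mem (Scheme.fpqcTopology.pullback_stable w hS)
  choose s hs using fun i ↦ hSF _ (h𝒱 i)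
  obtain ⟨f, hf⟩ := exists_sigma_section hF (fun i ↦ Spec (𝒱.X i)) s
  let p : ∐ (fun i ↦ Spec (𝒱.X i)) ⟶ W := Sigma.desc 𝒱.f
  have hp : Flat p := IsZariskiLocalAtSource.sigmaDesc (P := @Flat) fun i ↦ 𝒱.map_prop i
  have hp' : Surjective p := by
    refine ⟨fun x ↦ ?_⟩
    obtain ⟨y, hy⟩ := 𝒱.covers x
    refine ⟨Sigma.ι (fun i ↦ Spec (𝒱.X i)) _ y, ?_⟩
    rw [← Scheme.Hom.comp_apply]
    simpa [p] using hy
  have hfw : τ _ f = p ≫ w := by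
    refine Sigma.hom_ext _ _ fun i ↦ ?_
    rw [← hτ, hf, hs]
    simp [p]
  obtain ⟨Y', π', y', _, _, hy'⟩ := hloc _ f hfw
  obtain ⟨Y, π, y, r, h1, h2, h3⟩ := hy'.exists_of_isAffine hF hτ
  refine ⟨Y, π, y, h1, ?_, h2⟩
  refine MorphismProperty.of_isPullback_of_descendsAlong (P := @Smooth)
    (Q := @Surjective ⊓ @Flat ⊓ @QuasiCompact) h3.flip ⟨⟨hp', hp⟩, inferInstance⟩ ‹_›

/-- Each fibre of `F(T) → Hom(T, Z)` embeds into the set of morphisms from `T` to a scheme. This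
brings `F` back to values in `Type u`, as needed for the gluing of representing schemes. -/
theorem small_of_isUniversalOver
    (hloc : ∀ {W : Scheme.{u}} (w : W ⟶ Z) (f : F.obj (op W)), τ _ f = w →
      ∃ (Y : Scheme.{u}) (π : Y ⟶ W) (y : F.obj (op Y)), IsAffineHom π ∧ Smooth π ∧
      IsUniversalOver F τ w π y)
    (T : Scheme.{u}) : Small.{u} (F.obj (op T)) := by
  have (t : T ⟶ Z) : Small.{u} {f : F.obj (op T) // τ _ f = t} := by
    by_cases h : Nonempty {f : F.obj (op T) // τ _ f = t}
    · obtain ⟨f, hf⟩ := h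
      obtain ⟨Y, π, y, -, -, hy⟩ := hloc t f hf
      choose x hx using fun f : {f : F.obj (op T) // τ _ f = t} ↦
        (hy.2 (𝟙 T) f.1 (by rw [f.2, Category.id_comp])).exists
      refine small_of_injective (β := T ⟶ Y) (f := x) fun f₁ f₂ h ↦ Subtype.ext ?_
      rw [← (hx f₁).2, ← (hx f₂).2, h]
    · rw [not_nonempty_iff] at h
      infer_instance
  exact small_of_injective (β := Σ t : T ⟶ Z, {f : F.obj (op T) // τ _ f = t})
    (f := fun f ↦ ⟨τ _ f, f, rfl⟩) fun f₁ f₂ h ↦ by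
      have := congrArg (fun s ↦ s.2.1) h
      exact this

/-- Effective fpqc descent for affine morphisms: a sheaf over `Z` that is locally on `Z` represented
by affine smooth schemes is represented by a scheme which is affine and smooth over `Z`. -/
theorem exists_isUniversalOver
    (hF : Presieve.IsSheaf Scheme.fpqcTopology F)
    (hτ : ∀ {T T' : Scheme.{u}} (φ : T ⟶ T') (f : F.obj (op T')), τ _ (F.map φ.op f) = φ ≫ τ _ f)
    (hloc : ∀ {W : Scheme.{u}} (w : W ⟶ Z) (f : F.obj (op W)), τ _ f = w →
      ∃ (Y : Scheme.{u}) (π : Y ⟶ W) (y : F.obj (op Y)), IsAffineHom π ∧ Smooth π ∧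
      IsUniversalOver F τ w π y)
    {S : Sieve Z} (hS : S ∈ Scheme.fpqcTopology Z)
    (hSF : ∀ {W : Scheme.{u}} (w : W ⟶ Z), S w → ∃ f : F.obj (op W), τ _ f = w) :
    ∃ (Y : Scheme.{u}) (π : Y ⟶ Z) (y : F.obj (op Y)), IsAffineHom π ∧ Smooth π ∧
      IsUniversalOver F τ (𝟙 Z) π y := by
  have hsmall : FunctorToTypes.Small.{u} F := fun T ↦ small_of_isUniversalOver hloc T.unop
  let G : Scheme.{u}ᵒᵖ ⥤ Type u := FunctorToTypes.shrink.{u} F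
  let e : ∀ ⦃T : Scheme.{u}⦄, F.obj (op T) ≃ G.obj (op T) := fun T ↦ equivShrink _
  have he : ∀ ⦃T T' : Scheme.{u}⦄ (φ : T ⟶ T') (x : F.obj (op T')),
      e (F.map φ.op x) = G.map φ.op (e x) := fun T T' φ x ↦ by
    change e (F.map φ.op x) = e (F.map φ.op (e.symm (e x)))
    rw [Equiv.symm_apply_apply]
  have he' : ∀ ⦃T T' : Scheme.{u}⦄ (φ : T ⟶ T') (x : G.obj (op T')),
      e.symm (G.map φ.op x) = F.map φ.op (e.symm x) := fun T T' φ x ↦ by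
    rw [Equiv.symm_apply_eq, he, Equiv.apply_symm_apply]
  have hG : Presieve.IsSheaf Scheme.zariskiTopology G :=
    Presieve.isSheaf_of_nat_equiv e he
      (Presieve.isSheaf_of_le _ Scheme.zariskiTopology_le_fpqcTopology hF)
  choose Y' π y ha hsm hy using fun U : Z.affineOpens ↦
    have : IsAffine U.1 := U.2
    exists_isUniversalOver_of_isAffine hF hτ hloc hS hSF U.1.ι
  let f : ∀ U : Z.affineOpens, yoneda.obj (Y' U) ⟶ G := fun U ↦ yonedaEquiv.symm (e (y U))
  have hf : ∀ U {T : Scheme.{u}} (x : T ⟶ Y' U), (f U).app (op T) x = e (F.map x.op (y U)) :=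
    fun U T x ↦ (he x (y U)).symm
  -- For a section `s` over `T`, the base change of `Y' U → G` along `s` is the preimage of the open
  -- set `U` under the structure map `τ s` of the section.
  have hfo : ∀ U, IsOpenImmersion.presheaf (f U) := by
    intro U
    refine MorphismProperty.relative.of_exists fun T g ↦ ?_
    obtain ⟨s, rfl⟩ := yonedaEquiv.symm.surjective g
    obtain ⟨s, rfl⟩ := e.surjective s
    have hg : ∀ {T' : Scheme.{u}} (x : T' ⟶ T),
      (yonedaEquiv.symm (e s)).app (op T') x = e (F.map x.op s) := fun x ↦ (he x s).symm
    let c := pullback.fst (τ _ s) U.1.ι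
    obtain ⟨x, ⟨hx₁, hx₂⟩, -⟩ := (hy U).2 (pullback.snd (τ _ s) U.1.ι) (F.map c.op s)
      (by rw [hτ, pullback.condition])
    refine ⟨pullback (τ _ s) U.1.ι, yoneda.map x, c, ?_, inferInstance⟩
    refine .of_forall_isPullback_app fun ⟨X⟩ ↦ ?_
    rw [Types.isPullback_iff]
    refine ⟨?_, ?_, ?_⟩
    · ext a
      change (f U).app (op X) (a ≫ x) = (yonedaEquiv.symm (e s)).app (op X) (a ≫ c)
      rw [hf, hg, map_op_comp, hx₂, map_op_comp]
    · rintro (a : X ⟶ _) (b : X ⟶ _) ⟨-, h⟩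
      change a ≫ c = b ≫ c at h
      exact (cancel_mono c).1 h
    · intro (a : X ⟶ Y' U) (b : X ⟶ T) hab
      rw [hf, hg] at hab
      replace hab := (@e X).injective hab
      have h1 : b ≫ τ _ s = (a ≫ π U) ≫ U.1.ι := by
        rw [← hτ, ← hab, hτ, (hy U).1, Category.assoc]
      refine ⟨pullback.lift b (a ≫ π U) h1, ?_, ?_⟩
      · change pullback.lift b (a ≫ π U) h1 ≫ x = a
        refine (hy U).hom_ext hτ ?_ ?_
        · rw [Category.assoc, hx₁, pullback.lift_snd]
        · rw [map_op_comp, hx₂, ← map_op_comp, pullback.lift_fst, hab]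
      · exact pullback.lift_fst b (a ≫ π U) h1
  -- The preimages in `T` of the affine open subsets of `Z` cover `T`, and over each of them the
  -- section comes from `Y' U`.
  have : Presheaf.IsLocallySurjective Scheme.zariskiTopology (Sigma.desc f) := by
    refine ⟨fun {T} s ↦ ?_⟩
    obtain ⟨s, rfl⟩ := e.surjective s
    refine Scheme.zariskiTopology.superset_covering ?_
      (Scheme.zariskiTopology.pullback_stable (τ _ s)
        Z.directedAffineCover.mem_grothendieckTopology)
    have key : ∀ (X : Scheme.{u}) (c : X ⟶ T) (U : Z.affineOpens) (a : X ⟶ U.1),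
        a ≫ U.1.ι = c ≫ τ _ s → Presheaf.imageSieve (Sigma.desc f) (e s) c := ?_
    · rintro X c ⟨_, a, _, ⟨U⟩, h⟩
      exact key X c U a h
    intro X c U a h
    obtain ⟨x, ⟨hx₁, hx₂⟩, -⟩ := (hy U).2 a (F.map c.op s) (by rw [hτ]; exact h.symm)
    refine ⟨(Sigma.ι (fun U ↦ yoneda.obj (Y' U)) U).app (op X) x, ?_⟩
    change ((Sigma.ι (fun U ↦ yoneda.obj (Y' U)) U ≫ Sigma.desc f).app (op X)) x = _
    rw [Sigma.ι_desc, hf, hx₂, he]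
  have hrep := Scheme.LocalRepresentability.representableBy
    (F := ⟨G, (isSheaf_iff_isSheaf_of_type _ _).2 hG⟩) hfo
  set Y₀ := (Scheme.LocalRepresentability.glueData
    (F := ⟨G, (isSheaf_iff_isSheaf_of_type _ _).2 hG⟩) hfo).glued
  let y₀ : F.obj (op Y₀) := e.symm (hrep.homEquiv (𝟙 Y₀))
  have hy₀ : ∀ {T : Scheme.{u}} (x : T ⟶ Y₀), F.map x.op y₀ = e.symm (hrep.homEquiv x) := by
    intro T x
    rw [← he']
    congr 1
    rw [← hrep.homEquiv_comp, Category.comp_id]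
  have hU : IsUniversalOver F τ (𝟙 Z) (τ _ y₀) y₀ := by
    refine ⟨(Category.comp_id _).symm, fun {T} t s hs ↦ ⟨hrep.homEquiv.symm (e s), ⟨?_, ?_⟩, ?_⟩⟩
    · rw [← hτ, hy₀, Equiv.apply_symm_apply, Equiv.symm_apply_apply, hs, Category.comp_id]
    · rw [hy₀, Equiv.apply_symm_apply, Equiv.symm_apply_apply]
    · rintro x ⟨-, hx⟩
      rw [hy₀, Equiv.symm_apply_eq] at hx
      rw [← hx, Equiv.symm_apply_apply]
  -- The glued scheme restricts to `Y' U` over `U`, and being affine and being smooth are local on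
  -- the target.
  have hpb : ∀ U : Z.affineOpens, ∃ r : Y' U ⟶ Y₀, IsPullback r (π U) (τ _ y₀) U.1.ι := by
    intro U
    obtain ⟨r, ⟨hr₁, hr₂⟩, -⟩ := hU.2 (π U ≫ U.1.ι) (y U) (by rw [(hy U).1, Category.comp_id])
    exact ⟨r, (hy U).isPullback hτ hU (Category.comp_id _) hr₁ hr₂⟩
  refine ⟨Y₀, τ _ y₀, y₀, ?_, ?_, hU⟩
  · refine (IsZariskiLocalAtTarget.iff_of_openCover (P := @IsAffineHom)
      Z.directedAffineCover).2 fun U ↦ ?_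
    obtain ⟨r, hr⟩ := hpb U
    have := hr.isoPullback_inv_snd
    change IsAffineHom (pullback.snd (τ _ y₀) U.1.ι)
    rw [← this]
    have := ha U
    infer_instance
  · refine (IsZariskiLocalAtTarget.iff_of_openCover (P := @Smooth)
      Z.directedAffineCover).2 fun U ↦ ?_
    obtain ⟨r, hr⟩ := hpb U
    have := hr.isoPullback_inv_snd
    change Smooth (pullback.snd (τ _ y₀) U.1.ι)
    rw [← this]
    have := hsm U
    infer_instance

end

/-! ### From sheaves on schemes over a base to sheaves on all schemes. -/

section
variable {E : Type u} [Category.{v} E] {B : E}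

/-- Two morphisms of objects over `B` agree if the underlying morphisms agree. -/
theorem map_over_congr (F : (Over B)ᵒᵖ ⥤ Type w) {T T' : Over B} {φ ψ : T ⟶ T'}
    (h : φ.left = ψ.left) (x : F.obj (op T')) : F.map φ.op x = F.map ψ.op x := by
  rw [Over.OverMorphism.ext h]

theorem map_map_over (F : (Over B)ᵒᵖ ⥤ Type w) {T T' T'' : Over B} {φ : T'' ⟶ T'} {ψ : T' ⟶ T}
    {χ : T'' ⟶ T} (h : φ.left ≫ ψ.left = χ.left) (x : F.obj (op T)) :
    F.map φ.op (F.map ψ.op x) = F.map χ.op x := by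
  rw [← map_op_comp]
  exact map_over_congr F h x

theorem map_over_id (F : (Over B)ᵒᵖ ⥤ Type w) {T : Over B} {φ : T ⟶ T} (h : φ.left = 𝟙 _)
    (x : F.obj (op T)) : F.map φ.op x = x := by
  rw [map_over_congr F (ψ := 𝟙 T) h, op_id, F.map_id]
  rfl

theorem totalPresheaf_ext (F : (Over B)ᵒᵖ ⥤ Type w) {T : E} {b b' : T ⟶ B}
    {f : F.obj (op (Over.mk b))} {f' : F.obj (op (Over.mk b'))} (h : b = b')
    (hf : F.map (Over.homMk (𝟙 T) (by simp [h]) : Over.mk b ⟶ Over.mk b').op f' = f) :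
    (⟨b, f⟩ : Σ b : T ⟶ B, F.obj (op (Over.mk b))) = ⟨b', f'⟩ := by
  subst h
  have : (Over.homMk (𝟙 T) (by simp) : Over.mk b ⟶ Over.mk b) = 𝟙 _ :=
    Over.OverMorphism.ext rfl
  rw [this, op_id, F.map_id] at hf
  exact congrArg (Sigma.mk b) hf.symm

theorem totalPresheaf_eq (F : (Over B)ᵒᵖ ⥤ Type w) {T : E}
    {s s' : Σ b : T ⟶ B, F.obj (op (Over.mk b))} (h : s = s') {V : Over B}
    {φ : V ⟶ Over.mk s.1} {φ' : V ⟶ Over.mk s'.1} (hφ : φ.left = φ'.left) :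
    F.map φ.op s.2 = F.map φ'.op s'.2 := by
  subst h
  exact map_over_congr F hφ s.2

/-- The presheaf on `E` whose sections are the sections of a presheaf on `Over B` over some
morphism to `B`. -/
def totalPresheaf (F : (Over B)ᵒᵖ ⥤ Type w) : Eᵒᵖ ⥤ Type (max v w) where
  obj T := Σ b : T.unop ⟶ B, F.obj (op (Over.mk b))
  map {T T'} φ := ↾fun s ↦ ⟨φ.unop ≫ s.1,
    F.map (Over.homMk φ.unop : Over.mk (φ.unop ≫ s.1) ⟶ Over.mk s.1).op s.2⟩
  map_id T := by
    refine ConcreteCategory.hom_ext _ _ fun s ↦ ?_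
    exact totalPresheaf_ext F (f' := s.2) (Category.id_comp s.1) rfl
  map_comp {T T' T''} φ ψ := by
    refine ConcreteCategory.hom_ext _ _ fun s ↦ ?_
    refine totalPresheaf_ext F (Category.assoc ψ.unop φ.unop s.1) ?_
    refine (map_map_over F (χ := Over.homMk ψ.unop) (Category.id_comp _) _).trans ?_
    exact map_map_over F rfl s.2

/-- The structure morphisms to `B` glue first, as the topology is subcanonical; the sections then
glue over the object of `Over B` so obtained. The maps with underlying morphism `𝟙` only adjust the
structure morphisms. -/
theorem isSheaf_totalPresheaf {J : GrothendieckTopology E} [J.Subcanonical]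
    {F : (Over B)ᵒᵖ ⥤ Type w} (hF : Presieve.IsSheaf (J.over B) F) :
    Presieve.IsSheaf J (totalPresheaf F) := by
  intro T S hS x hx
  have hyon : Presieve.IsSheaf J (yoneda.obj B) :=
    GrothendieckTopology.Subcanonical.isSheaf_of_isRepresentable _
  rw [Presieve.compatible_iff_sieveCompatible] at hx
  obtain ⟨b, hb, hbu⟩ := existsUnique_glue hyon hS (fun φ h ↦ (x φ h).1) (fun ψ φ h ↦ by
    have := congrArg Sigma.fst (hx φ ψ h)
    exact this)
  replace hb : ∀ {T' : E} (φ : T' ⟶ T) (h : S φ), φ ≫ b = (x φ h).1 := fun φ h ↦ hb φ h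
  have hS' : (Sieve.overEquiv (Over.mk b)).symm S ∈ J.over B (Over.mk b) := by
    rw [GrothendieckTopology.mem_over_iff]
    exact ((Sieve.overEquiv (Over.mk b)).apply_symm_apply S).symm ▸ hS
  have hS'' : ∀ {V : Over B} (ψ : V ⟶ Over.mk b),
      (Sieve.overEquiv (Over.mk b)).symm S ψ → S ψ.left := fun ψ h ↦ h
  obtain ⟨f, hf, hfu⟩ := existsUnique_glue hF hS'
    (fun {V} ψ h ↦ F.map (Over.homMk (𝟙 _) (by
      have h1 := hb ψ.left (hS'' ψ h)
      have h2 := Over.w ψ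
      simpa using h1.symm.trans h2) :
        V ⟶ Over.mk (x ψ.left (hS'' ψ h)).1).op (x ψ.left (hS'' ψ h)).2)
    (fun {V V'} χ ψ h ↦ by
      have h1 := hx ψ.left χ.left (hS'' ψ h)
      refine (totalPresheaf_eq F (V := V') h1 (φ' := Over.homMk (𝟙 V'.left) ?_) rfl).trans ?_
      · have h2 := Over.w χ
        have h3 := Over.w ψ
        have h4 := hb ψ.left (hS'' ψ h)
        change 𝟙 _ ≫ χ.left ≫ (x ψ.left (hS'' ψ h)).1 = _
        rw [Category.id_comp, ← h4, ← Over.w χ, ← Over.w ψ]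
        rfl
      · have h2 : χ.left ≫ (x ψ.left (hS'' ψ h)).1 = V'.hom := by
          rw [← hb ψ.left (hS'' ψ h), ← Over.w χ, ← Over.w ψ]
          rfl
        refine (map_map_over F (χ := (Over.homMk χ.left h2 :
          V' ⟶ Over.mk (x ψ.left (hS'' ψ h)).1)) (Category.id_comp _) _).trans ?_
        refine (map_map_over F ?_ (x ψ.left (hS'' ψ h)).2).symm
        exact Category.comp_id χ.left)
  refine ⟨⟨b, f⟩, fun T' φ h ↦ ?_, fun ⟨b', f'⟩ h' ↦ ?_⟩
  · refine totalPresheaf_ext F (hb φ h) ?_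
    have := hf (Over.homMk φ : Over.mk (φ ≫ b) ⟶ Over.mk b) h
    refine Eq.trans ?_ this.symm
    exact map_over_congr F rfl _
  · have hbb : b' = b := hbu b' fun φ h ↦ congrArg Sigma.fst (h' φ h)
    subst hbb
    refine congrArg (Sigma.mk b') (hfu f' fun {V} ψ h ↦ ?_)
    have h1 := h' ψ.left h
    have h2 := totalPresheaf_eq F (V := V) h1.symm (φ := Over.homMk (𝟙 _) (by
      have h1 := hb ψ.left (hS'' ψ h)
      have h2 := Over.w ψ
      simpa using h1.symm.trans h2)) (φ' := Over.homMk (𝟙 _) (by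
      have h2 := Over.w ψ
      change 𝟙 _ ≫ ψ.left ≫ b' = _
      simpa using h2)) rfl
    refine Eq.trans ?_ h2.symm
    exact (map_map_over F (Category.id_comp _) f').symm

end

section
variable {B : Scheme.{u}} {F : (Over B)ᵒᵖ ⥤ Type w} {Z : Over B}
  {τ : ∀ T : Over B, F.obj (op T) → (T ⟶ Z)}

/-- Effective fpqc descent for affine morphisms of schemes over `B`: a sheaf over `Z` that is
locally on `Z` represented by affine smooth schemes is represented by a scheme which is affine and
smooth over `Z`. -/
theorem exists_isUniversalOver_over
    (hF : Presieve.IsSheaf (Scheme.fpqcTopology.over B) F)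
    (hτ : ∀ {T T' : Over B} (φ : T ⟶ T') (f : F.obj (op T')), τ _ (F.map φ.op f) = φ ≫ τ _ f)
    (hloc : ∀ {W : Over B} (w : W ⟶ Z) (f : F.obj (op W)), τ _ f = w →
      ∃ (Y : Over B) (π : Y ⟶ W) (y : F.obj (op Y)), IsAffineHom π.left ∧ Smooth π.left ∧
        IsUniversalOver F τ w π y)
    {S : Sieve Z} (hS : S ∈ Scheme.fpqcTopology.over B Z)
    (hSF : ∀ {W : Over B} (w : W ⟶ Z), S w → ∃ f : F.obj (op W), τ _ f = w) :
    ∃ (Y : Over B) (π : Y ⟶ Z) (y : F.obj (op Y)), IsAffineHom π.left ∧ Smooth π.left ∧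
      IsUniversalOver F τ (𝟙 Z) π y := by
  let τ' : ∀ T : Scheme.{u}, (totalPresheaf F).obj (op T) → (T ⟶ Z.left) :=
    fun T s ↦ (τ _ s.2).left
  have hτ' : ∀ {T T' : Scheme.{u}} (φ : T ⟶ T') (f : (totalPresheaf F).obj (op T')),
      τ' _ ((totalPresheaf F).map φ.op f) = φ ≫ τ' _ f := by
    intro T T' φ f
    exact congrArg CommaMorphism.left (hτ (Over.homMk φ : Over.mk (φ ≫ f.1) ⟶ Over.mk f.1) f.2)
  have hw : ∀ {T : Scheme.{u}} (s : (totalPresheaf F).obj (op T)), τ' _ s ≫ Z.hom = s.1 :=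
    fun s ↦ Over.w (τ _ s.2)
  -- A section of the total presheaf remembers its structure morphism to `B`, so universality over
  -- `B` and absolute universality test the same points.
  have huniv : ∀ {W Y : Over B} (w : W ⟶ Z) (π : Y ⟶ W) (y : F.obj (op Y)),
      IsUniversalOver F τ w π y ↔
        IsUniversalOver (totalPresheaf F) τ' w.left π.left ⟨Y.hom, y⟩ := by
    intro W Y w π y
    constructor
    · intro h
      refine ⟨congrArg CommaMorphism.left h.1, fun {T} t s hs ↦ ?_⟩
      have hb : t ≫ W.hom = s.1 := by
        rw [← hw s, hs, Category.assoc, Over.w]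
      let t' : Over.mk s.1 ⟶ W := Over.homMk t hb
      obtain ⟨x, ⟨hx₁, hx₂⟩, hxu⟩ := h.2 t' s.2 (Over.OverMorphism.ext hs)
      refine ⟨x.left, ⟨congrArg CommaMorphism.left hx₁, ?_⟩, ?_⟩
      · refine totalPresheaf_ext F (Over.w x) ?_
        rw [← hx₂, ← map_op_comp]
        exact map_over_congr F (by simp) _
      · rintro x' ⟨h₁, h₂⟩
        have hx' : x' ≫ Y.hom = s.1 := congrArg Sigma.fst h₂
        have := hxu (Over.homMk x' hx') ⟨Over.OverMorphism.ext h₁, ?_⟩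
        · rw [← this]
          rfl
        · have := totalPresheaf_eq F (V := Over.mk s.1) h₂ (φ := Over.homMk (𝟙 _) (by
            change 𝟙 _ ≫ x' ≫ Y.hom = _
            simpa using hx')) (φ' := 𝟙 _) rfl
          refine Eq.trans ?_ (this.trans (map_over_id F rfl _))
          exact (map_map_over F (Category.id_comp _) y).symm
    · intro h
      refine ⟨Over.OverMorphism.ext h.1, fun {T} t f hf ↦ ?_⟩
      obtain ⟨x, ⟨hx₁, hx₂⟩, hxu⟩ := h.2 t.left ⟨T.hom, f⟩ (congrArg CommaMorphism.left hf)
      have hx' : x ≫ Y.hom = T.hom := congrArg Sigma.fst hx₂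
      refine ⟨Over.homMk x hx', ⟨Over.OverMorphism.ext hx₁, ?_⟩, ?_⟩
      · have := totalPresheaf_eq F (V := T) hx₂ (φ := Over.homMk (𝟙 _) (by
            change 𝟙 _ ≫ x ≫ Y.hom = _
            simpa using hx')) (φ' := 𝟙 _) rfl
        refine Eq.trans ?_ (this.trans (map_over_id F rfl _))
        exact (map_map_over F (Category.id_comp _) y).symm
      · rintro x' ⟨h₁, h₂⟩
        refine Over.OverMorphism.ext (hxu x'.left ⟨congrArg CommaMorphism.left h₁, ?_⟩)
        refine totalPresheaf_ext F (Over.w x') ?_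
        rw [← h₂, ← map_op_comp]
        exact map_over_congr F (by simp) _
  obtain ⟨Y, π, y, h₁, h₂, h₃⟩ := exists_isUniversalOver (F := totalPresheaf F) (τ := τ')
    (isSheaf_totalPresheaf hF) hτ' (fun {W} w f hf ↦ by
      obtain ⟨Y, π, y, h₁, h₂, h₃⟩ := hloc (W := Over.mk f.1) (τ _ f.2) f.2 rfl
      rw [huniv] at h₃
      subst hf
      exact ⟨Y.left, π.left, ⟨Y.hom, y⟩, h₁, h₂, h₃⟩)
    (S := Sieve.overEquiv Z S) hS (fun {W} w h ↦ by
      have h' := (Sieve.overEquiv_iff S w).1 h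
      obtain ⟨f, hf⟩ := hSF _ h'
      exact ⟨⟨w ≫ Z.hom, f⟩, congrArg CommaMorphism.left hf⟩)
  have hπ : π ≫ Z.hom = y.1 := by
    rw [← hw y, h₃.1, Category.comp_id]
  refine ⟨Over.mk y.1, Over.homMk π hπ, y.2, h₁, h₂, ?_⟩
  rw [huniv]
  exact h₃

end

/-! ### Functions on finite free base changes. -/

/-- The base change of an algebra that is a free module with basis `e` is free with the image of
this basis. -/
theorem existsUnique_sum_of_isPushout {A B C P : CommRingCat.{u}} {f : A ⟶ B} {g : A ⟶ C}
    {inl : B ⟶ P} {inr : C ⟶ P} (h : IsPushout f g inl inr) {ι : Type*} [Fintype ι] (e : ι → C)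
    (he : ∀ c : C, ∃! a : ι → A, c = ∑ i, g.hom (a i) * e i) (p : P) :
    ∃! b : ι → B, p = ∑ i, inl.hom (b i) * inr.hom (e i) := by
  algebraize [f.hom, g.hom, inl.hom, inr.hom, inl.hom.comp f.hom]
  have : IsScalarTower A C P := .of_algebraMap_eq' (by
    have := congrArg CommRingCat.Hom.hom h.w
    exact this)
  have hp : Algebra.IsPushout A B C P := CommRingCat.isPushout_iff_isPushout.1 h
  let L : (ι → A) →ₗ[A] C := Fintype.linearCombination A e
  have hL : Function.Bijective L := by
    rw [Function.bijective_iff_existsUnique]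
    intro c
    obtain ⟨a, ha, hu⟩ := he c
    refine ⟨a, ?_, fun a' ha' ↦ hu a' ?_⟩
    · exact (Finset.sum_congr rfl fun i _ ↦ Algebra.smul_def _ _).trans ha.symm
    · exact ha'.symm.trans (Finset.sum_congr rfl fun i _ ↦ Algebra.smul_def _ _)
  let bas : Module.Basis ι A C := .ofEquivFun (LinearEquiv.ofBijective L hL).symm
  have hbas : ∀ i, bas i = e i := fun i ↦ by
    classical
    simp [bas, L, Fintype.linearCombination_apply, Pi.single_apply]
  let bas' : Module.Basis ι B P := hp.out.basis bas
  have hbas' : ∀ i, bas' i = inr.hom (e i) := fun i ↦ by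
    rw [IsBaseChange.basis_apply, hbas]
    rfl
  have key : ∀ b : ι → B, ∑ i, inl.hom (b i) * inr.hom (e i) = bas'.equivFun.symm b := by
    intro b
    rw [Module.Basis.equivFun_symm_apply]
    refine Finset.sum_congr rfl fun i _ ↦ ?_
    rw [hbas', Algebra.smul_def]
    rfl
  refine ⟨bas'.equivFun p, by beta_reduce; rw [key, LinearEquiv.symm_apply_apply], fun b hb ↦ ?_⟩
  rw [hb, key, LinearEquiv.apply_symm_apply]

section
variable {X Y S T : Scheme.{u}} {f : T ⟶ S} {g : Y ⟶ X} {iX : X ⟶ S} {iY : Y ⟶ T}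

/-- The functions on the base change of `X` along a finite free morphism of affine schemes. -/
theorem existsUnique_sum_of_isPullback [IsAffine S] [IsAffine T] (H : IsPullback g iY iX f)
    {ι : Type*} [Fintype ι] (e : ι → Γ(T, ⊤))
    (he : ∀ c : Γ(T, ⊤), ∃! a : ι → Γ(S, ⊤), c = ∑ i, f.appTop.hom (a i) * e i) (y : Γ(Y, ⊤)) :
    ∃! b : ι → Γ(X, ⊤), y = ∑ i, g.appTop.hom (b i) * iY.appTop.hom (e i) := by
  let r : ∀ U : X.Opens, Γ(Y, ⊤) →+* Γ(Y, g ⁻¹ᵁ U) := fun U ↦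
    (Y.presheaf.map (homOfLE (le_top : g ⁻¹ᵁ U ≤ ⊤)).op).hom
  -- `Ψ` is compatible with restriction, so the question is local on `X`. Over an affine open subset
  -- the functions on the preimage form a pushout of rings.
  let Ψ : ∀ U : X.Opens, (ι → Γ(X, U)) → Γ(Y, g ⁻¹ᵁ U) := fun U b ↦
    ∑ i, (g.app U).hom (b i) * r U (iY.appTop.hom (e i))
  have hnat : ∀ {U V : X.Opens} (hUV : U ≤ V) (b : ι → Γ(X, V)),
      (Y.presheaf.map (homOfLE (g.preimage_mono hUV)).op).hom (Ψ V b) =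
        Ψ U fun i ↦ (X.presheaf.map (homOfLE hUV).op).hom (b i) := by
    intro U V hUV b
    simp only [Ψ, map_sum, map_mul]
    refine Finset.sum_congr rfl fun i _ ↦ congrArg₂ (· * ·) ?_ ?_
    · exact congr(($(g.naturality (homOfLE hUV).op)).hom (b i)).symm
    · change ((Y.presheaf.map _ ≫ Y.presheaf.map _).hom _) = (Y.presheaf.map _).hom _
      rw [← Functor.map_comp]
      rfl
  have haff : ∀ U : X.Opens, IsAffineOpen U → ∀ y : Γ(Y, g ⁻¹ᵁ U), ∃! b, y = Ψ U b := by
    intro U hU y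
    have hpo := (isIso_pushoutSection_iff H (US := ⊤) (UT := ⊤) (UX := U) (UY := g ⁻¹ᵁ U)
      le_top le_top (by simp)).1
        (isIso_pushoutSection_of_isAffineOpen H _ _ _ (isAffineOpen_top S) (isAffineOpen_top T) hU)
    have e1 : f.appLE ⊤ ⊤ le_top = f.appTop := Scheme.Hom.appLE_eq_app f
    have e2 : g.appLE U (g ⁻¹ᵁ U) le_rfl = g.app U := Scheme.Hom.appLE_eq_app g
    have h1 := existsUnique_sum_of_isPushout hpo e (by
      rw [e1]; exact he) y
    have e3 : ∀ b : ι → Γ(X, U), Ψ U b = ∑ i, (g.appLE U (g ⁻¹ᵁ U) le_rfl).hom (b i) *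
        (iY.appLE ⊤ (g ⁻¹ᵁ U) le_top).hom (e i) := by
      intro b
      rw [e2]
      rfl
    simpa only [e3] using h1
  have hinj : ∀ (U : X.Opens) (b b' : ι → Γ(X, U)), Ψ U b = Ψ U b' → b = b' := by
    intro U b b' hb
    funext i
    refine X.IsSheaf.section_ext fun x hx ↦ ?_
    obtain ⟨_, ⟨V, hV, rfl⟩, hxV, hVU⟩ := X.isBasis_affineOpens.exists_subset_of_mem_open hx U.2
    replace hVU : V ≤ U := hVU
    refine ⟨V, hVU, hxV, ?_⟩
    have h := congrArg (Y.presheaf.map (homOfLE (g.preimage_mono hVU)).op).hom hb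
    rw [hnat hVU, hnat hVU] at h
    exact congrFun ((haff V hV _).unique rfl h) i
  have hsurj : ∃ b, y = Ψ ⊤ b := by
    choose β hβ _ using fun V : X.affineOpens ↦ haff V.1 V.2 (r V.1 y)
    have hr : ∀ {U V : X.Opens} (hUV : U ≤ V),
        (Y.presheaf.map (homOfLE (g.preimage_mono hUV)).op).hom (r V y) = r U y := by
      intro U V hUV
      change ((Y.presheaf.map _ ≫ Y.presheaf.map _).hom _) = (Y.presheaf.map _).hom _
      rw [← Functor.map_comp]
      rfl
    -- Intersections of affine open subsets need not be affine; the injectivity of `Ψ` over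
    -- arbitrary open subsets shows that the local coefficients agree there and hence glue.
    have hcov : (⊤ : X.Opens) ≤ ⨆ V : X.affineOpens, (V : X.Opens) :=
      (iSup_affineOpens_eq_top X).ge
    have hglue : ∀ i, ∃ s : Γ(X, ⊤), ∀ V : X.affineOpens,
        (X.presheaf.map (homOfLE (le_top : (V : X.Opens) ≤ ⊤)).op).hom s = β V i := by
      intro i
      obtain ⟨s, hs, -⟩ := X.sheaf.existsUnique_gluing' (fun V : X.affineOpens ↦ (V : X.Opens)) ⊤
        (fun V ↦ homOfLE le_top) hcov (fun V ↦ β V i) (by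
          intro V V'
          have h := hinj (V.1 ⊓ V'.1)
            (fun i ↦ (X.presheaf.map (homOfLE inf_le_left).op).hom (β V i))
            (fun i ↦ (X.presheaf.map (homOfLE inf_le_right).op).hom (β V' i)) (by
              rw [← hnat inf_le_left, ← hnat inf_le_right, ← hβ V, ← hβ V', hr inf_le_left,
                hr inf_le_right])
          exact congrFun h i)
      exact ⟨s, hs⟩
    choose b hb using hglue
    refine ⟨b, ?_⟩
    refine Y.sheaf.eq_of_locally_eq' (fun V : X.affineOpens ↦ g ⁻¹ᵁ (V : X.Opens)) ⊤
      (fun V ↦ homOfLE le_top) ?_ _ _ fun V ↦ ?_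
    · intro x _
      have := hcov (Set.mem_univ (g x) : g x ∈ (⊤ : X.Opens))
      simp only [TopologicalSpace.Opens.mem_iSup] at this ⊢
      exact this
    · refine Eq.trans (hβ V) (Eq.trans ?_ (hnat le_top b).symm)
      exact congrArg (Ψ V.1) (funext fun i ↦ (hb i V).symm)
  have hΨ : ∀ b : ι → Γ(X, ⊤), Ψ ⊤ b = ∑ i, g.appTop.hom (b i) * iY.appTop.hom (e i) := by
    intro b
    refine Finset.sum_congr rfl fun i _ ↦ congrArg (g.appTop.hom (b i) * ·) ?_
    exact congr($(Y.presheaf.map_id _).hom (iY.appTop.hom (e i)))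
  obtain ⟨b, hb⟩ := hsurj
  exact ⟨b, hb.trans (hΨ b), fun b' hb' ↦ hinj ⊤ _ _ (by rw [hΨ b', ← hb', hb])⟩
end

/-! ### Points of the thickenings. -/

section ThickPoints
variable {k : Type u} [Field k] {n : ℕ}

/-- The structure morphism of `S ×_k Spec k⟦z⟧/(z^(n+1))` over `Spec k⟦z⟧/(z^(n+1))`. -/
noncomputable def thickStr (n : ℕ) (S : SchOver k) : ((thick k n).obj S).left ⟶
    Spec (CommRingCat.of (k⟦X⟧ ⧸ Ideal.span {(X : k⟦X⟧) ^ (n + 1)})) :=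
  Limits.pullback.snd S.hom _

theorem thick_isPullback (n : ℕ) (S : SchOver k) :
    IsPullback (thickProj n S) (thickStr n S) S.hom (Spec.map (CommRingCat.ofHom
      (algebraMap k (k⟦X⟧ ⧸ Ideal.span {(X : k⟦X⟧) ^ (n + 1)})))) :=
  IsPullback.of_hasPullback _ _

theorem thickStr_comp (n : ℕ) (S : SchOver k) :
    thickStr n S ≫ Spec.map (CommRingCat.ofHom
      (Ideal.Quotient.mk (Ideal.span {(X : k⟦X⟧) ^ (n + 1)}))) = ((thick k n).obj S).hom := rfl

instance mono_spec_mk {R : Type u} [CommRing R] (I : Ideal R) :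
    Mono (Spec.map (CommRingCat.ofHom (Ideal.Quotient.mk I))) := by
  have : IsClosedImmersion (Spec.map (CommRingCat.ofHom (Ideal.Quotient.mk I))) :=
    IsClosedImmersion.spec_of_surjective _ Ideal.Quotient.mk_surjective
  infer_instance

theorem thick_map_proj {S S' : SchOver k} (f : S ⟶ S') :
    ((thick k n).map f).left ≫ thickProj n S' = thickProj n S ≫ f.left :=
  Limits.pullback.lift_fst _ _ _

theorem thick_map_str {S S' : SchOver k} (f : S ⟶ S') :
    ((thick k n).map f).left ≫ thickStr n S' = thickStr n S :=
  Limits.pullback.lift_snd _ _ _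

theorem thickIncl_proj (S : SchOver k) :
    ((thickIncl k n).app S).left ≫ thickProj (n + 1) S = thickProj n S :=
  Limits.pullback.lift_fst _ _ _

theorem thickIncl_str (S : SchOver k) :
    ((thickIncl k n).app S).left ≫ thickStr (n + 1) S = thickStr n S ≫ thickIncl₀ k n :=
  Limits.pullback.lift_snd _ _ _

/-- The structure of `T` over k⟦z⟧ already determines its map to the closed subscheme Spec
k⟦z⟧/(z^(n+1)). Hence a point of a thickening of `S` carries no more information than its projection
to `S`. -/
theorem comp_thickStr_eq {S S' : SchOver k} {T : SchOver k⟦X⟧} (t : T ⟶ (thick k n).obj S)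
    (t' : T ⟶ (thick k n).obj S') : t.left ≫ thickStr n S = t'.left ≫ thickStr n S' := by
  rw [← cancel_mono (Spec.map (CommRingCat.ofHom
      (Ideal.Quotient.mk (Ideal.span {(X : k⟦X⟧) ^ (n + 1)}))))]
  rw [Category.assoc, Category.assoc, thickStr_comp, thickStr_comp, Over.w, Over.w]

theorem thick_ext {S : SchOver k} {T : SchOver k⟦X⟧} {t t' : T ⟶ (thick k n).obj S}
    (h : t.left ≫ thickProj n S = t'.left ≫ thickProj n S) : t = t' :=
  Over.OverMorphism.ext ((thick_isPullback n S).hom_ext h (comp_thickStr_eq t t'))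

/-- The point `t` is there only to supply the map from `T` to Spec k⟦z⟧/(z^(n+1)); granted this, a
point of a thickening of `S'` is the same as a morphism of `k`-schemes to `S'`. -/
theorem exists_thick_lift {S S' : SchOver k} {T : SchOver k⟦X⟧} (t : T ⟶ (thick k n).obj S)
    (s : T.left ⟶ S'.left) (hs : s ≫ S'.hom = t.left ≫ thickProj n S ≫ S.hom) :
    ∃ t' : T ⟶ (thick k n).obj S', t'.left ≫ thickProj n S' = s := by
  have h : s ≫ S'.hom = (t.left ≫ thickStr n S) ≫ Spec.map (CommRingCat.ofHom
      (algebraMap k (k⟦X⟧ ⧸ Ideal.span {(X : k⟦X⟧) ^ (n + 1)}))) := by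
    rw [hs, (thick_isPullback n S).w, Category.assoc]
  refine ⟨Over.homMk ((thick_isPullback n S').lift s (t.left ≫ thickStr n S) h) ?_,
    (thick_isPullback n S').lift_fst _ _ _⟩
  have := (thick_isPullback n S').lift_snd s (t.left ≫ thickStr n S) h
  rw [← thickStr_comp, ← Category.assoc, this, Category.assoc, thickStr_comp, Over.w]

theorem comp_thickProj_hom {S S' : SchOver k} {T : SchOver k⟦X⟧} (t : T ⟶ (thick k n).obj S)
    (t' : T ⟶ (thick k n).obj S') :
    t.left ≫ thickProj n S ≫ S.hom = t'.left ≫ thickProj n S' ≫ S'.hom := by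
  rw [(thick_isPullback n S).w, (thick_isPullback n S').w, ← Category.assoc,
    comp_thickStr_eq t t', Category.assoc]

theorem comp_thick_map_proj {S U : SchOver k} {T : SchOver k⟦X⟧} (t : T ⟶ (thick k n).obj U)
    (f : U ⟶ S) : (t ≫ (thick k n).map f).left ≫ thickProj n S =
      (t.left ≫ thickProj n U) ≫ f.left := by
  rw [Over.comp_left, Category.assoc, thick_map_proj, Category.assoc]

theorem comp_thickIncl_proj {S : SchOver k} {T : SchOver k⟦X⟧} (t : T ⟶ (thick k n).obj S) :
    (t ≫ (thickIncl k n).app S).left ≫ thickProj (n + 1) S = t.left ≫ thickProj n S := by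
  rw [Over.comp_left, Category.assoc, thickIncl_proj]

/-- The points of a thickening of `S` with values in `T`, if there are any, are the points of `S`
with values in the `k`-scheme underlying `T`. -/
theorem exists_thick_unit {S : SchOver k} {T : SchOver k⟦X⟧} (t : T ⟶ (thick k n).obj S) :
    ∃ (T₀ : SchOver k) (η : T ⟶ (thick k n).obj T₀),
      ∀ (S' : SchOver k) (t' : T ⟶ (thick k n).obj S'),
        ∃! s : T₀ ⟶ S', η ≫ (thick k n).map s = t' := by
  -- `T₀` is the scheme `T` viewed over `k`, and `η` is the point whose projection to `T₀` is the
  -- identity.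
  let T₀ : SchOver k := Over.mk (t.left ≫ thickProj n S ≫ S.hom)
  obtain ⟨η, hη⟩ := exists_thick_lift (S' := T₀) t (𝟙 T.left) (Category.id_comp _)
  refine ⟨T₀, η, fun S' t' ↦ ⟨Over.homMk (t'.left ≫ thickProj n S') ?_, ?_, ?_⟩⟩
  · rw [Category.assoc]
    exact comp_thickProj_hom t' t
  · refine thick_ext ?_
    rw [comp_thick_map_proj, hη]
    exact Category.id_comp _
  · rintro s rfl
    exact Over.OverMorphism.ext ((Category.id_comp s.left).symm.trans
      ((congrArg (· ≫ s.left) hη.symm).trans (comp_thick_map_proj η s).symm))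

theorem isPullback_of_existsUnique {D : Type*} [Category D] {P Y Z W : D} {fst : P ⟶ Y}
    {snd : P ⟶ Z} {f : Y ⟶ W} {g : Z ⟶ W} (w : fst ≫ f = snd ≫ g)
    (h : ∀ {T : D} (a : T ⟶ Y) (b : T ⟶ Z), a ≫ f = b ≫ g → ∃ c : T ⟶ P, c ≫ fst = a ∧ c ≫ snd = b)
    (hext : ∀ {T : D} (c c' : T ⟶ P), c ≫ fst = c' ≫ fst → c ≫ snd = c' ≫ snd → c = c') :
    IsPullback fst snd f g := by
  refine ⟨⟨w⟩, ⟨PullbackCone.IsLimit.mk _ (fun s ↦ (h s.fst s.snd s.condition).choose)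
    (fun s ↦ (h s.fst s.snd s.condition).choose_spec.1)
    (fun s ↦ (h s.fst s.snd s.condition).choose_spec.2) fun s m h₁ h₂ ↦ hext _ _ ?_ ?_⟩⟩
  · exact h₁.trans (h s.fst s.snd s.condition).choose_spec.1.symm
  · exact h₂.trans (h s.fst s.snd s.condition).choose_spec.2.symm

theorem thickIncl_isPullback {S U : SchOver k} (f : U ⟶ S) :
    IsPullback ((thickIncl k n).app U) ((thick k n).map f) ((thick k (n + 1)).map f)
      ((thickIncl k n).app S) := by
  refine isPullback_of_existsUnique ((thickIncl k n).naturality f).symm ?_ ?_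
  · intro T a b h
    have h' := congrArg (fun m ↦ m.left ≫ thickProj (n + 1) S) h
    beta_reduce at h'
    rw [comp_thick_map_proj, comp_thickIncl_proj] at h'
    -- The point `b` ensures that `T` lives over the smaller thickening, and `a` supplies the
    -- projection to `U`.
    obtain ⟨c, hc⟩ := exists_thick_lift b (a.left ≫ thickProj (n + 1) U) (by
      rw [← Category.assoc b.left, ← h', Category.assoc (_ ≫ _) f.left, Over.w])
    refine ⟨c, thick_ext ?_, thick_ext ?_⟩
    · rw [comp_thickIncl_proj, hc]
    · rw [comp_thick_map_proj, hc, h']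
  · intro T c c' h _
    refine thick_ext ?_
    rw [← comp_thickIncl_proj, h, comp_thickIncl_proj]

/-- A covering of `V` induces a covering of every `T` with a morphism to a thickening of `V`. -/
theorem thick_covering {J : GrothendieckTopology Scheme.{u}} {V : SchOver k}
    {Sv : Sieve V} (hSv : Sv ∈ J.over _ V) {T : SchOver k⟦X⟧} (t : T ⟶ (thick k n).obj V)
    {R : Sieve T} (hR : ∀ {T' : SchOver k⟦X⟧} (φ : T' ⟶ T) {V' : SchOver k} (f : V' ⟶ V), Sv f →
      ∀ u : T' ⟶ (thick k n).obj V', u ≫ (thick k n).map f = φ ≫ t → R φ) :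
    R ∈ J.over _ T := by
  -- The covering is pulled back along the morphism of schemes `T → V`; a member of the pullback has
  -- its own point in a thickening of the corresponding `V'`.
  have h := J.pullback_stable (t.left ≫ thickProj n V) hSv
  refine J.superset_covering ?_ h
  intro Y φ hφ
  let φ' : Over.mk (φ ≫ T.hom) ⟶ T := Over.homMk φ rfl
  let V' : SchOver k := Over.mk ((φ ≫ t.left ≫ thickProj n V) ≫ V.hom)
  let f : V' ⟶ V := Over.homMk (φ ≫ t.left ≫ thickProj n V) rfl
  have hf : Sv f := (Sieve.overEquiv_iff _ _).1 hφ
  obtain ⟨u, hu⟩ := exists_thick_lift (S' := V') (φ' ≫ t) (𝟙 Y) (by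
    rw [Over.comp_left, Category.assoc]
    simp [V', φ'])
  refine (Sieve.overEquiv_iff _ _).2 (hR φ' f hf u (thick_ext ?_))
  rw [comp_thick_map_proj, hu, Over.comp_left, Category.assoc]
  exact Category.id_comp _

end ThickPoints

theorem tensorBase_val_injective {O F H : Type u} [CommRing O] [IsDedekindDomain O] [Field F]
    [Algebra O F] [IsFractionRing O F] [CommRing H] [HopfAlgebra F H] [Algebra O H]
    [IsScalarTower O F H] (D : Subalgebra O H) : Function.Injective (tensorBase F D.val D.val) :=
  have := flat_subalgebra F D
  tensorBase_injective D.val D.val Subtype.val_injective Subtype.val_injective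

/-! ### The universal property of the dilatation. -/

section Dilatation
variable {k A : Type u} [Field k] [CommRing A] [HopfAlgebra k A] {Q : ClosedSubgroupScheme k A}

/-- The inclusion of `A` into the coordinate ring of `G'` is a homomorphism. -/
noncomputable def inclHom (Q : ClosedSubgroupScheme k A) : A →ₐ[k] dilatation Q where
  toFun := dilatation.incl Q
  map_one' := rfl
  map_mul' a b := Subtype.ext (by simp [dilatation.incl])
  map_zero' := Subtype.ext (by simp [dilatation.incl])
  map_add' a b := Subtype.ext (by simp [dilatation.incl, TensorProduct.tmul_add])
  commutes' r := Subtype.ext (by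
    change (1 : FractionRing k⟦X⟧) ⊗ₜ[k] algebraMap k A r = algebraMap k (_ ⊗[k] A) r
    rw [Algebra.algebraMap_eq_smul_one, TensorProduct.tmul_smul, Algebra.algebraMap_eq_smul_one]
    rfl)

/-- The function `z⁻¹ b` on `G'` for a function `b` that vanishes on the subgroup. -/
noncomputable def dilatation.quot (b : A) (hb : Q.res b = 0) : dilatation Q :=
  ⟨(algebraMap k⟦X⟧ (FractionRing k⟦X⟧) X)⁻¹ ⊗ₜ[k] b, Algebra.subset_adjoin (Or.inr ⟨b, hb, rfl⟩)⟩

theorem algebraMap_X_ne_zero :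
    algebraMap k⟦X⟧ (FractionRing k⟦X⟧) X ≠ 0 := by
  simp [PowerSeries.X_ne_zero]

theorem algebraMap_X_mul_quot (b : A) (hb : Q.res b = 0) :
    algebraMap k⟦X⟧ (dilatation Q) X * dilatation.quot b hb = inclHom Q b := by
  refine Subtype.ext ?_
  rw [← Algebra.smul_def]
  change (X : k⟦X⟧) • ((algebraMap k⟦X⟧ (FractionRing k⟦X⟧) X)⁻¹ ⊗ₜ[k] b) = 1 ⊗ₜ b
  rw [TensorProduct.smul_tmul', Algebra.smul_def, mul_inv_cancel₀ algebraMap_X_ne_zero]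

theorem adjoin_dilatation_eq_top : Algebra.adjoin k⟦X⟧
    (Set.range (inclHom Q) ∪ {d | ∃ b hb, d = dilatation.quot (Q := Q) b hb}) = ⊤ := by
  rw [eq_top_iff]
  rintro ⟨d, hd⟩ -
  have h : dilatation Q ≤ (Algebra.adjoin k⟦X⟧ (Set.range (inclHom Q) ∪
      {d | ∃ b hb, d = dilatation.quot (Q := Q) b hb})).map (dilatation Q).val := by
    refine Algebra.adjoin_le ?_
    rintro x (⟨a, rfl⟩ | ⟨b, hb, rfl⟩)
    · exact ⟨inclHom Q a, Algebra.subset_adjoin (Or.inl ⟨a, rfl⟩), rfl⟩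
    · exact ⟨dilatation.quot b hb, Algebra.subset_adjoin (Or.inr ⟨b, hb, rfl⟩), rfl⟩
  obtain ⟨e, he, rfl⟩ := h hd
  exact he

section Lift
variable {E : Type*} [CommRing E] [Algebra k⟦X⟧ E]

/-- The remaining generators z⁻¹b are sent to solutions of z·e = f(b), which are unique when z is a
nonzerodivisor in `E`. -/
theorem dilatation_hom_ext (hX : algebraMap k⟦X⟧ E X ∈ nonZeroDivisors E)
    {f g : dilatation Q →ₐ[k⟦X⟧] E} (h : ∀ a, f (inclHom Q a) = g (inclHom Q a)) : f = g := by
  refine AlgHom.ext_of_adjoin_eq_top adjoin_dilatation_eq_top ?_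
  rintro _ (⟨a, rfl⟩ | ⟨b, hb, rfl⟩)
  · exact h a
  · refine mul_cancel_left_mem_nonZeroDivisors hX |>.1 ?_
    rw [← AlgHom.commutes f, ← map_mul, AlgHom.commutes, ← AlgHom.commutes g, ← map_mul,
      algebraMap_X_mul_quot, h]

/-- A nonzero power series over a field is a power of z times a unit. -/
theorem algebraMap_mem_nonZeroDivisors (hX : algebraMap k⟦X⟧ E X ∈ nonZeroDivisors E)
    {f : k⟦X⟧} (hf : f ≠ 0) : algebraMap k⟦X⟧ E f ∈ nonZeroDivisors E := by
  rw [← PowerSeries.X_pow_order_mul_divXPowOrder (f := f), map_mul, map_pow]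
  exact mul_mem (pow_mem hX _)
    ((PowerSeries.isUnit_divided_by_X_pow_order hf).map _).mem_nonZeroDivisors

/-- The universal property of the dilatation. -/
theorem exists_dilatation_lift [Algebra k E] [IsScalarTower k k⟦X⟧ E]
    (hX : algebraMap k⟦X⟧ E X ∈ nonZeroDivisors E) (h : A →ₐ[k] E)
    (hh : ∀ b, Q.res b = 0 → algebraMap k⟦X⟧ E X ∣ h b) :
    ∃ f : dilatation Q →ₐ[k⟦X⟧] E, ∀ a, f (inclHom Q a) = h a := by
  -- In the total ring of fractions of `E` all nonzero power series become invertible, so that `h`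
  -- extends to k((z)) ⊗ A. The divisibility hypothesis says that the generators of the dilatation
  -- land in `E`.
  let L := Localization (nonZeroDivisors E)
  let φ : FractionRing k⟦X⟧ →ₐ[k⟦X⟧] L := IsLocalization.liftAlgHom (M := nonZeroDivisors k⟦X⟧)
    (f := Algebra.ofId k⟦X⟧ L) (by
      rintro ⟨f, hf⟩
      change IsUnit (algebraMap k⟦X⟧ L f)
      rw [IsScalarTower.algebraMap_apply k⟦X⟧ E L]
      exact IsLocalization.map_units L (⟨_, algebraMap_mem_nonZeroDivisors hX
        (nonZeroDivisors.ne_zero hf)⟩ : nonZeroDivisors E))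
  let ψ : FractionRing k⟦X⟧ ⊗[k] A →ₐ[k⟦X⟧] L :=
    Algebra.TensorProduct.lift φ ((IsScalarTower.toAlgHom k E L).comp h) (fun _ _ ↦ Commute.all _ _)
  have hinj : Function.Injective (IsScalarTower.toAlgHom k⟦X⟧ E L) :=
    IsLocalization.injective L le_rfl
  have hψ1 : ∀ a : A, ψ (1 ⊗ₜ a) = algebraMap E L (h a) := fun a ↦ by
    simp [ψ]
  have hr : dilatation Q ≤ (IsScalarTower.toAlgHom k⟦X⟧ E L).range.comap ψ := by
    refine Algebra.adjoin_le ?_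
    rintro x (⟨a, rfl⟩ | ⟨b, hb, rfl⟩)
    · exact ⟨h a, (hψ1 a).symm⟩
    · obtain ⟨e, he⟩ := hh b hb
      refine ⟨e, ?_⟩
      have h1 : algebraMap k⟦X⟧ L X * ψ ((algebraMap k⟦X⟧ (FractionRing k⟦X⟧) X)⁻¹ ⊗ₜ[k] b) =
          algebraMap E L (h b) := by
        rw [← hψ1, ← Algebra.smul_def, ← map_smul, TensorProduct.smul_tmul', Algebra.smul_def,
          mul_inv_cancel₀ algebraMap_X_ne_zero]
      have h2 : IsUnit (algebraMap k⟦X⟧ L X) := by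
        rw [IsScalarTower.algebraMap_apply k⟦X⟧ E L]
        exact IsLocalization.map_units L (⟨_, hX⟩ : nonZeroDivisors E)
      refine h2.mul_left_cancel (Eq.trans ?_ h1.symm)
      rw [he, map_mul, ← IsScalarTower.algebraMap_apply]
      rfl
  refine ⟨((AlgEquiv.ofInjective _ hinj).symm : _ →ₐ[k⟦X⟧] E).comp
    ((ψ.comp (dilatation Q).val).codRestrict (IsScalarTower.toAlgHom k⟦X⟧ E L).range fun d ↦ hr d.2), fun a ↦ ?_⟩
  apply hinj
  have := AlgEquiv.ofInjective_apply (IsScalarTower.toAlgHom k⟦X⟧ E L) hinj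
    ((AlgEquiv.ofInjective _ hinj).symm
      ((ψ.comp (dilatation Q).val).codRestrict (IsScalarTower.toAlgHom k⟦X⟧ E L).range
        (fun d ↦ hr d.2) (inclHom Q a)))
  refine this.symm.trans ?_
  rw [AlgEquiv.apply_symm_apply]
  exact hψ1 a

end Lift

section TensorSquare
variable {H : Type u} [CommRing H] [Algebra k⟦X⟧ H] [Algebra k H] [IsScalarTower k k⟦X⟧ H]

/-- The homomorphism `A ⊗[k] A → H ⊗[k⟦z⟧] H` induced by a homomorphism `A → H`. -/
noncomputable def tensorSquare (i : A →ₐ[k] H) : A ⊗[k] A →ₐ[k] H ⊗[k⟦X⟧] H :=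
  Algebra.TensorProduct.lift
    ((Algebra.TensorProduct.includeLeft : H →ₐ[k] H ⊗[k⟦X⟧] H).comp i)
    (((Algebra.TensorProduct.includeRight : H →ₐ[k⟦X⟧] H ⊗[k⟦X⟧] H).restrictScalars k).comp i)
    (fun _ _ ↦ Commute.all _ _)

theorem tensorBase_tensorSquare {F M : Type u} [Field F] [Algebra k⟦X⟧ F] [CommRing M] [Algebra F M]
    [Algebra k⟦X⟧ M] [IsScalarTower k⟦X⟧ F M] [Algebra k F] [Algebra k M] [IsScalarTower k F M]
    (v : H →ₐ[k⟦X⟧] M) (i : A →ₐ[k] H) (j : A →ₐ[k] M) (h : ∀ a, v (i a) = j a) (x : A ⊗[k] A) :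
    tensorBase F v v (tensorSquare i x) = tensorBase (O := k) F j j x := by
  induction x with
  | zero => simp
  | add x y hx hy => simp only [map_add, hx, hy]
  | tmul u v => simp [tensorSquare, h]

/-- The tensor square of an order embeds into that of the generic fibre, so the two sides are
compared there, where the comultiplication is known by `hj`. -/
theorem IsHopfOrder.comul_eq_tensorSquare {F M : Type u} [Field F] [Algebra k⟦X⟧ F]
    [IsFractionRing k⟦X⟧ F] [CommRing M] [HopfAlgebra F M]
    [Algebra k⟦X⟧ M] [IsScalarTower k⟦X⟧ F M] [Algebra k F] [Algebra k M] [IsScalarTower k F M]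
    {D : Subalgebra k⟦X⟧ M} (hD : IsHopfOrder F D) [Algebra k D] [IsScalarTower k k⟦X⟧ D]
    (i : A →ₐ[k] D) (j : A →ₐ[k] M) (h : ∀ a, (i a : M) = j a)
    (hj : ∀ a, Coalgebra.comul (R := F) (j a) =
      tensorBase (O := k) F j j (Coalgebra.comul (R := k) a)) (a : A) :
    hD.comul (i a) = tensorSquare i (Coalgebra.comul (R := k) a) := by
  apply tensorBase_val_injective (F := F) D
  rw [hD.tensorBase_comul, h, hj, tensorBase_tensorSquare D.val i j h]

end TensorSquare

section Comul
variable {H : Type u} [CommRing H] [HopfAlgebra k⟦X⟧ H] [Algebra k H] [IsScalarTower k k⟦X⟧ H]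

/-- The homomorphism `i` is compatible with the comultiplications. -/
def ComulCompatible (i : A →ₐ[k] H) : Prop :=
  ∀ a : A, Coalgebra.comul (R := k⟦X⟧) (i a) = tensorSquare i (Coalgebra.comul (R := k) a)

/-- This makes the restriction of points from `H` to `A` multiplicative, and through it the
extension of points from `A` to `H`. -/
theorem ComulCompatible.ofConv_mul {i : A →ₐ[k] H} (hi : ComulCompatible i)
    {B : Type u} [CommRing B] [Algebra k⟦X⟧ B] [Algebra k B]
    [IsScalarTower k k⟦X⟧ B] (f g : WithConv (H →ₐ[k⟦X⟧] B)) (f₀ g₀ : WithConv (A →ₐ[k] B))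
    (hf : ∀ a, f.ofConv (i a) = f₀.ofConv a) (hg : ∀ a, g.ofConv (i a) = g₀.ofConv a)
    (a : A) : (f * g).ofConv (i a) = (f₀ * g₀).ofConv a := by
  change Algebra.TensorProduct.lmul' k⟦X⟧ (Algebra.TensorProduct.map f.ofConv g.ofConv
    (Coalgebra.comul (R := k⟦X⟧) (i a))) = Algebra.TensorProduct.lmul' k
      (Algebra.TensorProduct.map f₀.ofConv g₀.ofConv (Coalgebra.comul (R := k) a))
  rw [hi]
  induction Coalgebra.comul (R := k) a with
  | zero => simp
  | add x y hx hy => simp only [map_add, hx, hy]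
  | tmul u v => simp [tensorSquare, ← hf, ← hg]

end Comul

/-- The homomorphism of `A` into the Hopf algebra `H` over `k⟦z⟧` has the universal property of the
dilatation in the subgroup `Q` of the special fibre. -/
structure IsDilatation {H : Type u} [CommRing H] [HopfAlgebra k⟦X⟧ H] [Algebra k H]
    [IsScalarTower k k⟦X⟧ H] (Q : ClosedSubgroupScheme k A) (i : A →ₐ[k] H) : Prop where
  comul : ComulCompatible i
  exists_quot : ∀ b, Q.res b = 0 → ∃ d, algebraMap k⟦X⟧ H X * d = i b
  exists_lift : ∀ {E : Type u} [CommRing E] [Algebra k⟦X⟧ E] [Algebra k E] [IsScalarTower k k⟦X⟧ E],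
    algebraMap k⟦X⟧ E X ∈ nonZeroDivisors E → ∀ h : A →ₐ[k] E,
      (∀ b, Q.res b = 0 → algebraMap k⟦X⟧ E X ∣ h b) → ∃ f : H →ₐ[k⟦X⟧] E, ∀ a, f (i a) = h a
  hom_ext : ∀ {E : Type u} [CommRing E] [Algebra k⟦X⟧ E],
    algebraMap k⟦X⟧ E X ∈ nonZeroDivisors E → ∀ f g : H →ₐ[k⟦X⟧] E,
      (∀ a, f (i a) = g (i a)) → f = g

instance isScalarTower_dilatation : @IsScalarTower k k⟦X⟧ (dilatation Q) _
    (@Algebra.toSMul _ _ _ _ (@Bialgebra.toAlgebra _ _ _ _ (@HopfAlgebraStruct.toBialgebra _ _ _ _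
      (HopfAlgebra.toHopfAlgebraStruct (R := k⟦X⟧) (A := dilatation Q))))) _ :=
  inferInstanceAs (@IsScalarTower k k⟦X⟧ (dilatation Q) _
    (@Algebra.toSMul _ _ _ _ (dilatation Q).algebra) _)

/-- The identification of `K'` with the points of `G'` uses only the four properties recorded here
and not the construction of the subalgebra. -/
theorem isDilatation_inclHom : IsDilatation (H := dilatation Q) Q (inclHom Q) where
  comul := IsHopfOrder.comul_eq_tensorSquare (D := dilatation Q) (isHopfOrder_adjoin k⟦X⟧ Q.res Q.surjective _)
    (inclHom Q) Algebra.TensorProduct.includeRight (fun _ ↦ rfl)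
    (fun a ↦ (comul_base_tmul (1 : FractionRing k⟦X⟧) a).trans (one_smul _ _))
  exists_quot b hb := ⟨dilatation.quot b hb, algebraMap_X_mul_quot b hb⟩
  exists_lift hX h hh := exists_dilatation_lift hX h hh
  hom_ext hX f g h := dilatation_hom_ext hX h

end Dilatation

/-! ### Evaluating power series at a nilpotent element. -/

section TruncEval
variable {k : Type u} [Field k] {B E : Type*} [CommRing B] [Algebra k B] [CommRing E]
  [Algebra k⟦X⟧ E]

/-- The homomorphism `∑ bᵢ zⁱ ↦ ∑ φ(bᵢ) zⁱ` to a ring in which `z` is nilpotent. -/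
noncomputable def truncEval (n : ℕ) (hX : algebraMap k⟦X⟧ E X ^ (n + 1) = 0) (φ : B →+* E)
    (hφ : ∀ c : k, φ (algebraMap k B c) = algebraMap k⟦X⟧ E (PowerSeries.C c)) :
    B⟦X⟧ →ₐ[k⟦X⟧] E :=
  -- Polynomials that agree in degrees ≤ n have the same value, because z^(n+1) vanishes in `E`.
  -- Multiplicativity follows, as the product of two truncations agrees in these degrees with the
  -- truncation of the product.
  have hd : ∀ p q : Polynomial B, PowerSeries.trunc (n + 1) (p : B⟦X⟧) =
      PowerSeries.trunc (n + 1) (q : B⟦X⟧) →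
      p.eval₂ φ (algebraMap k⟦X⟧ E X) = q.eval₂ φ (algebraMap k⟦X⟧ E X) := by
    intro p q h
    have : Polynomial.X ^ (n + 1) ∣ p - q := by
      rw [Polynomial.X_pow_dvd_iff]
      intro d hd
      have := congrArg (fun r ↦ r.coeff d) h
      simp only [PowerSeries.coeff_trunc, if_pos hd, Polynomial.coeff_coe] at this
      rw [Polynomial.coeff_sub, this, sub_self]
    obtain ⟨r, hr⟩ := this
    rw [← sub_eq_zero, ← Polynomial.eval₂_sub, hr, Polynomial.eval₂_mul, Polynomial.eval₂_X_pow, hX,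
      zero_mul]
  { toFun := fun f ↦ (PowerSeries.trunc (n + 1) f).eval₂ φ (algebraMap k⟦X⟧ E X)
    map_one' := by simp
    map_mul' := fun f g ↦ by
      rw [← Polynomial.eval₂_mul]
      refine hd _ _ ?_
      rw [Polynomial.coe_mul, PowerSeries.trunc_trunc_mul_trunc, PowerSeries.trunc_trunc]
    map_zero' := by simp
    map_add' := fun f g ↦ by simp
    commutes' := fun f ↦ by
      change (PowerSeries.trunc (n + 1) (PowerSeries.map (algebraMap k B) f)).eval₂ φ _ = _
      -- The error of the truncation is a multiple of z^(n+1) and maps to zero in `E`, so it is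
      -- enough to check linearity on polynomials.
      have h : X ^ (n + 1) ∣ f - (PowerSeries.trunc (n + 1) f : k⟦X⟧) := by
        rw [PowerSeries.X_pow_dvd_iff]
        intro d hd
        rw [map_sub, Polynomial.coeff_coe, PowerSeries.coeff_trunc, if_pos hd, sub_self]
      obtain ⟨r, hr⟩ := h
      have h2 := congrArg (algebraMap k⟦X⟧ E) hr
      rw [map_mul, map_pow, hX, zero_mul, map_sub, sub_eq_zero] at h2
      have h3 : ∀ p : Polynomial k, p.eval₂ (φ.comp (algebraMap k B)) (algebraMap k⟦X⟧ E X) =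
          algebraMap k⟦X⟧ E (p : k⟦X⟧) := by
        intro p
        induction p using Polynomial.induction_on' with
        | add p q hp hq => rw [Polynomial.eval₂_add, hp, hq, Polynomial.coe_add, map_add]
        | monomial m a =>
          rw [Polynomial.eval₂_monomial, Polynomial.coe_monomial,
            PowerSeries.monomial_eq_C_mul_X_pow, map_mul, map_pow, RingHom.comp_apply, hφ]
      rw [h2, PowerSeries.trunc_map, Polynomial.eval₂_map, h3] }

theorem truncEval_apply (n : ℕ) (hX : algebraMap k⟦X⟧ E X ^ (n + 1) = 0) (φ : B →+* E)
    (hφ : ∀ c : k, φ (algebraMap k B c) = algebraMap k⟦X⟧ E (PowerSeries.C c)) (f : B⟦X⟧) :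
    truncEval n hX φ hφ f =
      ∑ i ∈ Finset.range (n + 1), φ (PowerSeries.coeff i f) * algebraMap k⟦X⟧ E X ^ i :=
  PowerSeries.eval₂_trunc_eq_sum_range _ _ _ _

end TruncEval

/-! ### The group `K'(B)` as the group of points `G'(B⟦z⟧)`. -/

section LoopExtension
variable {k A H : Type u} [Field k] [CommRing A] [HopfAlgebra k A] {Q : ClosedSubgroupScheme k A}
  [CommRing H] [HopfAlgebra k⟦X⟧ H] [Algebra k H] [IsScalarTower k k⟦X⟧ H] {i : A →ₐ[k] H}

theorem algebraMap_powerSeries_X (k B : Type*) [Field k] [CommRing B] [Algebra k B] :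
    algebraMap k⟦X⟧ B⟦X⟧ X = X :=
  PowerSeries.map_X _

theorem algebraMap_X_mem_nonZeroDivisors (k B : Type*) [Field k] [CommRing B] [Algebra k B] :
    algebraMap k⟦X⟧ B⟦X⟧ X ∈ nonZeroDivisors B⟦X⟧ := by
  rw [algebraMap_powerSeries_X, mem_nonZeroDivisors_iff_right]
  intro f hf
  exact PowerSeries.X_mul_injective (by simpa [mul_comm] using hf)

instance isScalarTower_powerSeries (k B : Type*) [Field k] [CommRing B] [Algebra k B] :
    IsScalarTower k k⟦X⟧ B⟦X⟧ :=
  .of_algebraMap_eq fun c ↦ by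
    rw [PowerSeries.algebraMap_apply, PowerSeries.algebraMap_apply]
    exact (PowerSeries.map_C (algebraMap k B) c).symm

variable {B : Type u} [CommRing B] [Algebra k B]

/-- A point of G factors through the closed subgroup Q as soon as it kills the functions vanishing
on Q, since `Q.res` is surjective. -/
theorem mem_loopSubgroup_iff (g : WithConv (A →ₐ[k] B⟦X⟧)) :
    g ∈ loopSubgroup Q B ↔ ∀ b, Q.res b = 0 → PowerSeries.constantCoeff (g.ofConv b) = 0 := by
  constructor
  · rintro ⟨p, hp⟩ b hb
    have h : p.ofConv (Q.res b) = PowerSeries.constantCoeff (g.ofConv b) := congr($hp b)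
    rw [← h, hb, map_zero]
  · intro h
    refine ⟨.toConv (AlgHom.liftOfSurjective (Q.res : A →ₐ[k] Q.coord) Q.surjective
      ((constCoeffAlgHom k B).comp g.ofConv) fun b hb ↦ h b hb), ?_⟩
    ext a
    exact AlgHom.liftOfSurjective_apply (Q.res : A →ₐ[k] Q.coord) Q.surjective
      ((constCoeffAlgHom k B).comp g.ofConv) (fun b hb ↦ h b hb) a

/-- A zero constant term means divisibility by z in `B⟦z⟧`, so membership in `loopSubgroup` is
precisely the hypothesis of the universal property of the dilatation. -/
theorem IsDilatation.exists_loopExtension (hi : IsDilatation Q i) (g : loopSubgroup Q B) :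
    ∃ f : H →ₐ[k⟦X⟧] B⟦X⟧, ∀ a, f (i a) = g.1.ofConv a := by
  refine hi.exists_lift (algebraMap_X_mem_nonZeroDivisors k B) _ fun b hb ↦ ?_
  rw [algebraMap_powerSeries_X, PowerSeries.X_dvd_iff]
  exact (mem_loopSubgroup_iff g.1).1 g.2 b hb

/-- The isomorphism of `K'(B)` with the group of `B⟦z⟧`-valued points of `G'`. -/
noncomputable def IsDilatation.loopExtension (hi : IsDilatation Q i) (B : Type u) [CommRing B]
    [Algebra k B] : loopSubgroup Q B →* WithConv (H →ₐ[k⟦X⟧] B⟦X⟧) :=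
  MonoidHom.mk' (fun g ↦ .toConv (hi.exists_loopExtension g).choose) fun g h ↦
    WithConv.ext (hi.hom_ext (algebraMap_X_mem_nonZeroDivisors k B) _ _ fun a ↦
      (((hi.exists_loopExtension (g * h)).choose_spec a).trans
        (hi.comul.ofConv_mul (.toConv (hi.exists_loopExtension g).choose)
          (.toConv (hi.exists_loopExtension h).choose) g.1 h.1
          (hi.exists_loopExtension g).choose_spec (hi.exists_loopExtension h).choose_spec a).symm))

theorem IsDilatation.loopExtension_apply (hi : IsDilatation Q i) (g : loopSubgroup Q B) (a : A) :
    (hi.loopExtension B g).ofConv (i a) = g.1.ofConv a :=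
  (hi.exists_loopExtension g).choose_spec a

theorem IsDilatation.eq_loopExtension (hi : IsDilatation Q i) (g : loopSubgroup Q B)
    {f : WithConv (H →ₐ[k⟦X⟧] B⟦X⟧)} (hf : ∀ a, f.ofConv (i a) = g.1.ofConv a) :
    f = hi.loopExtension B g :=
  WithConv.ext (hi.hom_ext (algebraMap_X_mem_nonZeroDivisors k B) _ _ fun a ↦
    (hf a).trans (hi.loopExtension_apply g a).symm)

theorem IsDilatation.loopExtension_injective (hi : IsDilatation Q i) :
    Function.Injective (hi.loopExtension B) := by
  intro g h hgh
  refine Subtype.ext (WithConv.ext (AlgHom.ext fun a ↦ ?_))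
  exact (hi.loopExtension_apply g a).symm.trans
    ((congrArg (fun f ↦ f.ofConv (i a)) hgh).trans (hi.loopExtension_apply h a))

/-- Every function that vanishes on Q becomes a multiple of z on `G'`, so under a point with values
in `B⟦z⟧` its constant coefficient is zero. -/
theorem IsDilatation.loopExtension_surjective (hi : IsDilatation Q i) :
    Function.Surjective (hi.loopExtension B) := by
  intro f
  have hc : ∀ c : k, algebraMap k⟦X⟧ B⟦X⟧ (algebraMap k k⟦X⟧ c) = algebraMap k B⟦X⟧ c :=
    fun c ↦ (IsScalarTower.algebraMap_apply k k⟦X⟧ B⟦X⟧ c).symm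
  refine ⟨⟨.toConv ((f.ofConv.restrictScalars k).comp i), ?_⟩, ?_⟩
  · refine (mem_loopSubgroup_iff _).2 fun b hb ↦ ?_
    obtain ⟨d, hd⟩ := hi.exists_quot b hb
    change PowerSeries.constantCoeff (f.ofConv (i b)) = 0
    rw [← hd, map_mul, AlgHom.commutes, algebraMap_powerSeries_X, map_mul,
      PowerSeries.constantCoeff_X, zero_mul]
  · exact (hi.eq_loopExtension _ fun a ↦ rfl).symm

end LoopExtension

/-! ### Functions on the thickenings and power series. -/

section GlobalSections

theorem algebraMap_globalSections {R : Type u} [CommRing R] (T : SchOver R) (r : R) :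
    algebraMap R (globalSections T) r =
      T.hom.appTop.hom ((Scheme.ΓSpecIso (CommRingCat.of R)).inv.hom r) := rfl

theorem appTop_specMap {R R' : Type u} [CommRing R] [CommRing R'] (f : R →+* R') (r : R) :
    (Spec.map (CommRingCat.ofHom f)).appTop.hom ((Scheme.ΓSpecIso (CommRingCat.of R)).inv.hom r) =
      (Scheme.ΓSpecIso (CommRingCat.of R')).inv.hom (f r) :=
  congr($(Scheme.ΓSpecIso_inv_naturality (CommRingCat.ofHom f)).hom r).symm

variable {k : Type u} [Field k] {n : ℕ} {V : SchOver k} {T : SchOver k⟦X⟧}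

theorem algebraMap_globalSections_thick (t : T ⟶ (thick k n).obj V) (f : k⟦X⟧) :
    algebraMap k⟦X⟧ (globalSections T) f = (t.left ≫ thickStr n V).appTop.hom
      ((Scheme.ΓSpecIso (CommRingCat.of _)).inv.hom
        (Ideal.Quotient.mk (Ideal.span {(X : k⟦X⟧) ^ (n + 1)}) f)) := by
  rw [algebraMap_globalSections, ← Over.w t, ← thickStr_comp, ← Category.assoc,
    Scheme.Hom.comp_appTop (t.left ≫ thickStr n V)]
  exact congrArg (t.left ≫ thickStr n V).appTop.hom (appTop_specMap _ _)

theorem algebraMap_X_pow_thick (t : T ⟶ (thick k n).obj V) :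
    algebraMap k⟦X⟧ (globalSections T) X ^ (n + 1) = 0 := by
  rw [← map_pow, algebraMap_globalSections_thick t, Ideal.Quotient.eq_zero_iff_mem.2
    (Ideal.mem_span_singleton_self _), map_zero, map_zero]
  rfl

/-- The pullback of functions along `T → S ×_k Spec k⟦z⟧/(z^(n+1)) → S`. -/
noncomputable def thickPull (t : T ⟶ (thick k n).obj V) : globalSections V →+* globalSections T :=
  (t.left ≫ thickProj n V).appTop.hom

theorem thickPull_algebraMap (t : T ⟶ (thick k n).obj V) (c : k) :
    thickPull t (algebraMap k (globalSections V) c) =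
      algebraMap k⟦X⟧ (globalSections T) (PowerSeries.C c) := by
  rw [algebraMap_globalSections_thick t, algebraMap_globalSections, thickPull]
  have h1 : (t.left ≫ thickProj n V).appTop.hom (V.hom.appTop.hom
      ((Scheme.ΓSpecIso (CommRingCat.of k)).inv.hom c)) =
      ((t.left ≫ thickProj n V) ≫ V.hom).appTop.hom
        ((Scheme.ΓSpecIso (CommRingCat.of k)).inv.hom c) := by
    rw [Scheme.Hom.comp_appTop (t.left ≫ thickProj n V)]; rfl
  refine h1.trans ?_
  rw [Category.assoc, (thick_isPullback n V).w, ← Category.assoc,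
    Scheme.Hom.comp_appTop (t.left ≫ thickStr n V)]
  exact congrArg (t.left ≫ thickStr n V).appTop.hom (appTop_specMap _ _)

/-- The homomorphism `Γ(V, O_V)⟦z⟧ → Γ(T, O_T)` that belongs to a point of a thickening of `V`. -/
noncomputable def thickEval (t : T ⟶ (thick k n).obj V) :
    (globalSections V)⟦X⟧ →ₐ[k⟦X⟧] globalSections T :=
  truncEval n (algebraMap_X_pow_thick t) (thickPull t) (thickPull_algebraMap t)

theorem thickEval_apply (t : T ⟶ (thick k n).obj V) (f : (globalSections V)⟦X⟧) :
    thickEval t f = ∑ i ∈ Finset.range (n + 1),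
      thickPull t (PowerSeries.coeff i f) * algebraMap k⟦X⟧ (globalSections T) X ^ i :=
  truncEval_apply _ _ _ _ _

theorem thickPull_comp {T' : SchOver k⟦X⟧} (φ : T' ⟶ T) (t : T ⟶ (thick k n).obj V)
    (b : globalSections V) :
    thickPull (φ ≫ t) b = ((algΓ (CommRingCat.of k⟦X⟧)).map φ).unop.hom (thickPull t b) := by
  rw [thickPull, Over.comp_left, Category.assoc, Scheme.Hom.comp_appTop]
  rfl

theorem thickPull_map {V' : SchOver k} (f : V ⟶ V') (t : T ⟶ (thick k n).obj V)
    (b : globalSections V') :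
    thickPull (t ≫ (thick k n).map f) b =
      thickPull t (((algΓ (CommRingCat.of k)).map f).unop.hom b) := by
  rw [thickPull, comp_thick_map_proj, Scheme.Hom.comp_appTop (t.left ≫ thickProj n V)]
  rfl

theorem thickPull_incl (t : T ⟶ (thick k n).obj V) (b : globalSections V) :
    thickPull (t ≫ (thickIncl k n).app V) b = thickPull t b := by
  rw [thickPull, comp_thickIncl_proj]
  rfl

theorem thickEval_comp {T' : SchOver k⟦X⟧} (φ : T' ⟶ T) (t : T ⟶ (thick k n).obj V)
    (f : (globalSections V)⟦X⟧) :
    thickEval (φ ≫ t) f = ((algΓ (CommRingCat.of k⟦X⟧)).map φ).unop.hom (thickEval t f) := by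
  simp only [thickEval_apply, map_sum, map_mul, map_pow, thickPull_comp, AlgHom.commutes]

theorem thickEval_map {V' : SchOver k} (f : V ⟶ V') (t : T ⟶ (thick k n).obj V)
    (b : (globalSections V')⟦X⟧) :
    thickEval (t ≫ (thick k n).map f) b =
      thickEval t (PowerSeries.mapAlgHom ((algΓ (CommRingCat.of k)).map f).unop.hom b) := by
  simp only [thickEval_apply, thickPull_map, PowerSeries.mapAlgHom_apply, PowerSeries.coeff_map]
  rfl

theorem thickEval_incl (t : T ⟶ (thick k n).obj V) (f : (globalSections V)⟦X⟧) :
    thickEval (t ≫ (thickIncl k n).app V) f = thickEval t f := by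
  rw [thickEval_apply, thickEval_apply, Finset.sum_range_succ, algebraMap_X_pow_thick t, mul_zero,
    add_zero]
  simp only [thickPull_incl]

/-- Divisibility by z^(n+1) is the vanishing of the coefficients of degree ≤ n, so these
coefficients are coordinates on the quotient. -/
theorem existsUnique_sum_quotient (n : ℕ) (c : k⟦X⟧ ⧸ Ideal.span {(X : k⟦X⟧) ^ (n + 1)}) :
    ∃! a : Fin (n + 1) → k, c = ∑ j, algebraMap k (k⟦X⟧ ⧸ Ideal.span {(X : k⟦X⟧) ^ (n + 1)}) (a j) *
      Ideal.Quotient.mk _ (X ^ (j : ℕ)) := by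
  have key : ∀ (f : k⟦X⟧) (a : Fin (n + 1) → k),
      Ideal.Quotient.mk (Ideal.span {(X : k⟦X⟧) ^ (n + 1)}) f = ∑ j, algebraMap k
        (k⟦X⟧ ⧸ Ideal.span {(X : k⟦X⟧) ^ (n + 1)}) (a j) * Ideal.Quotient.mk _ (X ^ (j : ℕ)) ↔
      ∀ j : Fin (n + 1), a j = PowerSeries.coeff j f := by
    intro f a
    have h1 : ∑ j, algebraMap k (k⟦X⟧ ⧸ Ideal.span {(X : k⟦X⟧) ^ (n + 1)}) (a j) *
        Ideal.Quotient.mk _ (X ^ (j : ℕ)) = Ideal.Quotient.mk _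
          (∑ j, PowerSeries.C (a j) * X ^ (j : ℕ)) := by
      rw [map_sum]
      exact Finset.sum_congr rfl fun j _ ↦ by rw [map_mul]; rfl
    rw [h1, Ideal.Quotient.eq, Ideal.mem_span_singleton, PowerSeries.X_pow_dvd_iff]
    have h2 : ∀ m : Fin (n + 1), PowerSeries.coeff (m : ℕ)
        (∑ j : Fin (n + 1), PowerSeries.C (a j) * X ^ (j : ℕ)) = a m := by
      intro m
      rw [map_sum, Finset.sum_eq_single m]
      · simp [PowerSeries.coeff_C_mul, PowerSeries.coeff_X_pow]
      · intro j _ hj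
        rw [PowerSeries.coeff_C_mul, PowerSeries.coeff_X_pow, if_neg (fun h ↦ hj (Fin.ext h.symm)),
          mul_zero]
      · simp
    constructor
    · intro h j
      have := h j j.2
      rw [map_sub, h2, sub_eq_zero] at this
      exact this.symm
    · intro h m hm
      rw [map_sub, h2 ⟨m, hm⟩, h ⟨m, hm⟩, sub_self]
  obtain ⟨f, rfl⟩ := Ideal.Quotient.mk_surjective c
  refine ⟨fun j ↦ PowerSeries.coeff j f, (key f _).2 fun j ↦ rfl, fun a ha ↦ ?_⟩
  exact funext ((key f a).1 ha)

/-- The thickening is the base change of the finite free extension k → k⟦z⟧/(z^(n+1)) with basis 1,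
z, …, z^n. Since the basis is finite, this describes the global functions for arbitrary V. -/
theorem existsUnique_sum_thick (n : ℕ) (V : SchOver k)
    (y : globalSections ((thick k n).obj V)) :
    ∃! b : Fin (n + 1) → globalSections V,
      y = ∑ j : Fin (n + 1), thickPull (𝟙 ((thick k n).obj V)) (b j) *
        algebraMap k⟦X⟧ (globalSections ((thick k n).obj V)) X ^ (j : ℕ) := by
  have h := existsUnique_sum_of_isPullback (thick_isPullback n V)
    (fun j : Fin (n + 1) ↦ (Scheme.ΓSpecIso (CommRingCat.of _)).inv.hom
      (Ideal.Quotient.mk (Ideal.span {(X : k⟦X⟧) ^ (n + 1)}) (X ^ (j : ℕ)))) ?_ y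
  · have e : ∀ b : Fin (n + 1) → globalSections V,
        ∑ j : Fin (n + 1), thickPull (𝟙 ((thick k n).obj V)) (b j) *
          algebraMap k⟦X⟧ (globalSections ((thick k n).obj V)) X ^ (j : ℕ) =
        ∑ j : Fin (n + 1), (thickProj n V).appTop.hom (b j) * (thickStr n V).appTop.hom
          ((Scheme.ΓSpecIso (CommRingCat.of _)).inv.hom
            (Ideal.Quotient.mk (Ideal.span {(X : k⟦X⟧) ^ (n + 1)}) (X ^ (j : ℕ)))) := by
      intro b
      refine Finset.sum_congr rfl fun j _ ↦ congrArg₂ (· * ·) ?_ ?_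
      · rw [thickPull, Over.id_left, Category.id_comp]
        rfl
      · rw [← map_pow, algebraMap_globalSections_thick (𝟙 ((thick k n).obj V)), Over.id_left,
          Category.id_comp]
    obtain ⟨b, hb, hu⟩ := h
    exact ⟨b, hb.trans (e b).symm, fun b' hb' ↦ hu b' (Eq.trans hb' (e b'))⟩
  · intro c
    obtain ⟨a, ha, hu⟩ := existsUnique_sum_quotient n ((Scheme.ΓSpecIso (CommRingCat.of _)).hom.hom c)
    have e0 : ∀ {R : CommRingCat.{u}} (x : Γ(Spec R, ⊤)),
        (Scheme.ΓSpecIso R).inv.hom ((Scheme.ΓSpecIso R).hom.hom x) = x := fun x ↦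
      congr($((Scheme.ΓSpecIso _).hom_inv_id).hom x)
    have e1 : ∀ {R : CommRingCat.{u}} (x : R),
        (Scheme.ΓSpecIso R).hom.hom ((Scheme.ΓSpecIso R).inv.hom x) = x := fun x ↦
      congr($((Scheme.ΓSpecIso _).inv_hom_id).hom x)
    refine ⟨fun j ↦ (Scheme.ΓSpecIso (CommRingCat.of k)).inv.hom (a j), ?_, fun a' ha' ↦ ?_⟩
    · have h := congrArg (Scheme.ΓSpecIso (CommRingCat.of _)).inv.hom ha
      rw [e0, map_sum] at h
      refine h.trans (Finset.sum_congr rfl fun j _ ↦ ?_)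
      rw [appTop_specMap]
      exact map_mul _ _ _
    · funext j
      have h := hu (fun j ↦ (Scheme.ΓSpecIso (CommRingCat.of k)).hom.hom (a' j)) ?_
      · rw [← h, e0]
      · rw [ha', map_sum]
        refine Finset.sum_congr rfl fun j _ ↦ ?_
        rw [map_mul, e1]
        congr 1
        rw [← e0 (a' j), appTop_specMap, e1]

/-- Compatible functions on the thickenings of `V` are the reductions of a unique power series. -/
theorem existsUnique_thickEval (V : SchOver k) (y : ∀ n, globalSections ((thick k n).obj V))
    (hy : ∀ n, ((algΓ (CommRingCat.of k⟦X⟧)).map ((thickIncl k n).app V)).unop.hom (y (n + 1)) =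
      y n) :
    ∃! f : (globalSections V)⟦X⟧, ∀ n, thickEval (𝟙 ((thick k n).obj V)) f = y n := by
  choose b hb hu using fun n ↦ existsUnique_sum_thick n V (y n)
  have hfin : ∀ (n : ℕ) (f : (globalSections V)⟦X⟧), thickEval (𝟙 ((thick k n).obj V)) f =
      ∑ j : Fin (n + 1), thickPull (𝟙 ((thick k n).obj V)) (PowerSeries.coeff j f) *
        algebraMap k⟦X⟧ (globalSections ((thick k n).obj V)) X ^ (j : ℕ) := by
    intro n f
    rw [thickEval_apply, Finset.sum_range]
  have hiff : ∀ (n : ℕ) (f : (globalSections V)⟦X⟧),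
      thickEval (𝟙 ((thick k n).obj V)) f = y n ↔ ∀ j : Fin (n + 1), PowerSeries.coeff j f = b n j := by
    intro n f
    rw [hfin]
    constructor
    · intro h j
      exact congrFun (hu n (fun j ↦ PowerSeries.coeff j f) h.symm) j
    · intro h
      simp only [h]
      exact (hb n).symm
  -- Restriction to the previous thickening drops the term of degree n+1 and keeps the others. To
  -- see this, `y (n + 1)` is written as the reduction of the polynomial with coefficients `b (n +
  -- 1)`.
  have hbb : ∀ (n : ℕ) (j : Fin (n + 1)), b (n + 1) j.castSucc = b n j := by
    intro n j
    refine congrFun (hu n (fun j ↦ b (n + 1) j.castSucc) ?_) j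
    have h := hy n
    have h1 : y (n + 1) = thickEval (𝟙 ((thick k (n + 1)).obj V))
        (PowerSeries.mk fun j ↦ if h : j < n + 2 then b (n + 1) ⟨j, h⟩ else 0) := by
      refine ((hiff _ _).2 fun j ↦ ?_).symm
      rw [PowerSeries.coeff_mk, dif_pos j.2]
    rw [h1, ← thickEval_comp, Category.comp_id] at h
    have h2 := thickEval_incl (𝟙 ((thick k n).obj V))
      (PowerSeries.mk fun j ↦ if h : j < n + 2 then b (n + 1) ⟨j, h⟩ else 0)
    rw [Category.id_comp] at h2
    rw [← h, h2, hfin]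
    refine Finset.sum_congr rfl fun j _ ↦ ?_
    rw [PowerSeries.coeff_mk, dif_pos (by omega)]
    rfl
  -- The coefficient of z^j is the same at all levels n ≥ j, so it may be read off at level j, where
  -- it is the last one.
  have hlast : ∀ (n : ℕ) (j : Fin (n + 1)), b n j = b j (Fin.last j) := by
    intro n
    induction n with
    | zero => intro j; obtain rfl : j = 0 := Fin.ext (by omega); rfl
    | succ n ih =>
      intro j
      induction j using Fin.lastCases with
      | last => rfl
      | cast j => rw [hbb, ih]; rfl
  refine ⟨PowerSeries.mk fun j ↦ b j (Fin.last j), fun n ↦ (hiff _ _).2 fun j ↦ ?_, fun f hf ↦ ?_⟩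
  · rw [PowerSeries.coeff_mk]
    exact (hlast n j).symm
  · ext m
    rw [PowerSeries.coeff_mk]
    exact (hiff m f).1 (hf m) (Fin.last m)

end GlobalSections

/-! ### Elements of `K'(V)` as compatible systems of points of `G'`. -/

section Reduction
variable {k A H : Type u} [Field k] [CommRing A] [HopfAlgebra k A] {Q : ClosedSubgroupScheme k A}
  [CommRing H] [HopfAlgebra k⟦X⟧ H] [Algebra k H] [IsScalarTower k k⟦X⟧ H] {i : A →ₐ[k] H}

/-- The group functor on schemes over `k⟦z⟧` that belongs to the Hopf algebra `H`. -/
noncomputable abbrev hopfGroup (H : Type u) [CommRing H] [HopfAlgebra k⟦X⟧ H] :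
    (SchOver k⟦X⟧)ᵒᵖ ⥤ GrpCat.{u} :=
  (algΓ (CommRingCat.of k⟦X⟧)).leftOp ⋙ hopfPoints k⟦X⟧ H

variable {n : ℕ} {V : SchOver k} {T : SchOver k⟦X⟧}

/-- The reduction `K'(V) → G'(T)` that belongs to a point of a thickening of `V`. -/
noncomputable def IsDilatation.red (hi : IsDilatation Q i) (t : T ⟶ (thick k n).obj V) :
    (loopGroup Q).obj (op V) →* (hopfGroup H).obj (op T) :=
  (postcompPoints H (thickEval t)).comp (hi.loopExtension (globalSections V))

theorem IsDilatation.red_apply (hi : IsDilatation Q i) (t : T ⟶ (thick k n).obj V)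
    (h : (loopGroup Q).obj (op V)) (d : H) :
    WithConv.ofConv (A := H →ₐ[k⟦X⟧] globalSections T) (hi.red t h) d =
      thickEval t ((hi.loopExtension (globalSections V) h).ofConv d) := rfl

theorem IsDilatation.red_comp (hi : IsDilatation Q i) {T' : SchOver k⟦X⟧} (φ : T' ⟶ T)
    (t : T ⟶ (thick k n).obj V) (h : (loopGroup Q).obj (op V)) :
    hi.red (φ ≫ t) h = (hopfGroup H).map φ.op (hi.red t h) :=
  WithConv.ext (AlgHom.ext fun d ↦ thickEval_comp φ t _)

/-- The homomorphism `B⟦z⟧ → B'⟦z⟧` induced by a homomorphism `B → B'`. -/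
noncomputable def mapSeries {B B' : Type*} [CommRing B] [CommRing B'] [Algebra k B] [Algebra k B']
    (φ : B →ₐ[k] B') : B⟦X⟧ →ₐ[k⟦X⟧] B'⟦X⟧ where
  toRingHom := PowerSeries.map φ.toRingHom
  commutes' f := by
    change PowerSeries.map φ.toRingHom (PowerSeries.map (algebraMap k B) f) =
      PowerSeries.map (algebraMap k B') f
    ext n
    rw [PowerSeries.coeff_map, PowerSeries.coeff_map, PowerSeries.coeff_map]
    exact φ.commutes _

theorem IsDilatation.loopExtension_map (hi : IsDilatation Q i) {V' : SchOver k} (f : V ⟶ V')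
    (h : (loopGroup Q).obj (op V')) :
    hi.loopExtension (globalSections V) ((loopGroup Q).map f.op h) =
      .toConv ((mapSeries ((algΓ (CommRingCat.of k)).map f).unop.hom).comp
        (hi.loopExtension (globalSections V') h).ofConv) :=
  (hi.eq_loopExtension _ fun a ↦ congrArg (PowerSeries.map _) (hi.loopExtension_apply _ a)).symm

theorem IsDilatation.red_map (hi : IsDilatation Q i) {V' : SchOver k} (f : V ⟶ V')
    (t : T ⟶ (thick k n).obj V) (h : (loopGroup Q).obj (op V')) :
    hi.red t ((loopGroup Q).map f.op h) = hi.red (t ≫ (thick k n).map f) h := by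
  refine WithConv.ext (AlgHom.ext fun d ↦ ?_)
  rw [hi.red_apply, hi.red_apply, hi.loopExtension_map, thickEval_map]
  rfl

theorem IsDilatation.red_incl (hi : IsDilatation Q i) (t : T ⟶ (thick k n).obj V)
    (h : (loopGroup Q).obj (op V)) :
    hi.red (t ≫ (thickIncl k n).app V) h = hi.red t h :=
  WithConv.ext (AlgHom.ext fun d ↦ thickEval_incl t _)

/-- A compatible family of points of `G'` over the thickenings of `V` is given by a unique element
of `K'(V)`. -/
theorem IsDilatation.existsUnique_red (hi : IsDilatation Q i) (V : SchOver k)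
    (g : ∀ (n : ℕ) {T : SchOver k⟦X⟧}, (T ⟶ (thick k n).obj V) → (hopfGroup H).obj (op T))
    (hg : ∀ (n : ℕ) {T T' : SchOver k⟦X⟧} (φ : T' ⟶ T) (t : T ⟶ (thick k n).obj V),
      g n (φ ≫ t) = (hopfGroup H).map φ.op (g n t))
    (hg' : ∀ (n : ℕ) {T : SchOver k⟦X⟧} (t : T ⟶ (thick k n).obj V),
      g (n + 1) (t ≫ (thickIncl k n).app V) = g n t) :
    ∃! h : (loopGroup Q).obj (op V), ∀ (n : ℕ) {T : SchOver k⟦X⟧} (t : T ⟶ (thick k n).obj V),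
      hi.red t h = g n t := by
  -- By naturality the family is determined by its values at the universal points, the identities of
  -- the thickenings.
  let y : ∀ n, H →ₐ[k⟦X⟧] globalSections ((thick k n).obj V) := fun n ↦
    WithConv.ofConv (A := H →ₐ[k⟦X⟧] globalSections ((thick k n).obj V)) (g n (𝟙 _))
  have hy : ∀ n d, ((algΓ (CommRingCat.of k⟦X⟧)).map ((thickIncl k n).app V)).unop.hom
      (y (n + 1) d) = y n d := by
    intro n d
    have h := hg (n + 1) ((thickIncl k n).app V) (𝟙 _)
    rw [Category.comp_id] at h
    have h' := hg' n (𝟙 ((thick k n).obj V))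
    rw [Category.id_comp] at h'
    have h2 := h.symm.trans h'
    exact congrArg (fun m ↦ WithConv.ofConv (A := H →ₐ[k⟦X⟧] globalSections ((thick k n).obj V)) m d) h2
  have hred : ∀ h : (loopGroup Q).obj (op V),
      (∀ (n : ℕ) {T : SchOver k⟦X⟧} (t : T ⟶ (thick k n).obj V), hi.red t h = g n t) ↔
      ∀ n d, thickEval (𝟙 ((thick k n).obj V))
        ((hi.loopExtension (globalSections V) h).ofConv d) = y n d := by
    intro h
    constructor
    · intro hh n d
      exact congrArg (fun m ↦ WithConv.ofConv
        (A := H →ₐ[k⟦X⟧] globalSections ((thick k n).obj V)) m d) (hh n (𝟙 _))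
    · intro hh n T t
      have h1 : hi.red (𝟙 ((thick k n).obj V)) h = g n (𝟙 _) :=
        WithConv.ext (AlgHom.ext (hh n))
      have h2 := hg n t (𝟙 _)
      have h3 := hi.red_comp t (𝟙 _) h
      rw [Category.comp_id] at h2 h3
      rw [h2, h3, h1]
  -- The power series are found separately for each function `d`; their uniqueness forces `f` to be
  -- a homomorphism of algebras.
  choose f hf hu using fun d ↦ existsUnique_thickEval V (fun n ↦ y n d) (fun n ↦ hy n d)
  let F : H →ₐ[k⟦X⟧] (globalSections V)⟦X⟧ :=
    { toFun := f
      map_one' := (hu 1 1 fun n ↦ by rw [map_one, map_one]).symm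
      map_mul' := fun a b ↦ (hu (a * b) _ fun n ↦ by rw [map_mul, hf a, hf b, map_mul]).symm
      map_zero' := (hu 0 0 fun n ↦ by rw [map_zero, map_zero]).symm
      map_add' := fun a b ↦ (hu (a + b) _ fun n ↦ by rw [map_add, hf a, hf b, map_add]).symm
      commutes' := fun r ↦ (hu _ _ fun n ↦ by rw [AlgHom.commutes, AlgHom.commutes]).symm }
  obtain ⟨h, hh⟩ := hi.loopExtension_surjective (B := globalSections V) (.toConv F)
  refine ⟨h, (hred h).2 fun n d ↦ ?_, fun h' hh' ↦ hi.loopExtension_injective ?_⟩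
  · rw [hh]
    exact hf d n
  · refine Eq.trans ?_ hh.symm
    exact WithConv.ext (AlgHom.ext fun d ↦ hu d _ fun n ↦ (hred h').1 hh' n d)

/-- The extension of a loop to the dilatation is unique, so any admissible `h'` is the chosen
extension, and the finite sum is its evaluation by `thickEval`. -/
theorem IsDilatation.eq_red_iff (hi : IsDilatation Q i) (h : (loopGroup Q).obj (op V))
    (t : T ⟶ (thick k n).obj V) (g : (hopfGroup H).obj (op T)) :
    (∃ h' : H →ₐ[k⟦X⟧] (globalSections V)⟦X⟧, (∀ a : A, h' (i a) = loopPoint h a) ∧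
      ∀ d : H, WithConv.ofConv (A := H →ₐ[k⟦X⟧] globalSections T) g d =
        ∑ i ∈ Finset.range (n + 1),
          (show globalSections T from
            (t.left ≫ thickProj n V).appTop.hom (PowerSeries.coeff i (h' d))) *
          algebraMap k⟦X⟧ (globalSections T) X ^ i) ↔ g = hi.red t h := by
  constructor
  · rintro ⟨h', h1, h2⟩
    refine WithConv.ext (AlgHom.ext fun d ↦ ?_)
    refine (h2 d).trans ?_
    have h3 : (WithConv.toConv h') = hi.loopExtension (globalSections V) h :=
      hi.eq_loopExtension _ h1
    rw [hi.red_apply, ← h3, thickEval_apply]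
    rfl
  · rintro rfl
    exact ⟨(hi.loopExtension (globalSections V) h).ofConv,
      hi.loopExtension_apply h, fun d ↦ thickEval_apply t _⟩

end Reduction

section
variable {k A : Type u} [Field k] [CommRing A] [HopfAlgebra k A] {Q : ClosedSubgroupScheme k A}
  {n : ℕ} {V : SchOver k} {T : SchOver k⟦X⟧}

/-- The reduction `K'(V) → G'(T)` that belongs to a point of a thickening of `V`. -/
noncomputable def reduction (Q : ClosedSubgroupScheme k A) (n : ℕ) {V : SchOver k} {T : SchOver k⟦X⟧}
    (t : T ⟶ (thick k n).obj V) :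
    (loopGroup Q).obj (op V) →* (hopfGroup (dilatation Q)).obj (op T) :=
  (isDilatation_inclHom (Q := Q)).red (H := dilatation Q) t

theorem isReduction_iff (h : (loopGroup Q).obj (op V)) (t : T ⟶ (thick k n).obj V)
    (g : (modelGroup Q).obj (op T)) : IsReduction h n t g ↔ g = reduction Q n t h :=
  (isDilatation_inclHom (Q := Q)).eq_red_iff (H := dilatation Q) h t g
end

/-! ### Abstract thickenings and the differences of trivializations. -/

/-- Group functors `H` on `C` and `Γ` on `D` such that the elements of `H(V)` are the compatible
systems of points of `Γ` over the thickenings `Th n V`. -/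
structure FormalSetting {C : Type (u + 1)} [Category.{u} C] {D : Type (u + 1)} [Category.{u} D]
    (Th : ℕ → C ⥤ D) (incl : ∀ n, Th n ⟶ Th (n + 1)) (Γ : Dᵒᵖ ⥤ GrpCat.{u})
    (H : Cᵒᵖ ⥤ GrpCat.{u}) (JC : GrothendieckTopology C) (JD : GrothendieckTopology D) where
  red : ∀ (n : ℕ) {V : C} {T : D}, (T ⟶ (Th n).obj V) → (H.obj (op V) →* Γ.obj (op T))
  red_comp : ∀ (n : ℕ) {V : C} {T T' : D} (φ : T' ⟶ T) (t : T ⟶ (Th n).obj V) (h : H.obj (op V)),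
    red n (φ ≫ t) h = Γ.map φ.op (red n t h)
  red_map : ∀ (n : ℕ) {V V' : C} {T : D} (f : V ⟶ V') (t : T ⟶ (Th n).obj V) (h : H.obj (op V')),
    red n t (H.map f.op h) = red n (t ≫ (Th n).map f) h
  red_incl : ∀ (n : ℕ) {V : C} {T : D} (t : T ⟶ (Th n).obj V) (h : H.obj (op V)),
    red (n + 1) (t ≫ (incl n).app V) h = red n t h
  existsUnique_red : ∀ (V : C) (g : ∀ (n : ℕ) {T : D}, (T ⟶ (Th n).obj V) → Γ.obj (op T)),
    (∀ (n : ℕ) {T T' : D} (φ : T' ⟶ T) (t : T ⟶ (Th n).obj V),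
      g n (φ ≫ t) = Γ.map φ.op (g n t)) →
    (∀ (n : ℕ) {T : D} (t : T ⟶ (Th n).obj V), g (n + 1) (t ≫ (incl n).app V) = g n t) →
    ∃! h : H.obj (op V), ∀ (n : ℕ) {T : D} (t : T ⟶ (Th n).obj V), red n t h = g n t
  exists_unit : ∀ (n : ℕ) {V : C} {T : D} (t : T ⟶ (Th n).obj V),
    ∃ (T₀ : C) (η : T ⟶ (Th n).obj T₀), ∀ (S : C) (s : T ⟶ (Th n).obj S),
      ∃! f : T₀ ⟶ S, η ≫ (Th n).map f = s
  isPullback_incl : ∀ (n : ℕ) {U V : C} (f : U ⟶ V),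
    IsPullback ((incl n).app U) ((Th n).map f) ((Th (n + 1)).map f) ((incl n).app V)
  covering : ∀ (n : ℕ) {V : C} {Sv : Sieve V}, Sv ∈ JC V → ∀ {T : D} (t : T ⟶ (Th n).obj V)
    {R : Sieve T}, (∀ {T' : D} (φ : T' ⟶ T) {V' : C} (f : V' ⟶ V), Sv f →
      ∀ u : T' ⟶ (Th n).obj V', u ≫ (Th n).map f = φ ≫ t → R φ) → R ∈ JD T
  isSheaf_group : Presieve.IsSheaf JD (Γ ⋙ forget GrpCat.{u})
  isSheaf_yoneda : ∀ Z : D, Presieve.IsSheaf JD (yoneda.obj Z)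

section
variable {C : Type (u + 1)} [Category.{u} C] {D : Type (u + 1)} [Category.{u} D]
  {Th : ℕ → C ⥤ D} {incl : ∀ n, Th n ⟶ Th (n + 1)} {Γ : Dᵒᵖ ⥤ GrpCat.{u}}
  {H : Cᵒᵖ ⥤ GrpCat.{u}} {JC : GrothendieckTopology C} {JD : GrothendieckTopology D}

theorem grp_map_comp {E : Type*} [Category E] (G : Eᵒᵖ ⥤ GrpCat.{u}) {T T' T'' : E} (a : T'' ⟶ T')
    (b : T' ⟶ T) (x : G.obj (op T)) : G.map (a ≫ b).op x = G.map a.op (G.map b.op x) := by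
  rw [op_comp, G.map_comp]; rfl

theorem grp_map_id {E : Type*} [Category E] (G : Eᵒᵖ ⥤ GrpCat.{u}) {T : E} (x : G.obj (op T)) :
    G.map (𝟙 T).op x = x := by
  rw [op_id, G.map_id]; rfl

namespace FormalSetting
theorem glue_group (F : FormalSetting Th incl Γ H JC JD) {T : D} {R : Sieve T} (hR : R ∈ JD T)
    (s : ∀ {T' : D} (φ : T' ⟶ T), R φ → Γ.obj (op T'))
    (hs : ∀ {T' T'' : D} (ψ : T'' ⟶ T') (φ : T' ⟶ T) (h : R φ),
      s (ψ ≫ φ) (R.downward_closed h ψ) = Γ.map ψ.op (s φ h)) :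
    ∃! x : Γ.obj (op T), ∀ {T' : D} (φ : T' ⟶ T) (h : R φ), Γ.map φ.op x = s φ h :=
  existsUnique_glue F.isSheaf_group hR s hs

theorem group_ext (F : FormalSetting Th incl Γ H JC JD)
    {T : D} {R : Sieve T} (hR : R ∈ JD T) {x y : Γ.obj (op T)}
    (h : ∀ {T' : D} (φ : T' ⟶ T), R φ → Γ.map φ.op x = Γ.map φ.op y) : x = y :=
  sheaf_ext F.isSheaf_group hR h

theorem glue_hom (F : FormalSetting Th incl Γ H JC JD) {T Z : D} {R : Sieve T} (hR : R ∈ JD T)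
    (s : ∀ {T' : D} (φ : T' ⟶ T), R φ → (T' ⟶ Z))
    (hs : ∀ {T' T'' : D} (ψ : T'' ⟶ T') (φ : T' ⟶ T) (h : R φ),
      s (ψ ≫ φ) (R.downward_closed h ψ) = ψ ≫ s φ h) :
    ∃! x : T ⟶ Z, ∀ {T' : D} (φ : T' ⟶ T) (h : R φ), φ ≫ x = s φ h :=
  existsUnique_glue (F.isSheaf_yoneda Z) hR s hs

theorem hom_ext (F : FormalSetting Th incl Γ H JC JD)
    {T Z : D} {R : Sieve T} (hR : R ∈ JD T) {x y : T ⟶ Z}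
    (h : ∀ {T' : D} (φ : T' ⟶ T), R φ → φ ≫ x = φ ≫ y) : x = y :=
  sheaf_ext (F.isSheaf_yoneda Z) hR h

/-- The thickenings preserve fibre products, as far as points are concerned. -/
theorem exists_lift_pullback (F : FormalSetting Th incl Γ H JC JD)
    {n : ℕ} {U V W S : C} {p : W ⟶ U} {q : W ⟶ V} {f : U ⟶ S} {g : V ⟶ S}
    (hW : IsPullback p q f g) {T : D} (u : T ⟶ (Th n).obj U) (v : T ⟶ (Th n).obj V)
    (h : u ≫ (Th n).map f = v ≫ (Th n).map g) :
    ∃ w : T ⟶ (Th n).obj W, w ≫ (Th n).map p = u ∧ w ≫ (Th n).map q = v := by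
  obtain ⟨T₀, η, hη⟩ := F.exists_unit n u
  obtain ⟨u₀, hu₀, -⟩ := hη _ u
  obtain ⟨v₀, hv₀, -⟩ := hη _ v
  -- The uniqueness of the factorization through `η` turns an equality of points of thickenings into
  -- an equality of morphisms in `C`, where the fibre product is available.
  have h₀ : u₀ ≫ f = v₀ ≫ g := (hη S (u ≫ (Th n).map f)).unique
    (by rw [Functor.map_comp, reassoc_of% hu₀]) (by rw [Functor.map_comp, reassoc_of% hv₀, h])
  refine ⟨η ≫ (Th n).map (hW.lift u₀ v₀ h₀), ?_, ?_⟩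
  · rw [Category.assoc, ← Functor.map_comp, hW.lift_fst, hu₀]
  · rw [Category.assoc, ← Functor.map_comp, hW.lift_snd, hv₀]

theorem hom_ext_pullback (F : FormalSetting Th incl Γ H JC JD)
    {n : ℕ} {U V W S : C} {p : W ⟶ U} {q : W ⟶ V} {f : U ⟶ S} {g : V ⟶ S}
    (hW : IsPullback p q f g) {T : D} {w w' : T ⟶ (Th n).obj W}
    (hp : w ≫ (Th n).map p = w' ≫ (Th n).map p) (hq : w ≫ (Th n).map q = w' ≫ (Th n).map q) :
    w = w' := by
  obtain ⟨T₀, η, hη⟩ := F.exists_unit n w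
  obtain ⟨w₀, rfl, -⟩ := hη _ w
  obtain ⟨w₁, rfl, -⟩ := hη _ w'
  congr 2
  refine hW.hom_ext ((hη _ (η ≫ (Th n).map (w₀ ≫ p))).unique rfl ?_)
    ((hη _ (η ≫ (Th n).map (w₀ ≫ q))).unique rfl ?_)
  · simpa only [Functor.map_comp, Category.assoc] using hp.symm
  · simpa only [Functor.map_comp, Category.assoc] using hq.symm

/-- The sieve on `T` given by a covering `U` of `S` and a point of a thickening of `S`. -/
theorem covers_mem (F : FormalSetting Th incl Γ H JC JD)
    {S : C} {I : Type u} {U : I → Over S} (hU : Covers JC U) {n : ℕ} {T : D}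
    (t : T ⟶ (Th n).obj S) {R : Sieve T}
    (hR : ∀ {T' : D} (φ : T' ⟶ T) (i : I) (u : T' ⟶ (Th n).obj (U i).left),
      u ≫ (Th n).map (U i).hom = φ ≫ t → R φ) : R ∈ JD T := by
  refine F.covering n hU t ?_
  rintro T' φ V' f ⟨_, a, _, ⟨i⟩, rfl⟩ u hu
  refine hR φ i (u ≫ (Th n).map a) ?_
  rw [Category.assoc, ← Functor.map_comp, hu]

end FormalSetting

namespace AdicSpace.Trivialization
variable {S U V : C} {Y : AdicSpace Th incl Γ S} {f : U ⟶ S} (α : Y.Trivialization f)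

theorem congr {n : ℕ} {T : D} {u u' : T ⟶ (Th n).obj U} {x x' : T ⟶ Y.X n} (hu : u = u')
    (hx : x = x') (h : x ≫ Y.π n = u ≫ (Th n).map f) (h' : x' ≫ Y.π n = u' ≫ (Th n).map f) :
    α.toFun n u x h = α.toFun n u' x' h' := by
  subst hu hx; rfl

theorem ext_point {n : ℕ} {T : D} {u : T ⟶ (Th n).obj U} {x x' : T ⟶ Y.X n}
    (h : x ≫ Y.π n = u ≫ (Th n).map f) (h' : x' ≫ Y.π n = u ≫ (Th n).map f)
    (e : α.toFun n u x h = α.toFun n u x' h') : x = x' :=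
  (α.bijective n u (α.toFun n u x' h')).unique ⟨h, e⟩ ⟨_, rfl⟩

/-- The point of `X n` over `u` with a given coordinate. -/
noncomputable def pt {n : ℕ} {T : D} (u : T ⟶ (Th n).obj U) (g : Γ.obj (op T)) : T ⟶ Y.X n :=
  (α.bijective n u g).choose

theorem pt_π {n : ℕ} {T : D} (u : T ⟶ (Th n).obj U) (g : Γ.obj (op T)) :
    α.pt u g ≫ Y.π n = u ≫ (Th n).map f :=
  (α.bijective n u g).choose_spec.1.choose

theorem toFun_pt {n : ℕ} {T : D} (u : T ⟶ (Th n).obj U) (g : Γ.obj (op T))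
    (h : α.pt u g ≫ Y.π n = u ≫ (Th n).map f) : α.toFun n u (α.pt u g) h = g :=
  (α.bijective n u g).choose_spec.1.choose_spec

theorem eq_pt {n : ℕ} {T : D} {u : T ⟶ (Th n).obj U} {g : Γ.obj (op T)} {x : T ⟶ Y.X n}
    (h : x ≫ Y.π n = u ≫ (Th n).map f) (hx : α.toFun n u x h = g) : x = α.pt u g :=
  α.ext_point h (α.pt_π u g) (hx.trans (α.toFun_pt u g _).symm)

theorem comp_pt {n : ℕ} {T T' : D} (φ : T' ⟶ T) (u : T ⟶ (Th n).obj U) (g : Γ.obj (op T)) :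
    φ ≫ α.pt u g = α.pt (φ ≫ u) (Γ.map φ.op g) :=
  have h : (φ ≫ α.pt u g) ≫ Y.π n = (φ ≫ u) ≫ (Th n).map f := by
    rw [Category.assoc, α.pt_π, Category.assoc]
  α.eq_pt h (by rw [α.natural n φ u _ (α.pt_π u g), α.toFun_pt])

theorem pt_incl {n : ℕ} {T : D} (u : T ⟶ (Th n).obj U) (g : Γ.obj (op T)) :
    α.pt u g ≫ Y.ι n = α.pt (u ≫ (incl n).app U) g :=
  have h : (α.pt u g ≫ Y.ι n) ≫ Y.π (n + 1) = (u ≫ (incl n).app U) ≫ (Th (n + 1)).map f := by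
    rw [Category.assoc, (Y.isPullback n).w, ← Category.assoc, α.pt_π, Category.assoc, Category.assoc,
      (incl n).naturality]
  α.eq_pt h (by rw [α.compatible n u _ (α.pt_π u g), α.toFun_pt])

theorem act_pt {n : ℕ} {T : D} (u : T ⟶ (Th n).obj U) (g h : Γ.obj (op T)) :
    Y.act n (α.pt u g) h = α.pt u (g * h) :=
  have h' : Y.act n (α.pt u g) h ≫ Y.π n = u ≫ (Th n).map f := by rw [Y.act_π, α.pt_π]
  α.eq_pt h' (by rw [α.equivariant n u _ h (α.pt_π u g), α.toFun_pt])

/-- The restriction of a trivialization along a morphism `a : V → U`. -/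
def restrict (a : V ⟶ U) {f' : V ⟶ S} (ha : a ≫ f = f') : Y.Trivialization f' where
  toFun n {T} v x hx := α.toFun n (v ≫ (Th n).map a) x (by
    rw [hx, ← ha, Functor.map_comp, Category.assoc])
  bijective n T v g := by
    obtain ⟨x, ⟨hx, hx'⟩, hu⟩ := α.bijective n (v ≫ (Th n).map a) g
    refine ⟨x, ⟨?_, hx'⟩, fun y ⟨hy, hy'⟩ ↦ hu y ⟨_, hy'⟩⟩
    rw [hx, ← ha, Functor.map_comp, Category.assoc]
  natural n T T' φ v x hx hx' := by
    refine Eq.trans (α.congr (Category.assoc _ _ _) rfl _ ?_) (α.natural n φ _ x _ ?_)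
    all_goals rw [Category.assoc, hx, ← ha, Functor.map_comp]; simp only [Category.assoc]
  equivariant n T v x g hx hx' := α.equivariant n _ x g _ _
  compatible n T v x hx hx' := by
    have h : (x ≫ Y.ι n) ≫ Y.π (n + 1) =
        ((v ≫ (Th n).map a) ≫ (incl n).app U) ≫ (Th (n + 1)).map f := by
      rw [hx', ← ha, Functor.map_comp]
      simp only [Category.assoc, NatTrans.naturality_assoc]
    refine Eq.trans (α.congr ?_ rfl _ h) (α.compatible n _ x _ _)
    rw [Category.assoc, Category.assoc, (incl n).naturality]

/-- Two trivializations over `f` differ by the left multiplication by an element of `H`. -/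
theorem existsUnique_transition (F : FormalSetting Th incl Γ H JC JD) (α β : Y.Trivialization f) :
    ∃! h : H.obj (op U), ∀ (n : ℕ) {T : D} (u : T ⟶ (Th n).obj U) (x : T ⟶ Y.X n)
      (hx : x ≫ Y.π n = u ≫ (Th n).map f), β.toFun n u x hx = F.red n u h * α.toFun n u x hx := by
  -- The transition element is the system of `β`-coordinates of the unit section of `α`.
  obtain ⟨h, hh, hu⟩ := F.existsUnique_red U
    (fun n T u ↦ β.toFun n u (α.pt u 1) (α.pt_π u 1))
    (fun n T T' φ u ↦ by
      have h' : (φ ≫ α.pt u 1) ≫ Y.π n = (φ ≫ u) ≫ (Th n).map f := by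
        rw [Category.assoc, α.pt_π, Category.assoc]
      rw [← β.natural n φ u _ (α.pt_π u 1) h']
      exact β.congr rfl (by rw [α.comp_pt, map_one]) _ _)
    (fun n T u ↦ by
      have h' : (α.pt u 1 ≫ Y.ι n) ≫ Y.π (n + 1) = (u ≫ (incl n).app U) ≫ (Th (n + 1)).map f := by
        rw [α.pt_incl, α.pt_π]
      rw [← β.compatible n u _ (α.pt_π u 1) h']
      exact β.congr rfl (α.pt_incl u 1).symm _ _)
  refine ⟨h, fun n T u x hx ↦ ?_, fun h' hh' ↦ hu _ fun n T u ↦ ?_⟩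
  · have e : x = Y.act n (α.pt u 1) (α.toFun n u x hx) := by
      rw [α.act_pt, one_mul]
      exact α.eq_pt hx rfl
    have h₁ : Y.act n (α.pt u 1) (α.toFun n u x hx) ≫ Y.π n = u ≫ (Th n).map f := by
      rw [← e, hx]
    have h₂ := β.equivariant n u (α.pt u 1) (α.toFun n u x hx) (α.pt_π u 1) h₁
    rw [hh n u]
    exact (β.congr rfl e _ _).trans h₂
  · have := hh' n u (α.pt u 1) (α.pt_π u 1)
    rw [α.toFun_pt, mul_one] at this
    exact this.symm

/-- The element of `H` by which two trivializations differ. -/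
noncomputable def transition (F : FormalSetting Th incl Γ H JC JD) (α β : Y.Trivialization f) :
    H.obj (op U) := (existsUnique_transition F α β).choose

theorem transition_spec (F : FormalSetting Th incl Γ H JC JD) (α β : Y.Trivialization f) {n : ℕ}
    {T : D} (u : T ⟶ (Th n).obj U) (x : T ⟶ Y.X n) (hx : x ≫ Y.π n = u ≫ (Th n).map f) :
    β.toFun n u x hx = F.red n u (transition F α β) * α.toFun n u x hx :=
  (existsUnique_transition F α β).choose_spec.1 n u x hx

theorem eq_transition (F : FormalSetting Th incl Γ H JC JD) (α β : Y.Trivialization f)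
    {h : H.obj (op U)} (hh : ∀ (n : ℕ) {T : D} (u : T ⟶ (Th n).obj U) (x : T ⟶ Y.X n)
      (hx : x ≫ Y.π n = u ≫ (Th n).map f), β.toFun n u x hx = F.red n u h * α.toFun n u x hx) :
    h = transition F α β :=
  (existsUnique_transition F α β).choose_spec.2 h hh

theorem transition_mul (F : FormalSetting Th incl Γ H JC JD) (α β δ : Y.Trivialization f) :
    transition F β δ * transition F α β = transition F α δ :=
  eq_transition F _ _ fun n T u x hx ↦ by
    rw [transition_spec F β δ, transition_spec F α β, map_mul, mul_assoc]

theorem transition_restrict (F : FormalSetting Th incl Γ H JC JD) (α β : Y.Trivialization f)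
    (a : V ⟶ U) {f' : V ⟶ S} (ha : a ≫ f = f') :
    H.map a.op (transition F α β) = transition F (α.restrict a ha) (β.restrict a ha) :=
  eq_transition F _ _ fun n T u x hx ↦ by
    rw [F.red_map]
    exact transition_spec F α β _ x _

/-- The trivialization `h α` for an element `h` of `H`. -/
def twist (F : FormalSetting Th incl Γ H JC JD) (h : H.obj (op U)) : Y.Trivialization f where
  toFun n {T} u x hx := F.red n u h * α.toFun n u x hx
  bijective n T u g := by
    obtain ⟨x, ⟨hx, hx'⟩, hu⟩ := α.bijective n u ((F.red n u h)⁻¹ * g)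
    refine ⟨x, ⟨hx, by rw [hx', mul_inv_cancel_left]⟩, fun y ⟨hy, hy'⟩ ↦ hu y ⟨hy, ?_⟩⟩
    rw [← hy', inv_mul_cancel_left]
  natural n T T' φ u x hx hx' := by rw [α.natural n φ u x hx, F.red_comp, map_mul]
  equivariant n T u x g hx hx' := by rw [α.equivariant n u x g hx, mul_assoc]
  compatible n T u x hx hx' := by rw [α.compatible n u x hx, F.red_incl]

end AdicSpace.Trivialization

end

/-! ### Transition cocycles and the families of coordinates that they glue. -/

section
variable {C : Type (u + 1)} [Category.{u} C] {D : Type (u + 1)} [Category.{u} D]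
  {Th : ℕ → C ⥤ D} {incl : ∀ n, Th n ⟶ Th (n + 1)} {Γ : Dᵒᵖ ⥤ GrpCat.{u}}
  {H : Cᵒᵖ ⥤ GrpCat.{u}} {JC : GrothendieckTopology C} {JD : GrothendieckTopology D}
  {S : C} {I : Type u} {U : I → Over S}

/-- The sieve of the morphisms to `T` that lift `t : T → Th n S` to a member of the family `U`. -/
def coverSieve (U : I → Over S) {n : ℕ} {T : D} (t : T ⟶ (Th n).obj S) : Sieve T where
  arrows T' φ := ∃ (i : I) (u : T' ⟶ (Th n).obj (U i).left), u ≫ (Th n).map (U i).hom = φ ≫ t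
  downward_closed := by
    rintro Y Z f ⟨i, u, hu⟩ g
    exact ⟨i, g ≫ u, by rw [Category.assoc, hu, Category.assoc]⟩

theorem FormalSetting.coverSieve_mem (F : FormalSetting Th incl Γ H JC JD) (hU : Covers JC U)
    {n : ℕ} {T : D} (t : T ⟶ (Th n).obj S) : coverSieve U t ∈ JD T :=
  F.covers_mem hU t fun φ i u hu ↦ ⟨i, u, hu⟩

theorem FormalSetting.exists_overlap [HasPullbacks C] (F : FormalSetting Th incl Γ H JC JD)
    {U V : Over S} {n : ℕ} {T : D} (u : T ⟶ (Th n).obj U.left) (v : T ⟶ (Th n).obj V.left)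
    (h : u ≫ (Th n).map U.hom = v ≫ (Th n).map V.hom) :
    ∃ (W : Over S) (a : W ⟶ U) (b : W ⟶ V) (w : T ⟶ (Th n).obj W.left),
      w ≫ (Th n).map a.left = u ∧ w ≫ (Th n).map b.left = v := by
  obtain ⟨w, hwu, hwv⟩ := F.exists_lift_pullback (IsPullback.of_hasPullback U.hom V.hom) u v h
  exact ⟨Over.mk (pullback.fst U.hom V.hom ≫ U.hom), Over.homMk (pullback.fst U.hom V.hom) rfl,
    Over.homMk (pullback.snd U.hom V.hom) pullback.condition.symm, w, hwu, hwv⟩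

/-- `γ` is the cocycle of the transition maps of the trivializations `α`. -/
def FormalSetting.IsTransition (F : FormalSetting Th incl Γ H JC JD) {Y : AdicSpace Th incl Γ S}
    (α : ∀ i, Y.Trivialization (U i).hom)
    (γ : PresheafOfGroups.OneCocycle (restrictOver H S) U) : Prop :=
  ∀ (i j : I) (V : Over S) (a : V ⟶ U i) (b : V ⟶ U j) (n : ℕ) (T : D)
    (w : T ⟶ (Th n).obj V.left) (x : T ⟶ Y.X n)
    (hi : x ≫ Y.π n = (w ≫ (Th n).map a.left) ≫ (Th n).map (U i).hom)
    (hj : x ≫ Y.π n = (w ≫ (Th n).map b.left) ≫ (Th n).map (U j).hom),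
    (α i).toFun n (w ≫ (Th n).map a.left) x hi =
      F.red n (V := V.left) w (γ.ev i j a b) * (α j).toFun n (w ≫ (Th n).map b.left) x hj

/-- Over a common `V` the cocycle value is the element by which the two restricted trivializations
differ. Its uniqueness gives both naturality and the cocycle identity. -/
theorem FormalSetting.exists_isTransition (F : FormalSetting Th incl Γ H JC JD)
    {Y : AdicSpace Th incl Γ S} (α : ∀ i, Y.Trivialization (U i).hom) :
    ∃ γ : PresheafOfGroups.OneCocycle (restrictOver H S) U, F.IsTransition α γ := by
  let ev : ∀ (i j : I) (V : Over S) (a : V ⟶ U i) (b : V ⟶ U j), H.obj (op V.left) :=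
    fun i j V a b ↦ AdicSpace.Trivialization.transition F
      ((α j).restrict b.left (Over.w b)) ((α i).restrict a.left (Over.w a))
  refine ⟨{ ev := fun i j V a b ↦ ev i j V a b
            ev_precomp := fun i j V V' φ a b ↦ ?_
            ev_trans := fun i j l V a b c ↦ ?_ }, fun i j V a b n T w x hi hj ↦ ?_⟩
  · refine (AdicSpace.Trivialization.transition_restrict F ((α j).restrict b.left (Over.w b))
      ((α i).restrict a.left (Over.w a)) φ.left (Over.w φ)).trans ?_
    refine AdicSpace.Trivialization.eq_transition F _ _ fun n T u x hx ↦ ?_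
    have h := AdicSpace.Trivialization.transition_spec F
      (((α j).restrict b.left (Over.w b)).restrict φ.left (Over.w φ))
      (((α i).restrict a.left (Over.w a)).restrict φ.left (Over.w φ)) u x hx
    refine Eq.trans ((α i).congr ?_ rfl _ _) (h.trans (congrArg _ ((α j).congr ?_ rfl _ _)))
    · rw [Over.comp_left, Functor.map_comp, Category.assoc]
    · rw [Over.comp_left, Functor.map_comp, Category.assoc]
  · exact AdicSpace.Trivialization.transition_mul F _ _ _
  · exact AdicSpace.Trivialization.transition_spec F ((α j).restrict b.left (Over.w b))
      ((α i).restrict a.left (Over.w a)) w x (by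
        rw [hi, Category.assoc, ← Functor.map_comp, Over.w a])

variable (F : FormalSetting Th incl Γ H JC JD)
  (γ : PresheafOfGroups.OneCocycle (restrictOver H S) U)

/-- The points with values in `T` of the `n`-th reduction of the formal torsor with cocycle `γ`: a
point `t` of the thickening of `S`, and coordinates over the members of the covering `U` that are
related by `γ`. -/
structure Fam (n : ℕ) (T : D) where
  t : T ⟶ (Th n).obj S
  s : ∀ (i : I) {T' : D} (φ : T' ⟶ T) (u : T' ⟶ (Th n).obj (U i).left),
    u ≫ (Th n).map (U i).hom = φ ≫ t → Γ.obj (op T')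
  natural : ∀ (i : I) {T' T'' : D} (ψ : T'' ⟶ T') (φ : T' ⟶ T) (u : T' ⟶ (Th n).obj (U i).left)
    (h : u ≫ (Th n).map (U i).hom = φ ≫ t) (h' : (ψ ≫ u) ≫ (Th n).map (U i).hom = (ψ ≫ φ) ≫ t),
    s i (ψ ≫ φ) (ψ ≫ u) h' = Γ.map ψ.op (s i φ u h)
  cocycle : ∀ (i j : I) (V : Over S) (a : V ⟶ U i) (b : V ⟶ U j) {T' : D} (φ : T' ⟶ T)
    (w : T' ⟶ (Th n).obj V.left) (hi : (w ≫ (Th n).map a.left) ≫ (Th n).map (U i).hom = φ ≫ t)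
    (hj : (w ≫ (Th n).map b.left) ≫ (Th n).map (U j).hom = φ ≫ t),
    s i φ (w ≫ (Th n).map a.left) hi =
      F.red n (V := V.left) w (γ.ev i j a b) * s j φ (w ≫ (Th n).map b.left) hj

namespace Fam
variable {F γ} {n : ℕ} {T T₁ : D}

theorem ext_s {f f' : Fam F γ n T} (ht : f.t = f'.t)
    (hs : ∀ (i : I) {T' : D} (φ : T' ⟶ T) (u : T' ⟶ (Th n).obj (U i).left)
      (h : u ≫ (Th n).map (U i).hom = φ ≫ f.t) (h' : u ≫ (Th n).map (U i).hom = φ ≫ f'.t),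
      f.s i φ u h = f'.s i φ u h') : f = f' := by
  cases f; cases f'
  cases ht
  congr
  funext i T' φ u h
  exact hs i φ u h h

theorem congr_s {f f' : Fam F γ n T} (hf : f = f') (i : I) {T' : D} {φ φ' : T' ⟶ T} (hφ : φ = φ')
    {u u' : T' ⟶ (Th n).obj (U i).left} (hu : u = u')
    (h : u ≫ (Th n).map (U i).hom = φ ≫ f.t) (h' : u' ≫ (Th n).map (U i).hom = φ' ≫ f'.t) :
    f.s i φ u h = f'.s i φ' u' h' := by
  subst hf hφ hu; rfl

/-- The restriction of a point along `ψ : T₁ → T`. -/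
def map (ψ : T₁ ⟶ T) (f : Fam F γ n T) : Fam F γ n T₁ where
  t := ψ ≫ f.t
  s i T' φ u h := f.s i (φ ≫ ψ) u (by rw [h, Category.assoc])
  natural i T' T'' χ φ u h h' := by
    have e : (χ ≫ u) ≫ (Th n).map (U i).hom = (χ ≫ φ ≫ ψ) ≫ f.t := by
      rw [h']; simp only [Category.assoc]
    exact (congr_s rfl i (Category.assoc _ _ _) rfl _ e).trans (f.natural i χ (φ ≫ ψ) u _ e)
  cocycle i j V a b T' φ w hi hj := f.cocycle i j V a b (φ ≫ ψ) w _ _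

variable (F γ n) in
/-- The presheaf of points of the torsor with cocycle `γ`. -/
def functor : Dᵒᵖ ⥤ Type (u + 1) where
  obj T := Fam F γ n T.unop
  map ψ := ↾fun f ↦ map ψ.unop f
  map_id T := by
    ext f
    exact ext_s (Category.id_comp _) fun i T' φ u h h' ↦ congr_s rfl i (Category.comp_id _) rfl _ _
  map_comp ψ χ := by
    ext f
    exact ext_s (Category.assoc _ _ _) fun i T' φ u h h' ↦
      congr_s rfl i (Category.assoc _ _ _).symm rfl _ _

/-- The right action of the group functor. -/
def act (f : Fam F γ n T) (g : Γ.obj (op T)) : Fam F γ n T where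
  t := f.t
  s i T' φ u h := f.s i φ u h * Γ.map φ.op g
  natural i T' T'' ψ φ u h h' := by rw [f.natural i ψ φ u h h', map_mul, grp_map_comp]
  cocycle i j V a b T' φ w hi hj := by rw [f.cocycle i j V a b φ w hi hj, mul_assoc]

theorem act_one (f : Fam F γ n T) : f.act 1 = f :=
  ext_s rfl fun i T' φ u h h' ↦ by simp [act]

theorem act_mul (f : Fam F γ n T) (g h : Γ.obj (op T)) : f.act (g * h) = (f.act g).act h :=
  ext_s rfl fun i T' φ u h h' ↦ by simp [act, mul_assoc]

theorem map_act (ψ : T₁ ⟶ T) (f : Fam F γ n T) (g : Γ.obj (op T)) :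
    map ψ (f.act g) = (map ψ f).act (Γ.map ψ.op g) :=
  ext_s rfl fun i T' φ u h h' ↦ by simp only [act, map, grp_map_comp]

/-- The points over a given point of the thickening of `S` form a principal homogeneous space. -/
theorem existsUnique_act_eq [HasPullbacks C] (hU : Covers JC U) {f f' : Fam F γ n T} (ht : f.t = f'.t) :
    ∃! g : Γ.obj (op T), f.act g = f' := by
  -- Changing the member of the covering multiplies both coordinates on the left by the same
  -- element, which cancels in the quotient. So the local quotients glue to an element of the group.
  have indep : ∀ {T' : D} (φ : T' ⟶ T) (i j : I) (u : T' ⟶ (Th n).obj (U i).left)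
      (v : T' ⟶ (Th n).obj (U j).left) (hi : u ≫ (Th n).map (U i).hom = φ ≫ f.t)
      (hj : v ≫ (Th n).map (U j).hom = φ ≫ f.t),
      (f.s i φ u hi)⁻¹ * f'.s i φ u (hi.trans (ht ▸ rfl)) =
        (f.s j φ v hj)⁻¹ * f'.s j φ v (hj.trans (ht ▸ rfl)) := by
    intro T' φ i j u v hi hj
    obtain ⟨W, a, b, w, rfl, rfl⟩ := F.exists_overlap u v (hi.trans hj.symm)
    rw [f.cocycle i j W a b φ w hi hj, f'.cocycle i j W a b φ w _ (hj.trans (ht ▸ rfl))]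
    group
  obtain ⟨g, hg, hgu⟩ := F.glue_group (F.coverSieve_mem hU f.t)
    (fun φ h ↦ (f.s h.choose φ h.choose_spec.choose h.choose_spec.choose_spec)⁻¹ *
      f'.s h.choose φ h.choose_spec.choose (h.choose_spec.choose_spec.trans (ht ▸ rfl)))
    (fun {T' T''} ψ φ h ↦ by
      have e : (ψ ≫ h.choose_spec.choose) ≫ (Th n).map (U h.choose).hom = (ψ ≫ φ) ≫ f.t := by
        rw [Category.assoc, h.choose_spec.choose_spec, Category.assoc]
      refine (indep (ψ ≫ φ) _ h.choose _ (ψ ≫ h.choose_spec.choose) _ e).trans ?_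
      rw [f.natural _ ψ φ _ h.choose_spec.choose_spec,
        f'.natural _ ψ φ _ (h.choose_spec.choose_spec.trans (ht ▸ rfl)), map_mul, map_inv])
  refine ⟨g, ext_s ht fun i T' φ u h h' ↦ ?_, fun g' hg' ↦ hgu _ fun φ h ↦ ?_⟩
  · change f.s i φ u h * Γ.map φ.op g = _
    have hφ : coverSieve U f.t φ := ⟨i, u, h⟩
    rw [hg φ hφ, indep φ _ i _ u hφ.choose_spec.choose_spec h, mul_inv_cancel_left]
  · rw [eq_inv_mul_iff_mul_eq]
    exact congr_s hg' _ rfl rfl h.choose_spec.choose_spec _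

end Fam
end

/-! ### The sheaf of points of the torsor with a given cocycle. -/

section
variable {C : Type (u + 1)} [Category.{u} C] {D : Type (u + 1)} [Category.{u} D]
  {Th : ℕ → C ⥤ D} {incl : ∀ n, Th n ⟶ Th (n + 1)} {Γ : Dᵒᵖ ⥤ GrpCat.{u}}
  {H : Cᵒᵖ ⥤ GrpCat.{u}} {JC : GrothendieckTopology C} {JD : GrothendieckTopology D}
  {S : C} {I : Type u} {U : I → Over S} {F : FormalSetting Th incl Γ H JC JD}
  {γ : PresheafOfGroups.OneCocycle (restrictOver H S) U}

/-- The coordinates of a point of a formal torsor. -/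
def FormalSetting.IsTransition.fam {Y : AdicSpace Th incl Γ S}
    {α : ∀ i, Y.Trivialization (U i).hom} (hα : F.IsTransition α γ) {n : ℕ} {T : D}
    (x : T ⟶ Y.X n) : Fam F γ n T where
  t := x ≫ Y.π n
  s i T' φ u h := (α i).toFun n u (φ ≫ x) (by rw [h, Category.assoc])
  natural i T' T'' ψ φ u h h' := by
    have e : (ψ ≫ φ ≫ x) ≫ Y.π n = (ψ ≫ u) ≫ (Th n).map (U i).hom := by
      rw [h']; simp only [Category.assoc]
    exact ((α i).congr rfl (Category.assoc _ _ _) _ e).trans ((α i).natural n ψ u _ _ e)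
  cocycle i j V a b T' φ w hi hj := hα i j V a b n _ w _ _ _

/-- The points of a formal torsor with cocycle `γ` are given by their coordinates. -/
theorem FormalSetting.IsTransition.existsUnique_fam_eq [HasPullbacks C] {Y : AdicSpace Th incl Γ S}
    {α : ∀ i, Y.Trivialization (U i).hom} (hα : F.IsTransition α γ) (hU : Covers JC U) {n : ℕ}
    {T : D} (f : Fam F γ n T) : ∃! x : T ⟶ Y.X n, hα.fam x = f := by
  -- The points of `Y` with the prescribed local coordinates agree on overlaps, because coordinates
  -- and trivializations change by the same cocycle. They glue since representable presheaves are
  -- sheaves.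
  have indep : ∀ {T' : D} (φ : T' ⟶ T) (i j : I) (u : T' ⟶ (Th n).obj (U i).left)
      (v : T' ⟶ (Th n).obj (U j).left) (hi : u ≫ (Th n).map (U i).hom = φ ≫ f.t)
      (hj : v ≫ (Th n).map (U j).hom = φ ≫ f.t),
      (α i).pt u (f.s i φ u hi) = (α j).pt v (f.s j φ v hj) := by
    intro T' φ i j u v hi hj
    obtain ⟨W, a, b, w, rfl, rfl⟩ := F.exists_overlap u v (hi.trans hj.symm)
    have h1 : (α i).pt (w ≫ (Th n).map a.left) (f.s i φ _ hi) ≫ Y.π n =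
        (w ≫ (Th n).map b.left) ≫ (Th n).map (U j).hom := by rw [(α i).pt_π, hi, hj]
    refine (α j).eq_pt h1 ?_
    have h2 := hα i j W a b n T' w _ ((α i).pt_π _ (f.s i φ _ hi)) h1
    rw [(α i).toFun_pt] at h2
    exact (mul_left_cancel ((f.cocycle i j W a b φ w hi hj).symm.trans h2)).symm
  obtain ⟨x, hx, hxu⟩ := F.glue_hom (Z := Y.X n) (F.coverSieve_mem hU f.t)
    (fun φ h ↦ (α h.choose).pt h.choose_spec.choose
      (f.s h.choose φ h.choose_spec.choose h.choose_spec.choose_spec))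
    (fun {T' T''} ψ φ h ↦ by
      have e : (ψ ≫ h.choose_spec.choose) ≫ (Th n).map (U h.choose).hom = (ψ ≫ φ) ≫ f.t := by
        rw [Category.assoc, h.choose_spec.choose_spec, Category.assoc]
      refine (indep (ψ ≫ φ) _ h.choose _ (ψ ≫ h.choose_spec.choose) _ e).trans ?_
      rw [f.natural _ ψ φ _ h.choose_spec.choose_spec, AdicSpace.Trivialization.comp_pt])
  refine ⟨x, ?_, fun y hy ↦ hxu y fun φ h ↦ ?_⟩
  · have ht : x ≫ Y.π n = f.t := by
      refine F.hom_ext (F.coverSieve_mem hU f.t) fun φ h ↦ ?_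
      rw [← Category.assoc, hx φ h, (α h.choose).pt_π, h.choose_spec.choose_spec]
    refine Fam.ext_s ht fun i T' φ u h h' ↦ ?_
    have hφ : coverSieve U f.t φ := ⟨i, u, h'⟩
    have e : φ ≫ x = (α i).pt u (f.s i φ u h') :=
      (hx φ hφ).trans (indep φ _ i _ u _ h')
    exact ((α i).congr rfl e _ ((α i).pt_π _ _)).trans ((α i).toFun_pt _ _ _)
  · have h1 : (φ ≫ y) ≫ Y.π n = h.choose_spec.choose ≫ (Th n).map (U h.choose).hom := by
      rw [h.choose_spec.choose_spec, ← hy, Category.assoc]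
      rfl
    refine (α h.choose).eq_pt h1 ?_
    exact Fam.congr_s hy _ rfl rfl (h1.symm.trans (Category.assoc _ _ _)) _

namespace Fam
variable {n : ℕ} {T : D}

/-- The base point glues because representable presheaves are sheaves, each coordinate because `Γ`
is a sheaf; naturality and the cocycle relation can then be checked locally. -/
theorem isSheaf_functor : Presieve.IsSheaf JD (functor F γ n) := by
  intro T R hR x hx
  rw [Presieve.compatible_iff_sieveCompatible] at hx
  have hx' : ∀ {T' T'' : D} (ψ : T'' ⟶ T') (φ : T' ⟶ T) (h : R φ),
      (x (ψ ≫ φ) (R.downward_closed h ψ) : Fam F γ n T'') = map ψ (x φ h : Fam F γ n T') :=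
    fun ψ φ h ↦ hx φ ψ h
  have xcongr : ∀ (i : I) {T' : D} {φ φ' : T' ⟶ T} (hφ : φ = φ') (h : R φ) (h' : R φ')
      {u u' : T' ⟶ (Th n).obj (U i).left} (hu : u = u')
      (h₁ : u ≫ (Th n).map (U i).hom = 𝟙 T' ≫ Fam.t (x φ h : Fam F γ n T'))
      (h₂ : u' ≫ (Th n).map (U i).hom = 𝟙 T' ≫ Fam.t (x φ' h' : Fam F γ n T')),
      Fam.s (x φ h : Fam F γ n T') i (𝟙 T') u h₁ =
        Fam.s (x φ' h' : Fam F γ n T') i (𝟙 T') u' h₂ := by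
    rintro i T' φ _ rfl h h' u _ rfl h₁ h₂
    rfl
  obtain ⟨t, ht, htu⟩ := F.glue_hom hR (fun φ h ↦ Fam.t (x φ h : Fam F γ n _))
    (fun ψ φ h ↦ congrArg Fam.t (hx' ψ φ h))
  have hloc : ∀ (i : I) {T' : D} (φ : T' ⟶ T) (u : T' ⟶ (Th n).obj (U i).left)
      (hu : u ≫ (Th n).map (U i).hom = φ ≫ t) {T'' : D} (ψ : T'' ⟶ T') (h : R (ψ ≫ φ)),
      (ψ ≫ u) ≫ (Th n).map (U i).hom = 𝟙 T'' ≫ Fam.t (x (ψ ≫ φ) h : Fam F γ n T'') := by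
    intro i T' φ u hu T'' ψ h
    rw [Category.assoc, hu, ← Category.assoc, ht _ h, Category.id_comp]
  -- The coordinate over `φ` is glued from the given sections over the `ψ ≫ φ` in the covering
  -- sieve, each evaluated at the identity of its own domain.
  have hs : ∀ (i : I) {T' : D} (φ : T' ⟶ T) (u : T' ⟶ (Th n).obj (U i).left)
      (hu : u ≫ (Th n).map (U i).hom = φ ≫ t),
      ∃! g : Γ.obj (op T'), ∀ {T'' : D} (ψ : T'' ⟶ T') (h : R (ψ ≫ φ)),
        Γ.map ψ.op g = Fam.s (x (ψ ≫ φ) h : Fam F γ n T'') i (𝟙 T'') (ψ ≫ u)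
          (hloc i φ u hu ψ h) := by
    intro i T' φ u hu
    refine F.glue_group (JD.pullback_stable φ hR) (fun ψ h ↦ Fam.s (x (ψ ≫ φ) h : Fam F γ n _) i
      (𝟙 _) (ψ ≫ u) (hloc i φ u hu ψ h)) fun {T₁ T₂} ψ χ h ↦ ?_
    have h2 : R (ψ ≫ χ ≫ φ) := R.downward_closed h ψ
    have e := hx' ψ (χ ≫ φ) h
    have e1 : (ψ ≫ χ ≫ u) ≫ (Th n).map (U i).hom =
        (ψ ≫ 𝟙 T₁) ≫ Fam.t (x (χ ≫ φ) h : Fam F γ n T₁) := by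
      rw [Category.assoc ψ, hloc i φ u hu χ h, Category.assoc]
    rw [← Fam.natural (x (χ ≫ φ) h : Fam F γ n T₁) i ψ (𝟙 T₁) (χ ≫ u) (hloc i φ u hu χ h) e1]
    have e2 : (ψ ≫ χ ≫ u) ≫ (Th n).map (U i).hom =
        𝟙 T₂ ≫ Fam.t (map ψ (x (χ ≫ φ) h : Fam F γ n T₁)) := by
      rw [e1, Category.comp_id, Category.id_comp]; rfl
    have e3 : (ψ ≫ χ ≫ u) ≫ (Th n).map (U i).hom =
        𝟙 T₂ ≫ Fam.t (x (ψ ≫ χ ≫ φ) h2 : Fam F γ n T₂) := by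
      rw [e2, ← e]
    refine (xcongr i (Category.assoc _ _ _) _ h2 (Category.assoc _ _ _) _ e3).trans ?_
    refine (congr_s e i rfl rfl e3 e2).trans ?_
    exact congr_s rfl i (by simp : 𝟙 T₂ ≫ ψ = ψ ≫ 𝟙 T₁) rfl _ _
  let s : ∀ (i : I) {T' : D} (φ : T' ⟶ T) (u : T' ⟶ (Th n).obj (U i).left)
      (hu : u ≫ (Th n).map (U i).hom = φ ≫ t), Γ.obj (op T') := fun i T' φ u hu ↦
    (hs i φ u hu).choose
  have hs_spec : ∀ (i : I) {T' : D} (φ : T' ⟶ T) (u : T' ⟶ (Th n).obj (U i).left)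
      (hu : u ≫ (Th n).map (U i).hom = φ ≫ t) {T'' : D} (ψ : T'' ⟶ T') (h : R (ψ ≫ φ)),
        Γ.map ψ.op (s i φ u hu) = Fam.s (x (ψ ≫ φ) h : Fam F γ n T'') i (𝟙 T'') (ψ ≫ u)
          (hloc i φ u hu ψ h) := fun i T' φ u hu ↦ (hs i φ u hu).choose_spec.1
  let f : Fam F γ n T :=
    { t := t
      s := fun i T' φ u hu ↦ s i φ u hu
      natural := fun i T' T'' ψ φ u h h' ↦ by
        refine F.group_ext (JD.pullback_stable (ψ ≫ φ) hR) fun {T₁} χ hχ ↦ ?_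
        rw [hs_spec i (ψ ≫ φ) (ψ ≫ u) h' χ hχ, ← grp_map_comp,
          hs_spec i φ u h (χ ≫ ψ) (by rwa [Category.assoc])]
        exact xcongr i (Category.assoc _ _ _).symm _ _ (Category.assoc _ _ _).symm _ _
      cocycle := fun i j V a b T' φ w hi hj ↦ by
        refine F.group_ext (JD.pullback_stable φ hR) fun {T₁} χ hχ ↦ ?_
        rw [map_mul, hs_spec i φ _ hi χ hχ, hs_spec j φ _ hj χ hχ]
        have h1 := hloc i φ _ hi χ hχ
        have h2 := hloc j φ _ hj χ hχ
        rw [← Category.assoc χ] at h1 h2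
        refine (congr_s rfl i rfl (Category.assoc _ _ _).symm _ h1).trans
          ((Fam.cocycle (x (χ ≫ φ) hχ : Fam F γ n T₁) i j V a b (𝟙 T₁) (χ ≫ w) h1 h2).trans ?_)
        exact congrArg₂ (· * ·) (F.red_comp n (V := V.left) χ w (γ.ev i j a b))
          (congr_s rfl j rfl (Category.assoc _ _ _) _ _) }
  refine ⟨f, fun T' φ h ↦ ?_, fun f' hf' ↦ ?_⟩
  · refine ext_s (f := map φ f) (f' := (x φ h : Fam F γ n T')) (ht φ h) fun i T'' χ u h₁ h₂ ↦ ?_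
    change s i (χ ≫ φ) u (h₁.trans (Category.assoc _ _ _).symm) = _
    have hχ : R (𝟙 T'' ≫ χ ≫ φ) := by
      rw [Category.id_comp]; exact R.downward_closed h χ
    have e := hs_spec i (χ ≫ φ) u (h₁.trans (Category.assoc _ _ _).symm) (𝟙 T'') hχ
    rw [grp_map_id] at e
    refine e.trans ?_
    have h₃ : u ≫ (Th n).map (U i).hom = 𝟙 T'' ≫ Fam.t (map χ (x φ h : Fam F γ n T')) := by
      rw [h₂, Category.id_comp]; rfl
    have h₄ : u ≫ (Th n).map (U i).hom =
        𝟙 T'' ≫ Fam.t (x (χ ≫ φ) (R.downward_closed h χ) : Fam F γ n T'') := by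
      rw [h₃, ← hx' χ φ h]
    refine (xcongr i (Category.id_comp _) _ (R.downward_closed h χ) (Category.id_comp _) _ h₄).trans ?_
    refine (congr_s (hx' χ φ h) i rfl rfl h₄ h₃).trans ?_
    exact congr_s rfl i (Category.id_comp χ) rfl _ _
  · have hf : ∀ {T' : D} (φ : T' ⟶ T) (h : R φ),
        map φ (f' : Fam F γ n T) = (x φ h : Fam F γ n T') := fun φ h ↦ hf' φ h
    have ht' : Fam.t (f' : Fam F γ n T) = t := htu _ fun φ h ↦ congrArg Fam.t (hf φ h)
    refine ext_s (f := (f' : Fam F γ n T)) (f' := f) ht' fun i T' φ u h₁ h₂ ↦ ?_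
    refine F.group_ext (JD.pullback_stable φ hR) fun {T₁} χ hχ ↦ ?_
    have h₃ : (χ ≫ u) ≫ (Th n).map (U i).hom = (χ ≫ φ) ≫ Fam.t (f' : Fam F γ n T) := by
      rw [Category.assoc, h₁, Category.assoc]
    refine Eq.trans ?_ (hs_spec i φ u h₂ χ hχ).symm
    rw [← Fam.natural (f' : Fam F γ n T) i χ φ u h₁ h₃]
    have h₄ : (χ ≫ u) ≫ (Th n).map (U i).hom =
        𝟙 T₁ ≫ Fam.t (map (χ ≫ φ) (f' : Fam F γ n T)) := by
      rw [h₃, Category.id_comp]; rfl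
    refine Eq.trans ?_ (congr_s (hf (χ ≫ φ) hχ) i rfl rfl h₄ (hloc i φ u h₂ χ hχ))
    exact congr_s rfl i (Category.id_comp _).symm rfl _ _

/-- The structure map of the presheaf of points. -/
def base (n : ℕ) (T : D) (f : (functor F γ n).obj (op T)) : T ⟶ (Th n).obj S :=
  Fam.t (f : Fam F γ n T)

theorem base_map {n : ℕ} {T T' : D} (φ : T ⟶ T') (f : (functor F γ n).obj (op T')) :
    base n T ((functor F γ n).map φ.op f) = φ ≫ base n _ f := rfl

/-- A section of the torsor over `W` identifies its points over `W` with the points of the group. -/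
theorem isUniversalOver_prod [HasPullbacks C] [HasBinaryProducts D] {M : D}
    (e : ∀ T : D, (T ⟶ M) ≃ Γ.obj (op T))
    (he : ∀ (T T' : D) (φ : T ⟶ T') (x : T' ⟶ M), e T (φ ≫ x) = Γ.map φ.op (e T' x))
    (hU : Covers JC U) {n : ℕ} {W : D} (f : Fam F γ n W) :
    IsUniversalOver (functor F γ n) (base n) f.t (prod.snd : M ⨯ W ⟶ W)
      ((map prod.snd f).act (e _ prod.fst)) := by
  refine ⟨rfl, fun {T} t f' hf' ↦ ?_⟩
  have key : ∀ x : T ⟶ M ⨯ W, x ≫ prod.snd = t →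
      (functor F γ n).map x.op ((map prod.snd f).act (e _ prod.fst)) =
        (map t f).act (e _ (x ≫ prod.fst)) := by
    rintro x rfl
    refine (map_act x (map prod.snd f) _).trans ?_
    rw [← he]
    exact ext_s (Category.assoc _ _ _).symm fun i T' φ u h h' ↦
      congrArg (· * _) (congr_s rfl i (Category.assoc _ _ _) rfl _ _)
  -- A point over `t` is a unique translate of the restriction of the section `f`, and the
  -- translating element is the coordinate in `M`.
  obtain ⟨g, hg, hgu⟩ := existsUnique_act_eq hU (f := map t f) (f' := (f' : Fam F γ n T)) hf'.symm
  refine ⟨prod.lift ((e T).symm g) t, ⟨prod.lift_snd _ _, ?_⟩, ?_⟩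
  · rw [key _ (prod.lift_snd _ _), prod.lift_fst, Equiv.apply_symm_apply]
    exact hg
  · rintro x ⟨hx, hgx⟩
    rw [key _ hx] at hgx
    refine Limits.prod.hom_ext ?_ (by rw [hx, prod.lift_snd])
    rw [prod.lift_fst, Equiv.eq_symm_apply]
    exact hgu _ hgx

/-- A point of the torsor with cocycle `γ` over the thickening of `W`, from a section over `W` of
the sheaf of cochains. -/
theorem exists_of_sections [HasPullbacks C] {n : ℕ} {T : D} {W : Over S}
    (v : T ⟶ (Th n).obj W.left)
    (β : ∀ (i : I) {V : Over S}, (V ⟶ U i) → (V ⟶ W) → H.obj (op V.left))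
    (hβ : ∀ (i : I) {V V' : Over S} (φ : V' ⟶ V) (a : V ⟶ U i) (b : V ⟶ W),
      β i (φ ≫ a) (φ ≫ b) = H.map φ.left.op (β i a b))
    (hγ : ∀ (i j : I) {V : Over S} (a : V ⟶ U i) (a' : V ⟶ U j) (b : V ⟶ W) {T : D}
      (w : T ⟶ (Th n).obj V.left), F.red n w (β i a b) =
        F.red n (V := V.left) w (γ.ev i j a a') * F.red n w (β j a' b)) :
    ∃ f : Fam F γ n T, f.t = v ≫ (Th n).map W.hom ∧
      ∀ (i : I) {T' : D} (φ : T' ⟶ T) (u : T' ⟶ (Th n).obj (U i).left)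
        (h : u ≫ (Th n).map (U i).hom = φ ≫ f.t) (V : Over S) (a : V ⟶ U i) (b : V ⟶ W)
        (w : T' ⟶ (Th n).obj V.left), w ≫ (Th n).map a.left = u → w ≫ (Th n).map b.left = φ ≫ v →
        F.red n w (β i a b) = f.s i φ u h := by
  -- The reduction of `β` at a point does not depend on the chosen object `V`: every choice factors
  -- through the fibre product of `U i` and `W` over `S`.
  have ov : ∀ (i : I) {T' : D} (φ : T' ⟶ T) (u : T' ⟶ (Th n).obj (U i).left)
      (h : u ≫ (Th n).map (U i).hom = φ ≫ v ≫ (Th n).map W.hom),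
      ∃ g : Γ.obj (op T'), ∀ (V : Over S) (a : V ⟶ U i) (b : V ⟶ W)
        (w : T' ⟶ (Th n).obj V.left), w ≫ (Th n).map a.left = u → w ≫ (Th n).map b.left = φ ≫ v →
        F.red n w (β i a b) = g := by
    intro i T' φ u h
    obtain ⟨w, hw, hw'⟩ := F.exists_lift_pullback
      (IsPullback.of_hasPullback (U i).hom W.hom) u (φ ≫ v) (by rw [h, Category.assoc])
    let P : Over S := Over.mk (pullback.fst (U i).hom W.hom ≫ (U i).hom)
    let p : P ⟶ U i := Over.homMk (pullback.fst (U i).hom W.hom) rfl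
    let q : P ⟶ W := Over.homMk (pullback.snd (U i).hom W.hom) pullback.condition.symm
    refine ⟨F.red n (V := P.left) w (β i p q), fun V a b w' h₁ h₂ ↦ ?_⟩
    let c : V ⟶ P := Over.homMk (pullback.lift a.left b.left (by rw [Over.w, Over.w])) (by
      change pullback.lift _ _ _ ≫ pullback.fst _ _ ≫ (U i).hom = V.hom
      rw [pullback.lift_fst_assoc, Over.w])
    have hcp : c ≫ p = a := Over.OverMorphism.ext (pullback.lift_fst _ _ _)
    have hcq : c ≫ q = b := Over.OverMorphism.ext (pullback.lift_snd _ _ _)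
    have h3 := hβ i c p q
    rw [hcp, hcq] at h3
    rw [h3]
    refine (F.red_map n c.left w' _).trans ?_
    congr 2
    refine F.hom_ext_pullback (IsPullback.of_hasPullback (U i).hom W.hom) ?_ ?_
    · rw [hw, Category.assoc, ← Functor.map_comp, ← h₁]
      exact congrArg (fun m ↦ w' ≫ (Th n).map m.left) hcp
    · rw [hw', Category.assoc, ← Functor.map_comp, ← h₂]
      exact congrArg (fun m ↦ w' ≫ (Th n).map m.left) hcq
  choose g hg using @ov
  refine ⟨{ t := v ≫ (Th n).map W.hom
            s := fun i T' φ u h ↦ g i φ u h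
            natural := fun i T' T'' ψ φ u h h' ↦ ?_
            cocycle := fun i i' V a b T' φ w hi hj ↦ ?_ }, rfl, fun i T' φ u h ↦ hg i φ u h⟩
  · obtain ⟨V, a, b, w, hw, hw'⟩ := F.exists_overlap u (φ ≫ v) (by rw [h, Category.assoc])
    rw [← hg i φ u h V a b w hw hw', ← F.red_comp]
    exact (hg i (ψ ≫ φ) (ψ ≫ u) h' V a b (ψ ≫ w) (by rw [Category.assoc, hw])
      (by rw [Category.assoc, hw', Category.assoc])).symm
  · obtain ⟨V', a', b', w', hw, hw'⟩ := F.exists_overlap (U := V) w (φ ≫ v) (by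
      rw [Category.assoc, ← hj, Category.assoc, ← Functor.map_comp, Over.w])
    rw [← hg i φ _ hi V' (a' ≫ a) b' w' (by
        rw [Over.comp_left, Functor.map_comp, ← Category.assoc, hw]) hw',
      ← hg i' φ _ hj V' (a' ≫ b) b' w' (by
        rw [Over.comp_left, Functor.map_comp, ← Category.assoc, hw]) hw',
      hγ i i' (a' ≫ a) (a' ≫ b) b']
    refine congrArg (· * _) ?_
    rw [← hw, ← γ.ev_precomp]
    exact F.red_map n _ _ _

/-- Over a member of the covering the torsor with cocycle `γ` has a section. -/
theorem exists_base_eq [HasPullbacks C] {n : ℕ} {W : D} (j : I) (v : W ⟶ (Th n).obj (U j).left) :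
    ∃ f : Fam F γ n W, f.t = v ≫ (Th n).map (U j).hom := by
  -- The cochain `γ.ev i j` gives the section whose coordinate over `U j` is 1; the relation
  -- required of it is the cocycle identity.
  obtain ⟨f, hf, -⟩ := exists_of_sections (F := F) (γ := γ) v (fun i V a b ↦ γ.ev i j a b)
    (fun i V V' φ a b ↦ (γ.ev_precomp i j φ a b).symm) (fun i i' V a a' b T w ↦ by
      rw [← γ.ev_trans i i' j a a' b]
      exact (F.red n w).map_mul _ _)
  exact ⟨f, hf⟩

end Fam
end

/-! ### Construction of the formal torsor with a given cocycle. -/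

section
variable {C : Type (u + 1)} [Category.{u} C] {D : Type (u + 1)} [Category.{u} D]
  {Th : ℕ → C ⥤ D} {incl : ∀ n, Th n ⟶ Th (n + 1)} {Γ : Dᵒᵖ ⥤ GrpCat.{u}}
  {H : Cᵒᵖ ⥤ GrpCat.{u}} {JC : GrothendieckTopology C} {JD : GrothendieckTopology D}
  {S : C} {I : Type u} {U : I → Over S} {F : FormalSetting Th incl Γ H JC JD}
  {γ : PresheafOfGroups.OneCocycle (restrictOver H S) U}

namespace Fam
variable {n : ℕ} {T T₁ : D}

/-- A point of the `n`-th reduction, as a point of the next one. -/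
noncomputable def toSucc (f : Fam F γ n T) : Fam F γ (n + 1) T where
  t := f.t ≫ (incl n).app S
  s i T' φ u h := f.s i φ ((F.isPullback_incl n (U i).hom).lift u (φ ≫ f.t)
    (h.trans (Category.assoc _ _ _).symm)) ((F.isPullback_incl n (U i).hom).lift_snd _ _ _)
  natural i T' T'' ψ φ u h h' := by
    have e : (ψ ≫ (F.isPullback_incl n (U i).hom).lift u (φ ≫ f.t)
        (h.trans (Category.assoc _ _ _).symm)) ≫ (Th n).map (U i).hom = (ψ ≫ φ) ≫ f.t := by
      rw [Category.assoc, IsPullback.lift_snd, Category.assoc]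
    refine Eq.trans (congr_s rfl i rfl ?_ _ e) (f.natural i ψ φ _ _ e)
    refine (F.isPullback_incl n (U i).hom).hom_ext ?_ ?_
    · rw [IsPullback.lift_fst, Category.assoc, IsPullback.lift_fst]
    · rw [IsPullback.lift_snd, e]
  cocycle i j V a b T' φ w hi hj := by
    have hV : w ≫ (Th (n + 1)).map V.hom = (φ ≫ f.t) ≫ (incl n).app S := by
      rw [← Over.w a, Functor.map_comp, ← Category.assoc, hi, Category.assoc]
    let w₀ := (F.isPullback_incl n V.hom).lift w (φ ≫ f.t) hV
    have hw₀ : w₀ ≫ (incl n).app V.left = w := IsPullback.lift_fst _ _ _ _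
    have key : ∀ (l : I) (c : V ⟶ U l) (h : (w ≫ (Th (n + 1)).map c.left) ≫
        (Th (n + 1)).map (U l).hom = (φ ≫ f.t) ≫ (incl n).app S),
        (F.isPullback_incl n (U l).hom).lift (w ≫ (Th (n + 1)).map c.left) (φ ≫ f.t) h =
          w₀ ≫ (Th n).map c.left := by
      intro l c h
      refine (F.isPullback_incl n (U l).hom).hom_ext ?_ ?_
      · rw [IsPullback.lift_fst, Category.assoc, (incl n).naturality, ← Category.assoc, hw₀]
      · rw [IsPullback.lift_snd, Category.assoc, ← Functor.map_comp, Over.w]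
        exact (IsPullback.lift_snd _ _ _ _).symm
    have h1 := key i a (hi.trans (Category.assoc _ _ _).symm)
    have h2 := key j b (hj.trans (Category.assoc _ _ _).symm)
    have e1 : (w₀ ≫ (Th n).map a.left) ≫ (Th n).map (U i).hom = φ ≫ f.t := by
      rw [← h1, IsPullback.lift_snd]
    have e2 : (w₀ ≫ (Th n).map b.left) ≫ (Th n).map (U j).hom = φ ≫ f.t := by
      rw [← h2, IsPullback.lift_snd]
    refine (congr_s rfl i rfl h1 _ e1).trans ((f.cocycle i j V a b φ w₀ e1 e2).trans ?_)
    refine congrArg₂ (· * ·) ?_ (congr_s rfl j rfl h2.symm _ _)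
    rw [← hw₀]
    exact (F.red_incl n (V := V.left) w₀ (γ.ev i j a b)).symm

theorem toSucc_s (f : Fam F γ n T) (i : I) {T' : D} (φ : T' ⟶ T)
    (u : T' ⟶ (Th n).obj (U i).left) (h : u ≫ (Th n).map (U i).hom = φ ≫ f.t)
    (h' : (u ≫ (incl n).app (U i).left) ≫ (Th (n + 1)).map (U i).hom = φ ≫ f.toSucc.t) :
    f.toSucc.s i φ (u ≫ (incl n).app (U i).left) h' = f.s i φ u h := by
  refine congr_s (f := f) (f' := f) rfl i rfl ?_ _ _
  refine (F.isPullback_incl n (U i).hom).hom_ext ?_ ?_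
  · rw [IsPullback.lift_fst]
  · rw [IsPullback.lift_snd, h]

theorem toSucc_injective {f f' : Fam F γ n T} (ht : f.t = f'.t) (h : f.toSucc = f'.toSucc) :
    f = f' := by
  refine ext_s ht fun i T' φ u h₁ h₂ ↦ ?_
  have e : (u ≫ (incl n).app (U i).left) ≫ (Th (n + 1)).map (U i).hom = φ ≫ f.toSucc.t := by
    rw [Category.assoc, ← (incl n).naturality, ← Category.assoc, h₁, Category.assoc]
    rfl
  rw [← toSucc_s f i φ u h₁ e, ← toSucc_s f' i φ u h₂ (by rw [e, h])]
  exact congr_s h i rfl rfl _ _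

/-- Together with `toSucc_injective` this says that the `n`-th functor of points is the restriction
of the next one to the smaller thickening of `S`, which yields the cartesian squares of the formal
scheme. -/
theorem exists_toSucc_eq (f : Fam F γ (n + 1) T) (t : T ⟶ (Th n).obj S)
    (ht : f.t = t ≫ (incl n).app S) : ∃ f₀ : Fam F γ n T, f₀.t = t ∧ f₀.toSucc = f := by
  have hs : ∀ (i : I) {T' : D} (φ : T' ⟶ T) (u : T' ⟶ (Th n).obj (U i).left)
      (h : u ≫ (Th n).map (U i).hom = φ ≫ t),
      (u ≫ (incl n).app (U i).left) ≫ (Th (n + 1)).map (U i).hom = φ ≫ f.t := by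
    intro i T' φ u h
    rw [Category.assoc, ← (incl n).naturality, ← Category.assoc, h, Category.assoc, ht]
  refine ⟨{ t := t
            s := fun i T' φ u h ↦ f.s i φ (u ≫ (incl n).app (U i).left) (hs i φ u h)
            natural := fun i T' T'' ψ φ u h h' ↦ ?_
            cocycle := fun i j V a b T' φ w hi hj ↦ ?_ }, rfl, ?_⟩
  · have e : (ψ ≫ u ≫ (incl n).app (U i).left) ≫ (Th (n + 1)).map (U i).hom = (ψ ≫ φ) ≫ f.t := by
      rw [Category.assoc, hs i φ u h, Category.assoc]
    exact (congr_s rfl i rfl (Category.assoc _ _ _) _ e).trans (f.natural i ψ φ _ _ e)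
  · have key : ∀ (l : I) (c : V ⟶ U l), (w ≫ (Th n).map c.left) ≫ (incl n).app (U l).left =
        (w ≫ (incl n).app V.left) ≫ (Th (n + 1)).map c.left := by
      intro l c
      rw [Category.assoc, Category.assoc, (incl n).naturality]
    have e1 := hs i φ _ hi
    have e2 := hs j φ _ hj
    rw [key] at e1 e2
    refine (congr_s rfl i rfl (key i a) _ e1).trans
      ((f.cocycle i j V a b φ (w ≫ (incl n).app V.left) e1 e2).trans ?_)
    exact congrArg₂ (· * ·) (F.red_incl n (V := V.left) w (γ.ev i j a b))
      (congr_s rfl j rfl (key j b).symm _ _)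
  · refine ext_s ht.symm fun i T' φ u h h' ↦ ?_
    exact congr_s rfl i rfl (IsPullback.lift_fst _ _ _ _) _ _

theorem map_toSucc (ψ : T₁ ⟶ T) (f : Fam F γ n T) : map ψ f.toSucc = (map ψ f).toSucc := by
  refine ext_s (Category.assoc _ _ _).symm fun i T' φ u h h' ↦ ?_
  refine congr_s (f := f) (f' := f) rfl i rfl ?_ _ _
  refine (F.isPullback_incl n (U i).hom).hom_ext ?_ ?_
  · rw [IsPullback.lift_fst, IsPullback.lift_fst]
  · rw [IsPullback.lift_snd, IsPullback.lift_snd]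
    exact Category.assoc _ _ _

theorem toSucc_act (f : Fam F γ n T) (g : Γ.obj (op T)) : f.toSucc.act g = (f.act g).toSucc :=
  rfl

theorem map_comp (φ : T₁ ⟶ T) {T₂ : D} (ψ : T₂ ⟶ T₁) (f : Fam F γ n T) :
    map (ψ ≫ φ) f = map ψ (map φ f) :=
  map_op_comp (functor F γ n) ψ φ f

/-- The points with a given coordinate over a member of the covering. -/
theorem existsUnique_s_eq [HasPullbacks C] (hU : Covers JC U) (i : I)
    (u : T ⟶ (Th n).obj (U i).left) (g : Γ.obj (op T)) :
    ∃! f : Fam F γ n T, ∃ h : u ≫ (Th n).map (U i).hom = 𝟙 T ≫ f.t, f.s i (𝟙 T) u h = g := by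
  obtain ⟨f₀, hf₀⟩ := exists_base_eq (F := F) (γ := γ) i u
  have h₀ : u ≫ (Th n).map (U i).hom = 𝟙 T ≫ f₀.t := by rw [hf₀, Category.id_comp]
  -- Any point over `u` is translated by the quotient of the wanted coordinate and its own.
  refine ⟨f₀.act ((f₀.s i (𝟙 T) u h₀)⁻¹ * g), ⟨h₀, ?_⟩, fun f ⟨h, hf⟩ ↦ ?_⟩
  · change f₀.s i (𝟙 T) u h₀ * Γ.map (𝟙 T).op _ = _
    rw [grp_map_id, mul_inv_cancel_left]
  · have ht : f₀.t = f.t := by simpa using h₀.symm.trans h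
    obtain ⟨g', hg', -⟩ := existsUnique_act_eq hU ht
    rw [← hg', ← hf, ← congr_s hg' i rfl rfl h₀ h]
    congr 1
    change _ = (f₀.s i (𝟙 T) u h₀)⁻¹ * (f₀.s i (𝟙 T) u h₀ * Γ.map (𝟙 T).op g')
    rw [grp_map_id, inv_mul_cancel_left]

end Fam

/-- If the presheaves of points are representable, there is a formal torsor with cocycle `γ`. -/
theorem exists_isTransition_of_universal [HasPullbacks C] (hU : Covers JC U) {Y : ℕ → D}
    (y : ∀ n, Fam F γ n (Y n))
    (hy : ∀ (n : ℕ) {T : D} (f : Fam F γ n T), ∃! x : T ⟶ Y n, Fam.map x (y n) = f) :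
    ∃ (Z : AdicSpace Th incl Γ S) (α : ∀ i, Z.Trivialization (U i).hom), F.IsTransition α γ := by
  choose p hp' hpu' using @hy
  have hp : ∀ (n : ℕ) {T : D} (f : Fam F γ n T), Fam.map (p n f) (y n) = f := hp'
  have hpu : ∀ (n : ℕ) {T : D} (f : Fam F γ n T) (x : T ⟶ Y n), Fam.map x (y n) = f → x = p n f :=
    hpu'
  have hpm : ∀ (n : ℕ) {T : D} (x : T ⟶ Y n), p n (Fam.map x (y n)) = x :=
    fun n T x ↦ (hpu n _ x rfl).symm
  have hpt : ∀ (n : ℕ) {T : D} (f : Fam F γ n T), p n f ≫ (y n).t = f.t :=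
    fun n T f ↦ congrArg Fam.t (hp n f)
  have hpc : ∀ (n : ℕ) {T T' : D} (φ : T' ⟶ T) (f : Fam F γ n T),
      φ ≫ p n f = p n (Fam.map φ f) := fun n T T' φ f ↦ hpu n _ _ (by rw [Fam.map_comp, hp])
  have hι : ∀ (n : ℕ) {T : D} (x : T ⟶ Y n),
      Fam.map (x ≫ p (n + 1) (y n).toSucc) (y (n + 1)) = (Fam.map x (y n)).toSucc := by
    intro n T x
    rw [Fam.map_comp, hp, Fam.map_toSucc]
  -- All the structure is transported from the functors of points: the transition maps represent
  -- `toSucc`, and the action represents `Fam.act`.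
  let Z : AdicSpace Th incl Γ S :=
    { X := Y
      π := fun n ↦ (y n).t
      ι := fun n ↦ p (n + 1) (y n).toSucc
      isPullback := fun n ↦ by
        refine isPullback_of_existsUnique (hpt _ _) (fun {T} a b hab ↦ ?_) fun {T} c c' h₁ h₂ ↦ ?_
        · obtain ⟨f₀, h₁, h₂⟩ := Fam.exists_toSucc_eq (Fam.map a (y (n + 1))) b hab
          refine ⟨p n f₀, ?_, (hpt n f₀).trans h₁⟩
          rw [hpc, Fam.map_toSucc, hp, h₂, hpm]
        · rw [← hpm n c, ← hpm n c']
          refine congrArg (p n) (Fam.toSucc_injective h₂ ?_)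
          rw [← hι, ← hι, h₁]
      act := fun n T x g ↦ p n ((Fam.map x (y n)).act g)
      act_π := fun n T x g ↦ hpt n _
      act_one := fun n T x ↦ by rw [Fam.act_one, hpm]
      act_mul := fun n T x g h ↦ by rw [Fam.act_mul, hp]
      comp_act := fun n T T' φ x g ↦ by rw [hpc, Fam.map_act, Fam.map_comp]
      act_ι := fun n T x g ↦ by rw [hpc, Fam.map_toSucc, hp, hι, Fam.toSucc_act] }
  -- The trivialization over `U i` reads the `i`-th coordinate at the identity. The transition law
  -- is then the cocycle relation built into `Fam`.
  refine ⟨Z, fun i ↦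
    { toFun := fun n T u x hx ↦ (Fam.map x (y n)).s i (𝟙 T) u (by
        rw [Category.id_comp]; exact hx.symm)
      bijective := fun n T u g ↦ by
        obtain ⟨f, ⟨h, hf⟩, hfu⟩ := Fam.existsUnique_s_eq (F := F) (γ := γ) hU i u g
        refine ⟨p n f, ⟨?_, ?_⟩, fun x ⟨hx, hx'⟩ ↦ ?_⟩
        · refine (hpt n f).trans ?_
          rw [h, Category.id_comp]
        · exact (Fam.congr_s (hp n f) i rfl rfl _ h).trans hf
        · exact (hpm n x).symm.trans (congrArg (p n) (hfu _ ⟨_, hx'⟩))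
      natural := fun n T T' φ u x hx hx' ↦ by
        have h : u ≫ (Th n).map (U i).hom = (𝟙 T' ≫ x) ≫ (y n).t := by
          rw [Category.id_comp]; exact hx.symm
        have h' : (φ ≫ u) ≫ (Th n).map (U i).hom = (φ ≫ 𝟙 T' ≫ x) ≫ (y n).t := by
          rw [Category.assoc, h, Category.assoc φ]
        refine Eq.trans (Fam.congr_s rfl i ?_ rfl _ h') ((y n).natural i φ (𝟙 T' ≫ x) u h h')
        rw [Category.id_comp, Category.id_comp]
      equivariant := fun n T u x g hx hx' ↦ by
        have h : u ≫ (Th n).map (U i).hom = 𝟙 T ≫ (Fam.map x (y n)).t := by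
          rw [Category.id_comp]; exact hx.symm
        refine (Fam.congr_s (hp n ((Fam.map x (y n)).act g)) i rfl rfl _ h).trans ?_
        change (Fam.map x (y n)).s i (𝟙 T) u h * Γ.map (𝟙 T).op g = _
        rw [grp_map_id]
      compatible := fun n T u x hx hx' ↦ by
        have h : u ≫ (Th n).map (U i).hom = 𝟙 T ≫ (Fam.map x (y n)).t := by
          rw [Category.id_comp]; exact hx.symm
        have h' : (u ≫ (incl n).app (U i).left) ≫ (Th (n + 1)).map (U i).hom =
            𝟙 T ≫ (Fam.map x (y n)).toSucc.t := by
          rw [Category.assoc, ← (incl n).naturality, ← Category.assoc, h, Category.assoc,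
            Category.id_comp, Category.id_comp]
          rfl
        exact (Fam.congr_s (hι n x) i rfl rfl _ h').trans
          (Fam.toSucc_s (Fam.map x (y n)) i (𝟙 T) u h h') }, ?_⟩
  intro i j V a b n T w x hi hj
  exact (Fam.map x (y n)).cocycle i j V a b (𝟙 T) w (hi.symm.trans (Category.id_comp _).symm)
    (hj.symm.trans (Category.id_comp _).symm)

end

/-! ### Uniqueness of the torsor with a given cocycle; transport of trivializations. -/

section
variable {C : Type (u + 1)} [Category.{u} C] {D : Type (u + 1)} [Category.{u} D]
  {Th : ℕ → C ⥤ D} {incl : ∀ n, Th n ⟶ Th (n + 1)} {Γ : Dᵒᵖ ⥤ GrpCat.{u}}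
  {H : Cᵒᵖ ⥤ GrpCat.{u}} {JC : GrothendieckTopology C} {JD : GrothendieckTopology D}
  {S : C} {I : Type u} {U : I → Over S} {F : FormalSetting Th incl Γ H JC JD}
  {γ : PresheafOfGroups.OneCocycle (restrictOver H S) U}

namespace FormalSetting.IsTransition
variable {Y Y' : AdicSpace Th incl Γ S} {α : ∀ i, Y.Trivialization (U i).hom}
  {α' : ∀ i, Y'.Trivialization (U i).hom} (hα : F.IsTransition α γ) (hα' : F.IsTransition α' γ)

theorem fam_comp {n : ℕ} {T T' : D} (ψ : T' ⟶ T) (x : T ⟶ Y.X n) :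
    hα.fam (ψ ≫ x) = Fam.map ψ (hα.fam x) :=
  Fam.ext_s (Category.assoc _ _ _) fun i T'' φ u h h' ↦
    (α i).congr rfl (Category.assoc _ _ _).symm _ _

theorem fam_ι {n : ℕ} {T : D} (x : T ⟶ Y.X n) : hα.fam (x ≫ Y.ι n) = (hα.fam x).toSucc := by
  refine Fam.ext_s ?_ fun i T' φ u h h' ↦ ?_
  · change (x ≫ Y.ι n) ≫ Y.π (n + 1) = (x ≫ Y.π n) ≫ _
    rw [Category.assoc, (Y.isPullback n).w, Category.assoc]
  · have e₀ : u ≫ (Th (n + 1)).map (U i).hom = (φ ≫ x ≫ Y.π n) ≫ (incl n).app S := by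
      rw [h']
      change φ ≫ (x ≫ Y.π n) ≫ _ = _
      simp only [Category.assoc]
    obtain ⟨u, rfl, hu⟩ := (F.isPullback_incl n (U i).hom).exists_lift _ _ e₀
    have hu' : u ≫ (Th n).map (U i).hom = φ ≫ (hα.fam x).t := hu
    rw [Fam.toSucc_s _ i φ u hu']
    have h₁ : (φ ≫ x) ≫ Y.π n = u ≫ (Th n).map (U i).hom := by rw [hu, Category.assoc]
    have h₂ : ((φ ≫ x) ≫ Y.ι n) ≫ Y.π (n + 1) =
        (u ≫ (incl n).app (U i).left) ≫ (Th (n + 1)).map (U i).hom := by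
      rw [h, Category.assoc φ, Category.assoc φ]
      rfl
    exact ((α i).congr rfl (Category.assoc _ _ _).symm _ h₂).trans
      ((α i).compatible n u (φ ≫ x) h₁ h₂)

theorem fam_act {n : ℕ} {T : D} (x : T ⟶ Y.X n) (g : Γ.obj (op T)) :
    hα.fam (Y.act n x g) = (hα.fam x).act g := by
  refine Fam.ext_s (Y.act_π n x g) fun i T' φ u h h' ↦ ?_
  have h₁ : (φ ≫ x) ≫ Y.π n = u ≫ (Th n).map (U i).hom := by
    rw [h', Category.assoc]; rfl
  have h₂ : Y.act n (φ ≫ x) (Γ.map φ.op g) ≫ Y.π n = u ≫ (Th n).map (U i).hom := by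
    rw [Y.act_π, h₁]
  exact ((α i).congr rfl (Y.comp_act n φ x g) _ h₂).trans ((α i).equivariant n u _ _ h₁ h₂)

/-- The generic point of a formal torsor is universal. -/
theorem isUniversalOver [HasPullbacks C] (hU : Covers JC U) (n : ℕ) :
    IsUniversalOver (Fam.functor F γ n) (Fam.base n) (𝟙 _) (Y.π n) (hα.fam (𝟙 (Y.X n))) := by
  refine ⟨(Category.id_comp _).trans (Category.comp_id _).symm, fun {T} t f hf ↦ ?_⟩
  obtain ⟨x, hx, hxu⟩ := hα.existsUnique_fam_eq hU (f : Fam F γ n T)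
  have key : ∀ x : T ⟶ Y.X n, Fam.map x (hα.fam (𝟙 (Y.X n))) = hα.fam x := fun x ↦ by
    rw [← hα.fam_comp, Category.comp_id]
  refine ⟨x, ⟨?_, (key x).trans hx⟩, fun x' h ↦ hxu x' ((key x').symm.trans h.2)⟩
  rw [Category.comp_id] at hf
  rw [← hf]
  exact congrArg Fam.t hx

/-- Formal torsors with the same cocycle are isomorphic. -/
theorem nonempty_iso [HasPullbacks C] (hα : F.IsTransition α γ) (hα' : F.IsTransition α' γ)
    (hU : Covers JC U) : Nonempty (Y.Iso Y') := by
  -- Both torsors represent the same functor of coordinates; the maps in the two directions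
  -- correspond to the generic points.
  have ex : ∀ {Y Y' : AdicSpace Th incl Γ S} {α : ∀ i, Y.Trivialization (U i).hom}
      {α' : ∀ i, Y'.Trivialization (U i).hom} (hα : F.IsTransition α γ)
      (hα' : F.IsTransition α' γ) (n : ℕ), ∃ p : Y.X n ⟶ Y'.X n,
      ∀ {T : D} (x : T ⟶ Y.X n), hα'.fam (x ≫ p) = hα.fam x := by
    intro Y Y' α α' hα hα' n
    obtain ⟨p, hp, -⟩ := hα'.existsUnique_fam_eq hU (hα.fam (𝟙 (Y.X n)))
    refine ⟨p, fun x ↦ ?_⟩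
    rw [hα'.fam_comp, hp, ← hα.fam_comp, Category.comp_id]
  have inj : ∀ {Y : AdicSpace Th incl Γ S} {α : ∀ i, Y.Trivialization (U i).hom}
      (hα : F.IsTransition α γ) {n : ℕ} {T : D} {x x' : T ⟶ Y.X n}, hα.fam x = hα.fam x' →
      x = x' := fun hα _ _ x x' h ↦ (hα.existsUnique_fam_eq hU (hα.fam x')).unique h rfl
  choose p hp using ex hα hα'
  choose q hq using ex hα' hα
  refine ⟨{ iso := fun n ↦ ⟨p n, q n, inj hα ?_, inj hα' ?_⟩
            hom_π := fun n ↦ ?_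
            hom_ι := fun n ↦ inj hα' ?_
            equivariant := fun n T x g ↦ inj hα' ?_ }⟩
  · rw [hq, ← Category.id_comp (p n), hp]
  · rw [hp, ← Category.id_comp (q n), hq]
  · have h := congrArg Fam.t (hp n (𝟙 _))
    rw [Category.id_comp] at h
    exact h.trans (Category.id_comp _)
  · change hα'.fam (p n ≫ Y'.ι n) = hα'.fam (Y.ι n ≫ p (n + 1))
    rw [hp, hα'.fam_ι, ← Category.id_comp (p n), hp, ← hα.fam_ι, Category.id_comp]
  · change hα'.fam (Y.act n x g ≫ p n) = hα'.fam (Y'.act n (x ≫ p n) g)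
    rw [hp, hα.fam_act, hα'.fam_act, hp]

end FormalSetting.IsTransition

namespace AdicSpace.Trivialization
variable {Y : AdicSpace Th incl Γ S}

theorem ext_toFun {V : C} {f : V ⟶ S} {α β : Y.Trivialization f}
    (h : ∀ (n : ℕ) {T : D} (u : T ⟶ (Th n).obj V) (x : T ⟶ Y.X n)
      (hx : x ≫ Y.π n = u ≫ (Th n).map f), α.toFun n u x hx = β.toFun n u x hx) : α = β := by
  cases α; cases β
  congr
  funext n T u x hx
  exact h n u x hx

theorem restrict_restrict {V W V' : C} {f : V ⟶ S} (α : Y.Trivialization f) (a : W ⟶ V)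
    {f' : W ⟶ S} (ha : a ≫ f = f') (b : V' ⟶ W) {f'' : V' ⟶ S} (hb : b ≫ f' = f'') :
    (α.restrict a ha).restrict b hb =
      α.restrict (b ≫ a) (by rw [Category.assoc, ha, hb]) :=
  ext_toFun fun n T u x hx ↦ α.congr (by rw [Functor.map_comp, Category.assoc]) rfl _ _

/-- The transport of a trivialization along an isomorphism. -/
def ofIso {Y' : AdicSpace Th incl Γ S} {V : C} {f : V ⟶ S} (α : Y.Trivialization f)
    (e : Y.Iso Y') : Y'.Trivialization f where
  toFun n {T} u x hx := α.toFun n u (x ≫ (e.iso n).inv) (by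
    rw [Category.assoc, ← e.hom_π, Iso.inv_hom_id_assoc, hx])
  bijective n T u g := by
    obtain ⟨x, ⟨hx, hx'⟩, hu⟩ := α.bijective n u g
    refine ⟨x ≫ (e.iso n).hom, ⟨by rw [Category.assoc, e.hom_π, hx], ?_⟩, fun y ⟨hy, hy'⟩ ↦ ?_⟩
    · exact (α.congr rfl (by rw [Category.assoc, Iso.hom_inv_id, Category.comp_id]) _ hx).trans hx'
    · rw [← Iso.comp_inv_eq]
      exact hu _ ⟨_, hy'⟩
  natural n T T' φ u x hx hx' := by
    have h : (φ ≫ x ≫ (e.iso n).inv) ≫ Y.π n = (φ ≫ u) ≫ (Th n).map f := by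
      rw [← hx', ← e.hom_π]
      simp
    exact (α.congr rfl (Category.assoc _ _ _) _ h).trans (α.natural n φ u _ _ h)
  equivariant n T u x g hx hx' := by
    have h₁ : (x ≫ (e.iso n).inv) ≫ Y.π n = u ≫ (Th n).map f := by
      rw [Category.assoc, ← e.hom_π, Iso.inv_hom_id_assoc, hx]
    have h₂ : Y.act n (x ≫ (e.iso n).inv) g ≫ Y.π n = u ≫ (Th n).map f := by
      rw [Y.act_π, h₁]
    refine Eq.trans (α.congr rfl ?_ _ h₂) (α.equivariant n u _ g h₁ h₂)
    rw [Iso.comp_inv_eq, e.equivariant, Category.assoc, Iso.inv_hom_id, Category.comp_id]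
  compatible n T u x hx hx' := by
    have h₁ : (x ≫ (e.iso n).inv) ≫ Y.π n = u ≫ (Th n).map f := by
      rw [Category.assoc, ← e.hom_π, Iso.inv_hom_id_assoc, hx]
    have h₃ : (x ≫ Y'.ι n) ≫ (e.iso (n + 1)).inv = (x ≫ (e.iso n).inv) ≫ Y.ι n := by
      rw [Iso.comp_inv_eq, Category.assoc, Category.assoc, ← e.hom_ι, Iso.inv_hom_id_assoc]
    have h₂ : ((x ≫ (e.iso n).inv) ≫ Y.ι n) ≫ Y.π (n + 1) =
        (u ≫ (incl n).app V) ≫ (Th (n + 1)).map f := by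
      rw [← h₃, Category.assoc, ← e.hom_π, Iso.inv_hom_id_assoc, hx']
    exact (α.congr rfl h₃ _ h₂).trans (α.compatible n u _ h₁ h₂)

/-- The base change of a trivialization. -/
def baseChange {S' V V' : C} {f : S' ⟶ S} {Y' : AdicSpace Th incl Γ S'} {g : V ⟶ S}
    (α : Y.Trivialization g) (φ : ∀ n, Y'.X n ⟶ Y.X n)
    (hφ : ∀ n, IsPullback (φ n) (Y'.π n) (Y.π n) ((Th n).map f))
    (hι : ∀ n, φ n ≫ Y.ι n = Y'.ι n ≫ φ (n + 1))
    (hact : ∀ (n : ℕ) {T : D} (y : T ⟶ Y'.X n) (g : Γ.obj (op T)),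
      Y'.act n y g ≫ φ n = Y.act n (y ≫ φ n) g) (g' : V' ⟶ S') (b : V' ⟶ V)
    (hb : b ≫ g = g' ≫ f) : Y'.Trivialization g' where
  toFun n {T} u y hy := α.toFun n (u ≫ (Th n).map b) (y ≫ φ n) (by
    rw [Category.assoc, (hφ n).w, ← Category.assoc, hy, Category.assoc, Category.assoc,
      ← Functor.map_comp, ← hb, Functor.map_comp])
  bijective n T u g := by
    obtain ⟨x, ⟨hx, hx'⟩, hu⟩ := α.bijective n (u ≫ (Th n).map b) g
    have h : x ≫ Y.π n = (u ≫ (Th n).map g') ≫ (Th n).map f := by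
      rw [hx, Category.assoc, Category.assoc, ← Functor.map_comp, hb, Functor.map_comp]
    refine ⟨(hφ n).lift x (u ≫ (Th n).map g') h, ⟨(hφ n).lift_snd _ _ _, ?_⟩,
      fun y ⟨hy, hy'⟩ ↦ (hφ n).hom_ext ?_ ?_⟩
    · exact (α.congr rfl ((hφ n).lift_fst _ _ _) _ hx).trans hx'
    · rw [(hφ n).lift_fst]
      exact hu _ ⟨_, hy'⟩
    · rw [(hφ n).lift_snd, hy]
  natural n T T' ψ u y hy hy' := by
    have h₁ : (y ≫ φ n) ≫ Y.π n = (u ≫ (Th n).map b) ≫ (Th n).map g := by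
      rw [Category.assoc, (hφ n).w, ← Category.assoc, hy, Category.assoc, Category.assoc,
        ← Functor.map_comp, ← hb, Functor.map_comp]
    have h₂ : (ψ ≫ y ≫ φ n) ≫ Y.π n = (ψ ≫ u ≫ (Th n).map b) ≫ (Th n).map g := by
      rw [Category.assoc, h₁, Category.assoc ψ]
    exact (α.congr (Category.assoc _ _ _) (Category.assoc _ _ _) _ h₂).trans
      (α.natural n ψ _ _ h₁ h₂)
  equivariant n T u y g₀ hy hy' := by
    have h₁ : (y ≫ φ n) ≫ Y.π n = (u ≫ (Th n).map b) ≫ (Th n).map g := by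
      rw [Category.assoc, (hφ n).w, ← Category.assoc, hy, Category.assoc, Category.assoc,
        ← Functor.map_comp, ← hb, Functor.map_comp]
    have h₂ : Y.act n (y ≫ φ n) g₀ ≫ Y.π n = (u ≫ (Th n).map b) ≫ (Th n).map g := by
      rw [Y.act_π, h₁]
    exact (α.congr rfl (hact n y g₀) _ h₂).trans (α.equivariant n _ _ g₀ h₁ h₂)
  compatible n T u y hy hy' := by
    have h₁ : (y ≫ φ n) ≫ Y.π n = (u ≫ (Th n).map b) ≫ (Th n).map g := by
      rw [Category.assoc, (hφ n).w, ← Category.assoc, hy, Category.assoc, Category.assoc,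
        ← Functor.map_comp, ← hb, Functor.map_comp]
    have h₃ : (y ≫ Y'.ι n) ≫ φ (n + 1) = (y ≫ φ n) ≫ Y.ι n := by
      rw [Category.assoc, ← hι, Category.assoc]
    have h₄ : (u ≫ (incl n).app V') ≫ (Th (n + 1)).map b =
        (u ≫ (Th n).map b) ≫ (incl n).app V := by
      rw [Category.assoc, Category.assoc, (incl n).naturality]
    have h₂ : ((y ≫ φ n) ≫ Y.ι n) ≫ Y.π (n + 1) =
        ((u ≫ (Th n).map b) ≫ (incl n).app V) ≫ (Th (n + 1)).map g := by
      rw [Category.assoc, (Y.isPullback n).w, ← Category.assoc, h₁, Category.assoc,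
        (incl n).naturality, Category.assoc, Category.assoc, Category.assoc]
    exact (α.congr h₄ h₃ _ h₂).trans (α.compatible n _ _ h₁ h₂)

end AdicSpace.Trivialization

end

/-! ### Čech classes of formal torsors. -/

section
variable {C : Type (u + 1)} [Category.{u} C] {D : Type (u + 1)} [Category.{u} D]
  {Th : ℕ → C ⥤ D} {incl : ∀ n, Th n ⟶ Th (n + 1)} {Γ : Dᵒᵖ ⥤ GrpCat.{u}}
  {H : Cᵒᵖ ⥤ GrpCat.{u}} {JC : GrothendieckTopology C} {JD : GrothendieckTopology D}
  {S : C} {I : Type u} {U : I → Over S} {F : FormalSetting Th incl Γ H JC JD}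
  {γ : PresheafOfGroups.OneCocycle (restrictOver H S) U}

theorem FormalSetting.red_ext (F : FormalSetting Th incl Γ H JC JD) {V : C} {h h' : H.obj (op V)}
    (e : ∀ (n : ℕ) {T : D} (t : T ⟶ (Th n).obj V), F.red n t h = F.red n t h') : h = h' :=
  (F.existsUnique_red V (fun n _ t ↦ F.red n t h') (fun n _ _ φ t ↦ F.red_comp n φ t h')
    (fun n _ t ↦ F.red_incl n t h')).unique e fun _ _ _ ↦ rfl

namespace FormalSetting.IsTransition
variable {Y : AdicSpace Th incl Γ S} {α : ∀ i, Y.Trivialization (U i).hom}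

theorem ev_eq (hα : F.IsTransition α γ) (i j : I) {V : Over S} (a : V ⟶ U i) (b : V ⟶ U j) :
    γ.ev i j a b = AdicSpace.Trivialization.transition F
      ((α j).restrict b.left (Over.w b)) ((α i).restrict a.left (Over.w a)) :=
  AdicSpace.Trivialization.eq_transition F _ _ fun n T u x hx ↦ hα i j V a b n T u x _ _

variable {I' : Type u} {U' : I' → Over S} {γ' : PresheafOfGroups.OneCocycle (restrictOver H S) U'}
  {α' : ∀ i, Y.Trivialization (U' i).hom}

/-- The cocycles of two families of trivializations of the same torsor are cohomologous. -/
theorem isCohomologous (hα : F.IsTransition α γ) (hα' : F.IsTransition α' γ')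
    (r : I' → I) (ρ : ∀ j, U' j ⟶ U (r j)) : (refineCocycle r ρ γ).IsCohomologous γ' := by
  let β : ∀ j, H.obj (op (U' j).left) := fun j ↦ AdicSpace.Trivialization.transition F
    ((α (r j)).restrict (ρ j).left (Over.w (ρ j))) (α' j)
  refine ⟨fun j ↦ β j, fun i j V a b ↦ ?_⟩
  have h : ∀ (j : I') (b : V ⟶ U' j), H.map b.left.op (β j) =
      AdicSpace.Trivialization.transition F
        ((α (r j)).restrict (b ≫ ρ j).left (Over.w _)) ((α' j).restrict b.left (Over.w b)) := by
    intro j b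
    refine (AdicSpace.Trivialization.transition_restrict F _ _ b.left (Over.w b)).trans ?_
    rw [AdicSpace.Trivialization.restrict_restrict]
    rfl
  let g : H.obj (op V.left) := γ.ev (r i) (r j) (a ≫ ρ i) (b ≫ ρ j)
  let g' : H.obj (op V.left) := γ'.ev i j a b
  have hg : g = _ := hα.ev_eq (r i) (r j) (a ≫ ρ i) (b ≫ ρ j)
  have hg' : g' = _ := hα'.ev_eq i j a b
  change H.map a.left.op (β i) * g = g' * H.map b.left.op (β j)
  rw [h, h, hg, hg', AdicSpace.Trivialization.transition_mul,
    AdicSpace.Trivialization.transition_mul]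

/-- The trivializations of `Y` are restricted to the refinement and multiplied on the left by the
cochain that relates the two cocycles. -/
theorem exists_of_isCohomologous (hα : F.IsTransition α γ)
    (r : I' → I) (ρ : ∀ j, U' j ⟶ U (r j)) (h : (refineCocycle r ρ γ).IsCohomologous γ') :
    ∃ α' : ∀ i, Y.Trivialization (U' i).hom, F.IsTransition α' γ' := by
  obtain ⟨β, hβ⟩ := h
  refine ⟨fun j ↦ ((α (r j)).restrict (ρ j).left (Over.w (ρ j))).twist F (β j), ?_⟩
  intro i j V a b n T w x hi hj
  have key : ∀ (j : I') (b : V ⟶ U' j),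
      F.red n (V := (U' j).left) (w ≫ (Th n).map b.left) (β j) =
        F.red n (V := V.left) w (H.map b.left.op (β j)) := fun j b ↦
    (F.red_map n b.left w (β j)).symm
  have e₁ : ∀ (j : I') (b : V ⟶ U' j), w ≫ (Th n).map (b ≫ ρ j).left =
      (w ≫ (Th n).map b.left) ≫ (Th n).map (ρ j).left := fun j b ↦ by
    rw [Over.comp_left, Functor.map_comp, Category.assoc]
  have e₂ : ∀ (j : I') (b : V ⟶ U' j),
      x ≫ Y.π n = (w ≫ (Th n).map b.left) ≫ (Th n).map (U' j).hom →
      x ≫ Y.π n = (w ≫ (Th n).map (b ≫ ρ j).left) ≫ (Th n).map (U (r j)).hom := fun j b h ↦ by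
    rw [h, Category.assoc, Category.assoc, ← Functor.map_comp, ← Functor.map_comp, Over.w, Over.w]
  have h₁ := hα (r i) (r j) V (a ≫ ρ i) (b ≫ ρ j) n T w x (e₂ i a hi) (e₂ j b hj)
  have h₂ : F.red n (V := V.left) w (H.map a.left.op (β i)) *
      F.red n (V := V.left) w (γ.ev (r i) (r j) (a ≫ ρ i) (b ≫ ρ j)) =
      F.red n (V := V.left) w (γ'.ev i j a b) * F.red n (V := V.left) w (H.map b.left.op (β j)) :=
    ((F.red n (V := V.left) w).map_mul _ _).symm.trans
      ((congrArg (F.red n (V := V.left) w) (hβ i j a b)).trans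
        ((F.red n (V := V.left) w).map_mul _ _))
  have h₃ : ∀ (j : I') (b : V ⟶ U' j) (h h'), (α (r j)).toFun n
      ((w ≫ (Th n).map b.left) ≫ (Th n).map (ρ j).left) x h =
        (α (r j)).toFun n (w ≫ (Th n).map (b ≫ ρ j).left) x h' :=
    fun j b h h' ↦ (α (r j)).congr (e₁ j b).symm rfl _ _
  change F.red n (V := (U' i).left) (w ≫ (Th n).map a.left) (β i) * (α (r i)).toFun n _ x _ =
    _ * (F.red n (V := (U' j).left) (w ≫ (Th n).map b.left) (β j) * (α (r j)).toFun n _ x _)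
  rw [key, key, ← mul_assoc]
  refine Eq.trans ?_ (congrArg (· * _) h₂)
  rw [mul_assoc]
  refine congrArg (_ * ·) ?_
  exact (h₃ i a _ (e₂ i a hi)).trans (h₁.trans (congrArg _ (h₃ j b _ _).symm))

end FormalSetting.IsTransition

theorem covers_mono {J J' : GrothendieckTopology C} (h : J ≤ J') (hU : Covers J U) :
    Covers J' U := h S hU

theorem covers_pullback [HasPullbacks C] {J : GrothendieckTopology C} {I' : Type u}
    {U' : I' → Over S} (hU : Covers J U) (hU' : Covers J U') :
    Covers J (fun p : I × I' ↦ Over.mk (pullback.fst (U p.1).hom (U' p.2).hom ≫ (U p.1).hom)) := by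
  refine J.superset_covering ?_ (J.intersection_covering hU hU')
  rintro V f ⟨⟨_, a, _, ⟨i⟩, ha⟩, ⟨_, b, _, ⟨i'⟩, hb⟩⟩
  refine ⟨_, pullback.lift a b (ha.trans hb.symm), _, ⟨(i, i')⟩, ?_⟩
  change pullback.lift a b _ ≫ pullback.fst _ _ ≫ _ = f
  rw [pullback.lift_fst_assoc, ha]

variable (F) in
/-- The formal space `Y` has trivializations with the cocycle `c`. -/
def FormalSetting.HasCocycle {J : GrothendieckTopology C} (Y : AdicSpace Th incl Γ S)
    (c : CechCocycle J H S) : Prop :=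
  ∃ α : ∀ i, Y.Trivialization (c.U i).hom, F.IsTransition α c.cocycle

namespace FormalSetting.HasCocycle
variable {J : GrothendieckTopology C} {Y Y' : AdicSpace Th incl Γ S} {c d : CechCocycle J H S}

theorem of_rel (h : F.HasCocycle Y c) (hcd : c.Rel d) : F.HasCocycle Y d := by
  obtain ⟨α, hα⟩ := h
  obtain ⟨r, ρ, hr⟩ := hcd
  exact hα.exists_of_isCohomologous r ρ hr

/-- The fibre products of the two coverings carry the trivializations restricted from the first.
Their cocycle refines both `c` and `d` up to coboundaries, because all these trivializations belong
to the same `Y`. -/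
theorem mk_eq [HasPullbacks C] (hc : F.HasCocycle Y c) (hd : F.HasCocycle Y d) :
    (Quot.mk _ c : CechH1 J H S) = Quot.mk _ d := by
  obtain ⟨α, hα⟩ := hc
  obtain ⟨β, hβ⟩ := hd
  let W : c.I × d.I → Over S := fun p ↦
    Over.mk (pullback.fst (c.U p.1).hom (d.U p.2).hom ≫ (c.U p.1).hom)
  let ρ : ∀ p : c.I × d.I, W p ⟶ c.U p.1 := fun p ↦
    Over.homMk (pullback.fst (c.U p.1).hom (d.U p.2).hom) rfl
  let σ : ∀ p : c.I × d.I, W p ⟶ d.U p.2 := fun p ↦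
    Over.homMk (pullback.snd (c.U p.1).hom (d.U p.2).hom) pullback.condition.symm
  obtain ⟨ε, hε⟩ := F.exists_isTransition
    (fun p : c.I × d.I ↦ (α p.1).restrict (ρ p).left (Over.w (ρ p)))
  let e : CechCocycle J H S := ⟨c.I × d.I, W, covers_pullback c.covers d.covers, ε⟩
  have h₁ : c.Rel e := ⟨Prod.fst, ρ, hα.isCohomologous hε _ _⟩
  have h₂ : d.Rel e := ⟨Prod.snd, σ, hβ.isCohomologous hε _ _⟩
  exact (Quot.sound h₁).trans (Quot.sound h₂).symm

theorem nonempty_iso [HasPullbacks C] (hJ : J ≤ JC) (hc : F.HasCocycle Y c)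
    (hc' : F.HasCocycle Y' c) : Nonempty (Y.Iso Y') := by
  obtain ⟨α, hα⟩ := hc
  obtain ⟨β, hβ⟩ := hc'
  exact hα.nonempty_iso hβ (covers_mono hJ c.covers)

theorem of_iso (h : F.HasCocycle Y c) (e : Y.Iso Y') : F.HasCocycle Y' c := by
  obtain ⟨α, hα⟩ := h
  refine ⟨fun i ↦ (α i).ofIso e, fun i j V a b n T w x hi hj ↦ ?_⟩
  exact hα i j V a b n T w _ _ _

theorem pullback [HasPullbacks C] {S' : C} {f : S' ⟶ S} {Y' : AdicSpace Th incl Γ S'}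
    (h : F.HasCocycle Y c) (hY : AdicSpace.IsBaseChange f Y' Y) :
    F.HasCocycle Y' (c.pullback f) := by
  obtain ⟨α, hα⟩ := h
  obtain ⟨φ, hφ, hι, hact⟩ := hY
  refine ⟨fun i ↦ (α i).baseChange φ hφ hι hact _ (Limits.pullback.fst (c.U i).hom f)
    pullback.condition, fun i j V a b n T w x hi hj ↦ ?_⟩
  have e : ∀ (i : c.I) (a : V ⟶ (Over.pullback f).obj (c.U i)),
      w ≫ (Th n).map (toBase f a).left =
        (w ≫ (Th n).map a.left) ≫ (Th n).map (Limits.pullback.fst (c.U i).hom f) := by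
    intro i a
    rw [Category.assoc, ← Functor.map_comp]
    congr 2
    simp [toBase, Over.mapPullbackAdj]
  have e' : ∀ (i : c.I) (a : V ⟶ (Over.pullback f).obj (c.U i)),
      x ≫ Y'.π n = (w ≫ (Th n).map a.left) ≫ (Th n).map ((Over.pullback f).obj (c.U i)).hom →
      (x ≫ φ n) ≫ Y.π n = (w ≫ (Th n).map (toBase f a).left) ≫ (Th n).map (c.U i).hom := by
    intro i a h
    rw [Category.assoc, (hφ n).w, ← Category.assoc, h, Category.assoc w, Category.assoc w,
      ← Functor.map_comp, ← Functor.map_comp, Over.w, Category.assoc, ← Functor.map_comp, Over.w]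
    rfl
  have := hα i j ((Over.map f).obj V) (toBase f a) (toBase f b) n T w (x ≫ φ n) (e' i a hi)
    (e' j b hj)
  refine ((α i).congr (e i a).symm rfl _ (e' i a hi)).trans (this.trans (congrArg _ ?_))
  exact (α j).congr (e j b) rfl _ _

end FormalSetting.HasCocycle

section
variable {J J' : GrothendieckTopology C} [HasPullbacks C]

theorem FormalSetting.exists_hasCocycle (F : FormalSetting Th incl Γ H JC JD)
    (Y : AdicTorsor Th incl Γ J S) : ∃ c : CechCocycle J H S, F.HasCocycle Y.toAdicSpace c := by
  obtain ⟨I, U, hU, hα⟩ := Y.locally_trivial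
  obtain ⟨γ, hγ⟩ := F.exists_isTransition (fun i ↦ (hα i).some)
  exact ⟨⟨I, U, hU, γ⟩, _, hγ⟩

/-- A formal space with a cocycle is a torsor. -/
def FormalSetting.HasCocycle.toTorsor {Y : AdicSpace Th incl Γ S} {c : CechCocycle J H S}
    (h : F.HasCocycle Y c) : AdicTorsor Th incl Γ J S :=
  { Y with locally_trivial := ⟨c.I, c.U, c.covers, fun i ↦ ⟨h.choose i⟩⟩ }

/-- The bijection between isomorphism classes of formal torsors and Čech cohomology classes. -/
noncomputable def FormalSetting.cechEquiv (F : FormalSetting Th incl Γ H JC JD) (hJ : J ≤ JC)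
    (hex : ∀ c : CechCocycle J H S, ∃ Y : AdicSpace Th incl Γ S, F.HasCocycle Y c) :
    AdicPHS Th incl Γ J S ≃ CechH1 J H S where
  toFun := Quot.lift (fun Y ↦ Quot.mk _ (F.exists_hasCocycle Y).choose) (by
    rintro Y Y' ⟨e⟩
    exact ((F.exists_hasCocycle Y).choose_spec.of_iso e).mk_eq (F.exists_hasCocycle Y').choose_spec)
  invFun := Quot.lift (fun c ↦ Quot.mk _ (hex c).choose_spec.toTorsor) (by
    intro c d hcd
    exact Quot.sound (((hex c).choose_spec.of_rel hcd).nonempty_iso hJ (hex d).choose_spec))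
  left_inv := by
    rintro ⟨Y⟩
    exact Quot.sound ((hex _).choose_spec.nonempty_iso hJ (F.exists_hasCocycle Y).choose_spec)
  right_inv := by
    rintro ⟨c⟩
    exact FormalSetting.HasCocycle.mk_eq (F.exists_hasCocycle (hex c).choose_spec.toTorsor).choose_spec
      (hex c).choose_spec

/-- The bijection is defined by a choice of trivializations; this computes it from any others, from
which all the naturality statements follow. -/
theorem FormalSetting.cechEquiv_mk (F : FormalSetting Th incl Γ H JC JD) (hJ : J ≤ JC)
    (hex : ∀ c : CechCocycle J H S, ∃ Y : AdicSpace Th incl Γ S, F.HasCocycle Y c)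
    {Y : AdicTorsor Th incl Γ J S} {c : CechCocycle J H S} (h : F.HasCocycle Y.toAdicSpace c) :
    F.cechEquiv hJ hex (Quot.mk _ Y) = Quot.mk _ c :=
  FormalSetting.HasCocycle.mk_eq (F.exists_hasCocycle Y).choose_spec h

/-- Equality of classes is generated by `Rel`, which is not symmetric, so having a given cocycle
must be shown invariant in both directions. Going back from `d` to `c`, a torsor with cocycle `c`
also has cocycle `d` and is therefore isomorphic to `Y`. -/
theorem FormalSetting.HasCocycle.of_mk_eq (hJ : J ≤ JC)
    (hex : ∀ c : CechCocycle J H S, ∃ Y : AdicSpace Th incl Γ S, F.HasCocycle Y c)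
    {Y : AdicSpace Th incl Γ S} {c d : CechCocycle J H S}
    (h : F.HasCocycle Y c) (hcd : (Quot.mk _ c : CechH1 J H S) = Quot.mk _ d) :
    F.HasCocycle Y d := by
  let p : CechH1 J H S → Prop := Quot.lift (fun c ↦ F.HasCocycle Y c) fun c d hr ↦ propext
    ⟨fun h ↦ h.of_rel hr, fun h ↦ by
      obtain ⟨Z, hZ⟩ := hex c
      obtain ⟨e⟩ := (hZ.of_rel hr).nonempty_iso hJ h
      exact hZ.of_iso e⟩
  exact (congrArg p hcd).mp h

/-- If torsors for the finer topology are locally trivial in the coarser one, the Čech cohomology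
sets agree. -/
theorem FormalSetting.bijective_map (F : FormalSetting Th incl Γ H JC JD) (h : J ≤ J') (hJ' : J' ≤ JC)
    (hex : ∀ c : CechCocycle J' H S, ∃ Y : AdicSpace Th incl Γ S, F.HasCocycle Y c)
    (hloc : ∀ {Y : AdicSpace Th incl Γ S} {c : CechCocycle J' H S}, F.HasCocycle Y c →
      ∃ d : CechCocycle J H S, F.HasCocycle Y d) :
    Function.Bijective (CechH1.map h H S) := by
  constructor
  · rintro ⟨c⟩ ⟨d⟩ hcd
    -- The formal torsor of `c` for the finer topology has the cocycle `d` as well. The comparison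
    -- of its two cocycles is then made in the coarser topology, to which both coverings belong.
    obtain ⟨Y, hY⟩ := hex { c with covers := h S c.covers }
    have hY' : F.HasCocycle Y ({ d with covers := h S d.covers } : CechCocycle J' H S) :=
      hY.of_mk_eq hJ' hex hcd
    exact FormalSetting.HasCocycle.mk_eq (F := F) (Y := Y) (c := c) (d := d) hY hY'
  · rintro ⟨c⟩
    obtain ⟨Y, hY⟩ := hex c
    obtain ⟨d, hd⟩ := hloc hY
    refine ⟨Quot.mk _ d, ?_⟩
    exact FormalSetting.HasCocycle.mk_eq (F := F) (Y := Y)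
      (c := { d with covers := h S d.covers }) hd hY

theorem FormalSetting.hasCocycle_trivial [HasBinaryProducts D] (F : FormalSetting Th incl Γ H JC JD)
    {M : D} (e : ∀ T : D, (T ⟶ M) ≃ Γ.obj (op T))
    (he : ∀ (T T' : D) (φ : T ⟶ T') (x : T' ⟶ M), e T (φ ≫ x) = Γ.map φ.op (e T' x))
    (J : GrothendieckTopology C) (S : C) :
    F.HasCocycle (AdicSpace.trivial Γ e he S) (J := J)
      { I := PUnit, U := fun _ ↦ Over.mk (𝟙 S), covers := covers_self J S, cocycle := 1 } := by
  refine ⟨fun _ ↦ AdicSpace.trivialTrivialization Γ e he S, fun i j V a b n T w x hi hj ↦ ?_⟩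
  exact (one_mul _).symm.trans (congrArg (· * _) (map_one (F.red n (V := V.left) w)).symm)

end
end

/-! ### Trivializations from sections, and their lifting. -/

section
variable {C : Type (u + 1)} [Category.{u} C] {D : Type (u + 1)} [Category.{u} D]
  {Th : ℕ → C ⥤ D} {incl : ∀ n, Th n ⟶ Th (n + 1)} {Γ : Dᵒᵖ ⥤ GrpCat.{u}}
  {H : Cᵒᵖ ⥤ GrpCat.{u}} {JC : GrothendieckTopology C} {JD : GrothendieckTopology D}
  {S : C} {I : Type u} {U : I → Over S} {F : FormalSetting Th incl Γ H JC JD}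
  {γ : PresheafOfGroups.OneCocycle (restrictOver H S) U}

namespace FormalSetting.IsTransition
variable {Y : AdicSpace Th incl Γ S} {α : ∀ i, Y.Trivialization (U i).hom}

theorem hom_ext [HasPullbacks C] (hα : F.IsTransition α γ) (hU : Covers JC U) {n : ℕ} {T : D}
    {x y : T ⟶ Y.X n} (h : hα.fam x = hα.fam y) : x = y :=
  (hα.existsUnique_fam_eq hU (hα.fam y)).unique h rfl

/-- The points of a formal torsor over a given point of the base form a principal homogeneous
space. -/
theorem existsUnique_act_eq [HasPullbacks C] (hα : F.IsTransition α γ) (hU : Covers JC U) {n : ℕ}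
    {T : D} {x y : T ⟶ Y.X n} (h : x ≫ Y.π n = y ≫ Y.π n) :
    ∃! g : Γ.obj (op T), Y.act n x g = y := by
  obtain ⟨g, hg, hgu⟩ := Fam.existsUnique_act_eq hU (f := hα.fam x) (f' := hα.fam y) h
  refine ⟨g, hα.hom_ext hU (by rw [hα.fam_act, hg]), fun g₁ hg₁ ↦ hgu g₁ ?_⟩
  change (hα.fam x).act g₁ = _
  rw [← hα.fam_act]
  exact congrArg hα.fam hg₁

/-- A compatible system of sections over the thickenings of `W` defines a trivialization. -/
theorem exists_trivialization [HasPullbacks C] (hα : F.IsTransition α γ) (hU : Covers JC U) {W : C}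
    {f : W ⟶ S} (x : ∀ n, (Th n).obj W ⟶ Y.X n) (hx : ∀ n, x n ≫ Y.π n = (Th n).map f)
    (hι : ∀ n, (incl n).app W ≫ x (n + 1) = x n ≫ Y.ι n) :
    ∃ β : Y.Trivialization f, ∀ (n : ℕ) {T : D} (u : T ⟶ (Th n).obj W)
      (h : (u ≫ x n) ≫ Y.π n = u ≫ (Th n).map f), β.toFun n u (u ≫ x n) h = 1 := by
  -- The coordinate of a point is the element that moves the section `x` to it. Each property of the
  -- trivialization follows from the uniqueness of this element.
  have hPT : ∀ (n : ℕ) {T : D} (u : T ⟶ (Th n).obj W) (y : T ⟶ Y.X n),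
      y ≫ Y.π n = u ≫ (Th n).map f → ∃ g : Γ.obj (op T), Y.act n (u ≫ x n) g = y ∧
        ∀ g' : Γ.obj (op T), Y.act n (u ≫ x n) g' = y → g' = g := fun n T u y h ↦
    hα.existsUnique_act_eq hU (by rw [Category.assoc, hx, h])
  choose d hd hdu using @hPT
  refine ⟨{ toFun := fun n T u y h ↦ d n u y h
            bijective := fun n T u g ↦ ?_
            natural := fun n T T' φ u y h h' ↦ ?_
            equivariant := fun n T u y g h h' ↦ ?_
            compatible := fun n T u y h h' ↦ ?_ }, fun n T u h ↦ ?_⟩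
  · refine ⟨Y.act n (u ≫ x n) g, ⟨by rw [Y.act_π, Category.assoc, hx], ?_⟩, fun y ⟨h, h'⟩ ↦ ?_⟩
    · exact (hdu n u _ _ g rfl).symm
    · rw [← h', hd]
  · refine (hdu n _ _ h' _ ?_).symm
    rw [Category.assoc, ← Y.comp_act, hd]
  · refine (hdu n _ _ h' _ ?_).symm
    rw [Y.act_mul, hd]
  · refine (hdu (n + 1) _ _ h' _ ?_).symm
    rw [Category.assoc, hι, ← Category.assoc, ← Y.act_ι, hd]
  · exact (hdu n u _ h 1 (Y.act_one _ _)).symm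

end FormalSetting.IsTransition

/-- Compatible systems of sections over the thickenings lift along `f : S₀ → S`. -/
def AdicSpace.LiftsSections (Y : AdicSpace Th incl Γ S) {S₀ : C} (f : S₀ ⟶ S) : Prop :=
  ∀ y : ∀ n, (Th n).obj S₀ ⟶ Y.X n, (∀ n, y n ≫ Y.π n = (Th n).map f) →
    (∀ n, (incl n).app S₀ ≫ y (n + 1) = y n ≫ Y.ι n) →
    ∃ x : ∀ n, (Th n).obj S ⟶ Y.X n, (∀ n, x n ≫ Y.π n = 𝟙 _) ∧
      (∀ n, (incl n).app S ≫ x (n + 1) = x n ≫ Y.ι n) ∧ ∀ n, (Th n).map f ≫ x n = y n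

/-- The lifting of trivializations of formal torsors. -/
theorem FormalSetting.IsTransition.exists_lift [HasPullbacks C] {Y : AdicSpace Th incl Γ S}
    {α : ∀ i, Y.Trivialization (U i).hom} (hα : F.IsTransition α γ) (hU : Covers JC U) {S₀ : C}
    {f : S₀ ⟶ S} (hY : Y.LiftsSections f) (α₀ : Y.Trivialization f) :
    ∃ β : Y.Trivialization (𝟙 S), ∀ (n : ℕ) {T : D} (u : T ⟶ (Th n).obj S₀) (x : T ⟶ Y.X n)
      (hx : x ≫ Y.π n = u ≫ (Th n).map f)
      (hx' : x ≫ Y.π n = (u ≫ (Th n).map f) ≫ (Th n).map (𝟙 S)),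
      α₀.toFun n u x hx = β.toFun n (u ≫ (Th n).map f) x hx' := by
  -- The trivialization `α₀` is replaced by its unit sections. A lift of these is the unit section
  -- of the required trivialization.
  obtain ⟨x, hx, hι, hf⟩ := hY (fun n ↦ α₀.pt (𝟙 _) 1)
    (fun n ↦ by rw [α₀.pt_π, Category.id_comp])
    (fun n ↦ by rw [α₀.comp_pt, α₀.pt_incl, map_one, Category.id_comp, Category.comp_id])
  obtain ⟨β, hβ⟩ := hα.exists_trivialization hU (f := 𝟙 S) x
    (fun n ↦ by rw [hx, CategoryTheory.Functor.map_id]) hι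
  refine ⟨β, fun n T u y hy hy' ↦ ?_⟩
  have e : (u ≫ (Th n).map f) ≫ x n = α₀.pt u 1 := by
    rw [Category.assoc, hf, α₀.comp_pt, Category.comp_id, map_one]
  have hy₀ : Y.act n ((u ≫ (Th n).map f) ≫ x n) (α₀.toFun n u y hy) = y := by
    rw [e, α₀.act_pt, one_mul]
    exact (α₀.eq_pt hy rfl).symm
  have h₁ : ((u ≫ (Th n).map f) ≫ x n) ≫ Y.π n = (u ≫ (Th n).map f) ≫ (Th n).map (𝟙 S) := by
    rw [Category.assoc, hx, CategoryTheory.Functor.map_id]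
  have h₂ : Y.act n ((u ≫ (Th n).map f) ≫ x n) (α₀.toFun n u y hy) ≫ Y.π n =
      (u ≫ (Th n).map f) ≫ (Th n).map (𝟙 S) := by rw [hy₀, hy']
  have h₃ := β.equivariant n (u ≫ (Th n).map f) _ (α₀.toFun n u y hy) h₁ h₂
  rw [hβ, one_mul] at h₃
  exact h₃.symm.trans (β.congr rfl hy₀ _ _)

/-- The group functor `H` is a sheaf. -/
theorem FormalSetting.isSheaf_base [HasPullbacks C] (F : FormalSetting Th incl Γ H JC JD) :
    Presieve.IsSheaf JC (H ⋙ forget GrpCat.{u}) := by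
  intro V R hR s hs
  rw [Presieve.compatible_iff_sieveCompatible] at hs
  let σ : ∀ {V' : C} (f : V' ⟶ V), R f → H.obj (op V') := fun f h ↦ s f h
  have hσ : ∀ {V' V'' : C} (g : V'' ⟶ V') (f : V' ⟶ V) (h : R f),
      σ (g ≫ f) (R.downward_closed h g) = H.map g.op (σ f h) := fun g f h ↦ hs f g h
  have σcongr : ∀ {V' : C} {f f' : V' ⟶ V} (e : f = f') (h : R f) (h' : R f'),
      σ f h = σ f' h' := by rintro V' f _ rfl h h'; rfl
  -- The reduction of the given sections at a point depends only on its image in the thickening of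
  -- `V`. Hence these reductions glue to a compatible system of points of `Γ`, which comes from an
  -- element of `H(V)`.
  have indep : ∀ (n : ℕ) {T : D} {V₁ V₂ : C} (f₁ : V₁ ⟶ V) (f₂ : V₂ ⟶ V) (h₁ : R f₁) (h₂ : R f₂)
      (u₁ : T ⟶ (Th n).obj V₁) (u₂ : T ⟶ (Th n).obj V₂),
      u₁ ≫ (Th n).map f₁ = u₂ ≫ (Th n).map f₂ → F.red n u₁ (σ f₁ h₁) = F.red n u₂ (σ f₂ h₂) := by
    intro n T V₁ V₂ f₁ f₂ h₁ h₂ u₁ u₂ h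
    obtain ⟨w, rfl, rfl⟩ := F.exists_lift_pullback (IsPullback.of_hasPullback f₁ f₂) u₁ u₂ h
    rw [← F.red_map, ← F.red_map, ← hσ, ← hσ]
    exact congrArg _ (σcongr pullback.condition _ _)
  let Q : ∀ (n : ℕ) {T : D} (t : T ⟶ (Th n).obj V), Sieve T := fun n T t ↦
    { arrows := fun T' φ ↦ ∃ (V' : C) (f : V' ⟶ V) (u : T' ⟶ (Th n).obj V'), R f ∧
        u ≫ (Th n).map f = φ ≫ t
      downward_closed := by
        rintro _ _ _ ⟨V', f, u, hf, hu⟩ g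
        exact ⟨V', f, g ≫ u, hf, by rw [Category.assoc, hu, Category.assoc]⟩ }
  have hQ : ∀ (n : ℕ) {T : D} (t : T ⟶ (Th n).obj V), Q n t ∈ JD T := fun n T t ↦
    F.covering n hR t fun φ V' f hf u hu ↦ ⟨V', f, u, hf, hu⟩
  have hglue : ∀ (n : ℕ) {T : D} (t : T ⟶ (Th n).obj V), ∃ g : Γ.obj (op T),
      ∀ {T' : D} (φ : T' ⟶ T) {V' : C} (f : V' ⟶ V) (hf : R f) (u : T' ⟶ (Th n).obj V'),
        u ≫ (Th n).map f = φ ≫ t → Γ.map φ.op g = F.red n u (σ f hf) := by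
    intro n T t
    obtain ⟨g, hg, -⟩ := F.glue_group (hQ n t) (fun φ h ↦ F.red n h.choose_spec.choose_spec.choose
      (σ h.choose_spec.choose h.choose_spec.choose_spec.choose_spec.1)) (fun {T' T''} ψ φ h ↦ by
        rw [← F.red_comp]
        have h' : Q n t (ψ ≫ φ) := (Q n t).downward_closed h ψ
        refine indep n _ _ _ _ _ _ ?_
        rw [h'.choose_spec.choose_spec.choose_spec.2, Category.assoc, Category.assoc,
          h.choose_spec.choose_spec.choose_spec.2])
    refine ⟨g, fun φ V' f hf u hu ↦ ?_⟩
    have h : Q n t φ := ⟨V', f, u, hf, hu⟩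
    refine (hg φ h).trans (indep n _ _ _ _ _ _ ?_)
    rw [h.choose_spec.choose_spec.choose_spec.2, hu]
  choose g hg using @hglue
  obtain ⟨h, hh, hhu⟩ := F.existsUnique_red V (fun n T t ↦ g n t)
    (fun n T T' φ t ↦ by
      refine F.group_ext (hQ n (φ ≫ t)) fun ψ hψ ↦ ?_
      obtain ⟨V', f, u, hf, hu⟩ := hψ
      rw [hg n (φ ≫ t) ψ f hf u hu, ← grp_map_comp,
        hg n t (ψ ≫ φ) f hf u (by rw [hu, Category.assoc])])
    (fun n T t ↦ by
      refine F.group_ext (hQ n t) fun ψ hψ ↦ ?_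
      obtain ⟨V', f, u, hf, hu⟩ := hψ
      rw [hg n t ψ f hf u hu, hg (n + 1) (t ≫ (incl n).app V) ψ f hf (u ≫ (incl n).app V') (by
        rw [Category.assoc, ← (incl n).naturality, ← Category.assoc, hu, Category.assoc]),
        F.red_incl])
  refine ⟨h, fun V' f hf ↦ F.red_ext fun n T t ↦ ?_, fun h' hh' ↦ hhu h' fun n T t ↦ ?_⟩
  · refine (F.red_map n f t h).trans ((hh n _).trans ?_)
    have := hg n (t ≫ (Th n).map f) (𝟙 T) f hf t (Category.id_comp _).symm
    rw [grp_map_id] at this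
    exact this
  · refine F.group_ext (hQ n t) fun ψ hψ ↦ ?_
    obtain ⟨V', f, u, hf, hu⟩ := hψ
    rw [hg n t ψ f hf u hu, ← F.red_comp, ← hu]
    refine (F.red_map n f u h').symm.trans (congrArg _ ?_)
    exact hh' f hf

end

/-! ### Torsors under the sheaf of groups and their global points. -/

section
variable {C : Type (u + 1)} [Category.{u} C] {D : Type (u + 1)} [Category.{u} D]
  {Th : ℕ → C ⥤ D} {incl : ∀ n, Th n ⟶ Th (n + 1)} {Γ : Dᵒᵖ ⥤ GrpCat.{u}}
  {H : Cᵒᵖ ⥤ GrpCat.{u}} {JC : GrothendieckTopology C} {JD : GrothendieckTopology D}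
  {S : C} {I : Type u} {U : I → Over S} {F : FormalSetting Th incl Γ H JC JD}
  {γ : PresheafOfGroups.OneCocycle (restrictOver H S) U}

namespace RightSpace
variable (X : RightSpace H S)

/-- The terminal morphism in the category of objects over `S`. -/
abbrev toTerminal (V : Over S) : V ⟶ Over.mk (𝟙 S) := Over.homMk V.hom (Category.comp_id _)

theorem hom_terminal_ext {V : Over S} (a b : V ⟶ Over.mk (𝟙 S)) : a = b :=
  Over.mkIdTerminal.hom_ext a b

/-- The point of `X` over `U` that belongs to a trivialization over `U`. -/
theorem exists_point {U : Over S} (t : (X.restrict U.hom).Trivialization) :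
    ∃ p : X.P.obj (op U),
      (∀ {V : Over S} (a : V ⟶ U) (q : X.P.obj (op V)),
        ∃! h : H.obj (op V.left), X.act (X.P.map a.op p) h = q) ∧
      ∀ (T : Over U.left) (x : X.P.obj (op ((Over.map U.hom).obj T))),
        X.act (X.P.map (Over.homMk T.hom rfl : (Over.map U.hom).obj T ⟶ U).op p)
          (t.equiv T x) = x := by
  let e : U ⟶ (Over.map U.hom).obj (Over.mk (𝟙 U.left)) := Over.homMk (𝟙 _) (by simp)
  let p₀ : X.P.obj (op ((Over.map U.hom).obj (Over.mk (𝟙 U.left)))) :=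
    (t.equiv (Over.mk (𝟙 U.left))).symm 1
  have key : ∀ (T : Over U.left) (c : (Over.map U.hom).obj T ⟶ U), c.left = T.hom →
      ∀ x : X.P.obj (op ((Over.map U.hom).obj T)),
      X.act (X.P.map c.op (X.P.map e.op p₀)) (t.equiv T x) = x := by
    intro T c hc x
    let c₀ : T ⟶ Over.mk (𝟙 U.left) := Over.homMk T.hom (Category.comp_id _)
    have hc₀ : c ≫ e = (Over.map U.hom).map c₀ :=
      Over.OverMorphism.ext ((Category.comp_id _).trans hc)
    rw [← map_op_comp, hc₀]
    apply (t.equiv T).injective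
    refine (t.equivariant (T := T) _ _).trans ?_
    have h : t.equiv T (X.P.map ((Over.map U.hom).map c₀).op p₀) = 1 := by
      refine (t.natural c₀ p₀).trans ?_
      rw [Equiv.apply_symm_apply, map_one]
    exact (congrArg (· * _) h).trans (one_mul _)
  refine ⟨X.P.map e.op p₀, fun {V} a q ↦ ?_, fun T x ↦ key T _ rfl x⟩
  -- The trivialization lives on objects over `U`. The maps `m` and `m'` identify `V` with the
  -- object over `S` obtained from `a : V → U`, whose structure morphism is only propositionally the
  -- same.
  let m : V ⟶ (Over.map U.hom).obj (Over.mk a.left) := Over.homMk (𝟙 _) (by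
    rw [Category.id_comp]; exact Over.w a)
  let m' : (Over.map U.hom).obj (Over.mk a.left) ⟶ V := Over.homMk (𝟙 _) (by
    rw [Category.id_comp]; exact (Over.w a).symm)
  let c : (Over.map U.hom).obj (Over.mk a.left) ⟶ U := Over.homMk a.left rfl
  have hmm' : m ≫ m' = 𝟙 V := Over.OverMorphism.ext (Category.id_comp _)
  have hmc : m ≫ c = a := Over.OverMorphism.ext (Category.id_comp _)
  have hma : m' ≫ a = c := Over.OverMorphism.ext (Category.id_comp _)
  have hH : ∀ h : H.obj (op V.left), H.map m.left.op h = h := fun h ↦ grp_map_id H h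
  have hH' : ∀ h : H.obj (op V.left), H.map m'.left.op h = h := fun h ↦ grp_map_id H h
  have hex : ∀ q : X.P.obj (op V), X.act (X.P.map a.op (X.P.map e.op p₀))
      (t.equiv (Over.mk a.left) (X.P.map m'.op q)) = q := by
    intro q
    have h := congrArg (X.P.map m.op) (key (Over.mk a.left) c rfl (X.P.map m'.op q))
    rw [X.map_act, ← map_op_comp X.P m c, hmc] at h
    have h' : X.P.map m.op (X.P.map m'.op q) = q := by
      rw [← map_op_comp, hmm']; simp
    exact (congrArg _ (hH _).symm).trans (h.trans h')
  refine ⟨_, hex q, fun h hh ↦ ?_⟩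
  have h₁ := congrArg (fun q ↦ t.equiv (Over.mk a.left) (X.P.map m'.op q)) hh
  refine Eq.trans ?_ h₁
  have h₂ : X.P.map m'.op (X.act (X.P.map a.op (X.P.map e.op p₀)) h) =
      X.act (X.P.map c.op (X.P.map e.op p₀)) h := by
    rw [X.map_act, ← map_op_comp X.P m' a, hma]
    exact congrArg _ (hH' h)
  have h₃ : t.equiv (Over.mk a.left) (X.P.map c.op (X.P.map e.op p₀)) = 1 := by
    have h := key (Over.mk a.left) c rfl (X.P.map c.op (X.P.map e.op p₀))
    have h' := (t.equivariant (T := Over.mk a.left) (X.P.map c.op (X.P.map e.op p₀)) _).symm.trans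
      (congrArg (t.equiv (Over.mk a.left)) h)
    exact mul_eq_left.mp h'
  refine Eq.trans ?_ (congrArg (t.equiv (Over.mk a.left)) h₂).symm
  refine Eq.trans ?_ (t.equivariant (T := Over.mk a.left) (X.P.map c.op (X.P.map e.op p₀)) h).symm
  exact ((one_mul h).symm.trans (congrArg (fun z : H.obj (op V.left) ↦ z * h) h₃.symm))

/-- The trivialization that belongs to a global point. -/
theorem exists_trivialization (p : X.P.obj (op (Over.mk (𝟙 S))))
    (hp : ∀ {V : Over S} (q : X.P.obj (op V)),
      ∃! h : H.obj (op V.left), X.act (X.P.map (toTerminal V).op p) h = q) :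
    ∃ α : X.Trivialization, ∀ {V : Over S} (q : X.P.obj (op V)),
      X.act (X.P.map (toTerminal V).op p) (α.equiv V q) = q := by
  have hp' : ∀ {V : Over S} (q : X.P.obj (op V)), ∃ h : H.obj (op V.left),
      X.act (X.P.map (toTerminal V).op p) h = q ∧ ∀ h' : H.obj (op V.left),
        X.act (X.P.map (toTerminal V).op p) h' = q → h' = h := fun q ↦ hp q
  choose d hd hdu using @hp'
  refine ⟨{ equiv := fun V ↦
              { toFun := fun q ↦ d q
                invFun := fun h ↦ X.act (X.P.map (toTerminal V).op p) h
                left_inv := fun q ↦ hd q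
                right_inv := fun h ↦ (hdu _ h rfl).symm }
            natural := fun {V V'} φ q ↦ (hdu _ _ ?_).symm
            equivariant := fun {V} q g ↦ (hdu _ _ ?_).symm }, fun q ↦ hd q⟩
  · rw [hom_terminal_ext (toTerminal V) (φ ≫ toTerminal V'), map_op_comp, ← X.map_act]
    exact congrArg _ (hd q)
  · rw [X.act_mul]
    exact congrArg (X.act · g) (hd q)

end RightSpace

/-- The sieve of the objects over `V` that map to a member of the family `U`. -/
def memberSieve (U : I → Over S) (V : Over S) : Sieve V where
  arrows V' _ := ∃ i, Nonempty (V' ⟶ U i)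
  downward_closed := by
    rintro _ _ _ ⟨i, ⟨a⟩⟩ g
    exact ⟨i, ⟨g ≫ a⟩⟩

theorem memberSieve_mem {J : GrothendieckTopology C} (hU : Covers J U) (V : Over S) :
    memberSieve U V ∈ J.over S V := by
  rw [GrothendieckTopology.mem_over_iff]
  refine J.superset_covering ?_ (J.pullback_stable V.hom hU)
  rintro W g ⟨_, a, _, ⟨i⟩, hab⟩
  rw [Sieve.overEquiv_iff]
  exact ⟨i, ⟨Over.homMk a hab⟩⟩

end

/-! ### Lifting of trivializations of sheaf torsors. -/

section
variable {C : Type (u + 1)} [Category.{u} C] {D : Type (u + 1)} [Category.{u} D]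
  {Th : ℕ → C ⥤ D} {incl : ∀ n, Th n ⟶ Th (n + 1)} {Γ : Dᵒᵖ ⥤ GrpCat.{u}}
  {H : Cᵒᵖ ⥤ GrpCat.{u}} {JC J : GrothendieckTopology C} {JD : GrothendieckTopology D}
  {S S₀ : C} [HasPullbacks C]

/-- A compatible system of points of a formal torsor over the thickenings of `W`, from a section
over `W` of the sheaf of cochains. -/
theorem FormalSetting.IsTransition.exists_sections {I : Type u} {U : I → Over S}
    {F : FormalSetting Th incl Γ H JC JD} {γ : PresheafOfGroups.OneCocycle (restrictOver H S) U}
    {Y : AdicSpace Th incl Γ S} {α : ∀ i, Y.Trivialization (U i).hom} (hα : F.IsTransition α γ)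
    (hU : Covers JC U) {W : Over S}
    (β : ∀ (i : I) {V : Over S}, (V ⟶ U i) → (V ⟶ W) → H.obj (op V.left))
    (hβ : ∀ (i : I) {V V' : Over S} (φ : V' ⟶ V) (a : V ⟶ U i) (b : V ⟶ W),
      β i (φ ≫ a) (φ ≫ b) = H.map φ.left.op (β i a b))
    (hγ : ∀ (i j : I) {V : Over S} (a : V ⟶ U i) (a' : V ⟶ U j) (b : V ⟶ W) {n : ℕ} {T : D}
      (w : T ⟶ (Th n).obj V.left), F.red n w (β i a b) =
        F.red n (V := V.left) w (γ.ev i j a a') * F.red n w (β j a' b)) :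
    ∃ y : ∀ n, (Th n).obj W.left ⟶ Y.X n, (∀ n, y n ≫ Y.π n = (Th n).map W.hom) ∧
      (∀ n, (incl n).app W.left ≫ y (n + 1) = y n ≫ Y.ι n) ∧
      ∀ (n : ℕ) (i : I) {V : Over S} (a : V ⟶ U i) (b : V ⟶ W) {T : D}
        (w : T ⟶ (Th n).obj V.left) (h : (w ≫ (Th n).map b.left ≫ y n) ≫ Y.π n =
          (w ≫ (Th n).map a.left) ≫ (Th n).map (U i).hom),
        F.red n w (β i a b) = (α i).toFun n (w ≫ (Th n).map a.left)
          (w ≫ (Th n).map b.left ≫ y n) h := by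
  have hf := fun n ↦ Fam.exists_of_sections (F := F) (γ := γ) (𝟙 ((Th n).obj W.left)) β hβ
    (fun i j V a a' b T w ↦ hγ i j a a' b w)
  choose f hft hfs using hf
  choose y hy _ using fun n ↦ hα.existsUnique_fam_eq hU (f n)
  have hyt : ∀ n, y n ≫ Y.π n = (Th n).map W.hom := fun n ↦ by
    have h := congrArg Fam.t (hy n)
    rw [hft, Category.id_comp] at h
    exact h
  have key : ∀ (n : ℕ) (i : I) {V : Over S} (a : V ⟶ U i) (b : V ⟶ W) {T : D}
        (w : T ⟶ (Th n).obj V.left) (h : (w ≫ (Th n).map b.left ≫ y n) ≫ Y.π n =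
          (w ≫ (Th n).map a.left) ≫ (Th n).map (U i).hom),
        F.red n w (β i a b) = (α i).toFun n (w ≫ (Th n).map a.left)
          (w ≫ (Th n).map b.left ≫ y n) h := by
    intro n i V a b T w h
    have h₁ : (w ≫ (Th n).map a.left) ≫ (Th n).map (U i).hom =
        (w ≫ (Th n).map b.left) ≫ (f n).t := by
      rw [hft, Category.id_comp, Category.assoc, Category.assoc, ← Functor.map_comp,
        ← Functor.map_comp, Over.w, Over.w]
    have h₂ : (w ≫ (Th n).map a.left) ≫ (Th n).map (U i).hom =
        (w ≫ (Th n).map b.left) ≫ (hα.fam (y n)).t := by rw [h₁, ← hy n]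
    refine (hfs n i _ _ h₁ V a b w rfl (Category.comp_id _).symm).trans ?_
    refine (Fam.congr_s (hy n).symm i rfl rfl h₁ h₂).trans ?_
    exact (α i).congr rfl (Category.assoc _ _ _) _ _
  -- Compatibility for varying n is checked on coordinates. These are reductions of `β`, and `red`
  -- does not change when a point is viewed in the next thickening.
  refine ⟨y, hyt, fun n ↦ hα.hom_ext hU ?_, key⟩
  have hy₁ : (y n ≫ Y.ι n) ≫ Y.π (n + 1) = (Th n).map W.hom ≫ (incl n).app S := by
    rw [Category.assoc, (Y.isPullback n).w, ← Category.assoc, hyt]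
  have hy₂ : ((incl n).app W.left ≫ y (n + 1)) ≫ Y.π (n + 1) =
      (Th n).map W.hom ≫ (incl n).app S := by
    rw [Category.assoc, hyt, ← (incl n).naturality]
  refine Fam.ext_s (hy₂.trans hy₁.symm) fun i T φ u h h' ↦ ?_
  have e₀ : u ≫ (Th (n + 1)).map (U i).hom = (φ ≫ (Th n).map W.hom) ≫ (incl n).app S := by
    rw [h, Category.assoc]
    exact congrArg (φ ≫ ·) hy₂
  obtain ⟨u, rfl, hu⟩ := (F.isPullback_incl n (U i).hom).exists_lift _ _ e₀
  obtain ⟨V, a, b, w, rfl, rfl⟩ := F.exists_overlap u φ hu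
  have nat : ∀ {Z : Over S} (c : V ⟶ Z), (w ≫ (Th n).map c.left) ≫ (incl n).app Z.left =
      (w ≫ (incl n).app V.left) ≫ (Th (n + 1)).map c.left := fun c ↦ by
    rw [Category.assoc, (incl n).naturality, Category.assoc]
  have h₁ : ((w ≫ (incl n).app V.left) ≫ (Th (n + 1)).map b.left ≫ y (n + 1)) ≫ Y.π (n + 1) =
      ((w ≫ (incl n).app V.left) ≫ (Th (n + 1)).map a.left) ≫ (Th (n + 1)).map (U i).hom := by
    rw [Category.assoc, Category.assoc ((Th (n + 1)).map b.left), hyt, Category.assoc _ _ ((Th (n + 1)).map (U i).hom),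
      ← Functor.map_comp, ← Functor.map_comp, Over.w, Over.w]
  have h₂ : (w ≫ (Th n).map b.left ≫ y n) ≫ Y.π n =
      (w ≫ (Th n).map a.left) ≫ (Th n).map (U i).hom := by
    rw [hu, Category.assoc, Category.assoc, hyt, Category.assoc]
  have k₁ := key (n + 1) i a b (w ≫ (incl n).app V.left) h₁
  have k₂ := key n i a b w h₂
  have h₃ : ((w ≫ (Th n).map b.left ≫ y n) ≫ Y.ι n) ≫ Y.π (n + 1) =
      ((w ≫ (Th n).map a.left) ≫ (incl n).app (U i).left) ≫ (Th (n + 1)).map (U i).hom := by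
    rw [Category.assoc, (Y.isPullback n).w, ← Category.assoc, h₂, Category.assoc,
      (incl n).naturality, ← Category.assoc]
  have h₄ := (α i).compatible n (w ≫ (Th n).map a.left) _ h₂ h₃
  refine Eq.trans ((α i).congr (nat a) ?_ _ h₁) (k₁.symm.trans ((F.red_incl n w _).trans
    (k₂.trans (h₄.symm.trans ((α i).congr rfl ?_ _ _)))))
  · rw [← Category.assoc, nat b, Category.assoc]
  · simp only [Category.assoc]

variable (F : FormalSetting Th incl Γ H JC JD)

/-- The lifting of trivializations of torsors under the sheaf of groups `H`. -/
theorem FormalSetting.exists_trivialization_lift (hJ : J ≤ JC) (f : S₀ ⟶ S)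
    (hex : ∀ c : CechCocycle J H S, ∃ Y : AdicSpace Th incl Γ S, F.HasCocycle Y c)
    (hlift : ∀ (Y : AdicSpace Th incl Γ S) (c : CechCocycle J H S), F.HasCocycle Y c →
      Y.LiftsSections f)
    (X : RightSpace H S) (hX : X.IsTorsor J) (α₀ : (X.restrict f).Trivialization) :
    ∃ α : X.Trivialization, ∀ (T : Over S₀) (x : X.P.obj (op ((Over.map f).obj T))),
      α₀.equiv T x = α.equiv ((Over.map f).obj T) x := by
  obtain ⟨hXs, I, U, hU, ht⟩ := hX
  have hXs' : Presieve.IsSheaf (J.over S) X.P := (isSheaf_iff_isSheaf_of_type _ _).1 hXs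
  have hHs : Presieve.IsSheaf (J.over S) (restrictOver H S ⋙ forget GrpCat.{u}) := by
    have h : Presieve.IsSheaf J (H ⋙ forget GrpCat.{u}) := Presieve.isSheaf_of_le _ hJ F.isSheaf_base
    exact (Over.forget S).op_comp_isSheaf_of_isSheaf_type (J := J.over S) h
  have hp' : ∀ i, ∃ p : X.P.obj (op (U i)), ∀ {V : Over S} (a : V ⟶ U i) (q : X.P.obj (op V)),
      ∃ h : H.obj (op V.left), X.act (X.P.map a.op p) h = q ∧
        ∀ h' : H.obj (op V.left), X.act (X.P.map a.op p) h' = q → h' = h := fun i ↦ by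
    obtain ⟨p, hp, -⟩ := X.exists_point (ht i).some
    exact ⟨p, fun a q ↦ hp a q⟩
  choose p d hd hdu using hp'
  have hinj : ∀ (i : I) {V : Over S} (a : V ⟶ U i) {h h' : H.obj (op V.left)},
      X.act (X.P.map a.op (p i)) h = X.act (X.P.map a.op (p i)) h' → h = h' := fun i V a h h' e ↦
    (hdu i a _ h e).trans (hdu i a _ h' rfl).symm
  obtain ⟨p₀, hp₀, hp₀'⟩ := X.exists_point (U := Over.mk f) α₀
  -- The local points satisfy p_j = p_i · ev i j, so `ev` is the cocycle of `X`; the formal torsor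
  -- `Y` below is chosen to have this cocycle too.
  let ev : ∀ (i j : I) {V : Over S} (a : V ⟶ U i) (b : V ⟶ U j), H.obj (op V.left) :=
    fun i j V a b ↦ d i a (X.P.map b.op (p j))
  have hev : ∀ (i j : I) {V : Over S} (a : V ⟶ U i) (b : V ⟶ U j),
      X.act (X.P.map a.op (p i)) (ev i j a b) = X.P.map b.op (p j) := fun i j V a b ↦ hd i a _
  let γ : PresheafOfGroups.OneCocycle (restrictOver H S) U :=
    { ev := fun i j V a b ↦ ev i j a b
      ev_precomp := fun i j V V' φ a b ↦ by
        change H.map φ.left.op (ev i j a b) = ev i j (φ ≫ a) (φ ≫ b)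
        apply hinj i (φ ≫ a)
        rw [hev, map_op_comp, ← X.map_act, hev, ← map_op_comp]
      ev_trans := fun i j l V a b c ↦ by
        change ev i j a b * ev j l b c = ev i l a c
        apply hinj i a
        rw [hev, X.act_mul, hev, hev] }
  obtain ⟨Y, α, hα⟩ := hex ⟨I, U, hU, γ⟩
  have hY := hlift Y ⟨I, U, hU, γ⟩ ⟨α, hα⟩
  -- The coordinates of the point `p₀` of the given trivialization satisfy β_i = ev i j · β_j, hence
  -- they define a compatible system of sections of `Y` over the thickenings of `S₀`.
  let β : ∀ (i : I) {V : Over S}, (V ⟶ U i) → (V ⟶ Over.mk f) → H.obj (op V.left) :=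
    fun i V a b ↦ d i a (X.P.map b.op p₀)
  have hβ : ∀ (i : I) {V : Over S} (a : V ⟶ U i) (b : V ⟶ Over.mk f),
      X.act (X.P.map a.op (p i)) (β i a b) = X.P.map b.op p₀ := fun i V a b ↦ hd i a _
  obtain ⟨y, hy, hyι, hys⟩ := hα.exists_sections (covers_mono hJ hU) (W := Over.mk f) β
    (fun i V V' φ a b ↦ by
      apply hinj i (φ ≫ a)
      rw [hβ, map_op_comp X.P φ a, ← X.map_act, hβ, ← map_op_comp])
    (fun i j V a a' b n T w ↦ by
      have h : β i a b = ev i j a a' * β j a' b := by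
        apply hinj i a
        rw [hβ, X.act_mul, hev, hβ]
      rw [h]
      exact map_mul _ _ _)
  obtain ⟨x, hx, hxι, hxf⟩ := hY y hy hyι
  -- The coordinates of the lifted sections over `U i` form a compatible system of points of `Γ`,
  -- that is, an element of `H(U i)`.
  have hb : ∀ i, ∃ b : H.obj (op (U i).left), ∀ (n : ℕ) {T : D} (w : T ⟶ (Th n).obj (U i).left),
      F.red n w b = (α i).toFun n w (w ≫ (Th n).map (U i).hom ≫ x n)
        (by rw [Category.assoc, Category.assoc, hx, Category.comp_id]) := fun i ↦ by
    refine (F.existsUnique_red (U i).left (fun n T w ↦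
      (α i).toFun n w (w ≫ (Th n).map (U i).hom ≫ x n)
        (by rw [Category.assoc, Category.assoc, hx, Category.comp_id]))
      (fun n T T' φ w ↦ ?_) (fun n T w ↦ ?_)).exists
    · have h : (φ ≫ w ≫ (Th n).map (U i).hom ≫ x n) ≫ Y.π n =
          (φ ≫ w) ≫ (Th n).map (U i).hom := by
        simp only [Category.assoc, hx, Category.comp_id]
      exact ((α i).congr rfl (Category.assoc _ _ _) _ h).trans ((α i).natural n φ w _ _ h)
    · have h : ((w ≫ (Th n).map (U i).hom ≫ x n) ≫ Y.ι n) ≫ Y.π (n + 1) =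
          (w ≫ (incl n).app (U i).left) ≫ (Th (n + 1)).map (U i).hom := by
        rw [Category.assoc, (Y.isPullback n).w]
        simp only [Category.assoc, reassoc_of% hx, NatTrans.naturality]
      refine Eq.trans ((α i).congr rfl ?_ _ h) ((α i).compatible n w _ _ h)
      simp only [Category.assoc, ← hxι, NatTrans.naturality_assoc]
  choose b hb using hb
  have hbγ : ∀ (i j : I) {V : Over S} (a : V ⟶ U i) (a' : V ⟶ U j),
      H.map a.left.op (b i) = ev i j a a' * H.map a'.left.op (b j) := by
    intro i j V a a'
    refine F.red_ext fun n T w ↦ ?_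
    rw [map_mul, F.red_map, F.red_map, hb, hb]
    have e : ∀ (i : I) (a : V ⟶ U i), (w ≫ (Th n).map a.left) ≫ (Th n).map (U i).hom ≫ x n =
        w ≫ (Th n).map V.hom ≫ x n := fun i a ↦ by
      rw [Category.assoc, ← Functor.map_comp_assoc, Over.w]
    have e' : ∀ (i : I) (a : V ⟶ U i), (w ≫ (Th n).map V.hom ≫ x n) ≫ Y.π n =
        (w ≫ (Th n).map a.left) ≫ (Th n).map (U i).hom := fun i a ↦ by
      rw [Category.assoc, Category.assoc, hx, Category.comp_id, Category.assoc,
        ← Functor.map_comp, Over.w]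
    refine ((α i).congr rfl (e i a) _ (e' i a)).trans ((hα i j V a a' n T w _ (e' i a)
      (e' j a')).trans (congrArg _ ((α j).congr rfl (e j a').symm _ _)))
  -- Since b_i = ev i j · b_j, the points p_i · b_i agree on overlaps. They glue to a global point
  -- `P` of `X`, which gives the trivialization.
  let q : ∀ i, X.P.obj (op (U i)) := fun i ↦ X.act (p i) (b i)
  have hq : ∀ (i : I) {V : Over S} (a : V ⟶ U i), X.P.map a.op (q i) =
      X.act (X.P.map a.op (p i)) (H.map a.left.op (b i)) := fun i V a ↦ X.map_act a _ _
  have hqq : ∀ (i j : I) {V : Over S} (a : V ⟶ U i) (a' : V ⟶ U j),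
      X.P.map a.op (q i) = X.P.map a'.op (q j) := by
    intro i j V a a'
    rw [hq, hq, hbγ i j a a', X.act_mul, hev]
  obtain ⟨P, hP, -⟩ := existsUnique_glue hXs' (memberSieve_mem hU (Over.mk (𝟙 S)))
    (fun φ h ↦ X.P.map h.choose_spec.some.op (q h.choose)) (fun ψ φ h ↦ by
      rw [← map_op_comp]
      exact hqq _ _ _ _)
  have hP' : ∀ {V : Over S} (φ : V ⟶ Over.mk (𝟙 S)) (i : I) (a : V ⟶ U i),
      X.P.map φ.op P = X.P.map a.op (q i) := fun φ i a ↦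
    (hP φ ⟨i, ⟨a⟩⟩).trans (hqq _ _ _ _)
  have hPloc : ∀ {V : Over S} (i : I) (a : V ⟶ U i) (z : X.P.obj (op V)),
      ∃! h : H.obj (op V.left), X.act (X.P.map (RightSpace.toTerminal V).op P) h = z := by
    intro V i a z
    have e : ∀ h, X.act (X.P.map (RightSpace.toTerminal V).op P) h =
        X.act (X.P.map a.op (p i)) (H.map a.left.op (b i) * h) := fun h ↦ by
      rw [hP' _ i a, hq, X.act_mul]
    refine ⟨(H.map a.left.op (b i))⁻¹ * d i a z, ?_, fun h hh ↦ ?_⟩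
    · change X.act _ _ = _
      rw [e, mul_inv_cancel_left, hd]
    · rw [eq_inv_mul_iff_mul_eq]
      exact hdu i a z _ ((e h).symm.trans hh)
  have hres : ∀ {V V' : Over S} (φ : V' ⟶ V), X.P.map (RightSpace.toTerminal V').op P =
      X.P.map φ.op (X.P.map (RightSpace.toTerminal V).op P) := fun φ ↦ by
    rw [← map_op_comp]
    exact congrArg (fun m ↦ X.P.map m.op P) (RightSpace.hom_terminal_ext _ _)
  have hglue : ∀ {V : Over S} (s : ∀ {V' : Over S} (φ : V' ⟶ V), memberSieve U V φ →
      H.obj (op V'.left)), (∀ {V' V'' : Over S} (ψ : V'' ⟶ V') (φ : V' ⟶ V) (h : memberSieve U V φ),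
        s (ψ ≫ φ) ((memberSieve U V).downward_closed h ψ) = H.map ψ.left.op (s φ h)) →
      ∃! x : H.obj (op V.left), ∀ {V' : Over S} (φ : V' ⟶ V) (h : memberSieve U V φ),
        H.map φ.left.op x = s φ h := fun s hs ↦ existsUnique_glue hHs (memberSieve_mem hU _) s hs
  have hPloc' : ∀ {V V' : Over S} (φ : V' ⟶ V) (hφ : memberSieve U V φ) (z : X.P.obj (op V')),
      ∃ h : H.obj (op V'.left), X.act (X.P.map (RightSpace.toTerminal V').op P) h = z ∧
        ∀ h', X.act (X.P.map (RightSpace.toTerminal V').op P) h' = z → h' = h :=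
    fun φ hφ z ↦ hPloc hφ.choose hφ.choose_spec.some z
  choose δ hδ hδu using @hPloc'
  obtain ⟨α', hα'⟩ := X.exists_trivialization P (fun {V} z ↦ by
    obtain ⟨h, hh, hhu⟩ := hglue (V := V) (fun {V'} φ hφ ↦ δ φ hφ (X.P.map φ.op z))
      (fun {V' V''} ψ φ hφ ↦ by
        refine (hδu _ _ _ _ ?_).symm
        rw [hres ψ, map_op_comp X.P ψ φ, ← X.map_act, hδ])
    refine ⟨h, sheaf_ext hXs' (memberSieve_mem hU V) fun {V'} φ hφ ↦ ?_, fun h' hh' ↦ hhu h' ?_⟩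
    · rw [X.map_act, ← hres, hh φ hφ, hδ]
    · intro V' φ hφ
      refine hδu _ _ _ _ ?_
      rw [hres φ, ← X.map_act]
      exact congrArg _ hh')
  -- The lifted sections restrict to those of `p₀`, so the coordinates `b i` restrict to `β i`; as
  -- `X` is separated, `P` lies over `p₀`.
  have hPp : X.P.map (RightSpace.toTerminal (Over.mk f)).op P = p₀ := by
    refine sheaf_ext hXs' (memberSieve_mem hU (Over.mk f)) ?_
    rintro V m ⟨i, ⟨a⟩⟩
    rw [← map_op_comp, hP' _ i a, hq, ← hβ i a m]
    refine congrArg _ (F.red_ext fun n T w ↦ ?_)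
    have e : (w ≫ (Th n).map a.left) ≫ (Th n).map (U i).hom ≫ x n =
        w ≫ (Th n).map m.left ≫ y n := by
      rw [← hxf, Category.assoc, ← Functor.map_comp_assoc, ← Functor.map_comp_assoc, Over.w]
      congr 3
      exact (Over.w m).symm
    have e' : (w ≫ (Th n).map m.left ≫ y n) ≫ Y.π n =
        (w ≫ (Th n).map a.left) ≫ (Th n).map (U i).hom := by
      rw [← e]
      simp only [Category.assoc, hx, Category.comp_id]
    rw [F.red_map, hb, hys n i a m w e']
    exact (α i).congr rfl e _ _
  refine ⟨α', fun T z ↦ ?_⟩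
  have h₁ := hp₀' T z
  have h₂ := hα' (V := (Over.map f).obj T) z
  refine (hp₀ (Over.homMk T.hom rfl : (Over.map f).obj T ⟶ Over.mk f) z).unique h₁ ?_
  rw [← hPp, ← hres]
  exact h₂

end

/-! ### Application to `K'` and `G'`: existence, affineness and smoothness. -/

section
variable {k A : Type u} [Field k] [CommRing A] [HopfAlgebra k A] (Q : ClosedSubgroupScheme k A)

theorem isSheaf_yoneda_over {B : Scheme.{u}} (Z : Over B) :
    Presieve.IsSheaf (Scheme.fpqcTopology.over B) (yoneda.obj Z) :=
  GrothendieckTopology.Subcanonical.isSheaf_of_isRepresentable _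

/-- `G'` is represented by a scheme, and the fpqc topology is subcanonical. -/
theorem isSheaf_modelGroup :
    Presieve.IsSheaf (Scheme.fpqcTopology.over (Spec (CommRingCat.of k⟦X⟧)))
      (modelGroup Q ⋙ forget GrpCat.{u}) := by
  refine Presieve.isSheaf_iso _ (NatIso.ofComponents (fun T ↦ (modelPoint Q T.unop).toIso) ?_)
    (isSheaf_yoneda_over (modelScheme Q))
  intro T T' φ
  ext x
  exact modelPoint_comp Q φ.unop x

/-- The group functors `K'` and `G'`. -/
noncomputable def formalSetting : FormalSetting (thick k) (thickIncl k) (modelGroup Q) (loopGroup Q)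
    (Scheme.fpqcTopology.over (Spec (CommRingCat.of k)))
    (Scheme.fpqcTopology.over (Spec (CommRingCat.of k⟦X⟧))) where
  red n _ _ t := reduction Q n t
  red_comp n _ _ _ φ t h := (isDilatation_inclHom (Q := Q)).red_comp (H := dilatation Q) φ t h
  red_map n _ _ _ f t h := (isDilatation_inclHom (Q := Q)).red_map (H := dilatation Q) f t h
  red_incl n _ _ t h := (isDilatation_inclHom (Q := Q)).red_incl (H := dilatation Q) t h
  existsUnique_red V g hg hg' :=
    (isDilatation_inclHom (Q := Q)).existsUnique_red (H := dilatation Q) V g hg hg'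
  exists_unit n _ _ t := exists_thick_unit t
  isPullback_incl n _ _ f := thickIncl_isPullback f
  covering n _ _ hSv _ t _ hR := thick_covering hSv t hR
  isSheaf_group := isSheaf_modelGroup Q
  isSheaf_yoneda Z := isSheaf_yoneda_over Z

theorem isTransitionCocycle_iff {S : SchOver k} {Y : FormalSpace Q S} {I : Type u} {U : I → Over S}
    {α : ∀ i, Y.Trivialization (U i).hom}
    {γ : PresheafOfGroups.OneCocycle (restrictOver (loopGroup Q) S) U} :
    IsTransitionCocycle Y U α γ ↔ (formalSetting Q).IsTransition α γ := by
  refine forall_congr' fun i ↦ forall_congr' fun j ↦ forall_congr' fun V ↦ forall_congr' fun a ↦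
    forall_congr' fun b ↦ forall_congr' fun n ↦ forall_congr' fun T ↦ forall_congr' fun t ↦
    forall_congr' fun x ↦ forall_congr' fun hi ↦ forall_congr' fun hj ↦ ⟨?_, fun h ↦ ?_⟩
  · rintro ⟨g, hg, h⟩
    have hg' := (isReduction_iff (Q := Q) (V := V.left) (γ.ev i j a b) t g).1 hg
    rw [hg'] at h
    exact h
  · exact ⟨_, (isReduction_iff (V := V.left) _ _ _).2 rfl, h⟩

end

section
variable {k A : Type u} [Field k] [CommRing A] [HopfAlgebra k A] {Q : ClosedSubgroupScheme k A}

theorem isAffineHom_smooth_spec (R E : Type u) [CommRing R] [CommRing E] [Algebra R E]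
    (h : Algebra.Smooth R E) :
    IsAffineHom (Spec.map (CommRingCat.ofHom (algebraMap R E))) ∧
      Smooth (Spec.map (CommRingCat.ofHom (algebraMap R E))) := by
  refine ⟨inferInstance, ?_⟩
  rw [HasRingHomProperty.Spec_iff (P := @Smooth)]
  exact (RingHom.smooth_algebraMap).2 h

theorem Over.isPullback_prod_left {B : Scheme.{u}} (M W : Over B) :
    IsPullback (prod.fst : M ⨯ W ⟶ M).left (prod.snd : M ⨯ W ⟶ W).left M.hom W.hom := by
  refine IsPullback.of_iso_pullback ⟨?_⟩ (Over.prodLeftIsoPullback M W)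
    (Over.prodLeftIsoPullback_hom_fst M W) (Over.prodLeftIsoPullback_hom_snd M W)
  rw [Over.w, Over.w]

theorem isAffineHom_smooth_prod_snd (h : Algebra.Smooth k⟦X⟧ (dilatation Q)) (W : SchOver k⟦X⟧) :
    IsAffineHom (prod.snd : modelScheme Q ⨯ W ⟶ W).left ∧
      Smooth (prod.snd : modelScheme Q ⨯ W ⟶ W).left := by
  obtain ⟨h₁, h₂⟩ : IsAffineHom (modelScheme Q).hom ∧ Smooth (modelScheme Q).hom :=
    isAffineHom_smooth_spec k⟦X⟧ (dilatation Q) h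
  have hp := Over.isPullback_prod_left (modelScheme Q) W
  exact ⟨MorphismProperty.of_isPullback (P := @IsAffineHom) hp h₁,
    MorphismProperty.of_isPullback (P := @Smooth) hp h₂⟩

variable {J : GrothendieckTopology (SchOver k)} {S : SchOver k} {I : Type u} {U : I → Over S}

/-- The sheaf of points has sections over the members of the covering, and over any `W` with a
section it is `G' × W`, which is affine and smooth over `W`. So fpqc descent for affine morphisms
applies. -/
theorem exists_isUniversalOver_fam (h : Algebra.Smooth k⟦X⟧ (dilatation Q))
    (hU : Covers (Scheme.fpqcTopology.over (Spec (CommRingCat.of k))) U)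
    (γ : PresheafOfGroups.OneCocycle (restrictOver (loopGroup Q) S) U) (n : ℕ) :
    ∃ (Y : SchOver k⟦X⟧) (π : Y ⟶ (thick k n).obj S)
      (y : (Fam.functor (formalSetting Q) γ n).obj (op Y)), IsAffineHom π.left ∧ Smooth π.left ∧
        IsUniversalOver (Fam.functor (formalSetting Q) γ n) (Fam.base n) (𝟙 _) π y := by
  refine exists_isUniversalOver_over Fam.isSheaf_functor (fun φ f ↦ Fam.base_map φ f) ?_
    ((formalSetting Q).coverSieve_mem hU (𝟙 ((thick k n).obj S))) ?_
  · rintro W w f rfl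
    obtain ⟨h₁, h₂⟩ := isAffineHom_smooth_prod_snd h W
    exact ⟨_, _, _, h₁, h₂, Fam.isUniversalOver_prod (modelPoint Q)
      (fun _ _ φ x ↦ modelPoint_comp Q φ x) hU (f : Fam (formalSetting Q) γ n W)⟩
  · rintro W w ⟨i, u, hu⟩
    obtain ⟨f, hf⟩ := Fam.exists_base_eq (F := formalSetting Q) (γ := γ) i u
    exact ⟨f, hf.trans (hu.trans (Category.comp_id _))⟩

/-- Every cocycle is the cocycle of a formal torsor. -/
theorem exists_hasCocycle (h : Algebra.Smooth k⟦X⟧ (dilatation Q))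
    (hJ : J ≤ Scheme.fpqcTopology.over (Spec (CommRingCat.of k)))
    (c : CechCocycle J (loopGroup Q) S) :
    ∃ Y : FormalSpace Q S, (formalSetting Q).HasCocycle Y c := by
  choose Y π y _ _ hy using exists_isUniversalOver_fam h (covers_mono hJ c.covers) c.cocycle
  refine exists_isTransition_of_universal (covers_mono hJ c.covers)
    (fun n ↦ (y n : Fam (formalSetting Q) c.cocycle n (Y n))) fun n T f ↦ ?_
  obtain ⟨x, hx, hxu⟩ := (hy n).2 (Fam.base n T f) f (Category.comp_id _).symm
  refine ⟨x, hx.2, fun x' hx' ↦ hxu x' ⟨?_, hx'⟩⟩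
  have e := congrArg Fam.t hx'
  have e' : Fam.t (y n : Fam (formalSetting Q) c.cocycle n (Y n)) = π n :=
    (hy n).1.trans (Category.comp_id _)
  exact (congrArg (x' ≫ ·) e'.symm).trans e

/-- The reductions of formal torsors are affine and smooth. -/
theorem FormalSetting.HasCocycle.isAffineHom_smooth (h : Algebra.Smooth k⟦X⟧ (dilatation Q))
    (hJ : J ≤ Scheme.fpqcTopology.over (Spec (CommRingCat.of k)))
    {c : CechCocycle J (loopGroup Q) S} {Y : FormalSpace Q S}
    (hY : (formalSetting Q).HasCocycle Y c) (n : ℕ) :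
    IsAffineHom (Y.π n).left ∧ Smooth (Y.π n).left := by
  obtain ⟨α, hα⟩ := hY
  -- The reduction of `Y` and the scheme constructed by descent carry universal sections of the same
  -- functor; a cartesian square over the identity transfers the two properties.
  have hu := hα.isUniversalOver (covers_mono hJ c.covers) n
  obtain ⟨Z, π, z, h₁, h₂, hz⟩ := exists_isUniversalOver_fam h (covers_mono hJ c.covers) c.cocycle n
  obtain ⟨r, ⟨hr, hr'⟩, -⟩ := hz.2 (Y.π n) _ hu.1
  have hp := (hu.isPullback (fun φ f ↦ Fam.base_map φ f) hz (Category.id_comp _)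
    (hr.trans (Category.comp_id _).symm) hr').map (Over.forget _)
  exact ⟨MorphismProperty.of_isPullback (P := @IsAffineHom) hp h₁,
    MorphismProperty.of_isPullback (P := @Smooth) hp h₂⟩

end

/-! ### Smoothness of the dilatation. -/

theorem isAdicComplete_sq {R M : Type*} [CommRing R] [AddCommGroup M] [Module R M] (I : Ideal R)
    [h : IsAdicComplete I M] : IsAdicComplete (I ^ 2) M := by
  have hle (n : ℕ) : ((I ^ 2) ^ n • ⊤ : Submodule R M) ≤ I ^ n • ⊤ := by
    rw [← pow_mul]
    exact Submodule.smul_mono_left (Ideal.pow_le_pow_right (by omega))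
  refine @IsAdicComplete.mk R _ (I ^ 2) M _ _ ⟨fun x hx ↦ h.haus' x fun n ↦ (hx n).mono (hle n)⟩
    ⟨fun f hf ↦ ?_⟩
  obtain ⟨L, hL⟩ := h.prec' f fun {m n} hmn ↦ (hf hmn).mono (hle m)
  refine ⟨L, fun n ↦ (hf (show n ≤ 2 * n by omega)).trans ?_⟩
  have := hL (2 * n)
  rwa [pow_mul] at this

section
variable {k A P C : Type u} [CommRing k] [CommRing A] [CommRing P] [CommRing C] [Algebra k A]
  [Algebra k P] [Algebra A P] [IsScalarTower k A P] [Algebra k C] [Algebra A C]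
  [IsScalarTower k A C]

/-- A derivation is the first order part of a homomorphism into power series. -/
theorem exists_powerSeries_of_derivation [Algebra.FormallySmooth k A] (δ : Derivation k A C) :
    ∃ h : A →ₐ[k] C⟦X⟧, (∀ a, PowerSeries.constantCoeff (h a) = algebraMap A C a) ∧
      ∀ a, PowerSeries.coeff 1 (h a) = δ a := by
  let I : Ideal C⟦X⟧ := Ideal.span {X}
  have hI {x : C⟦X⟧} : x ∈ I ^ 2 ↔ X ^ 2 ∣ x := by
    rw [Ideal.span_singleton_pow, Ideal.mem_span_singleton]
  have : IsAdicComplete (I ^ 2) C⟦X⟧ := isAdicComplete_sq I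
  -- By the Leibniz rule a ↦ a + δ(a)X is multiplicative modulo X². Formal smoothness lifts it to
  -- `C⟦X⟧`, which is complete for the ideal (X²).
  let g (a : A) : C⟦X⟧ := PowerSeries.C (algebraMap A C a) + X * PowerSeries.C (δ a)
  let g' : A →ₐ[k] C⟦X⟧ ⧸ I ^ 2 := AlgHom.ofLinearMap
    { toFun a := Ideal.Quotient.mk _ (g a)
      map_add' a b := by
        rw [← map_add]; congr 1; simp only [g, map_add]; ring
      map_smul' r a := by
        rw [RingHom.id_apply, Algebra.smul_def r (Ideal.Quotient.mk (I ^ 2) (g a))]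
        change _ = Ideal.Quotient.mk (I ^ 2) (algebraMap k C⟦X⟧ r) * _
        rw [← map_mul]; congr 1
        simp only [g, Algebra.smul_def, map_mul, mul_add, Derivation.leibniz,
          Derivation.map_algebraMap, map_add, map_zero,
          ← IsScalarTower.algebraMap_apply]
        have : (algebraMap k C⟦X⟧) r = PowerSeries.C (algebraMap k C r) :=
          PowerSeries.algebraMap_apply
        rw [this]
        ring }
    (by
      change Ideal.Quotient.mk _ (g 1) = 1
      simp [g])
    (fun a b ↦ by
      change Ideal.Quotient.mk _ (g (a * b)) = Ideal.Quotient.mk _ (g a) * Ideal.Quotient.mk _ (g b)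
      rw [← map_mul, eq_comm, Ideal.Quotient.eq, hI]
      refine ⟨PowerSeries.C (δ a * δ b), ?_⟩
      simp only [g, map_mul, Derivation.leibniz, map_add, Algebra.smul_def]
      ring)
  obtain ⟨h, hh⟩ := Algebra.FormallySmooth.exists_mkₐ_comp_eq_of_isAdicComplete g'
  have key (a : A) : ∃ x, h a = g a + X ^ 2 * x := by
    have : Ideal.Quotient.mk (I ^ 2) (h a) = Ideal.Quotient.mk _ (g a) := DFunLike.congr_fun hh a
    obtain ⟨x, hx⟩ := hI.1 (Ideal.Quotient.eq.1 this)
    exact ⟨x, by rw [← hx]; ring⟩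
  refine ⟨h, fun a ↦ ?_, fun a ↦ ?_⟩
  · obtain ⟨x, hx⟩ := key a
    rw [hx]
    simp [g]
  · obtain ⟨x, hx⟩ := key a
    rw [hx, pow_two, mul_assoc, map_add, show 1 = 0 + 1 from rfl, PowerSeries.coeff_succ_X_mul]
    simp only [g, map_add]
    rw [show 0 + 1 = 1 from rfl, PowerSeries.coeff_C, show 1 = 0 + 1 from rfl, PowerSeries.coeff_succ_X_mul]
    simp

/-- Deformation of the homomorphism `A → P → C` with prescribed normal direction modulo `J`. -/
theorem exists_powerSeries_of_normal [Algebra.FormallySmooth k A] [Algebra.FormallySmooth k P]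
    (hP : Function.Surjective (algebraMap A P)) (J : Ideal C)
    (hC : ∀ b, algebraMap A P b = 0 → algebraMap A C b = 0)
    (ψ : RingHom.ker (algebraMap A P) →ₗ[A] C ⧸ J) :
    ∃ h : A →ₐ[k] C⟦X⟧, (∀ a, PowerSeries.constantCoeff (h a) = algebraMap A C a) ∧
      ∀ b : RingHom.ker (algebraMap A P),
        Ideal.Quotient.mk J (PowerSeries.coeff 1 (h b)) = ψ b := by
  -- Smoothness of `P` splits the conormal sequence, so a linear functional on the kernel ideal
  -- extends to the differentials of `A` over `k`, as long as that ideal acts by zero on the target.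
  obtain ⟨l, hl⟩ := (Algebra.FormallySmooth.iff_split_injection (R := k) hP).1 inferInstance
  let ψ' : (RingHom.ker (algebraMap A P)).Cotangent →ₗ[A] C ⧸ J := Submodule.liftQ _ ψ <| by
    rw [Submodule.smul_le]
    intro r hr x _
    have h0 : algebraMap A C r = 0 := hC r hr
    rw [LinearMap.mem_ker, map_smul, ← algebraMap_smul C, h0, zero_smul]
  let m : Ω[A⁄k] →ₗ[A] C ⧸ J := ψ' ∘ₗ l ∘ₗ TensorProduct.mk A P Ω[A⁄k] 1
  -- The module of differentials of a formally smooth algebra is projective; this lifts the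
  -- functional from `C ⧸ J` to `C`, where it is a derivation.
  obtain ⟨L, hL⟩ := Module.projective_lifting_property
    ((Ideal.Quotient.mkₐ A J).toLinearMap) m Ideal.Quotient.mk_surjective
  obtain ⟨h, h₀, h₁⟩ := exists_powerSeries_of_derivation (L.compDer (KaehlerDifferential.D k A))
  refine ⟨h, h₀, fun b ↦ ?_⟩
  rw [h₁]
  have e₁ := DFunLike.congr_fun hL (KaehlerDifferential.D k A b)
  refine e₁.trans ?_
  have e₂ := DFunLike.congr_fun hl (Ideal.toCotangent _ b)
  exact congrArg ψ' e₂
end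

section
variable {k A H C : Type u} [Field k] [CommRing A] [HopfAlgebra k A] {Q : ClosedSubgroupScheme k A}
  [CommRing H] [HopfAlgebra k⟦X⟧ H] [Algebra k H] [IsScalarTower k k⟦X⟧ H] {i : A →ₐ[k] H}
  [CommRing C] [Algebra k⟦X⟧ C]

/-- Where z is invertible the divisibility condition is void, so homomorphisms from `H` are
homomorphisms from `A`, and these lift because `A` is formally smooth. -/
theorem IsDilatation.exists_lift_of_isUnit [Algebra.FormallySmooth k A] (hi : IsDilatation Q i)
    (J : Ideal C) (hJ : J ^ 2 = ⊥) (hC : IsUnit (algebraMap k⟦X⟧ C X))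
    (φ : H →ₐ[k⟦X⟧] C ⧸ J) :
    ∃ f : H →ₐ[k⟦X⟧] C, (Ideal.Quotient.mkₐ k⟦X⟧ J).comp f = φ := by
  let _ : Algebra k C := Algebra.compHom C (algebraMap k k⟦X⟧)
  have : IsScalarTower k k⟦X⟧ C := .of_algebraMap_eq fun _ ↦ rfl
  obtain ⟨g, hg⟩ := Algebra.FormallySmooth.exists_lift J ⟨2, hJ⟩ ((φ.restrictScalars k).comp i)
  obtain ⟨f, hf⟩ := hi.exists_lift hC.mem_nonZeroDivisors g fun _ _ ↦ hC.dvd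
  refine ⟨f, hi.hom_ext ?_ _ _ fun a ↦ ?_⟩
  · exact (hC.map (Ideal.Quotient.mk J)).mem_nonZeroDivisors
  · rw [AlgHom.comp_apply, hf]
    exact DFunLike.congr_fun hg a

theorem algebraMap_eq_of_algebraMap_X_eq_zero (hC : algebraMap k⟦X⟧ C X = 0) (f : k⟦X⟧) :
    algebraMap k⟦X⟧ C f = algebraMap k⟦X⟧ C (PowerSeries.C (PowerSeries.constantCoeff f)) := by
  conv_lhs => rw [PowerSeries.eq_X_mul_shift_add_const f, map_add, map_mul, hC, zero_mul, zero_add]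

/-- As z = 0 in `C`, the restriction of `φ` to `A` factors through the coordinate ring of Q, which
is smooth, so it lifts to some `g`. What remains of `φ` are its values on the elements z⁻¹b, an
`A`-linear map `ψ` on the ideal of Q. A deformation A → C⟦X⟧ of `g` with first order term `ψ` modulo
`J` extends to `H` with z ↦ X. Its constant term is the lift, since the extension sends z⁻¹b to
X⁻¹h(b), whose constant term is the linear coefficient of h(b). -/
theorem IsDilatation.exists_lift_of_eq_zero [Algebra.FormallySmooth k A]
    [Algebra.FormallySmooth k Q.coord] (hi : IsDilatation Q i)
    (hX : algebraMap k⟦X⟧ H X ∈ nonZeroDivisors H)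
    (hadj : Algebra.adjoin k⟦X⟧ (Set.range i ∪
      {d | ∃ b, Q.res b = 0 ∧ algebraMap k⟦X⟧ H X * d = i b}) = ⊤)
    (J : Ideal C) (hJ : J ^ 2 = ⊥) (hC : algebraMap k⟦X⟧ C X = 0) (φ : H →ₐ[k⟦X⟧] C ⧸ J) :
    ∃ f : H →ₐ[k⟦X⟧] C, (Ideal.Quotient.mkₐ k⟦X⟧ J).comp f = φ := by
  let _ : Algebra k C := Algebra.compHom C (algebraMap k k⟦X⟧)
  have : IsScalarTower k k⟦X⟧ C := .of_algebraMap_eq fun _ ↦ rfl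
  have hφ : φ (algebraMap k⟦X⟧ H X) = 0 := by
    rw [AlgHom.commutes]
    exact (congrArg (Ideal.Quotient.mk J) hC).trans (map_zero _)
  have hker (b : A) (hb : Q.res b = 0) : φ (i b) = 0 := by
    obtain ⟨d, hd⟩ := hi.exists_quot b hb
    rw [← hd, map_mul, hφ, zero_mul]
  obtain ⟨g, hg⟩ := Algebra.FormallySmooth.exists_lift J ⟨2, hJ⟩
    (AlgHom.liftOfSurjective (Q.res : A →ₐ[k] Q.coord) Q.surjective
      ((φ.restrictScalars k).comp i) (fun b hb ↦ hker b hb))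
  replace hg (a : A) : Ideal.Quotient.mk J (g (Q.res a)) = φ (i a) := by
    refine (DFunLike.congr_fun hg (Q.res a)).trans ?_
    exact AlgHom.liftOfSurjective_apply _ _ _ _ a
  let _ : Algebra A Q.coord := (Q.res : A →ₐ[k] Q.coord).toRingHom.toAlgebra
  let _ : Algebra A C := (g.comp (Q.res : A →ₐ[k] Q.coord)).toRingHom.toAlgebra
  have : IsScalarTower k A Q.coord := .of_algebraMap_eq fun r ↦ ((Q.res : A →ₐ[k] Q.coord).commutes r).symm
  have : IsScalarTower k A C := .of_algebraMap_eq fun r ↦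
    ((g.comp (Q.res : A →ₐ[k] Q.coord)).commutes r).symm
  have hsmul (a : A) (x : C ⧸ J) : a • x = φ (i a) * x := by
    rw [← hg, Algebra.smul_def]
    rfl
  choose q hq using fun b : RingHom.ker (algebraMap A Q.coord) ↦ hi.exists_quot b b.2
  have hq' {d d' : H} (h : algebraMap k⟦X⟧ H X * d = algebraMap k⟦X⟧ H X * d') : d = d' :=
    (mul_cancel_left_mem_nonZeroDivisors hX).1 h
  let ψ : RingHom.ker (algebraMap A Q.coord) →ₗ[A] C ⧸ J :=
    { toFun b := φ (q b)
      map_add' b c := by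
        rw [← map_add]
        exact congrArg φ (hq' (by rw [hq, mul_add, hq, hq, ← map_add]; rfl))
      map_smul' a b := by
        rw [RingHom.id_apply, hsmul, ← map_mul]
        refine congrArg φ (hq' ?_)
        rw [hq, mul_left_comm, hq, ← map_mul]
        rfl }
  obtain ⟨h, h₀, h₁⟩ := exists_powerSeries_of_normal (k := k) (P := Q.coord) Q.surjective J
    (fun b hb ↦ (congrArg g hb).trans (map_zero g)) ψ
  have hXC : algebraMap k⟦X⟧ C⟦X⟧ X = X := PowerSeries.map_X _
  obtain ⟨f, hf⟩ := hi.exists_lift (E := C⟦X⟧)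
    (algebraMap_X_mem_nonZeroDivisors k C) h (fun b hb ↦ by
      rw [hXC, PowerSeries.X_dvd_iff, h₀]
      exact (congrArg g hb).trans (map_zero g))
  -- Although `f` sends z to X, its constant term is linear over k⟦z⟧: both sides see only the
  -- constant term of `s`, because z is zero in `C`.
  have hf' (s : k⟦X⟧) : PowerSeries.constantCoeff (f (algebraMap k⟦X⟧ H s)) =
      algebraMap k⟦X⟧ C s := by
    rw [AlgHom.commutes, algebraMap_eq_of_algebraMap_X_eq_zero hC]
    rw [← PowerSeries.coeff_zero_eq_constantCoeff_apply, PowerSeries.algebraMap_apply'',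
      PowerSeries.coeff_map, PowerSeries.coeff_zero_eq_constantCoeff_apply]
    rfl
  refine ⟨{ (PowerSeries.constantCoeff.comp (f : H →+* C⟦X⟧)) with commutes' := hf' },
    AlgHom.ext_of_adjoin_eq_top hadj ?_⟩
  rintro _ (⟨a, rfl⟩ | ⟨b, hb, hd⟩)
  · change Ideal.Quotient.mk J (PowerSeries.constantCoeff (f (i a))) = _
    rw [hf, h₀]
    exact hg a
  · rename_i d
    have hd' : d = q ⟨b, hb⟩ := hq' (hd.trans (hq ⟨b, hb⟩).symm)
    change Ideal.Quotient.mk J (PowerSeries.constantCoeff (f d)) = _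
    have e : X * f d = h b := by rw [← hf, ← hd, map_mul, AlgHom.commutes, hXC]
    have e' : PowerSeries.coeff 1 (h b) = PowerSeries.constantCoeff (f d) := by
      rw [← e, show 1 = 0 + 1 from rfl, PowerSeries.coeff_succ_X_mul,
        PowerSeries.coeff_zero_eq_constantCoeff]
    rw [← e', hd']
    exact h₁ ⟨b, hb⟩

/-- Homomorphisms of `K`-algebras from `K ⊗ H` are homomorphisms of `R`-algebras from `H`, so the
lifting problem may be posed for `H`. -/
theorem formallySmooth_tensor {R K H : Type u} [CommRing R] [CommRing K] [Algebra R K] [CommRing H]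
    [Algebra R H]
    (h : ∀ (C : Type u) [CommRing C] [Algebra R C] [Algebra K C] [IsScalarTower R K C]
      (J : Ideal C), J ^ 2 = ⊥ → ∀ φ : H →ₐ[R] C ⧸ J,
        ∃ f : H →ₐ[R] C, (Ideal.Quotient.mkₐ R J).comp f = φ) :
    Algebra.FormallySmooth K (K ⊗[R] H) := by
  refine .of_comp_surjective fun C _ _ J hJ φ ↦ ?_
  let _ : Algebra R C := Algebra.compHom C (algebraMap R K)
  have : IsScalarTower R K C := .of_algebraMap_eq fun _ ↦ rfl
  obtain ⟨f, hf⟩ := h C J hJ ((φ.restrictScalars R).comp Algebra.TensorProduct.includeRight)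
  refine ⟨Algebra.TensorProduct.lift (Algebra.ofId K C) f fun _ _ ↦ Commute.all _ _, ?_⟩
  refine Algebra.TensorProduct.ext (Subsingleton.elim _ _) ?_
  refine AlgHom.ext fun x ↦ ?_
  have := DFunLike.congr_fun hf x
  simpa using this

/-- The dilatation of a smooth group in a smooth subgroup has formally smooth fibres. -/
theorem IsDilatation.formallySmooth_fiber [Algebra.FormallySmooth k A]
    [Algebra.FormallySmooth k Q.coord] (hi : IsDilatation Q i)
    (hX : algebraMap k⟦X⟧ H X ∈ nonZeroDivisors H)
    (hadj : Algebra.adjoin k⟦X⟧ (Set.range i ∪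
      {d | ∃ b, Q.res b = 0 ∧ algebraMap k⟦X⟧ H X * d = i b}) = ⊤) (K : Type u) [Field K]
      [Algebra k⟦X⟧ K] : Algebra.FormallySmooth K (K ⊗[k⟦X⟧] H) := by
  refine formallySmooth_tensor fun C _ _ _ _ J hJ φ ↦ ?_
  -- In a field over k⟦z⟧ the element z is zero or invertible, and the two lifting lemmas cover
  -- these cases.
  by_cases hK : algebraMap k⟦X⟧ K X = 0
  · refine hi.exists_lift_of_eq_zero hX hadj J hJ ?_ φ
    rw [IsScalarTower.algebraMap_apply k⟦X⟧ K C, hK, map_zero]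
  · refine hi.exists_lift_of_isUnit J hJ ?_ φ
    rw [IsScalarTower.algebraMap_apply k⟦X⟧ K C]
    exact (Ne.isUnit hK).map _

end

section
variable {k A : Type u} [Field k] [CommRing A] [HopfAlgebra k A] {Q : ClosedSubgroupScheme k A}

section
variable {H : Type u} [CommRing H] [HopfAlgebra k⟦X⟧ H] [Algebra k H] [IsScalarTower k k⟦X⟧ H]
  {i : A →ₐ[k] H}

/-- Generators of `A`, together with z⁻¹b for b in a finite set of generators of the ideal of Q,
suffice: division by z is unique in `H`, hence linear in b. -/
theorem IsDilatation.finiteType [Algebra.FiniteType k A] (hi : IsDilatation Q i)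
    (hX : algebraMap k⟦X⟧ H X ∈ nonZeroDivisors H)
    (hadj : Algebra.adjoin k⟦X⟧ (Set.range i ∪
      {d | ∃ b, Q.res b = 0 ∧ algebraMap k⟦X⟧ H X * d = i b}) = ⊤) :
    Algebra.FiniteType k⟦X⟧ H := by
  classical
  have : IsNoetherianRing A := Algebra.FiniteType.isNoetherianRing k A
  obtain ⟨s, hs⟩ := Algebra.FiniteType.out (R := k) (A := A)
  obtain ⟨t, ht⟩ := (isNoetherianRing_iff_ideal_fg A).1 inferInstance
    (RingHom.ker (Q.res : A →ₐ[k] Q.coord))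
  have ht' (b : A) (hb : b ∈ t) : Q.res b = 0 := by
    have := Ideal.subset_span (Finset.mem_coe.2 hb)
    rw [ht] at this
    exact this
  choose q hq using hi.exists_quot
  let G : Finset H := s.image i ∪ t.attach.image fun b ↦ q b.1 (ht' b.1 b.2)
  refine ⟨G, eq_top_iff.2 (hadj.symm.le.trans (Algebra.adjoin_le ?_))⟩
  have h₁ (a : A) : i a ∈ Algebra.adjoin k⟦X⟧ (G : Set H) := by
    have : Algebra.adjoin k (s : Set A) ≤
        ((Algebra.adjoin k⟦X⟧ (G : Set H)).restrictScalars k).comap i := by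
      refine Algebra.adjoin_le fun x hx ↦ Algebra.subset_adjoin ?_
      exact Finset.mem_coe.2 (Finset.mem_union_left _ (Finset.mem_image_of_mem _ hx))
    rw [hs] at this
    exact this (Algebra.mem_top : a ∈ ⊤)
  rintro _ (⟨a, rfl⟩ | ⟨b, hb, hd⟩)
  · exact h₁ a
  · rename_i d
    have key (b : A) (hb : b ∈ Ideal.span (t : Set A)) : ∃ d ∈ Algebra.adjoin k⟦X⟧ (G : Set H),
        algebraMap k⟦X⟧ H X * d = i b := by
      induction hb using Submodule.span_induction with
      | mem b hb =>
        exact ⟨q b (ht' b hb), Algebra.subset_adjoin (Finset.mem_coe.2 (Finset.mem_union_right _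
          (Finset.mem_image_of_mem _ (Finset.mem_attach _ ⟨b, hb⟩)))), hq _ _⟩
      | zero => exact ⟨0, zero_mem _, by simp⟩
      | add b c _ _ hb hc =>
        obtain ⟨d, hd, e⟩ := hb
        obtain ⟨d', hd', e'⟩ := hc
        exact ⟨d + d', add_mem hd hd', by rw [mul_add, e, e', map_add]⟩
      | smul a b _ hb =>
        obtain ⟨d, hd, e⟩ := hb
        exact ⟨i a * d, mul_mem (h₁ a) hd, by rw [mul_left_comm, e, smul_eq_mul, map_mul]⟩
    obtain ⟨d', hd', e⟩ := key b (by rw [ht]; exact hb)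
    rwa [(mul_cancel_left_mem_nonZeroDivisors hX).1 (hd.trans e.symm)]

/-- The dilatation of a smooth group in a smooth subgroup is smooth. -/
theorem IsDilatation.smooth [Algebra.Smooth k A] [Algebra.FormallySmooth k Q.coord]
    (hH : Module.Flat k⟦X⟧ H) (hi : IsDilatation Q i)
    (hX : algebraMap k⟦X⟧ H X ∈ nonZeroDivisors H)
    (hadj : Algebra.adjoin k⟦X⟧ (Set.range i ∪
      {d | ∃ b, Q.res b = 0 ∧ algebraMap k⟦X⟧ H X * d = i b}) = ⊤) :
    Algebra.Smooth k⟦X⟧ H := by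
  have := hi.finiteType hX hadj
  have : Algebra.FinitePresentation k⟦X⟧ H := Algebra.FinitePresentation.of_finiteType.1 this
  -- This is the fibre criterion: a flat algebra of finite presentation with formally smooth fibres
  -- is smooth.
  exact Algebra.Smooth.of_formallySmooth_fiber fun I _ ↦ hi.formallySmooth_fiber hX hadj _
end

theorem smooth_dilatation (hA : Algebra.Smooth k A) (hQ : Algebra.Smooth k Q.coord) :
    Algebra.Smooth k⟦X⟧ (dilatation Q) := by
  have : Module.Flat k⟦X⟧ (dilatation Q) := flat_subalgebra (FractionRing k⟦X⟧) (dilatation Q)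
  refine IsDilatation.smooth (H := dilatation Q) (i := inclHom Q) this isDilatation_inclHom ?_ ?_
  · refine mem_nonZeroDivisors_iff_left.2 fun x hx ↦ Subtype.ext ?_
    have hx' : (X : k⟦X⟧) • (x : FractionRing k⟦X⟧ ⊗[k] A) = 0 := by
      refine (congrArg Subtype.val (Algebra.smul_def (X : k⟦X⟧) x)).trans ?_
      exact congrArg Subtype.val hx
    have e := congrArg ((algebraMap k⟦X⟧ (FractionRing k⟦X⟧) X)⁻¹ • ·) hx'
    simp only [smul_zero] at e
    rwa [← algebraMap_smul (FractionRing k⟦X⟧) (X : k⟦X⟧), smul_smul,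
      inv_mul_cancel₀ algebraMap_X_ne_zero, one_smul] at e
  · refine eq_top_iff.2 (adjoin_dilatation_eq_top.symm.le.trans (Algebra.adjoin_mono ?_))
    refine Set.union_subset_union_right _ ?_
    rintro _ ⟨b, hb, rfl⟩
    exact ⟨b, hb, algebraMap_X_mul_quot b hb⟩

theorem smooth_dilatation_of_isBorel (hA : IsSplitConnectedReductive k A)
    (hQ : Q = ClosedSubgroupScheme.whole k A ∨ Q.IsBorel) :
    Algebra.Smooth k⟦X⟧ (dilatation Q) := by
  refine smooth_dilatation hA.1.smooth ?_
  rcases hQ with rfl | hQ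
  · exact hA.1.smooth
  · exact hQ.smooth
end

/-! ### Lifting sections of smooth affine morphisms through nilpotent thickenings. -/

section
/-- Lifting of two compatible homomorphisms from a smooth algebra to quotients of the base. -/
theorem exists_algHom_lift_of_glue {R E S₁ S₂ : Type u} [CommRing R] [CommRing E] [CommRing S₁]
    [CommRing S₂] [Algebra R E] [Algebra R S₁] [Algebra R S₂] [Algebra.FormallySmooth R E]
    (hn : IsNilpotent (RingHom.ker (algebraMap R S₂))) (f₁ : E →ₐ[R] S₁) (f₂ : E →ₐ[R] S₂)
    (h : ∀ e, ∃ r, algebraMap R S₁ r = f₁ e ∧ algebraMap R S₂ r = f₂ e) :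
    ∃ f : E →ₐ[R] R, ∀ e, algebraMap R S₁ (f e) = f₁ e ∧ algebraMap R S₂ (f e) = f₂ e := by
  -- The compatibility `h` says that the pair of homomorphisms lands in the image of `R` in the
  -- product. The kernel of `R` onto this image lies in the kernel to `S₂`, so it is nilpotent and
  -- the infinitesimal lifting property applies.
  let ρ : R →ₐ[R] S₁ × S₂ := Algebra.ofId R _
  let σ : E →ₐ[R] ρ.range := (f₁.prod f₂).codRestrict ρ.range fun e ↦ by
    obtain ⟨r, h₁, h₂⟩ := h e
    exact ⟨r, Prod.ext h₁ h₂⟩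
  have hker : IsNilpotent (RingHom.ker (ρ.rangeRestrict : R →+* ρ.range)) := by
    obtain ⟨n, hn⟩ := hn
    refine ⟨n, le_bot_iff.1 (le_trans (Ideal.pow_right_mono ?_ n) hn.le)⟩
    intro r hr
    exact congrArg (fun x : ρ.range ↦ x.1.2) hr
  let f := Algebra.FormallySmooth.liftOfSurjective σ ρ.rangeRestrict ρ.rangeRestrict_surjective hker
  have hf (e : E) : ρ (f e) = (f₁ e, f₂ e) := congrArg Subtype.val
    (Algebra.FormallySmooth.liftOfSurjective_apply σ ρ.rangeRestrict
      ρ.rangeRestrict_surjective hker e)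
  exact ⟨f, fun e ↦ ⟨congrArg Prod.fst (hf e), congrArg Prod.snd (hf e)⟩⟩

theorem exists_hom_appTop {X Y : Scheme.{u}} [IsAffine Y] (φ : Γ(Y, ⊤) ⟶ Γ(X, ⊤)) :
    ∃ f : X ⟶ Y, f.appTop = φ := by
  refine ⟨X.toSpecΓ ≫ Spec.map φ ≫ Y.isoSpec.inv, ?_⟩
  rw [Scheme.Hom.comp_appTop, Scheme.Hom.comp_appTop, Scheme.toSpecΓ_appTop, Category.assoc,
    Scheme.ΓSpecIso_naturality, ← Scheme.toSpecΓ_appTop, ← Category.assoc,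
    ← Scheme.Hom.comp_appTop, Scheme.toSpecΓ_isoSpec_inv]
  exact Category.id_comp _

theorem appTop_comp_apply {X Y Z : Scheme.{u}} (f : X ⟶ Y) (g : Y ⟶ Z) (r : Γ(Z, ⊤)) :
    (f ≫ g).appTop.hom r = f.appTop.hom (g.appTop.hom r) := by
  rw [Scheme.Hom.comp_appTop]
  rfl

/-- Such test morphisms bound ideals by means of the universal property of fibre products, with no
computation of tensor products. -/
theorem exists_hom_ker_eq (T : Scheme.{u}) [IsAffine T] (I : Ideal Γ(T, ⊤)) :
    ∃ (Z : Scheme.{u}) (f : Z ⟶ T), RingHom.ker f.appTop.hom = I := by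
  obtain ⟨f, hf⟩ := exists_hom_appTop (X := Spec (CommRingCat.of (Γ(T, ⊤) ⧸ I))) (Y := T)
    (CommRingCat.ofHom (Ideal.Quotient.mk I) ≫ (Scheme.ΓSpecIso _).inv)
  refine ⟨_, f, Ideal.ext fun r ↦ ?_⟩
  rw [RingHom.mem_ker, hf, ← Ideal.Quotient.eq_zero_iff_mem]
  exact map_eq_zero_iff _ (ConcreteCategory.bijective_of_isIso
    (Scheme.ΓSpecIso (CommRingCat.of (Γ(T, ⊤) ⧸ I))).inv).1

variable {T T₁ T₂ W : Scheme.{u}} [IsAffine T] {j₁ : T₁ ⟶ T} {j₂ : T₂ ⟶ T} {w₁ : W ⟶ T₁}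
  {w₂ : W ⟶ T₂} [IsClosedImmersion j₁] [IsClosedImmersion j₂]

theorem surjective_appTop_of_isClosedImmersion (j : T₁ ⟶ T) [IsClosedImmersion j] :
    Function.Surjective j.appTop.hom :=
  (IsClosedImmersion.isAffine_surjective_of_isAffine j).2

/-- A morphism to the affine scheme `T` factors over a closed subscheme if the functions that vanish
on the subscheme pull back to zero. -/
theorem exists_comp_eq_of_ker_le (j : T₁ ⟶ T) [IsClosedImmersion j] {Z : Scheme.{u}} (f : Z ⟶ T)
    (h : RingHom.ker j.appTop.hom ≤ RingHom.ker f.appTop.hom) : ∃ z : Z ⟶ T₁, z ≫ j = f := by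
  have := (IsClosedImmersion.isAffine_surjective_of_isAffine j).1
  have hs := surjective_appTop_of_isClosedImmersion j
  obtain ⟨z, hz⟩ := exists_hom_appTop (X := Z) (Y := T₁)
    (CommRingCat.ofHom ((RingHom.liftOfSurjective j.appTop.hom hs) ⟨f.appTop.hom, h⟩))
  refine ⟨z, ext_of_isAffine (CommRingCat.hom_ext (RingHom.ext fun r ↦ ?_))⟩
  rw [appTop_comp_apply, hz]
  exact RingHom.liftOfRightInverse_comp_apply _ _ _ _ r

/-- The closed subscheme cut out by the sum of the two ideals maps to both closed subschemes, hence
to their intersection. -/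
theorem ker_appTop_comp_le (h : IsPullback w₁ w₂ j₁ j₂) :
    RingHom.ker (w₁ ≫ j₁).appTop.hom ≤ RingHom.ker j₁.appTop.hom ⊔ RingHom.ker j₂.appTop.hom := by
  obtain ⟨Z, f, hf⟩ := exists_hom_ker_eq T
    (RingHom.ker j₁.appTop.hom ⊔ RingHom.ker j₂.appTop.hom)
  obtain ⟨z₁, hz₁⟩ := exists_comp_eq_of_ker_le j₁ f (le_sup_left.trans hf.ge)
  obtain ⟨z₂, hz₂⟩ := exists_comp_eq_of_ker_le j₂ f (le_sup_right.trans hf.ge)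
  rw [← hf]
  intro r hr
  have e : h.lift z₁ z₂ (hz₁.trans hz₂.symm) ≫ w₁ ≫ j₁ = f := by
    rw [h.lift_fst_assoc, hz₁]
  rw [RingHom.mem_ker, ← e, appTop_comp_apply]
  exact (congrArg _ hr).trans (map_zero _)

/-- The base change of a nilpotent thickening of affine schemes is a nilpotent thickening. -/
theorem isNilpotent_ker_of_isPullback {S S₁ : Scheme.{u}} [IsAffine S] {j : S₁ ⟶ S}
    [IsClosedImmersion j] {p : T ⟶ S} {p₁ : T₁ ⟶ S₁} (h : IsPullback j₁ p₁ p j)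
    (hn : IsNilpotent (RingHom.ker j.appTop.hom)) : IsNilpotent (RingHom.ker j₁.appTop.hom) := by
  obtain ⟨Z, f, hf⟩ := exists_hom_ker_eq T ((RingHom.ker j.appTop.hom).map p.appTop.hom)
  obtain ⟨z, hz⟩ := exists_comp_eq_of_ker_le j (f ≫ p) fun r hr ↦ by
    rw [RingHom.mem_ker, appTop_comp_apply, ← RingHom.mem_ker, hf]
    exact Ideal.mem_map_of_mem _ hr
  obtain ⟨n, hn⟩ := hn
  refine ⟨n, le_bot_iff.1 (le_trans (Ideal.pow_right_mono ?_ n)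
    ((Ideal.map_pow p.appTop.hom (RingHom.ker j.appTop.hom) n).symm.trans
      ((congrArg _ hn).trans Ideal.map_bot)).le)⟩
  rw [← hf]
  intro r hr
  rw [RingHom.mem_ker, ← h.lift_fst f z hz.symm, appTop_comp_apply]
  exact (congrArg _ hr).trans (map_zero _)

/-- Sections of a smooth affine morphism over two closed subschemes of an affine scheme that agree on
the intersection extend, if one of the subschemes is defined by a nilpotent ideal. -/
theorem exists_section_of_isPullback {Y : Scheme.{u}} (h : IsPullback w₁ w₂ j₁ j₂)
    (hn : IsNilpotent (RingHom.ker j₂.appTop.hom)) (π : Y ⟶ T) [IsAffineHom π] [Smooth π]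
    (x₁ : T₁ ⟶ Y) (hx₁ : x₁ ≫ π = j₁) (x₂ : T₂ ⟶ Y) (hx₂ : x₂ ≫ π = j₂)
    (hw : w₁ ≫ x₁ = w₂ ≫ x₂) : ∃ x : T ⟶ Y, x ≫ π = 𝟙 T ∧ j₁ ≫ x = x₁ ∧ j₂ ≫ x = x₂ := by
  have hY : IsAffine Y := isAffine_of_isAffineHom π
  have hs₁ := surjective_appTop_of_isClosedImmersion j₁
  have hs₂ := surjective_appTop_of_isClosedImmersion j₂
  have hsm : π.appTop.hom.Smooth := HasRingHomProperty.appTop (P := @Smooth) π inferInstance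
  let _ : Algebra Γ(T, ⊤) Γ(Y, ⊤) := π.appTop.hom.toAlgebra
  let _ : Algebra Γ(T, ⊤) Γ(T₁, ⊤) := j₁.appTop.hom.toAlgebra
  let _ : Algebra Γ(T, ⊤) Γ(T₂, ⊤) := j₂.appTop.hom.toAlgebra
  have hsm' : Algebra.Smooth Γ(T, ⊤) Γ(Y, ⊤) := hsm
  let f₁ : Γ(Y, ⊤) →ₐ[Γ(T, ⊤)] Γ(T₁, ⊤) :=
    { x₁.appTop.hom with commutes' r := (appTop_comp_apply x₁ π r).symm.trans (by rw [hx₁]; rfl) }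
  let f₂ : Γ(Y, ⊤) →ₐ[Γ(T, ⊤)] Γ(T₂, ⊤) :=
    { x₂.appTop.hom with commutes' r := (appTop_comp_apply x₂ π r).symm.trans (by rw [hx₂]; rfl) }
  obtain ⟨f, hf⟩ := exists_algHom_lift_of_glue hn f₁ f₂ fun e ↦ by
    obtain ⟨r₁, hr₁⟩ := hs₁ (x₁.appTop.hom e)
    obtain ⟨r₂, hr₂⟩ := hs₂ (x₂.appTop.hom e)
    have hr : r₁ - r₂ ∈ RingHom.ker (w₁ ≫ j₁).appTop.hom := by
      rw [RingHom.mem_ker, map_sub, sub_eq_zero]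
      conv_rhs => rw [h.w]
      rw [appTop_comp_apply, appTop_comp_apply, hr₁, hr₂, ← appTop_comp_apply,
        ← appTop_comp_apply, hw]
    -- The two lifts agree on the intersection, so they differ by a + b with `a` zero on the first
    -- subscheme and `b` zero on the second; thus r₁ - a = r₂ + b restricts correctly to both.
    obtain ⟨a, ha, b, hb, hab⟩ := Submodule.mem_sup.1 (ker_appTop_comp_le h hr)
    refine ⟨r₁ - a, ?_, ?_⟩
    · exact (map_sub j₁.appTop.hom r₁ a).trans (by rw [RingHom.mem_ker.1 ha, sub_zero, hr₁]; rfl)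
    · have e' : r₁ - a = r₂ + b := by rw [sub_eq_iff_eq_add, add_assoc, add_comm b, hab]; ring
      rw [e']
      exact (map_add j₂.appTop.hom r₂ b).trans (by rw [RingHom.mem_ker.1 hb, add_zero, hr₂]; rfl)
  obtain ⟨x, hx⟩ := exists_hom_appTop (X := T) (Y := Y) (CommRingCat.ofHom f.toRingHom)
  refine ⟨x, ext_of_isAffine (CommRingCat.hom_ext (RingHom.ext fun r ↦ ?_)),
    ext_of_isAffine (CommRingCat.hom_ext (RingHom.ext fun r ↦ ?_)),
    ext_of_isAffine (CommRingCat.hom_ext (RingHom.ext fun r ↦ ?_))⟩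
  · rw [appTop_comp_apply, hx]
    exact f.commutes r
  · rw [appTop_comp_apply, hx]
    exact (hf r).1
  · rw [appTop_comp_apply, hx]
    exact (hf r).2

/-- A lift of `g` through `π` is a section of the base change of `π` along `g`. -/
theorem exists_lift_of_isPullback {Y B : Scheme.{u}} (h : IsPullback w₁ w₂ j₁ j₂)
    (hn : IsNilpotent (RingHom.ker j₂.appTop.hom)) (π : Y ⟶ B) [IsAffineHom π] [Smooth π]
    (g : T ⟶ B) (x₁ : T₁ ⟶ Y) (hx₁ : x₁ ≫ π = j₁ ≫ g) (x₂ : T₂ ⟶ Y) (hx₂ : x₂ ≫ π = j₂ ≫ g)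
    (hw : w₁ ≫ x₁ = w₂ ≫ x₂) : ∃ x : T ⟶ Y, x ≫ π = g ∧ j₁ ≫ x = x₁ ∧ j₂ ≫ x = x₂ := by
  obtain ⟨x, hx, h₁, h₂⟩ := exists_section_of_isPullback h hn (Limits.pullback.snd π g)
    (Limits.pullback.lift x₁ j₁ hx₁) (Limits.pullback.lift_snd _ _ _)
    (Limits.pullback.lift x₂ j₂ hx₂) (Limits.pullback.lift_snd _ _ _)
    (Limits.pullback.hom_ext
      (by rw [Category.assoc, Category.assoc, Limits.pullback.lift_fst, Limits.pullback.lift_fst, hw])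
      (by rw [Category.assoc, Category.assoc, Limits.pullback.lift_snd, Limits.pullback.lift_snd, h.w]))
  refine ⟨x ≫ Limits.pullback.fst π g, ?_, ?_, ?_⟩
  · rw [Category.assoc, Limits.pullback.condition, reassoc_of% hx]
  · rw [reassoc_of% h₁, Limits.pullback.lift_fst]
  · rw [reassoc_of% h₂, Limits.pullback.lift_fst]
end

theorem exists_dependent_seq {α : ℕ → Type*} {p : ∀ n, α n → Prop} {r : ∀ n, α n → α (n + 1) → Prop}
    (h₀ : ∃ a, p 0 a) (hs : ∀ n a, p n a → ∃ b, p (n + 1) b ∧ r n a b) :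
    ∃ s : ∀ n, α n, (∀ n, p n (s n)) ∧ ∀ n, r n (s n) (s (n + 1)) := by
  choose f hf using hs
  let s (n : ℕ) : {a : α n // p n a} :=
    Nat.rec ⟨h₀.choose, h₀.choose_spec⟩ (fun n a ↦ ⟨f n a.1 a.2, (hf n a.1 a.2).1⟩) n
  exact ⟨fun n ↦ (s n).1, fun n ↦ (s n).2, fun n ↦ (hf n (s n).1 (s n).2).2⟩

theorem exists_over_lift {K : Scheme.{u}} {T T₁ T₂ W Y B : Over K} [IsAffine T.left]
    {j₁ : T₁ ⟶ T} {j₂ : T₂ ⟶ T} {w₁ : W ⟶ T₁} {w₂ : W ⟶ T₂} (h₁ : IsClosedImmersion j₁.left)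
    (h₂ : IsClosedImmersion j₂.left) (h : IsPullback w₁ w₂ j₁ j₂)
    (hn : IsNilpotent (RingHom.ker j₂.left.appTop.hom)) (π : Y ⟶ B)
    (hπ : IsAffineHom π.left ∧ Smooth π.left) (g : T ⟶ B)
    (x₁ : T₁ ⟶ Y) (hx₁ : x₁ ≫ π = j₁ ≫ g) (x₂ : T₂ ⟶ Y) (hx₂ : x₂ ≫ π = j₂ ≫ g)
    (hw : w₁ ≫ x₁ = w₂ ≫ x₂) : ∃ x : T ⟶ Y, x ≫ π = g ∧ j₁ ≫ x = x₁ ∧ j₂ ≫ x = x₂ := by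
  obtain ⟨hπ₁, hπ₂⟩ := hπ
  obtain ⟨x, hx, e₁, e₂⟩ := exists_lift_of_isPullback (T := T.left) (T₁ := T₁.left)
    (T₂ := T₂.left) (W := W.left) (j₁ := j₁.left) (j₂ := j₂.left) (h.map (Over.forget K)) hn π.left g.left
    x₁.left (congrArg CommaMorphism.left hx₁) x₂.left (congrArg CommaMorphism.left hx₂)
    (congrArg CommaMorphism.left hw)
  refine ⟨Over.homMk x ?_, ?_, ?_, ?_⟩
  · rw [← Over.w π, reassoc_of% hx, Over.w]
  · exact Over.OverMorphism.ext hx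
  · exact Over.OverMorphism.ext e₁
  · exact Over.OverMorphism.ext e₂

/-! ### Nilpotent thickenings and lifting of compatible systems of sections. -/

section
variable {k : Type u} [Field k] {n : ℕ}

theorem isPullback_thick_map {S S₀ : SchOver k} (f : S₀ ⟶ S) :
    IsPullback ((thick k n).map f).left (thickProj n S₀) (thickProj n S) f.left := by
  refine IsPullback.of_right (h₁₂ := thickStr n S) (h₂₂ := S.hom) ?_ (thick_map_proj f)
    (thick_isPullback n S).flip
  rw [thick_map_str, Over.w]
  exact (thick_isPullback n S₀).flip

theorem isPullback_thickIncl (S : SchOver k) :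
    IsPullback ((thickIncl k n).app S).left (thickStr n S) (thickStr (n + 1) S)
      (thickIncl₀ k n) := by
  refine IsPullback.of_right (h₁₂ := thickProj (n + 1) S) ?_ (thickIncl_str S)
    (thick_isPullback (n + 1) S)
  rw [thickIncl_proj, thickIncl₀_algebraMap]
  exact thick_isPullback n S

instance isAffine_thick (S : SchOver k) [IsAffine S.left] : IsAffine ((thick k n).obj S).left := by
  have : IsAffineHom (thickProj n S) :=
    MorphismProperty.of_isPullback (P := @IsAffineHom) (thick_isPullback n S).flip inferInstance
  exact isAffine_of_isAffineHom (thickProj n S)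

theorem isNilpotent_ker_appTop_spec {R R' : CommRingCat.{u}} (φ : R ⟶ R')
    (h : IsNilpotent (RingHom.ker φ.hom)) :
    IsNilpotent (RingHom.ker (Spec.map φ).appTop.hom) := by
  obtain ⟨n, hn⟩ := h
  refine ⟨n, le_bot_iff.1 (le_trans (Ideal.pow_right_mono
    (J := (RingHom.ker φ.hom).map (Scheme.ΓSpecIso R).inv.hom) ?_ n)
    ((Ideal.map_pow _ _ n).symm.trans ((congrArg _ hn).trans Ideal.map_bot)).le)⟩
  intro r hr
  have e : (Scheme.ΓSpecIso R).inv.hom ((Scheme.ΓSpecIso R).hom.hom r) = r :=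
    congrArg (fun m ↦ m.hom r) (Scheme.ΓSpecIso R).hom_inv_id
  rw [← e]
  refine Ideal.mem_map_of_mem _ ?_
  have e' := congrArg (fun m ↦ m.hom r) (Scheme.ΓSpecIso_naturality φ)
  refine RingHom.mem_ker.2 (e'.symm.trans ?_)
  exact (congrArg (Scheme.ΓSpecIso R').hom.hom hr).trans (map_zero _)

theorem isClosedImmersion_thickIncl₀ : IsClosedImmersion (thickIncl₀ k n) :=
  IsClosedImmersion.spec_of_surjective _ (Ideal.Quotient.factor_surjective (span_pow_le k n))

theorem isNilpotent_ker_thickIncl₀ :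
    IsNilpotent (RingHom.ker (thickIncl₀ k n).appTop.hom) := by
  refine isNilpotent_ker_appTop_spec _ ⟨2, ?_⟩
  rw [CommRingCat.hom_ofHom, Ideal.Quotient.factor_ker, ← Ideal.map_pow, Ideal.zero_eq_bot,
    Ideal.map_eq_bot_iff_le_ker, Ideal.mk_ker, Ideal.span_singleton_pow,
    Ideal.span_singleton_le_span_singleton, ← pow_mul]
  -- The ideal of each step has square zero because n + 2 ≤ 2(n + 1).
  exact pow_dvd_pow _ (by omega)

theorem isClosedImmersion_thickIncl (S : SchOver k) :
    IsClosedImmersion ((thickIncl k n).app S).left :=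
  MorphismProperty.of_isPullback (P := @IsClosedImmersion) (isPullback_thickIncl S).flip
    isClosedImmersion_thickIncl₀

theorem isNilpotent_ker_thickIncl (S : SchOver k) [IsAffine S.left] :
    IsNilpotent (RingHom.ker ((thickIncl k n).app S).left.appTop.hom) := by
  have := isClosedImmersion_thickIncl₀ (k := k) (n := n)
  have := isClosedImmersion_thickIncl (n := n) S
  exact isNilpotent_ker_of_isPullback (isPullback_thickIncl S) isNilpotent_ker_thickIncl₀

section
variable {S S₀ : SchOver k} {f : S₀ ⟶ S} {Γ : (SchOver k⟦X⟧)ᵒᵖ ⥤ GrpCat.{u}}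
  {Y : AdicSpace (thick k) (thickIncl k) Γ S}

theorem isClosedImmersion_thick_map (hf : IsClosedImmersion f.left) :
    IsClosedImmersion ((thick k n).map f).left :=
  MorphismProperty.of_isPullback (P := @IsClosedImmersion) (isPullback_thick_map f).flip hf

theorem isNilpotent_ker_thick_map [IsAffine S.left] (hf : IsClosedImmersion f.left)
    (hn : IsNilpotent (RingHom.ker f.left.appTop.hom)) :
    IsNilpotent (RingHom.ker ((thick k n).map f).left.appTop.hom) := by
  have := isClosedImmersion_thick_map (n := n) hf
  exact isNilpotent_ker_of_isPullback (isPullback_thick_map f) hn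

/-- Compatible sections lift along nilpotent thickenings of affine schemes. -/
theorem liftsSections_of_smooth [IsAffine S.left]
    (hY : ∀ n, IsAffineHom (Y.π n).left ∧ Smooth (Y.π n).left) (hf : IsClosedImmersion f.left)
    (hn : IsNilpotent (RingHom.ker f.left.appTop.hom)) : Y.LiftsSections f := by
  intro y hy hι
  suffices h : ∃ x : ∀ n, (thick k n).obj S ⟶ Y.X n,
      (∀ n, x n ≫ Y.π n = 𝟙 _ ∧ (thick k n).map f ≫ x n = y n) ∧
      ∀ n, (thickIncl k n).app S ≫ x (n + 1) = x n ≫ Y.ι n by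
    obtain ⟨x, hx, hx'⟩ := h
    exact ⟨x, fun n ↦ (hx n).1, hx', fun n ↦ (hx n).2⟩
  refine exists_dependent_seq (α := fun n ↦ (thick k n).obj S ⟶ Y.X n)
    (p := fun n x ↦ x ≫ Y.π n = 𝟙 _ ∧ (thick k n).map f ≫ x = y n)
    (r := fun n x x' ↦ (thickIncl k n).app S ≫ x' = x ≫ Y.ι n) ?_ ?_
  · have h := isClosedImmersion_thick_map (n := 0) hf
    have hm : Mono ((thick k 0).map f) := (Over.forget _).mono_of_mono_map
      (inferInstanceAs (Mono ((thick k 0).map f).left))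
    -- At level zero there is only one condition, so both closed subschemes are taken to be the
    -- thickening of `S₀`, which is its own intersection.
    obtain ⟨x, h₁, h₂, -⟩ := exists_over_lift h h (IsKernelPair.id_of_mono ((thick k 0).map f))
      (isNilpotent_ker_thick_map hf hn) (Y.π 0) (hY 0) (𝟙 _) (y 0)
      ((hy 0).trans (Category.comp_id _).symm) (y 0) ((hy 0).trans (Category.comp_id _).symm) rfl
    exact ⟨x, h₁, h₂⟩
  · rintro n x ⟨h₁, h₂⟩
    -- The section is prescribed on the previous thickening of `S` and on the next thickening of
    -- `S₀`; these meet in the previous thickening of `S₀`, where both restrict to `y n`.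
    obtain ⟨x', hπ, hx, hf'⟩ := exists_over_lift (isClosedImmersion_thickIncl S)
      (isClosedImmersion_thick_map hf) (thickIncl_isPullback f).flip (isNilpotent_ker_thick_map hf hn)
      (Y.π (n + 1)) (hY (n + 1)) (𝟙 _) (x ≫ Y.ι n)
      (by rw [Category.assoc, (Y.isPullback n).w, reassoc_of% h₁, Category.comp_id])
      (y (n + 1)) ((hy _).trans (Category.comp_id _).symm)
      (by rw [← Category.assoc, h₂, hι])
    exact ⟨x', ⟨hπ, hf'⟩, hx⟩

/-- Points of the special fibre of a smooth formal scheme with values in affine schemes lift. -/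
theorem exists_points_of_smooth [IsAffine S₀.left]
    (hY : ∀ n, IsAffineHom (Y.π n).left ∧ Smooth (Y.π n).left)
    (x₀ : (thick k 0).obj S₀ ⟶ Y.X 0) (hx₀ : x₀ ≫ Y.π 0 = (thick k 0).map f) :
    ∃ x : ∀ n, (thick k n).obj S₀ ⟶ Y.X n, (∀ n, x n ≫ Y.π n = (thick k n).map f) ∧
      ∀ n, (thickIncl k n).app S₀ ≫ x (n + 1) = x n ≫ Y.ι n := by
  refine exists_dependent_seq (p := fun n x ↦ x ≫ Y.π n = (thick k n).map f)
    (r := fun n x x' ↦ (thickIncl k n).app S₀ ≫ x' = x ≫ Y.ι n) ⟨x₀, hx₀⟩ fun n x hx ↦ ?_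
  have h := isClosedImmersion_thickIncl (n := n) S₀
  have hm : Mono ((thickIncl k n).app S₀) := (Over.forget _).mono_of_mono_map
    (inferInstanceAs (Mono ((thickIncl k n).app S₀).left))
  have e : (x ≫ Y.ι n) ≫ Y.π (n + 1) = (thickIncl k n).app S₀ ≫ (thick k (n + 1)).map f := by
    rw [Category.assoc, (Y.isPullback n).w, reassoc_of% hx]
    exact (thickIncl k n).naturality f
  obtain ⟨x', h₁, h₂, -⟩ := exists_over_lift h h (IsKernelPair.id_of_mono ((thickIncl k n).app S₀))
    (isNilpotent_ker_thickIncl S₀) (Y.π (n + 1)) (hY (n + 1)) _ (x ≫ Y.ι n) e (x ≫ Y.ι n) e rfl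
  exact ⟨x', h₁, h₂⟩
end

theorem isClosedImmersion_affineIncl {R : Type u} [CommRing R] [Algebra k R] (𝔞 : Ideal R) :
    IsClosedImmersion (affineIncl k 𝔞).left :=
  IsClosedImmersion.spec_of_surjective (CommRingCat.ofHom (Ideal.Quotient.mk 𝔞))
    Ideal.Quotient.mk_surjective

theorem isNilpotent_ker_affineIncl {R : Type u} [CommRing R] [Algebra k R] {𝔞 : Ideal R}
    (h : IsNilpotent 𝔞) : IsNilpotent (RingHom.ker (affineIncl k 𝔞).left.appTop.hom) := by
  refine isNilpotent_ker_appTop_spec (CommRingCat.ofHom (Ideal.Quotient.mk 𝔞)) ?_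
  rwa [CommRingCat.hom_ofHom, Ideal.mk_ker]

end

/-! ### Étale local sections of smooth morphisms. -/

section
variable {k : Type u} [Field k]

/-- A nonzero polynomial over an extension of `k` does not vanish at some point whose coordinates
are algebraic over `k`. -/
theorem exists_eval_algebraicClosure_ne_zero {K : Type u} {σ : Type*} [Field K] [IsAlgClosed K] [Algebra k K]
    {p : MvPolynomial σ K} (hp : p ≠ 0) :
    ∃ (χ : AlgebraicClosure k →ₐ[k] K) (b : σ → AlgebraicClosure k),
      MvPolynomial.eval (fun i ↦ χ (b i)) p ≠ 0 := by
  let χ : AlgebraicClosure k →ₐ[k] K := IsAlgClosed.lift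
  -- An algebraic closure is infinite even if `k` is finite, and a nonzero polynomial does not
  -- vanish on all points with coordinates in an infinite subset of a field.
  have hinf : (Set.range χ).Infinite := Set.infinite_range_of_injective χ.injective
  by_contra! hc
  refine hp (MvPolynomial.funext_set (fun _ ↦ Set.range χ) (fun _ ↦ hinf) fun x hx ↦ ?_)
  choose b hb using fun i ↦ hx i (Set.mem_univ i)
  obtain rfl : (fun i ↦ χ (b i)) = x := funext hb
  rw [hc, map_zero]

/-- Finitely many algebraic elements generate a finite extension, and this is separable because `k`
is perfect. -/
theorem etale_adjoin [PerfectField k] {L : Type u} {ι : Type*} [Field L] [Algebra k L]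
    [Algebra.IsAlgebraic k L] [Finite ι] (b : ι → L) :
    Algebra.Etale k (IntermediateField.adjoin k (Set.range b)) := by
  have : FiniteDimensional k (IntermediateField.adjoin k (Set.range b)) := by
    refine IntermediateField.finiteDimensional_adjoin fun x _ ↦ Algebra.IsIntegral.isIntegral x
  have : Algebra.FinitePresentation k (IntermediateField.adjoin k (Set.range b)) :=
    Algebra.FinitePresentation.of_finiteType.1 inferInstance
  exact ⟨Algebra.FormallyEtale.of_isSeparable k _, this⟩

/-- Over a perfect field, an étale algebra over a polynomial ring over `R` meets some point of the affine
space with values in an étale `R`-algebra. -/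
theorem exists_etale_point [PerfectField k] {R B : Type u} {σ : Type*} [CommRing R] [Algebra k R] [CommRing B]
    [Finite σ] (g : MvPolynomial σ R →+* B) (hg : g.Etale) (q : PrimeSpectrum B) :
    ∃ (R' : Type u) (_ : CommRing R') (_ : Algebra R R') (ε : MvPolynomial σ R →ₐ[R] R')
      (p' : PrimeSpectrum R'), Algebra.Etale R R' ∧
        PrimeSpectrum.comap ε.toRingHom p' ∈ Set.range (PrimeSpectrum.comap g) ∧
        PrimeSpectrum.comap (algebraMap R R') p' =
          PrimeSpectrum.comap (g.comp MvPolynomial.C) q := by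
  let _ := g.toAlgebra
  have hg' : Algebra.Etale (MvPolynomial σ R) B := hg
  -- The image of an étale morphism is open, so it suffices that the point of affine space lies in a
  -- basic open set D(h) around the image of `q`.
  have hopen : IsOpen (Set.range (PrimeSpectrum.comap g)) :=
    (PrimeSpectrum.isOpenMap_comap_of_hasGoingDown_of_finitePresentation
      (R := MvPolynomial σ R) (S := B)).isOpen_range
  obtain ⟨_, ⟨h, rfl⟩, hq, hsub⟩ :=
    PrimeSpectrum.isTopologicalBasis_basic_opens.exists_subset_of_mem_open
      (Set.mem_range_self q) hopen
  let p := PrimeSpectrum.comap (g.comp MvPolynomial.C) q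
  let K := AlgebraicClosure p.asIdeal.ResidueField
  have hker (r : R) : algebraMap R K r = 0 ↔ r ∈ p.asIdeal := by
    rw [IsScalarTower.algebraMap_apply R p.asIdeal.ResidueField K,
      map_eq_zero_iff _ (algebraMap p.asIdeal.ResidueField K).injective,
      Ideal.algebraMap_residueField_eq_zero]
  -- If `h` vanished on the whole fibre over `p`, its coefficients would lie in `p`, and `h` would
  -- vanish at the image of `q`.
  have hne : MvPolynomial.map (algebraMap R K) h ≠ 0 := fun h0 ↦ by
    refine hq ?_
    have hm : h ∈ Ideal.map MvPolynomial.C p.asIdeal := MvPolynomial.mem_map_C_iff.2 fun m ↦ by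
      rw [← hker, ← MvPolynomial.coeff_map, h0, MvPolynomial.coeff_zero]
    have hle : Ideal.map MvPolynomial.C p.asIdeal ≤ (PrimeSpectrum.comap g q).asIdeal :=
      Ideal.map_le_iff_le_comap.2 fun r hr ↦ hr
    exact hle hm
  obtain ⟨χ, b, hb⟩ := exists_eval_algebraicClosure_ne_zero (k := k) hne
  let L := IntermediateField.adjoin k (Set.range b)
  have : Algebra.Etale k L := etale_adjoin b
  -- The coordinates generate a finite étale extension L of `k`, so `R ⊗ L` is étale over `R`. The
  -- kernel of `ψ` is the prime over `p` at which the polynomial `h` does not vanish.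
  let ψ : R ⊗[k] L →ₐ[k] K := Algebra.TensorProduct.lift (IsScalarTower.toAlgHom k R K)
    (χ.comp L.val) fun _ _ ↦ Commute.all _ _
  let b' (i : σ) : L := ⟨b i, IntermediateField.subset_adjoin _ _ ⟨i, rfl⟩⟩
  let ε : MvPolynomial σ R →ₐ[R] R ⊗[k] L := MvPolynomial.aeval fun i ↦ (1 : R) ⊗ₜ[k] b' i
  refine ⟨R ⊗[k] L, inferInstance, inferInstance, ε, ⟨RingHom.ker ψ, RingHom.ker_isPrime ψ⟩,
    inferInstance, hsub ?_, ?_⟩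
  · change ψ (ε h) ≠ 0
    have e : ψ.toRingHom.comp ε.toRingHom =
        (MvPolynomial.eval fun i ↦ χ (b i)).comp (MvPolynomial.map (algebraMap R K)) := by
      refine MvPolynomial.ringHom_ext (fun r ↦ ?_) fun i ↦ ?_
      · simp [ε, ψ]
      · simp [ε, ψ, b']
    exact (DFunLike.congr_fun e h).trans_ne hb
  · refine PrimeSpectrum.ext (Ideal.ext fun r ↦ ?_)
    change ψ (algebraMap R (R ⊗[k] L) r) = 0 ↔ r ∈ p.asIdeal
    rw [← hker]
    simp [ψ]

/-- A smooth morphism has étale local sections through the points of its image. -/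
theorem exists_etale_section [PerfectField k] {Y S : Scheme.{u}} (π : Y ⟶ S) [Smooth π]
    (s : S ⟶ Spec (CommRingCat.of k)) (y : Y) :
    ∃ (U : Scheme.{u}) (e : U ⟶ S) (t : U ⟶ Y), IsAffine U ∧ Etale e ∧ t ≫ π = e ∧
      π y ∈ Set.range e := by
  obtain ⟨U, hU, V, hV, hy, hVU, hst⟩ := Smooth.exists_isStandardSmooth π y
  -- Near `y` the morphism is étale over an affine space. The required section lives on the fibre
  -- product of this étale map with a point of affine space that has values in an étale algebra and
  -- meets its image.
  obtain ⟨n, g, hgC, hg⟩ := hst.exists_etale_mvPolynomial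
  let _ : Algebra k Γ(S, U) := (Spec.preimage (hU.fromSpec ≫ s)).hom.toAlgebra
  obtain ⟨v, hv⟩ : y ∈ Set.range hV.fromSpec := by rw [hV.range_fromSpec]; exact hy
  obtain ⟨R', _, _, ε, p', hR', ⟨q, hq⟩, hp'⟩ := exists_etale_point (k := k) g hg v
  have : Etale (Spec.map (CommRingCat.ofHom g)) := by
    rw [HasRingHomProperty.Spec_iff (P := @Etale)]
    exact hg
  have : Etale (Spec.map (CommRingCat.ofHom (algebraMap Γ(S, U) R'))) := by
    rw [HasRingHomProperty.Spec_iff (P := @Etale)]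
    exact RingHom.etale_algebraMap.2 hR'
  let ε' := Spec.map (CommRingCat.ofHom ε.toRingHom)
  let g' := Spec.map (CommRingCat.ofHom g)
  have e₁ : ε' ≫ Spec.map (CommRingCat.ofHom MvPolynomial.C) =
      Spec.map (CommRingCat.ofHom (algebraMap Γ(S, U) R')) := by
    rw [← Spec.map_comp, ← CommRingCat.ofHom_comp]
    congr 2
    exact ε.comp_algebraMap
  have e₂ : g' ≫ Spec.map (CommRingCat.ofHom MvPolynomial.C) = Spec.map (π.appLE U V hVU) := by
    rw [← Spec.map_comp, ← CommRingCat.ofHom_comp, hgC]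
    rfl
  obtain ⟨z, hz, -⟩ := Scheme.Pullback.exists_preimage_pullback (f := ε') (g := g') p' q hq.symm
  refine ⟨Limits.pullback ε' g', Limits.pullback.fst ε' g' ≫
    Spec.map (CommRingCat.ofHom (algebraMap Γ(S, U) R')) ≫ hU.fromSpec,
    Limits.pullback.snd ε' g' ≫ hV.fromSpec, inferInstance, inferInstance, ?_, z, ?_⟩
  · rw [Category.assoc, ← IsAffineOpen.SpecMap_appLE_fromSpec π hU hV hVU, ← e₁, ← e₂,
      Category.assoc, Category.assoc, Limits.pullback.condition_assoc]
  · rw [← hv, ← Scheme.Hom.comp_apply, ← IsAffineOpen.SpecMap_appLE_fromSpec π hU hV hVU,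
      Scheme.Hom.comp_apply, Scheme.Hom.comp_apply, Scheme.Hom.comp_apply, hz]
    refine congrArg hU.fromSpec (hp'.trans ?_)
    rw [hgC]
    rfl
end

/-! ### Étale local triviality of formal torsors. -/

section
variable {k : Type u} [Field k]

theorem exists_mem_range_of_mem_fpqcTopology {S : Scheme.{u}} {R : Sieve S}
    (hR : R ∈ Scheme.fpqcTopology S) (s : S) :
    ∃ (Z : Scheme.{u}) (g : Z ⟶ S), R g ∧ s ∈ Set.range g := by
  obtain ⟨R', hR', hle⟩ := Precoverage.mem_toGrothendieck_iff_of_isStableUnderComposition.1 hR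
  obtain ⟨Z, g, hg, hs⟩ :=
    (Presieve.mem_comap_jointlySurjectivePrecoverage_iff _).1 hR'.2.1 s
  exact ⟨Z, g, hle _ _ hg, hs⟩

theorem exists_mem_range_of_covers {S : SchOver k} {I : Type u} {U : I → Over S}
    (hU : Covers (Scheme.fpqcTopology.over (Spec (CommRingCat.of k))) U) (s : S.left) :
    ∃ i, s ∈ Set.range (U i).hom.left := by
  obtain ⟨Z, g, hg, z, rfl⟩ := exists_mem_range_of_mem_fpqcTopology hU s
  obtain ⟨W, a, _, ⟨i⟩, hab⟩ := (Sieve.overEquiv_iff _ _).1 hg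
  refine ⟨i, a.left z, ?_⟩
  have e := congrArg CommaMorphism.left hab
  rw [← Scheme.Hom.comp_apply]
  exact congrArg (fun m : Z ⟶ S.left ↦ m z) e

theorem covers_etale {S : SchOver k} {I : Type u} {U : I → Over S}
    (he : ∀ i, Etale (U i).hom.left) (hs : ∀ s : S.left, ∃ i, s ∈ Set.range (U i).hom.left) :
    Covers (Top3.etale.topology k) U := by
  have h : Presieve.ofArrows (fun i ↦ (U i).left.left) (fun i ↦ (U i).hom.left) ∈
      Scheme.precoverage @Etale S.left := (Scheme.ofArrows_mem_precoverage_iff _).2 ⟨hs, he⟩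
  refine Scheme.etaleTopology.superset_covering ?_ (Precoverage.generate_mem_toGrothendieck h)
  rw [Sieve.generate_le_iff]
  rintro _ _ ⟨i⟩
  refine (Sieve.overEquiv_iff _ _).2 ⟨(U i).left, Over.homMk (𝟙 _) ?_, _, ⟨i⟩, ?_⟩
  · exact (Category.id_comp _).trans (Over.w (U i).hom).symm
  · exact Over.OverMorphism.ext (Category.id_comp _)

theorem bijective_algebraMap_quotient_X :
    Function.Bijective (algebraMap k (k⟦X⟧ ⧸ Ideal.span {(X : k⟦X⟧) ^ (0 + 1)})) := by
  have : Nontrivial (k⟦X⟧ ⧸ Ideal.span {(X : k⟦X⟧) ^ (0 + 1)}) := by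
    rw [Ideal.Quotient.nontrivial_iff, Ne, Ideal.span_singleton_eq_top, zero_add, pow_one]
    exact PowerSeries.X_prime.not_isUnit
  refine ⟨RingHom.injective _, fun x ↦ ?_⟩
  obtain ⟨f, rfl⟩ := Ideal.Quotient.mk_surjective x
  refine ⟨PowerSeries.constantCoeff f, Ideal.Quotient.eq.2 (Ideal.mem_span_singleton.2 ?_)⟩
  rw [zero_add, pow_one, PowerSeries.X_dvd_iff]
  simp

/-- The reduction modulo z of a formal torsor may thus be regarded as a scheme over `S` itself. -/
instance isIso_thickProj_zero (S : SchOver k) : IsIso (thickProj 0 S) := by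
  have : IsIso (Spec.map (CommRingCat.ofHom
      (algebraMap k (k⟦X⟧ ⧸ Ideal.span {(X : k⟦X⟧) ^ (0 + 1)})))) := by
    have : IsIso (CommRingCat.ofHom
        (algebraMap k (k⟦X⟧ ⧸ Ideal.span {(X : k⟦X⟧) ^ (0 + 1)}))) :=
      (ConcreteCategory.isIso_iff_bijective _).2 bijective_algebraMap_quotient_X
    infer_instance
  exact (thick_isPullback 0 S).isIso_fst_of_isIso

variable {A : Type u} [CommRing A] [HopfAlgebra k A] {Q : ClosedSubgroupScheme k A}
  {J : GrothendieckTopology (SchOver k)} {S : SchOver k}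

/-- The special fibre of a formal torsor is surjective over the base. -/
theorem FormalSetting.HasCocycle.exists_point
    (hJ : J ≤ Scheme.fpqcTopology.over (Spec (CommRingCat.of k)))
    {c : CechCocycle J (loopGroup Q) S} {Y : FormalSpace Q S}
    (hY : (formalSetting Q).HasCocycle Y c) (s : S.left) :
    ∃ y : (Y.X 0).left, ((Y.π 0).left ≫ thickProj 0 S) y = s := by
  obtain ⟨α, -⟩ := hY
  obtain ⟨i, v, rfl⟩ := exists_mem_range_of_covers (covers_mono hJ c.covers) s
  -- The unit section over a member of the covering reaches every point in the image of that member.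
  let x : (thick k 0).obj (c.U i).left ⟶ Y.X 0 := (α i).pt (𝟙 _) 1
  have hx : x ≫ Y.π 0 = (thick k 0).map (c.U i).hom := by
    rw [(α i).pt_π, Category.id_comp]
  refine ⟨x.left ((inv (thickProj 0 (c.U i).left)) v), ?_⟩
  have e : inv (thickProj 0 (c.U i).left) ≫ x.left ≫ (Y.π 0).left ≫ thickProj 0 S =
      (c.U i).hom.left := by
    rw [IsIso.inv_comp_eq, ← Over.comp_left_assoc, hx, thick_map_proj]
  rw [← Scheme.Hom.comp_apply, ← Scheme.Hom.comp_apply, e]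

/-- A formal torsor is trivial over an étale neighbourhood of every point of the base. -/
theorem FormalSetting.HasCocycle.exists_etale_trivialization [PerfectField k]
    (h : Algebra.Smooth k⟦X⟧ (dilatation Q))
    (hJ : J ≤ Scheme.fpqcTopology.over (Spec (CommRingCat.of k)))
    {c : CechCocycle J (loopGroup Q) S} {Y : FormalSpace Q S}
    (hY : (formalSetting Q).HasCocycle Y c) (s : S.left) :
    ∃ U : Over S, Etale U.hom.left ∧ s ∈ Set.range U.hom.left ∧
      Nonempty (Y.Trivialization U.hom) := by
  obtain ⟨y, rfl⟩ := hY.exists_point hJ s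
  have hsm := hY.isAffineHom_smooth h hJ
  have := (hsm 0).2
  -- An étale local section of the special fibre is enough: as `U` is affine, the section lifts
  -- successively to all thickenings, and the resulting system trivializes the torsor.
  obtain ⟨U, e, t, hU, he, ht, hy⟩ := exists_etale_section ((Y.π 0).left ≫ thickProj 0 S) S.hom y
  let V : SchOver k := Over.mk (e ≫ S.hom)
  let f : V ⟶ S := Over.homMk e rfl
  have : IsAffine V.left := hU
  have hx : (thickProj 0 V ≫ t) ≫ (Y.π 0).left = ((thick k 0).map f).left := by
    rw [← cancel_mono (thickProj 0 S), thick_map_proj, Category.assoc, Category.assoc, ht]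
    rfl
  let x₀ : (thick k 0).obj V ⟶ Y.X 0 := Over.homMk (thickProj 0 V ≫ t) (by
    rw [← Over.w (Y.π 0), ← Category.assoc, hx, Over.w])
  obtain ⟨x, hxπ, hxι⟩ := exists_points_of_smooth (Y := Y) (f := f) hsm x₀
    (Over.OverMorphism.ext hx)
  obtain ⟨α, hα⟩ := hY
  obtain ⟨β, -⟩ := hα.exists_trivialization (covers_mono hJ c.covers) x hxπ hxι
  exact ⟨Over.mk f, he, hy, ⟨β⟩⟩

theorem FormalSetting.HasCocycle.exists_etale [PerfectField k]
    (h : Algebra.Smooth k⟦X⟧ (dilatation Q))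
    (hJ : J ≤ Scheme.fpqcTopology.over (Spec (CommRingCat.of k)))
    {c : CechCocycle J (loopGroup Q) S} {Y : FormalSpace Q S}
    (hY : (formalSetting Q).HasCocycle Y c) :
    ∃ d : CechCocycle (Top3.etale.topology k) (loopGroup Q) S,
      (formalSetting Q).HasCocycle Y d := by
  choose U he hs hα using hY.exists_etale_trivialization h hJ
  obtain ⟨γ, hγ⟩ := (formalSetting Q).exists_isTransition (U := U) fun s ↦ (hα s).some
  exact ⟨⟨S.left, U, covers_etale he fun s ↦ ⟨s, hs s⟩, γ⟩, _, hγ⟩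

end

end LoopTorsor

/-! ### The theorem. -/

theorem proposition2 {k A : Type u} [Field k] [Finite k] [CommRing A] [HopfAlgebra k A]
    (hG : IsSplitConnectedReductive k A) (Q : ClosedSubgroupScheme k A)
    (hQ : Q = ClosedSubgroupScheme.whole k A ∨ Q.IsBorel) :
    -- (a) the natural bijection of pointed sets
    (∃ Φ : ∀ (τ : Top3) (S : SchOver k),
        PHS Q (τ.topology k) S ≃ CechH1 (τ.topology k) (loopGroup Q) S,
      (∀ τ S, Φ τ S (PHS.base Q (τ.topology k) S) =
        CechH1.base (τ.topology k) (loopGroup Q) S) ∧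
      -- the class of a torsor is the class of the cocycle of transition maps
      (∀ (τ : Top3) (S : SchOver k) (X : FormalTorsor Q (τ.topology k) S) (I : Type u)
        (U : I → Over S) (hU : Covers (τ.topology k) U)
        (α : ∀ i, X.toAdicSpace.Trivialization (U i).hom),
        ∃ γ : PresheafOfGroups.OneCocycle (restrictOver (loopGroup Q) S) U,
          IsTransitionCocycle X.toAdicSpace U α γ ∧
            Φ τ S (Quot.mk _ X) = Quot.mk _ ⟨I, U, hU, γ⟩) ∧
      -- functoriality in the scheme
      (∀ (τ : Top3) (S S' : SchOver k) (f : S' ⟶ S) (X : FormalTorsor Q (τ.topology k) S)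
        (Y : FormalTorsor Q (τ.topology k) S'),
        AdicSpace.IsBaseChange f Y.toAdicSpace X.toAdicSpace →
          Φ τ S' (Quot.mk _ Y) = CechH1.pullback f (Φ τ S (Quot.mk _ X))) ∧
      -- functoriality in the topology
      (∀ (S : SchOver k) (x : PHS Q (Top3.etale.topology k) S),
        Φ .fppf S (AdicPHS.map (etale_le_fppf k) S x) =
          CechH1.map (etale_le_fppf k) (loopGroup Q) S (Φ .etale S x)) ∧
      (∀ (S : SchOver k) (x : PHS Q (Top3.fppf.topology k) S),
        Φ .fpqc S (AdicPHS.map (fppf_le_fpqc k) S x) =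
          CechH1.map (fppf_le_fpqc k) (loopGroup Q) S (Φ .fppf S x))) ∧
    -- (b) comparison of the topologies
    (∀ S : SchOver k,
      Function.Bijective (CechH1.map (etale_le_fppf k) (loopGroup Q) S) ∧
      Function.Bijective (CechH1.map (fppf_le_fpqc k) (loopGroup Q) S)) ∧
    -- (c) lifting of trivializations
    (∀ (R : Type u) [CommRing R] [Algebra k R] (𝔞 : Ideal R), IsNilpotent 𝔞 → ∀ τ : Top3,
      (∀ X : RightSpace (loopGroup Q) (affineSch k R), X.IsTorsor (τ.topology k) →
        ∀ ᾱ : (X.restrict (affineIncl k 𝔞)).Trivialization,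
          ∃ α : X.Trivialization, ∀ (T : Over (affineSch k (R ⧸ 𝔞)))
            (x : X.P.obj (op ((Over.map (affineIncl k 𝔞)).obj T))),
            ᾱ.equiv T x = α.equiv ((Over.map (affineIncl k 𝔞)).obj T) x) ∧
      (∀ (X : FormalTorsor Q (τ.topology k) (affineSch k R))
        (ᾱ : X.toAdicSpace.Trivialization (affineIncl k 𝔞)),
        ∃ α : X.toAdicSpace.Trivialization (𝟙 (affineSch k R)),
          ∀ (n : ℕ) (T : SchOver k⟦X⟧) (u : T ⟶ (thick k n).obj (affineSch k (R ⧸ 𝔞)))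
            (x : T ⟶ X.X n) (hx : x ≫ X.π n = u ≫ (thick k n).map (affineIncl k 𝔞))
            (hx' : x ≫ X.π n = (u ≫ (thick k n).map (affineIncl k 𝔞)) ≫ (thick k n).map (𝟙 _)),
            ᾱ.toFun n u x hx =
              α.toFun n (u ≫ (thick k n).map (affineIncl k 𝔞)) x hx')) := by
  -- Finiteness of `k` enters through perfectness, which the étale local sections need.
  have : PerfectField k := inferInstance
  -- The hypotheses on G and Q enter through the smoothness of `G'`.
  have hD := smooth_dilatation_of_isBorel hG hQ
  have hle (τ : Top3) : τ.topology k ≤ Scheme.fpqcTopology.over (Spec (CommRingCat.of k)) :=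
    match τ with
    | .etale => (etale_le_fppf k).trans (fppf_le_fpqc k)
    | .fppf => fppf_le_fpqc k
    | .fpqc => le_rfl
  have hex (τ : Top3) (S : SchOver k) (c : CechCocycle (τ.topology k) (loopGroup Q) S) :=
    exists_hasCocycle hD (hle τ) c
  refine ⟨⟨fun τ S ↦ (formalSetting Q).cechEquiv (hle τ) (hex τ S), ?_, ?_, ?_, ?_, ?_⟩, ?_, ?_⟩
  · intro τ S
    exact (formalSetting Q).cechEquiv_mk (hle τ) (hex τ S) ((formalSetting Q).hasCocycle_trivial
      (modelPoint Q) (fun _ _ φ x ↦ modelPoint_comp Q φ x) (τ.topology k) S)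
  · intro τ S Y I U hU α
    obtain ⟨γ, hγ⟩ := (formalSetting Q).exists_isTransition α
    exact ⟨γ, (isTransitionCocycle_iff Q).2 hγ,
      (formalSetting Q).cechEquiv_mk (hle τ) (hex τ S) (c := ⟨I, U, hU, γ⟩) ⟨α, hγ⟩⟩
  · intro τ S S' f Y Y' hYY'
    obtain ⟨c, hc⟩ := (formalSetting Q).exists_hasCocycle Y
    rw [(formalSetting Q).cechEquiv_mk (hle τ) (hex τ S) hc,
      (formalSetting Q).cechEquiv_mk (hle τ) (hex τ S') (hc.pullback hYY')]
    rfl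
  · rintro S ⟨Y⟩
    obtain ⟨c, hc⟩ := (formalSetting Q).exists_hasCocycle Y
    refine ((formalSetting Q).cechEquiv_mk (hle .fppf) (hex .fppf S)
      (c := { c with covers := etale_le_fppf k S c.covers }) hc).trans ?_
    exact (congrArg (CechH1.map (etale_le_fppf k) (loopGroup Q) S)
      ((formalSetting Q).cechEquiv_mk (hle .etale) (hex .etale S) hc)).symm
  · rintro S ⟨Y⟩
    obtain ⟨c, hc⟩ := (formalSetting Q).exists_hasCocycle Y
    refine ((formalSetting Q).cechEquiv_mk (hle .fpqc) (hex .fpqc S)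
      (c := { c with covers := fppf_le_fpqc k S c.covers }) hc).trans ?_
    exact (congrArg (CechH1.map (fppf_le_fpqc k) (loopGroup Q) S)
      ((formalSetting Q).cechEquiv_mk (hle .fppf) (hex .fppf S) hc)).symm
  · intro S
    refine ⟨(formalSetting Q).bijective_map _ (hle .fppf) (hex .fppf S)
      fun hY ↦ hY.exists_etale hD (hle .fppf),
      (formalSetting Q).bijective_map _ (hle .fpqc) (hex .fpqc S) fun hY ↦ ?_⟩
    -- An fpqc torsor is trivial étale locally, and an étale covering is in particular an fppf
    -- covering.
    obtain ⟨d, hd⟩ := hY.exists_etale hD (hle .fpqc)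
    exact ⟨{ d with covers := etale_le_fppf k S d.covers }, hd⟩
  · intro R _ _ 𝔞 h𝔞 τ
    have hlift (Y : FormalSpace Q (affineSch k R))
        (c : CechCocycle (τ.topology k) (loopGroup Q) (affineSch k R))
        (hY : (formalSetting Q).HasCocycle Y c) : Y.LiftsSections (affineIncl k 𝔞) :=
      have : IsAffine (affineSch k R).left := inferInstanceAs (IsAffine (Spec (CommRingCat.of R)))
      liftsSections_of_smooth (hY.isAffineHom_smooth hD (hle τ)) (isClosedImmersion_affineIncl 𝔞)
        (isNilpotent_ker_affineIncl h𝔞)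
    refine ⟨fun Y hY ᾱ ↦ (formalSetting Q).exists_trivialization_lift (hle τ) _
      (hex τ (affineSch k R)) hlift Y hY ᾱ, fun Y ᾱ ↦ ?_⟩
    obtain ⟨c, hc⟩ := (formalSetting Q).exists_hasCocycle Y
    obtain ⟨α, hα⟩ := hc
    obtain ⟨β, hβ⟩ := hα.exists_lift (covers_mono (hle τ) c.covers) (hlift _ c ⟨α, hα⟩) ᾱ
    exact ⟨β, fun n T u x hx hx' ↦ hβ n u x hx hx'⟩
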